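/- **Notation.** Let $B=\mathbb Q+\mathbb Qi+\mathbb Qj+\mathbb Qij$ ($i^2=j^2=-1$, $ij=-ji$) be the definite quaternion algebra over $\mathbb Q$ of discriminant $2$, $\mathcal O=\mathbb Z+\mathbb Zi+\mathbb Zj+\mathbb Z\frac{1+i+j+ij}2$ the Hurwitz order, $\mathbb H=B\otimes\mathbb R$, $\nu$ the reduced norm, $|x|=\sqrt{\nu(x)}$, $\varpi_2=1+i$, and $\mathcal S=\varpi_2\mathcal O$ the dual lattice of $\mathcal O$ with respect to $\mathrm{Re}(xy)$. For $r\in\mathbb C$ let $\mathcal M(\mathrm{GL}_2(\mathcal O),r)$ be the space of smooth functions $F$ of moderate growth on $\mathrm{GL}_2(\mathbb H)$ with $F(z\gamma gk)=F(g)$ for $z\in\mathbb R_{>0}$, $\gamma\in \mathrm{GL}_2(\mathcal O)$, ${}^t\bar kk=1$, and $\Omega F=-\frac12\left(\frac{r^2}4+1\right)F$, where $\Omega$ is the Casimir operator of $\mathfrak{sl}_2(\mathbb H)$ with respect to the Killing form. Let $A(\beta)$, $\beta\in\mathcal S\setminus\{0\}$, be the Fourier coefficients in $$F\left(\begin{pmatrix}1&x\\0&1\end{pmatrix}\begin{pmatrix}\sqrt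 y&0\\0&\sqrt y^{-1}\end{pmatrix}\right)=u(y)+\sum_{\beta\in\mathcal S\setminus\{0\}}A(\beta)\,y^2K_{\sqrt{-1}r}(2\pi|\beta|y)\,e^{2\pi\sqrt{-1}\,\mathrm{Re}(\beta x)} ;$$ $F$ is cuspidal if $\int_{\mathbb H/\mathcal O}F\left(\begin{pmatrix}1&x\\0&1\end{pmatrix}g\right)dx=0$ for all $g$. Write $\beta=\varpi_2^u n\beta_0$ with $u\ge0$, $n\ge 1$ odd and $\beta_0$ primitive (that is, $\beta_0\in\mathcal S\setminus\{0\}$, $\varpi_2\mid\beta_0$, $\varpi_2^2\nmid\beta_0$, and no odd integer $m>1$ divides $\beta_0$). The Maass space $\mathcal M^*(\mathrm{GL}_2(\mathcal O),r)$ consists of the $F\in\mathcal M(\mathrm{GL}_2(\mathcal O),r)$ such that $A(\beta)$ depends only on $K=|\beta|^2$, $u$, $n$, say $A(\beta)=A(K,u,n)$, and, with $A(K,u,n)=0$ for $u<0$, * for some $\epsilon\in\{\pm1\}$, $A(K,u,n)=-\frac{3\epsilon}{\sqrt2}A\left(\frac K2,u-1,n\right)-A\left(\frac K4,u-2,n\right)$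 whenever $u\ge1$; * $A(K,u,n)=\sum_{d\mid n}d\,A\left(\frac K{d^2},u,1\right)$. For a prime $p$ put $B_p=B\otimes\mathbb Q_p$ and $K_p=\mathrm{GL}_2(\mathcal O\otimes\mathbb Z_p)$. The Hecke algebra of $(\mathrm{GL}_2(B_p),K_p)$ acts on $\mathcal M(\mathrm{GL}_2(\mathcal O),r)$: if $K_phK_p=\bigsqcup_i h_iK_p$ with $h_i\in\mathrm{GL}_2(\mathcal O[1/p])$, the double coset $K_phK_p$ maps $F$ to $g\mapsto\sum_iF(h_i^{-1}g)$. A Hecke eigenform is a nonzero $F$ that is an eigenfunction of all these operators for all primes $p$. For such an $F$, let $\Pi_{F,p}$ be the local component at $p$ of the automorphic representation associated with $F$: the spherical irreducible constituent of the representation of $\mathrm{GL}_2(B_p)$ generated by the adelization of $F$. For odd $p$ identify $\mathrm{GL}_2(B_p)$ with $\mathrm{GL}_4(\mathbb Q_p)$ by means of an isomorphism $B_p\cong M_2(\mathbb Q_p)$ that takes $\mathcal O\otimes\mathbb Z_p$ to $M_2(\mathbb Z_p)$. **Proposition 5.1.** Let $r\in\mathbb C$, let $F\in\mathcal M^*(\mathrm{GL}_2(\mathcal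 O),r)$ be a cuspidal Hecke eigenform, and let $p$ be an odd prime. Then there is $\lambda_p\in\mathbb C$ such that: 1. The eigenvalues of $F$ under the double cosets of $\mathrm{diag}(p,p,p,p)$, $\mathrm{diag}(p,p,p,1)$, $\mathrm{diag}(p,p,1,1)$, $\mathrm{diag}(p,1,1,1)$ are, respectively, $$\mu_1=1,\qquad \mu_2=p(p+1)\lambda_p,\qquad \mu_3=p^2\lambda_p^2+p^3+p,\qquad \mu_4=p(p+1)\lambda_p.$$ 2. The local component $\Pi_{F,p}$ exists, and for unramified characters $\chi_1,\dots,\chi_4$ of $\mathbb Q_p^\times$, $\Pi_{F,p}$ is a constituent of the normalized principal series $\mathrm{Ind}_{\mathcal B_4(\mathbb Q_p)}^{\mathrm{GL}_4(\mathbb Q_p)}(\chi_1\times\chi_2\times\chi_3\times\chi_4)$ if and only if, up to a permutation of the $\chi_i$, $$\chi_1(p)=p^{1/2}\,\frac{\lambda_p+\sqrt{\lambda_p^2-4}}2,\quad \chi_2(p)=p^{1/2}\,\frac{\lambda_p-\sqrt{\lambda_p^2-4}}2,\quad \chi_3(p)=p^{-1/2}\,\frac{\lambda_p+\sqrt{\lambda_p^2-4}}2,\quad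 \chi_4(p)=p^{-1/2}\,\frac{\lambda_p-\sqrt{\lambda_p^2-4}}2 .$$ -/

import Mathlib

open scoped Quaternion Matrix ContDiff

noncomputable section

namespace MaassLift

/-! ### The quaternion algebra `B`, the Hurwitz order and its general linear groups

For a field `R` of characteristic different from two, `ℍ[R] = R + R i + R j + R k` is Mathlib's
quaternion algebra, `i² = j² = k² = -1`, `ij = -ji = k`. Thus `ℍ[ℚ]` is `B` (the definite
quaternion algebra over `ℚ` of discriminant two), `ℍ[ℝ] = B ⊗ ℝ` and `ℍ[ℚ_[p]] = B ⊗ ℚ_p`. -/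

/-- The quaternion `a + b i + c j + d k`. -/
def quat {R : Type} [CommRing R] (a b c d : R) : ℍ[R] := ⟨a, b, c, d⟩

@[simp] theorem quat_re {R : Type} [CommRing R] (a b c d : R) : (quat a b c d).re = a := rfl

@[simp] theorem quat_imI {R : Type} [CommRing R] (a b c d : R) : (quat a b c d).imI = b := rfl

@[simp] theorem quat_imJ {R : Type} [CommRing R] (a b c d : R) : (quat a b c d).imJ = c := rfl

@[simp] theorem quat_imK {R : Type} [CommRing R] (a b c d : R) : (quat a b c d).imK = d := rfl

/-- `Z + Z i + Z j + Z (1 + i + j + ij)/2` for a subring `Z` of the field `R`. For `Z = ℤ` in `ℚ`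
this is the Hurwitz order `𝒪`, for `Z = ℤ_p` in `ℚ_p` it is `𝒪_p = 𝒪 ⊗ ℤ_p`. -/
def hurwitz {R : Type} [Field R] [NeZero (2 : R)] (Z : Subring R) : Subring ℍ[R] where
  carrier := {x | ∃ a b c d : Z, x.re = (a : R) + (d : R) / 2 ∧ x.imI = (b : R) + (d : R) / 2 ∧
    x.imJ = (c : R) + (d : R) / 2 ∧ x.imK = (d : R) / 2}
  zero_mem' := ⟨0, 0, 0, 0, by simp⟩
  one_mem' := ⟨1, 0, 0, 0, by simp⟩
  neg_mem' := by
    rintro x ⟨a, b, c, d, h⟩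
    refine ⟨-a, -b, -c, -d, ?_⟩
    simp only [Quaternion.re_neg, Quaternion.imI_neg, Quaternion.imJ_neg, Quaternion.imK_neg, h]
    push_cast
    refine ⟨?_, ?_, ?_, ?_⟩ <;> ring
  add_mem' := by
    rintro x y ⟨a, b, c, d, h⟩ ⟨a', b', c', d', h'⟩
    refine ⟨a + a', b + b', c + c', d + d', ?_⟩
    simp only [Quaternion.re_add, Quaternion.imI_add, Quaternion.imJ_add, Quaternion.imK_add, h, h']
    push_cast
    refine ⟨?_, ?_, ?_, ?_⟩ <;> ring
  mul_mem' := by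
    rintro x y ⟨a, b, c, d, h⟩ ⟨a', b', c', d', h'⟩
    have h2 : (2 : R) ≠ 0 := NeZero.ne 2
    refine ⟨a * a' - b * b' - c * c' - b * c' + c * b' - b * d' - d * c' - d * d',
      a * b' + b * a' - b * c' + c * b' + c * d' + d * b' - d * c',
      a * c' + c * a' - b * c' + c * b' - b * d' + c * d' + d * b',
      b * c' + b * c' - c * b' - c * b' + a * d' + b * d' - c * d' + d * a' + d * c' - d * b'
        + d * d', ?_⟩
    simp only [Quaternion.re_mul, Quaternion.imI_mul, Quaternion.imJ_mul, Quaternion.imK_mul, h, h']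
    push_cast
    refine ⟨?_, ?_, ?_, ?_⟩ <;> field_simp <;> ring

/-- Extension of scalars `ℍ[R] → ℍ[S]` along a ring homomorphism `R → S`. -/
def quatMap {R S : Type} [CommRing R] [CommRing S] (f : R →+* S) : ℍ[R] →+* ℍ[S] where
  toFun x := quat (f x.re) (f x.imI) (f x.imJ) (f x.imK)
  map_one' := by apply Quaternion.ext <;> simp
  map_zero' := by apply Quaternion.ext <;> simp
  map_add' x y := by apply Quaternion.ext <;> simp
  map_mul' x y := by
    apply Quaternion.ext
    · simp only [quat_re, quat_imI, quat_imJ, quat_imK, Quaternion.re_mul, map_sub, map_mul]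
    · simp only [quat_re, quat_imI, quat_imJ, quat_imK, Quaternion.imI_mul, map_sub, map_add, map_mul]
    · simp only [quat_re, quat_imI, quat_imJ, quat_imK, Quaternion.imJ_mul, map_sub, map_add, map_mul]
    · simp only [quat_re, quat_imI, quat_imJ, quat_imK, Quaternion.imK_mul, map_sub, map_add, map_mul]

/-- `GL₂(D)`: the invertible two by two matrices over a (not necessarily commutative) ring. -/
abbrev GL2 (D : Type) [Ring D] : Type := (Matrix (Fin 2) (Fin 2) D)ˣ

/-- The homomorphism `GL₂(D) → GL₂(E)` induced by a ring homomorphism `D → E`. -/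
def glMap {D E : Type} [Ring D] [Ring E] (f : D →+* E) : GL2 D →* GL2 E :=
  Units.map (f.mapMatrix : Matrix (Fin 2) (Fin 2) D →+* Matrix (Fin 2) (Fin 2) E).toMonoidHom

/-- `GL₂(O)` as a subgroup of `GL₂(D)`, for a subring `O` of `D`. -/
def glOver {D : Type} [Ring D] (O : Subring D) : Subgroup (GL2 D) := (glMap O.subtype).range

/-- The Hurwitz order `𝒪` in `B`. -/
def order : Subring ℍ[ℚ] := hurwitz (Int.castRingHom ℚ).range

/-- `𝒪[1/p]`. -/
def orderAway (p : ℕ) : Subring ℍ[ℚ] := hurwitz (Subring.closure {(p : ℚ)⁻¹})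

/-- The local order `𝒪_p` in `B_p`. -/
def orderLoc (p : ℕ) [Fact p.Prime] : Subring ℍ[ℚ_[p]] := hurwitz (PadicInt.subring p)

/-- The real Lie group `G = GL₂(ℍ)`. -/
abbrev GReal : Type := GL2 ℍ[ℝ]

/-- The group `GL₂(B_p)`. -/
abbrev GLoc (p : ℕ) [Fact p.Prime] : Type := GL2 ℍ[ℚ_[p]]

/-- The maximal compact subgroup `K_p = GL₂(𝒪_p)`. -/
def KLoc (p : ℕ) [Fact p.Prime] : Subgroup (GLoc p) := glOver (orderLoc p)

/-- `B → B ⊗ ℝ`. -/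
def toQuatReal : ℍ[ℚ] →+* ℍ[ℝ] := quatMap (algebraMap ℚ ℝ)

/-- `GL₂(B) → GL₂(ℍ)`. -/
def toReal : GL2 ℍ[ℚ] →* GReal := glMap toQuatReal

/-- `GL₂(B) → GL₂(B_p)`. -/
def toLoc (p : ℕ) [Fact p.Prime] : GL2 ℍ[ℚ] →* GLoc p := glMap (quatMap (algebraMap ℚ ℚ_[p]))

/-! ### Maass forms on `GL₂(ℍ)` -/

/-- `n(x)`. -/
def nUnip (x : ℍ[ℝ]) : GReal where
  val := !![1, x; 0, 1]
  inv := !![1, -x; 0, 1]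
  val_inv := by
    refine Matrix.ext fun i j => ?_
    fin_cases i <;> fin_cases j <;> simp [Matrix.mul_apply, Fin.sum_univ_two]
  inv_val := by
    refine Matrix.ext fun i j => ?_
    fin_cases i <;> fin_cases j <;> simp [Matrix.mul_apply, Fin.sum_univ_two]

/-- The diagonal matrix with entries the real numbers `s, t ≠ 0`. -/
def realDiag (s t : ℝˣ) : GReal where
  val := !![((s : ℝ) : ℍ[ℝ]), 0; 0, ((t : ℝ) : ℍ[ℝ])]
  inv := !![(((s⁻¹ : ℝˣ) : ℝ) : ℍ[ℝ]), 0; 0, (((t⁻¹ : ℝˣ) : ℝ) : ℍ[ℝ])]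
  val_inv := by
    refine Matrix.ext fun i j => ?_
    fin_cases i <;> fin_cases j <;>
      simp [-Units.val_inv_eq_inv_val, Matrix.mul_apply, Fin.sum_univ_two, ← Quaternion.coe_mul]
  inv_val := by
    refine Matrix.ext fun i j => ?_
    fin_cases i <;> fin_cases j <;>
      simp [-Units.val_inv_eq_inv_val, Matrix.mul_apply, Fin.sum_univ_two, ← Quaternion.coe_mul]

/-- `√y` as a unit, for `y > 0`. -/
def sqrtUnit (y : Set.Ioi (0 : ℝ)) : ℝˣ := Units.mk0 (Real.sqrt y) (Real.sqrt_ne_zero'.2 y.2)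

/-- `a_y = diag(√y, √y⁻¹)`. -/
def aDiag (y : Set.Ioi (0 : ℝ)) : GReal := realDiag (sqrtUnit y) (sqrtUnit y)⁻¹

/-- A function on the open subset `GL₂(ℍ)` of `M₂(ℍ)`, extended by zero to `M₂(ℍ)`. -/
def extendZero (F : GReal → ℂ) (M : Matrix (Fin 2) (Fin 2) ℍ[ℝ]) : ℂ :=
  open Classical in if h : IsUnit M then F h.unit else 0

/-- `F` is a smooth function on the open subset `GL₂(ℍ)` of the real vector space `M₂(ℍ)`. -/
def IsSmooth (F : GReal → ℂ) : Prop :=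
  ContDiffOn ℝ ∞ (fun m : Fin 2 → Fin 2 → ℍ[ℝ] => extendZero F (Matrix.of m))
    {m | IsUnit (Matrix.of m)}

/-- The action of `X ∈ 𝔤𝔩₂(ℍ) = M₂(ℍ)` by the left-invariant vector field,
`(X F)(g) = d/dt F(g exp(tX))` at `t = 0`; for smooth `F` the curve `g exp(tX)` may be replaced by
`g (1 + tX)`, which has the same tangent vector at `t = 0`. -/
def lieDeriv (X : Matrix (Fin 2) (Fin 2) ℍ[ℝ]) (F : GReal → ℂ) (g : GReal) : ℂ :=
  deriv (fun t : ℝ => extendZero F ((g : Matrix (Fin 2) (Fin 2) ℍ[ℝ]) * (1 + t • X))) 0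

/-- The basis `1, i, j, k` of `ℍ`. -/
def quatBasis : Fin 4 → ℍ[ℝ] := ![quat 1 0 0 0, quat 0 1 0 0, quat 0 0 1 0, quat 0 0 0 1]

/-- The Casimir operator `Ω` of `𝔰𝔩₂(ℍ)` with respect to its Killing form
`B(X, Y) = 16 Re tr(XY)`. In the basis `H = diag(1, -1)`, `diag(q, 0)`, `diag(0, q)` for
`q ∈ {i, j, k}`, `E_q = [0, q; 0, 0]`, `E'_q = [0, 0; q, 0]` for `q ∈ {1, i, j, k}`, one has
`B(H, H) = 32`, `B(diag(q, 0), diag(q, 0)) = B(diag(0, q), diag(0, q)) = -16`, and the dual basis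
vector of `E_q` is `E'_{q̄} / 16`. -/
def casimir (F : GReal → ℂ) (g : GReal) : ℂ :=
  (1 / 32 : ℂ) * lieDeriv !![1, 0; 0, -1] (lieDeriv !![1, 0; 0, -1] F) g
  + (1 / 16 : ℂ) * ∑ q : Fin 4,
      (lieDeriv !![0, quatBasis q; 0, 0] (lieDeriv !![0, 0; star (quatBasis q), 0] F) g
        + lieDeriv !![0, 0; star (quatBasis q), 0] (lieDeriv !![0, quatBasis q; 0, 0] F) g)
  - (1 / 16 : ℂ) * ∑ q : Fin 3,
      (lieDeriv !![quatBasis q.succ, 0; 0, 0] (lieDeriv !![quatBasis q.succ, 0; 0, 0] F) g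
        + lieDeriv !![0, 0; 0, quatBasis q.succ] (lieDeriv !![0, 0; 0, quatBasis q.succ] F) g)

/-- Moderate growth: `F` is bounded by a power of the size of the entries of `g` and `g⁻¹`. -/
def IsModerateGrowth (F : GReal → ℂ) : Prop :=
  ∃ (C : ℝ) (N : ℕ), ∀ g : GReal, ‖F g‖ ≤ C * (∑ i, ∑ j,
    (‖(g : Matrix (Fin 2) (Fin 2) ℍ[ℝ]) i j‖
      + ‖((g⁻¹ : GReal) : Matrix (Fin 2) (Fin 2) ℍ[ℝ]) i j‖)) ^ N

/-- The space `ℳ(GL₂(𝒪), r)`. -/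
structure IsMaassForm (r : ℂ) (F : GReal → ℂ) : Prop where
  smooth : IsSmooth F
  casimir_eq : ∀ g, casimir F g = -(1 / 2 : ℂ) * (r ^ 2 / 4 + 1) * F g
  left_inv : ∀ γ ∈ glOver order, ∀ g, F (toReal γ * g) = F g
  right_inv : ∀ k : GReal, (k : Matrix (Fin 2) (Fin 2) ℍ[ℝ])ᴴ * (k : Matrix _ _ ℍ[ℝ]) = 1 →
    ∀ g, F (g * k) = F g
  center_inv : ∀ c : ℝˣ, 0 < (c : ℝ) → ∀ g, F (realDiag c c * g) = F g
  growth : IsModerateGrowth F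

/-! ### Fourier coefficients and cusp forms -/

/-- Coordinates on `ℍ` with respect to the basis `1, i, j, (1+i+j+ij)/2` of `𝒪`; the unit cube is
a fundamental domain for `ℍ / 𝒪`. -/
def latticeCoord (t : Fin 4 → ℝ) : ℍ[ℝ] :=
  quat (t 0 + t 3 / 2) (t 1 + t 3 / 2) (t 2 + t 3 / 2) (t 3 / 2)

/-- `∫_{ℍ/𝒪} F(n(x) g) e^{-2π√-1 Re(βx)} dx`, the measure being normalized to total mass one. -/
def fourierIntegral (F : GReal → ℂ) (β : ℍ[ℚ]) (g : GReal) : ℂ :=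
  ∫ t in Set.Icc (0 : Fin 4 → ℝ) 1, F (nUnip (latticeCoord t) * g) *
    Complex.exp (-2 * Real.pi * Complex.I * ((toQuatReal β * latticeCoord t).re : ℝ))

/-- `F` is cuspidal: its constant term vanishes. (`GL₂(𝒪)` has only one cusp.) -/
def IsCuspidal (F : GReal → ℂ) : Prop := ∀ g : GReal, fourierIntegral F 0 g = 0

/-- The modified Bessel function `K_s(z) = ∫_0^∞ e^{-z cosh t} cosh(s t) dt`, for `z > 0`. -/
def besselK (s : ℂ) (z : ℝ) : ℂ :=
  ∫ t in Set.Ioi (0 : ℝ), (Real.exp (-z * Real.cosh t) : ℂ) * Complex.cosh (s * t)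

/-- `|β| = √ν(β)`. -/
def quatAbs (β : ℍ[ℚ]) : ℝ := Real.sqrt ((Quaternion.normSq β : ℚ) : ℝ)

/-- The Fourier coefficient `A(β)` of `F`: the number with
`∫_{ℍ/𝒪} F(n(x) a_y) e^{-2π√-1 Re(βx)} dx = A(β) y² K_{√-1 r}(2π|β|y)` for all `y > 0`
(and `0` if there is none, which does not happen for `F ∈ ℳ(GL₂(𝒪), r)` and `β ≠ 0`). -/
def fourierCoeff (r : ℂ) (F : GReal → ℂ) (β : ℍ[ℚ]) : ℂ :=
  open Classical in
  if h : ∃ a : ℂ, ∀ y : Set.Ioi (0 : ℝ), fourierIntegral F β (aDiag y) =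
      a * ((y : ℝ) : ℂ) ^ 2 * besselK (Complex.I * r) (2 * Real.pi * quatAbs β * y)
  then h.choose else 0

/-! ### The Maass space -/

/-- The lattice `𝒮` dual to `𝒪` with respect to `(x, y) ↦ Re(xy)`. -/
def dualLattice : Set ℍ[ℚ] := {β | ∀ x ∈ order, ∃ m : ℤ, (β * x).re = m}

/-- `ϖ₂ = 1 + i`. -/
def varpi : ℍ[ℚ] := quat 1 1 0 0

/-- The set `𝒮^prim` of primitive elements of `𝒮`. -/
def primitiveSet : Set ℍ[ℚ] :=
  {β | β ∈ dualLattice ∧ β ≠ 0 ∧ (∃ x ∈ order, β = varpi * x) ∧ (¬ ∃ x ∈ order, β = varpi ^ 2 * x) ∧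
    ∀ n : ℕ, Odd n → 1 < n → ¬ ∃ x ∈ order, β = (n : ℍ[ℚ]) * x}

/-- `(K, u, n)` are the invariants of `β ∈ 𝒮 ∖ {0}`: one has `β = ϖ₂^u n β₀` with `β₀` primitive
and `n` odd and positive, and `K = |β|²`. -/
def HasInvariants (β : ℍ[ℚ]) (K : ℚ) (u n : ℕ) : Prop :=
  Odd n ∧ (∃ β₀ ∈ primitiveSet, β = varpi ^ u * (n : ℍ[ℚ]) * β₀) ∧ K = Quaternion.normSq β

/-- The conditions that define the Maass space, for a family of Fourier coefficients `A(β)`: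
`A(β)` depends only on `(K, u, n)`, so that it can be written `A(K, u, n)`; with
`A(K, u, n) = 0` for `u < 0`, the two recurrence relations hold for the invariants `(K, u, n)` of
elements of `𝒮 ∖ {0}`. The first of them is a relation for `u ≥ 1`. -/
def MaassRelations (A : ℍ[ℚ] → ℂ) : Prop :=
  ∃ a : ℚ → ℤ → ℕ → ℂ,
    (∀ β K u n, HasInvariants β K u n → A β = a K u n) ∧
    (∀ K u n, u < 0 → a K u n = 0) ∧
    (∃ ε : ℂ, (ε = 1 ∨ ε = -1) ∧ ∀ β K u n, HasInvariants β K u n → 1 ≤ u →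
      a K u n = -3 * ε / (Real.sqrt 2 : ℂ) * a (K / 2) (u - 1) n - a (K / 4) (u - 2) n) ∧
    (∀ β K u n, HasInvariants β K u n →
      a K u n = ∑ d ∈ n.divisors, (d : ℂ) * a (K / (d : ℚ) ^ 2) u 1)

/-- The Maass space `ℳ*(GL₂(𝒪), r)`. -/
def IsInMaassSpace (r : ℂ) (F : GReal → ℂ) : Prop :=
  IsMaassForm r F ∧ MaassRelations (fourierCoeff r F)

/-! ### Adelization and Hecke operators -/

/-- The adelic function attached to `F`, on the places `p` and `∞`: by strong approximation
`GL₂(B_p) = GL₂(𝒪[1/p]) K_p`, and for `F` left invariant under `GL₂(𝒪)` this is the function on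
`GL₂(B_p) × GL₂(ℍ)` that is left invariant under `GL₂(𝒪[1/p])`, right invariant under `K_p`, and
equal to `F` on `{1} × GL₂(ℍ)`, namely `(γ k, g) ↦ F(γ⁻¹ g)`. -/
def adelize (p : ℕ) [Fact p.Prime] (F : GReal → ℂ) (x : GLoc p) (g : GReal) : ℂ :=
  open Classical in
  if h : ∃ γ : GL2 ℍ[ℚ], γ ∈ glOver (orderAway p) ∧ (toLoc p γ)⁻¹ * x ∈ KLoc p
  then F ((toReal h.choose)⁻¹ * g) else 0

/-- The Hecke operator of the characteristic function of `K_p h K_p`: if `K_p h K_p` is the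
disjoint union of finitely many cosets `x K_p`, it maps `F` to the sum of the right translates by
`x` of the adelization of `F`, restricted to `{1} × GL₂(ℍ)`. -/
def heckeOp (p : ℕ) [Fact p.Prime] (h : GLoc p) (F : GReal → ℂ) : GReal → ℂ := fun g =>
  ∑ᶠ x ∈ ((fun x : GLoc p => (x : GLoc p ⧸ KLoc p)) ''
    DoubleCoset.doubleCoset h (KLoc p : Set (GLoc p)) (KLoc p) : Set (GLoc p ⧸ KLoc p)),
    adelize p F x.out g

/-- `F` is a Hecke eigenform: it is nonzero and an eigenfunction of the Hecke algebra of
`(GL₂(B_p), K_p)` for every prime `p`. -/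
def IsHeckeEigenform (F : GReal → ℂ) : Prop :=
  F ≠ 0 ∧ ∀ (p : ℕ) [Fact p.Prime] (h : GLoc p), ∃ μ : ℂ, heckeOp p h F = μ • F

/-! ### Local representations -/

/-- The representation of `G` by right translations on the functions on `G` with values in `M`. -/
def rightTranslation (G M : Type) [Group G] [AddCommGroup M] [Module ℂ M] :
    Representation ℂ G (G → M) where
  toFun h :=
    { toFun := fun f g => f (g * h)
      map_add' := fun _ _ => rfl
      map_smul' := fun _ _ => rfl }
  map_one' := by ext f g; simp
  map_mul' h k := by ext f g; simp [mul_assoc]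

/-- The representation of `GL₂(B_p)` generated by the adelization of `F`. -/
def generatedRep (p : ℕ) [Fact p.Prime] (F : GReal → ℂ) :
    Subrepresentation (rightTranslation (GLoc p) (GReal → ℂ)) where
  toSubmodule := Submodule.span ℂ
    (Set.range fun h : GLoc p => rightTranslation (GLoc p) (GReal → ℂ) h (adelize p F))
  apply_mem_toSubmodule g v hv := by
    induction hv using Submodule.span_induction with
    | mem x hx =>
      obtain ⟨h, rfl⟩ := hx
      refine Submodule.subset_span ⟨g * h, ?_⟩
      simp
    | zero => simp
    | add x y _ _ hx hy => rw [map_add]; exact Submodule.add_mem _ hx hy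
    | smul a x _ hx => rw [map_smul]; exact Submodule.smul_mem _ a hx

/-- `σ` is an irreducible constituent (irreducible subquotient) of `ρ`. -/
def IsConstituent {G V W : Type} [Group G] [AddCommGroup V] [Module ℂ V] [AddCommGroup W]
    [Module ℂ W] (σ : Representation ℂ G W) (ρ : Representation ℂ G V) : Prop :=
  σ.IsIrreducible ∧ ∃ (U : Subrepresentation ρ)
    (f : Representation.IntertwiningMap U.toRepresentation σ), Function.Surjective f

/-- `σ` is the local component `Π_{F,p}` at `p` of the automorphic representation associated with
`F`: the spherical irreducible constituent of the representation of `GL₂(B_p)` generated by the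
adelization of `F`. -/
def IsLocalComponent (p : ℕ) [Fact p.Prime] (F : GReal → ℂ) {W : Type} [AddCommGroup W]
    [Module ℂ W] (σ : Representation ℂ (GLoc p) W) : Prop :=
  IsConstituent σ (generatedRep p F).toRepresentation ∧
    ∃ w : W, w ≠ 0 ∧ ∀ k ∈ KLoc p, σ k w = w

/-- `GL₄(ℚ_p)`. -/
abbrev GL4 (p : ℕ) [Fact p.Prime] : Type := (Matrix (Fin 4) (Fin 4) ℚ_[p])ˣ

/-- An identification of `B_p` with `M₂(ℚ_p)` that takes `𝒪_p` to `M₂(ℤ_p)`; it exists for odd `p`,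
and any two differ by conjugation with an element of `ℚ_p^× GL₂(ℤ_p)`. -/
structure Splitting (p : ℕ) [Fact p.Prime] where
  equiv : ℍ[ℚ_[p]] ≃ₐ[ℚ_[p]] Matrix (Fin 2) (Fin 2) ℚ_[p]
  mem_order_iff : ∀ x, x ∈ orderLoc p ↔ ∀ i j, equiv x i j ∈ PadicInt.subring p

/-- The identification of `GL₂(B_p)` with `GL₄(ℚ_p)` that results from `B_p ≅ M₂(ℚ_p)`, by reading
a two by two matrix of two by two blocks as a four by four matrix. -/
def Splitting.toGL4 {p : ℕ} [Fact p.Prime] (θ : Splitting p) : GLoc p ≃* GL4 p :=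
  Units.mapEquiv (((θ.equiv.toRingEquiv.mapMatrix (m := Fin 2)).trans
    (Matrix.compRingEquiv (Fin 2) (Fin 2) ℚ_[p])).trans
      (Matrix.reindexRingEquiv ℚ_[p] (finProdFinEquiv : Fin 2 × Fin 2 ≃ Fin 4))).toMulEquiv

/-- `p` as an element of `ℚ_p^×`. -/
def pUnit (p : ℕ) [hp : Fact p.Prime] : ℚ_[p]ˣ :=
  Units.mk0 (p : ℚ_[p]) (Nat.cast_ne_zero.2 hp.out.ne_zero)

/-- The diagonal matrix in `GL₄(ℚ_p)` whose first `m` entries are `p` and whose other entries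
are `1`. -/
def diagP (p : ℕ) [Fact p.Prime] (m : ℕ) : GL4 p :=
  Units.map (Matrix.diagonalRingHom (Fin 4) ℚ_[p]).toMonoidHom
    (MulEquiv.piUnits.symm fun i : Fin 4 => if (i : ℕ) < m then pUnit p else 1)

/-- An unramified character of `ℚ_p^×`: it is trivial on `ℤ_p^×`. -/
def IsUnramified {p : ℕ} [Fact p.Prime] (χ : ℚ_[p]ˣ →* ℂˣ) : Prop :=
  ∀ u : ℚ_[p]ˣ, ‖(u : ℚ_[p])‖ = 1 → χ u = 1

/-- The (normalized, smooth) principal series representation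
`Ind_{𝓑₄(ℚ_p)}^{GL₄(ℚ_p)}(χ₁ × χ₂ × χ₃ × χ₄)`, with `GL₄(ℚ_p)` acting by right translations: it
consists of the functions that are right invariant under an open subgroup and satisfy
`f(bg) = χ₁(b₁₁)χ₂(b₂₂)χ₃(b₃₃)χ₄(b₄₄) |b₁₁|^{3/2} |b₂₂|^{1/2} |b₃₃|^{-1/2} |b₄₄|^{-3/2} f(g)` for
upper triangular `b`. -/
def principalSeries {p : ℕ} [Fact p.Prime] (χ : Fin 4 → (ℚ_[p]ˣ →* ℂˣ)) :
    Subrepresentation (rightTranslation (GL4 p) ℂ) where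
  toSubmodule :=
    { carrier := {f |
        (∀ (b : GL4 p) (t : Fin 4 → ℚ_[p]ˣ),
          (∀ i, (b : Matrix (Fin 4) (Fin 4) ℚ_[p]) i i = t i) →
          (∀ i j, j < i → (b : Matrix (Fin 4) (Fin 4) ℚ_[p]) i j = 0) →
          ∀ g, f (b * g) = (∏ i, (χ i (t i) : ℂ) *
            ((‖(t i : ℚ_[p])‖ ^ ((3 - 2 * (i : ℕ) : ℝ) / 2) : ℝ) : ℂ)) * f g) ∧
        ∃ U : Subgroup (GL4 p), IsOpen (U : Set (GL4 p)) ∧ ∀ k ∈ U, ∀ g, f (g * k) = f g}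
      add_mem' := by
        rintro f f' ⟨h, U, hU, hf⟩ ⟨h', U', hU', hf'⟩
        refine ⟨fun b t ht hb g => ?_, U ⊓ U', hU.inter hU', fun k hk g => ?_⟩
        · simp only [Pi.add_apply]
          rw [h b t ht hb g, h' b t ht hb g, mul_add]
        · simp only [Pi.add_apply]
          rw [hf k hk.1 g, hf' k hk.2 g]
      zero_mem' := ⟨fun b t _ _ g => by simp, ⊤, isOpen_univ, fun _ _ _ => rfl⟩
      smul_mem' := by
        rintro c f ⟨h, U, hU, hf⟩
        refine ⟨fun b t ht hb g => ?_, U, hU, fun k hk g => ?_⟩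
        · simp only [Pi.smul_apply, smul_eq_mul]
          rw [h b t ht hb g, mul_left_comm]
        · simp only [Pi.smul_apply]
          rw [hf k hk g] }
  apply_mem_toSubmodule x f := by
    rintro ⟨h, U, hU, hf⟩
    refine ⟨fun b t ht hb g => ?_,
      U.comap (MulAut.conj x⁻¹).toMonoidHom, ?_, fun k hk g => ?_⟩
    · change f (b * g * x) = _ * f (g * x)
      rw [mul_assoc, h b t ht hb]
    · exact hU.preimage ((continuous_const.mul continuous_id).mul continuous_const)
    · change f (g * k * x) = f (g * x)
      have := hf _ hk (g * x)
      rw [← this]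
      simp [mul_assoc]

/-- `p^{1/2}(λ + √(λ²-4))/2`, `p^{1/2}(λ - √(λ²-4))/2`, `p^{-1/2}(λ + √(λ²-4))/2`,
`p^{-1/2}(λ - √(λ²-4))/2`. -/
def satakeParam (p : ℕ) (l : ℂ) : Fin 4 → ℂ :=
  ![(Real.sqrt p : ℂ) * ((l + (l ^ 2 - 4) ^ (1 / 2 : ℂ)) / 2),
    (Real.sqrt p : ℂ) * ((l - (l ^ 2 - 4) ^ (1 / 2 : ℂ)) / 2),
    (Real.sqrt p : ℂ)⁻¹ * ((l + (l ^ 2 - 4) ^ (1 / 2 : ℂ)) / 2),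
    (Real.sqrt p : ℂ)⁻¹ * ((l - (l ^ 2 - 4) ^ (1 / 2 : ℂ)) / 2)]

end MaassLift

end

/-!
A form `F` in the Maass space is determined by its Fourier coefficients `A(β)`, and by the Maass
relations `A(β)` depends only on the norm of `β` and on its divisibility properties. The Hecke
operators at `p` act on the coefficients, and both facts together determine the eigenvalues.

The Casimir equation turns the Fourier integral at `β` into a solution of an ordinary differential
equation (`IsMaassForm.isRadialSolution`). A solution of moderate growth is a multiple of
`y² K_{√-1 r}(2π|β|y)`, because its Wronskian with this function is a multiple `c y³`, and
`c = 0` since the Bessel function decays (`IsRadialSolution.exists_eq_bessel`). So `A(β)` is given by an integral over `ℍ / 𝒪`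
(`IsMaassForm.fourierIntegral_eq_fourierCoeff`), and a cusp form that is not zero has a nonzero
coefficient (`IsMaassForm.exists_fourierCoeff_ne_zero`).

Right ideals of the Hurwitz order are principal, so that the cosets in the double coset of
`diag(p, …, p, 1, …, 1)` have upper triangular representatives in `GL₂(𝒪[1/p])`. Their diagonal
entries are `1`, `p` or generators `a x` of the `p + 1` maximal right ideals above `p`, and
`IsMaassForm.hecke_fourierCoeff` expresses the Hecke operators through coefficients at
`β * a x`, `(a y)⁻¹ * β`, `(a y)⁻¹ * β * a x`, `p * β` and `p⁻¹ * β`.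

For forms in the Maass space, some `A(β) ≠ 0` with `ν(β)` prime to `p`
(`MaassRelations.eq_zero_of_coprime`). At such a `β` most terms vanish for want of integrality, and
the others agree since their arguments have the same invariants. With `λ = A(β α) / A(β)`, where
`ν(α) = p`, the relations for `T₁`, `T₂`, `T₃` at `β` and for `T₁` at an element of norm `p ν(β)`
give the eigenvalues (`MaassRelations.eigenvalues`).

For the local component, a spherical function on `GL_n(ℚ_p)` which is an eigenfunction of the
Hecke operators is determined by the eigenvalues (`spherical_eq_zero`), by induction on the
elementary divisors. Two vectors with the same spherical function generate representations with a
common irreducible constituent (`isConstituent_of_spherical`), and a spherical constituent of the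
principal series has its Hecke eigenvalues, the elementary symmetric functions of the `χ_i(p)` up
to powers of `p`. Hence being a constituent amounts to an identity of elementary symmetric
functions (`isConstituent_principalSeries_iff`), which holds for the parameters `satakeParam`
(`satakeParam_esymm`). Spherical vectors of a local component have the eigenvalues of `F`
(`exists_spherical_of_constituent`), and a local component exists as an irreducible quotient of
the representation generated by the adelization of `F` (`IsMaassForm.exists_localComponent`).
-/

open scoped Quaternion Matrix ContDiff

noncomputable section

namespace MaassLift

/-! ### Integral matrices over `ℚ_p`, Iwasawa and Smith decompositions -/

section LocalMatrices
open Finset hiding inv_def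
open Matrix hiding mul_inv_rev zpow_add
variable {p : ℕ} [hp : Fact p.Prime] {n : ℕ}

/-- The group `GL_n(ℚ_p)`. -/
abbrev GLp (p : ℕ) [Fact p.Prime] (n : ℕ) : Type := (Matrix (Fin n) (Fin n) ℚ_[p])ˣ

/-- The matrix `M` has entries in `ℤ_p`. -/
def IntMat {m n : Type} (M : Matrix m n ℚ_[p]) : Prop := ∀ i j, M i j ∈ PadicInt.subring p

theorem intMat_iff_norm {m n : Type} {M : Matrix m n ℚ_[p]} : IntMat M ↔ ∀ i j, ‖M i j‖ ≤ 1 :=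
  Iff.rfl

theorem IntMat.mul {l m n : Type} [Fintype m] {M : Matrix l m ℚ_[p]} {N : Matrix m n ℚ_[p]}
    (hM : IntMat M) (hN : IntMat N) : IntMat (M * N) := fun i j => by
  rw [mul_apply]
  exact sum_mem fun k _ => mul_mem (hM i k) (hN k j)

theorem IntMat.add {m n : Type} {M N : Matrix m n ℚ_[p]} (hM : IntMat M) (hN : IntMat N) :
    IntMat (M + N) := fun i j => add_mem (hM i j) (hN i j)

theorem IntMat.sub {m n : Type} {M N : Matrix m n ℚ_[p]} (hM : IntMat M) (hN : IntMat N) :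
    IntMat (M - N) := fun i j => sub_mem (hM i j) (hN i j)

theorem IntMat.smul {m n : Type} {M : Matrix m n ℚ_[p]} (hM : IntMat M) {c : ℚ_[p]}
    (hc : c ∈ PadicInt.subring p) : IntMat (c • M) := fun i j => mul_mem hc (hM i j)

theorem IntMat.one {m : Type} [DecidableEq m] : IntMat (1 : Matrix m m ℚ_[p]) := fun i j => by
  rw [one_apply]
  split_ifs
  exacts [one_mem _, zero_mem _]

theorem IntMat.submatrix {m n m' n' : Type} {M : Matrix m n ℚ_[p]} (hM : IntMat M) (f : m' → m)
    (g : n' → n) : IntMat (M.submatrix f g) := fun i j => hM (f i) (g j)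

theorem IntMat.exists_lift {m n : Type} {M : Matrix m n ℚ_[p]} (hM : IntMat M) :
    ∃ N : Matrix m n ℤ_[p], N.map (PadicInt.Coe.ringHom (p := p)) = M :=
  ⟨fun i j => ⟨M i j, hM i j⟩, rfl⟩

theorem IntMat.det_mem {m : Type} [Fintype m] [DecidableEq m] {M : Matrix m m ℚ_[p]}
    (hM : IntMat M) : M.det ∈ PadicInt.subring p := by
  obtain ⟨N, rfl⟩ := hM.exists_lift
  have := RingHom.map_det (PadicInt.Coe.ringHom (p := p)) N
  rw [RingHom.mapMatrix_apply] at this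
  rw [← this]
  exact N.det.2

theorem IntMat.adjugate {m : Type} [Fintype m] [DecidableEq m] {M : Matrix m m ℚ_[p]}
    (hM : IntMat M) : IntMat M.adjugate := by
  obtain ⟨N, rfl⟩ := hM.exists_lift
  have := RingHom.map_adjugate (PadicInt.Coe.ringHom (p := p)) N
  rw [RingHom.mapMatrix_apply, RingHom.mapMatrix_apply] at this
  rw [← this]
  exact fun i j => (N.adjugate i j).2

/-- `GL_n(ℤ_p)` as a subgroup of `GL_n(ℚ_p)`. -/
def KGL (p : ℕ) [Fact p.Prime] (n : ℕ) : Subgroup (GLp p n) where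
  carrier := {g | IntMat g.val ∧ IntMat (g⁻¹).val}
  one_mem' := ⟨by simpa using IntMat.one, by simpa using IntMat.one⟩
  mul_mem' := by
    rintro a b ⟨ha, ha'⟩ ⟨hb, hb'⟩
    refine ⟨by simpa using ha.mul hb, ?_⟩
    rw [mul_inv_rev]
    simpa using hb'.mul ha'
  inv_mem' := by
    rintro a ⟨ha, ha'⟩
    exact ⟨ha', by simpa using ha⟩

theorem norm_det_of_mem_KGL {g : GLp p n} (hg : g ∈ KGL p n) : ‖g.val.det‖ = 1 := by
  have h1 : ‖g.val.det‖ ≤ 1 := hg.1.det_mem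
  have h2 : ‖(g⁻¹).val.det‖ ≤ 1 := hg.2.det_mem
  have h3 : g.val.det * (g⁻¹).val.det = 1 := by rw [← det_mul, Units.mul_inv, det_one]
  have h4 := congrArg norm h3
  rw [norm_mul, norm_one] at h4
  nlinarith [norm_nonneg g.val.det]

theorem det_unit_ne_zero (g : GLp p n) : g.val.det ≠ 0 :=
  ((isUnit_iff_isUnit_det _).1 g.isUnit).ne_zero

theorem mem_KGL_of_det {g : GLp p n} (hg : IntMat g.val) (hd : ‖g.val.det‖ = 1) : g ∈ KGL p n := by
  refine ⟨hg, ?_⟩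
  rw [coe_units_inv, inv_def, Ring.inverse_eq_inv']
  exact hg.adjugate.smul (by rw [PadicInt.mem_subring_iff, norm_inv, hd, inv_one])

/-- Permutation matrices, acting on columns from the right and on rows from the left. -/
theorem exists_KGL_perm (σ : Equiv.Perm (Fin n)) : ∃ k ∈ KGL p n,
    (∀ M : Matrix (Fin n) (Fin n) ℚ_[p], M * k.val = M.submatrix id σ) ∧
    (∀ M : Matrix (Fin n) (Fin n) ℚ_[p], (k⁻¹).val * M = M.submatrix σ id) := by
  let a : Matrix (Fin n) (Fin n) ℚ_[p] := (1 : Matrix (Fin n) (Fin n) ℚ_[p]).submatrix id σ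
  let b : Matrix (Fin n) (Fin n) ℚ_[p] := (1 : Matrix (Fin n) (Fin n) ℚ_[p]).submatrix σ id
  have ha : ∀ M : Matrix (Fin n) (Fin n) ℚ_[p], M * a = M.submatrix id σ := fun M => by
    have := submatrix_mul M (1 : Matrix (Fin n) (Fin n) ℚ_[p]) id id σ Function.bijective_id
    rw [mul_one] at this
    rw [this, submatrix_id_id]
  have hb : ∀ M : Matrix (Fin n) (Fin n) ℚ_[p], b * M = M.submatrix σ id := fun M => by
    have := submatrix_mul (1 : Matrix (Fin n) (Fin n) ℚ_[p]) M σ id id Function.bijective_id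
    rw [one_mul] at this
    rw [this, submatrix_id_id]
  have hba : b * a = 1 := by
    rw [ha]
    ext i j
    simp [b, one_apply]
  have hab : a * b = 1 := mul_eq_one_comm.1 hba
  exact ⟨⟨a, b, hab, hba⟩, ⟨IntMat.one.submatrix _ _, IntMat.one.submatrix _ _⟩, ha, hb⟩

/-- The elements `1 + x yᵀ` of `GL_n(ℤ_p)`, for integral `x` and `y` with `yᵀ x = 0`. -/
theorem exists_KGL_transvec {x y : Fin n → ℚ_[p]} (hx : ∀ i, ‖x i‖ ≤ 1) (hy : ∀ i, ‖y i‖ ≤ 1)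
    (h : y ⬝ᵥ x = 0) : ∃ k ∈ KGL p n, k.val = 1 + vecMulVec x y := by
  have hv : vecMulVec x y * vecMulVec x y = 0 := by
    rw [vecMulVec_mul_vecMulVec, h]
    simp
  have hi : IntMat (vecMulVec x y) := fun i j => mul_mem (show x i ∈ PadicInt.subring p from
    hx i) (show y j ∈ PadicInt.subring p from hy j)
  refine ⟨⟨1 + vecMulVec x y, 1 - vecMulVec x y, ?_, ?_⟩,
    ⟨IntMat.one.add hi, IntMat.one.sub hi⟩, rfl⟩
  · rw [add_mul, mul_sub, mul_sub, hv]; simp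
  · rw [sub_mul, mul_add, mul_add, hv]; simp

theorem norm_div_le_one_of_le {a b : ℚ_[p]} (h : ‖a‖ ≤ ‖b‖) : ‖a / b‖ ≤ 1 := by
  rw [norm_div]
  exact div_le_one_of_le₀ h (norm_nonneg _)

/-- One step of the reduction to upper triangular form by column operations: clear row `t`. -/
theorem exists_clear_row (M : Matrix (Fin n) (Fin n) ℚ_[p]) (t : Fin n)
    (hM : ∀ i j, t < i → j < i → M i j = 0) :
    ∃ k ∈ KGL p n, ∀ i j, t ≤ i → j < i → (M * k.val) i j = 0 := by
  obtain ⟨j₀, hj₀, hmax⟩ := (Finset.Iic t).exists_max_image (fun j => ‖M t j‖) ⟨t, by simp⟩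
  simp only [mem_Iic] at hj₀ hmax
  obtain ⟨s, hs, hsM, -⟩ := exists_KGL_perm (p := p) (Equiv.swap j₀ t)
  set M' := M.submatrix id (Equiv.swap j₀ t) with hM'
  have hle : ∀ j, j ≤ t → Equiv.swap j₀ t j ≤ t := fun j hj => by
    rcases eq_or_ne j t with rfl | h1
    · simpa using hj₀
    rcases eq_or_ne j j₀ with rfl | h2
    · simp
    · rwa [Equiv.swap_apply_of_ne_of_ne h2 h1]
  have h1 : ∀ i j, t < i → j < i → M' i j = 0 := fun i j hi hj => by
    refine hM i _ hi ?_
    by_cases h : j ≤ t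
    · exact (hle j h).trans_lt hi
    · rw [Equiv.swap_apply_of_ne_of_ne]
      · exact hj
      · rintro rfl; exact h hj₀
      · rintro rfl; exact h le_rfl
  have h2 : ∀ j, j ≤ t → ‖M' t j‖ ≤ ‖M' t t‖ := fun j hj => by
    have := hmax _ (hle j hj)
    simpa [hM'] using this
  let y : Fin n → ℚ_[p] := fun j => if j < t then -(M' t j / M' t t) else 0
  have hy : ∀ j, ‖y j‖ ≤ 1 := fun j => by
    simp only [y]
    split_ifs with h
    · rw [norm_neg]; exact norm_div_le_one_of_le (h2 j h.le)
    · simp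
  obtain ⟨k, hk, hk'⟩ := exists_KGL_transvec (x := Pi.single t 1) (y := y) (fun i => by
    rcases eq_or_ne i t with rfl | h
    · simp
    · simp [h]) hy (by simp [y])
  refine ⟨s * k, mul_mem hs hk, fun i j hi hj => ?_⟩
  rw [Units.val_mul, ← mul_assoc, hsM, ← hM', hk', mul_add, mul_one, Matrix.add_apply,
    mul_vecMulVec, vecMulVec_apply]
  simp only [mulVec_single_one, col_apply]
  rcases hi.eq_or_lt with rfl | hi
  · simp only [y, hj, if_true]
    by_cases h0 : M' t t = 0
    · have := h2 j hj.le
      rw [h0, norm_zero] at this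
      rw [norm_le_zero_iff.1 this, h0]; simp
    · field_simp; ring
  · rw [h1 i j hi hj, h1 i t hi hi]; simp

/-- Iwasawa decomposition: every matrix becomes upper triangular after multiplication from the
right with an element of `GL_n(ℤ_p)`. -/
theorem exists_upperTriangular (M : Matrix (Fin n) (Fin n) ℚ_[p]) :
    ∃ k ∈ KGL p n, ∀ i j, j < i → (M * k.val) i j = 0 := by
  suffices H : ∀ t : ℕ, t ≤ n → ∃ k ∈ KGL p n, ∀ i j : Fin n, n - t ≤ (i : ℕ) → j < i →
      (M * k.val) i j = 0 by
    obtain ⟨k, hk, h⟩ := H n le_rfl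
    exact ⟨k, hk, fun i j => h i j (by omega)⟩
  intro t
  induction t with
  | zero => exact fun _ => ⟨1, one_mem _, fun i j hi => by omega⟩
  | succ t ih =>
    intro ht
    obtain ⟨k, hk, h⟩ := ih (by omega)
    obtain ⟨k', hk', h'⟩ := exists_clear_row (M * k.val)
      ⟨n - (t + 1), by omega⟩ (fun i j hi hj => h i j (by
        have : n - (t + 1) < (i : ℕ) := hi
        omega) hj)
    refine ⟨k * k', mul_mem hk hk', fun i j hi hj => ?_⟩
    rw [Units.val_mul, ← mul_assoc]
    exact h' i j (show n - (t + 1) ≤ (i : ℕ) from hi) hj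

/-- One step of the reduction to diagonal form. -/
theorem exists_clear_cross (M : Matrix (Fin n) (Fin n) ℚ_[p]) (t : Fin n)
    (hM : ∀ i j, (i < t ∨ j < t) → i ≠ j → M i j = 0) :
    ∃ k₁ ∈ KGL p n, ∃ k₂ ∈ KGL p n, ∀ i j, (i ≤ t ∨ j ≤ t) → i ≠ j →
      (k₁.val * M * k₂.val) i j = 0 := by
  obtain ⟨⟨i₀, j₀⟩, hij, hmax⟩ := (Finset.Ici t ×ˢ Finset.Ici t).exists_max_image
    (fun ij => ‖M ij.1 ij.2‖) ⟨(t, t), by simp⟩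
  simp only [mem_product, mem_Ici, Prod.forall] at hij hmax
  obtain ⟨s, hs, -, hsM⟩ := exists_KGL_perm (p := p) (Equiv.swap i₀ t)
  obtain ⟨s', hs', hsM', -⟩ := exists_KGL_perm (p := p) (Equiv.swap j₀ t)
  set M' := M.submatrix (Equiv.swap i₀ t) (Equiv.swap j₀ t) with hM'
  have hge : ∀ a j : Fin n, t ≤ a → t ≤ j → t ≤ Equiv.swap a t j := fun a j ha hj => by
    rcases eq_or_ne j t with rfl | h1
    · simpa using ha
    rcases eq_or_ne j a with rfl | h2
    · simp
    · rwa [Equiv.swap_apply_of_ne_of_ne h2 h1]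
  have hlt : ∀ a j : Fin n, t ≤ a → j < t → Equiv.swap a t j = j := fun a j ha hj =>
    Equiv.swap_apply_of_ne_of_ne (by rintro rfl; exact absurd hj (not_lt.2 ha)) hj.ne
  have h1 : ∀ i j, (i < t ∨ j < t) → i ≠ j → M' i j = 0 := fun i j h hne => by
    simp only [hM', submatrix_apply]
    by_cases hi : i < t
    · rw [hlt _ i hij.1 hi]
      refine hM _ _ (Or.inl hi) ?_
      by_cases hj : j < t
      · rwa [hlt _ j hij.2 hj]
      · exact (hi.trans_le (hge _ j hij.2 (not_lt.1 hj))).ne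
    · have hj : j < t := h.resolve_left hi
      rw [hlt _ j hij.2 hj]
      exact hM _ _ (Or.inr hj) (hj.trans_le (hge _ i hij.1 (not_lt.1 hi))).ne'
  have h2 : ∀ i j, t ≤ i → t ≤ j → ‖M' i j‖ ≤ ‖M' t t‖ := fun i j hi hj => by
    have := hmax _ _ ⟨hge _ i hij.1 hi, hge _ j hij.2 hj⟩
    simpa [hM'] using this
  let x : Fin n → ℚ_[p] := fun i => if t < i then -(M' i t / M' t t) else 0
  let y : Fin n → ℚ_[p] := fun j => if t < j then -(M' t j / M' t t) else 0
  have hx : ∀ j, ‖x j‖ ≤ 1 := fun j => by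
    simp only [x]
    split_ifs with h
    · rw [norm_neg]; exact norm_div_le_one_of_le (h2 j t h.le le_rfl)
    · simp
  have hy : ∀ j, ‖y j‖ ≤ 1 := fun j => by
    simp only [y]
    split_ifs with h
    · rw [norm_neg]; exact norm_div_le_one_of_le (h2 t j le_rfl h.le)
    · simp
  have hs1 : ∀ i, ‖(Pi.single t 1 : Fin n → ℚ_[p]) i‖ ≤ 1 := fun i => by
    rcases eq_or_ne i t with rfl | h
    · simp
    · simp [h]
  obtain ⟨k, hk, hk1⟩ := exists_KGL_transvec (x := Pi.single t 1) (y := y) hs1 hy (by simp [y])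
  obtain ⟨k', hk', hk1'⟩ := exists_KGL_transvec (x := x) (y := Pi.single t 1) hx hs1 (by simp [x])
  refine ⟨k' * s⁻¹, mul_mem hk' (inv_mem hs), s' * k, mul_mem hs' hk, fun i j hi hj => ?_⟩
  have e : (k' * s⁻¹).val * M * (s' * k).val = k'.val * M' * k.val := by
    rw [Units.val_mul, Units.val_mul, mul_assoc k'.val, hsM,
      ← mul_assoc, mul_assoc k'.val, hsM', submatrix_submatrix]
    rfl
  have e2 : (k'.val * M' * k.val) i j = M' i j + x i * M' t j + (M' i t + x i * M' t t) * y j := by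
    rw [hk1, hk1', add_mul, one_mul, mul_add, mul_one, Matrix.add_apply, Matrix.add_apply,
      vecMulVec_mul, mul_vecMulVec]
    simp [vecMulVec_apply]
  rw [e, e2]
  by_cases hi0 : i < t
  · have : x i = 0 := by simp [x, hi0.not_gt]
    rw [h1 i j (Or.inl hi0) hj, h1 i t (Or.inl hi0) hi0.ne, this]; simp
  by_cases hj0 : j < t
  · have : y j = 0 := by simp [y, hj0.not_gt]
    rw [h1 i j (Or.inr hj0) hj, h1 t j (Or.inr hj0) hj0.ne', this]; simp
  have hz : M' t t = 0 → ∀ i j, t ≤ i → t ≤ j → M' i j = 0 := fun h i j hi hj => by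
    have := h2 i j hi hj
    rw [h, norm_zero] at this
    exact norm_le_zero_iff.1 this
  rcases hi with hi | hi
  · obtain rfl : i = t := le_antisymm hi (not_lt.1 hi0)
    have hj' : i < j := lt_of_le_of_ne (not_lt.1 hj0) hj
    have hx0 : x i = 0 := by simp [x]
    rw [hx0]
    by_cases h0 : M' i i = 0
    · rw [hz h0 i j le_rfl hj'.le, h0]; simp
    · simp only [y, hj', if_true]; field_simp; ring
  · obtain rfl : j = t := le_antisymm hi (not_lt.1 hj0)
    have hi' : j < i := lt_of_le_of_ne (not_lt.1 hi0) hj.symm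
    have hx0 : y j = 0 := by simp [y]
    rw [hx0]
    by_cases h0 : M' j j = 0
    · rw [hz h0 i j hi'.le le_rfl, h0]; simp
    · simp only [x, hi', if_true]; field_simp; ring

theorem exists_diagonal (M : Matrix (Fin n) (Fin n) ℚ_[p]) :
    ∃ k₁ ∈ KGL p n, ∃ k₂ ∈ KGL p n, ∀ i j, i ≠ j → (k₁.val * M * k₂.val) i j = 0 := by
  suffices H : ∀ t : ℕ, t ≤ n → ∃ k₁ ∈ KGL p n, ∃ k₂ ∈ KGL p n, ∀ i j : Fin n,
      ((i : ℕ) < t ∨ (j : ℕ) < t) → i ≠ j →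
      (k₁.val * M * k₂.val) i j = 0 by
    obtain ⟨k, hk, k', hk', h⟩ := H n le_rfl
    exact ⟨k, hk, k', hk', fun i j => h i j (Or.inl i.2)⟩
  intro t
  induction t with
  | zero => exact fun _ => ⟨1, one_mem _, 1, one_mem _, fun i j hi => by omega⟩
  | succ t ih =>
    intro ht
    obtain ⟨k, hk, k', hk', h⟩ := ih (by omega)
    obtain ⟨l, hl, l', hl', h'⟩ := exists_clear_cross (k.val * M * k'.val) ⟨t, by omega⟩ h
    refine ⟨l * k, mul_mem hl hk, k' * l', mul_mem hk' hl', fun i j hi hj => ?_⟩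
    have := h' i j (by
      simp only [Fin.le_def]
      omega) hj
    simpa only [Units.val_mul, mul_assoc] using this

/-- `p` to the power of an integer vector, as a diagonal matrix. -/
def diagPow (p : ℕ) [Fact p.Prime] (a : Fin n → ℤ) : GLp p n :=
  Units.map (diagonalRingHom (Fin n) ℚ_[p]).toMonoidHom
    (MulEquiv.piUnits.symm fun i => pUnit p ^ a i)

@[simp] theorem coe_diagPow (a : Fin n → ℤ) : (diagPow p a : Matrix (Fin n) (Fin n) ℚ_[p])
    = diagonal fun i => (p : ℚ_[p]) ^ a i := by
  simp only [diagPow, Units.coe_map]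
  change diagonal _ = _
  congr 1
  ext i
  simp [pUnit]

theorem diagPow_add (a b : Fin n → ℤ) : diagPow p (a + b) = diagPow p a * diagPow p b := by
  simp only [diagPow]
  rw [← map_mul, ← map_mul]
  congr 2
  ext i
  simp [zpow_add]

theorem diagPow_zero : diagPow p (0 : Fin n → ℤ) = 1 := by
  apply Units.ext
  simp

theorem diagPow_neg (a : Fin n → ℤ) : diagPow p (-a) = (diagPow p a)⁻¹ := by
  rw [eq_inv_iff_mul_eq_one, ← diagPow_add, neg_add_cancel, diagPow_zero]

theorem diagPow_perm (a : Fin n → ℤ) (σ : Equiv.Perm (Fin n)) :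
    ∃ k ∈ KGL p n, diagPow p (a ∘ σ) = k⁻¹ * diagPow p a * k := by
  obtain ⟨k, hk, h1, h2⟩ := exists_KGL_perm (p := p) σ
  refine ⟨k, hk, Units.ext ?_⟩
  rw [Units.val_mul, Units.val_mul, h2, h1, coe_diagPow, coe_diagPow]
  ext i j
  simp [diagonal_apply]

/-- Smith normal form. -/
theorem exists_smith (g : GLp p n) :
    ∃ k₁ ∈ KGL p n, ∃ k₂ ∈ KGL p n, ∃ a : Fin n → ℤ, Antitone a ∧ g = k₁ * diagPow p a * k₂ := by
  obtain ⟨k, hk, k', hk', h⟩ := exists_diagonal g.val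
  set D := k * g * k' with hD
  have hDd : ∀ i j, i ≠ j → D.val i j = 0 := by simpa [hD] using h
  have hDe : D.val = diagonal fun i => D.val i i := by
    ext i j
    rcases eq_or_ne i j with rfl | hij
    · simp
    · rw [hDd i j hij, diagonal_apply_ne _ hij]
  have hne : ∀ i, D.val i i ≠ 0 := by
    have := det_unit_ne_zero D
    rw [hDe, det_diagonal, prod_ne_zero_iff] at this
    exact fun i => this i (mem_univ _)
  choose b hb using fun i => (⟨_, Padic.norm_eq_zpow_neg_valuation (hne i)⟩ : ∃ b : ℤ, ‖D.val i i‖ = (p : ℝ) ^ (-b))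
  have hnorm : ∀ i, ‖(p : ℚ_[p]) ^ (-b i) * D.val i i‖ = 1 := fun i => by
    rw [norm_mul, hb, Padic.norm_p_zpow]
    rw [neg_neg]
    rw [← zpow_add₀ (by exact_mod_cast hp.out.ne_zero), add_neg_cancel, zpow_zero]
  have hm : diagPow p (-b) * D ∈ KGL p n := by
    have e : (diagPow p (-b) * D).val = diagonal fun i => (p : ℚ_[p]) ^ (-b i) * D.val i i := by
      rw [Units.val_mul, hDe, coe_diagPow, diagonal_mul_diagonal]
      simp
    refine mem_KGL_of_det ?_ ?_
    · rw [e]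
      intro i j
      rw [diagonal_apply]
      split_ifs
      · exact (hnorm i).le
      · exact zero_mem _
    · rw [e, det_diagonal, norm_prod]
      exact prod_eq_one fun i _ => hnorm i
  set σ := Tuple.sort (-b)
  obtain ⟨l, hl, hl'⟩ := diagPow_perm (p := p) b σ
  refine ⟨k⁻¹ * l, mul_mem (inv_mem hk) hl, l⁻¹ * (diagPow p (-b) * D) * k'⁻¹,
    mul_mem (mul_mem (inv_mem hl) hm) (inv_mem hk'), b ∘ σ, ?_, ?_⟩
  · have := Tuple.monotone_sort (-b)
    intro i j hij
    have := this hij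
    simpa using this
  · rw [hl', diagPow_neg, hD]
    group

end LocalMatrices

/-! ### Coset representatives and spherical functions on `GL_n(ℚ_p)` -/

section Cosets
open PadicInt Finset
open Matrix hiding mul_inv_rev zpow_neg zpow_neg_one
variable {p : ℕ} [hp : Fact p.Prime] {n : ℕ}

theorem IntMat.units_mul {g h : GLp p n} (hg : IntMat g.val) (hh : IntMat h.val) :
    IntMat (g * h).val := by
  rw [Units.val_mul]
  exact hg.mul hh

theorem zpow_mem_subring_iff {a : ℤ} : (p : ℚ_[p]) ^ a ∈ subring p ↔ 0 ≤ a := by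
  rw [mem_subring_iff, Padic.norm_p_zpow, zpow_le_one_iff_right₀ (by exact_mod_cast hp.out.one_lt)]
  omega

theorem norm_det_diagPow (a : Fin n → ℤ) :
    ‖(diagPow p a : Matrix (Fin n) (Fin n) ℚ_[p]).det‖ = (p : ℝ) ^ (-∑ i, a i) := by
  rw [coe_diagPow, det_diagonal, norm_prod, ← sum_neg_distrib]
  have h0 : (p : ℝ) ≠ 0 := by exact_mod_cast hp.out.ne_zero
  rw [← prod_congr rfl fun i _ => (Padic.norm_p_zpow (p := p) (a i)).symm]
  induction (Finset.univ : Finset (Fin n)) using Finset.induction_on with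
  | empty => simp
  | insert i s hi ih => rw [prod_insert hi, sum_insert hi, zpow_add₀ h0, ih]

theorem zpow_p_injective {a b : ℤ} (h : (p : ℝ) ^ a = (p : ℝ) ^ b) : a = b :=
  zpow_right_injective₀ (by exact_mod_cast hp.out.pos) (by exact_mod_cast hp.out.one_lt.ne') h

/-- Half of the uniqueness of the Smith normal form: if `b_t > a_t`, then the rows up to `t` and
the columns from `t` on would form a block of zeros modulo `p` in an invertible matrix. -/
theorem smith_le {a b : Fin n → ℤ} (ha : Antitone a) (hb : Antitone b)
    {k k' : GLp p n} (hk : k ∈ KGL p n) (hk' : k' ∈ KGL p n)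
    (h : k * diagPow p a = diagPow p b * k') : b ≤ a := by
  intro t
  by_contra! hlt
  have hsmall : ∀ i j, i ≤ t → t ≤ j → ‖k.val i j‖ < 1 := by
    intro i j hi hj
    have e := congrArg (fun g : GLp p n => ‖g.val i j‖) h
    simp only [Units.val_mul, coe_diagPow, mul_diagonal, diagonal_mul, norm_mul,
      Padic.norm_p_zpow] at e
    have h1 : ‖k'.val i j‖ ≤ 1 := hk'.1 i j
    have hp1 : (1 : ℝ) < p := by exact_mod_cast hp.out.one_lt
    have h2 : (p : ℝ) ^ (-b i) < (p : ℝ) ^ (-a j) :=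
      zpow_lt_zpow_right₀ hp1 (neg_lt_neg ((ha hj).trans_lt (hlt.trans_le (hb hi))))
    have h3 : (0 : ℝ) < (p : ℝ) ^ (-b i) := by positivity
    nlinarith [norm_nonneg (k.val i j)]
  have hdet := norm_det_of_mem_KGL hk
  refine absurd hdet (ne_of_lt ?_)
  rw [det_apply]
  have hterm : ∀ σ : Equiv.Perm (Fin n), ‖Equiv.Perm.sign σ • ∏ i, k.val (σ i) i‖ < 1 := by
    intro σ
    obtain ⟨j, hj, hσ⟩ : ∃ j, t ≤ j ∧ σ j ≤ t := by
      by_contra! hc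
      have : (Finset.Ici t).map σ.toEmbedding ⊆ Finset.Ioi t := by
        intro x hx
        obtain ⟨j, hj, rfl⟩ := mem_map.1 hx
        exact mem_Ioi.2 (hc j (mem_Ici.1 hj))
      have := card_le_card this
      rw [card_map, Fin.card_Ici, Fin.card_Ioi] at this
      omega
    have hs : ‖Equiv.Perm.sign σ • ∏ i, k.val (σ i) i‖ = ∏ i, ‖k.val (σ i) i‖ := by
      rcases Int.units_eq_one_or (Equiv.Perm.sign σ) with h | h <;> simp [h]
    rw [hs, ← mul_prod_erase _ _ (mem_univ j)]
    have h1 := hsmall (σ j) j hσ hj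
    have h2 : ∏ i ∈ Finset.univ.erase j, ‖k.val (σ i) i‖ ≤ 1 :=
      prod_le_one (fun _ _ => norm_nonneg _) fun i _ => hk.1 _ _
    exact (mul_le_of_le_one_right (norm_nonneg _) h2).trans_lt h1
  obtain ⟨σ, -, hσ⟩ := IsUltrametricDist.exists_norm_finsetSum_le_of_nonempty
    (univ_nonempty (α := Equiv.Perm (Fin n))) (fun σ => Equiv.Perm.sign σ • ∏ i, k.val (σ i) i)
  exact hσ.trans_lt (hterm σ)

theorem smith_unique {a b : Fin n → ℤ} (ha : Antitone a) (hb : Antitone b)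
    {k k' : GLp p n} (hk : k ∈ KGL p n) (hk' : k' ∈ KGL p n)
    (h : diagPow p a = k * diagPow p b * k') : a = b := by
  refine le_antisymm (smith_le hb ha hk (inv_mem hk') ?_)
    (smith_le ha hb (inv_mem hk) hk' ?_)
  · rw [h]; group
  · rw [h]; group

/-- The indicator function of a set of indices. -/
def ind (I : Finset (Fin n)) : Fin n → ℤ := fun i => if i ∈ I then 1 else 0

theorem sum_ind (I : Finset (Fin n)) : ∑ i, ind I i = I.card := by simp [ind]

/-- The pairs of indices `i < j` with `i ∈ I`, `j ∉ I`: the free entries of the coset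
representatives with diagonal `p^I`. -/
def IsFree (I : Finset (Fin n)) (i j : Fin n) : Prop := i < j ∧ i ∈ I ∧ j ∉ I

instance (I : Finset (Fin n)) (i j : Fin n) : Decidable (IsFree I i j) :=
  inferInstanceAs (Decidable (_ ∧ _ ∧ _))

/-- The strictly upper triangular part of a coset representative. -/
def nilPart (p : ℕ) [Fact p.Prime] (I : Finset (Fin n)) (c : Fin n × Fin n → ℕ) :
    Matrix (Fin n) (Fin n) ℚ_[p] :=
  of fun i j => if IsFree I i j then (c (i, j) : ℚ_[p]) else 0

theorem nilPart_mul_nilPart (I : Finset (Fin n)) (c c' : Fin n × Fin n → ℕ) :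
    nilPart p I c * nilPart p I c' = 0 := by
  ext i j
  rw [Matrix.mul_apply]
  refine Finset.sum_eq_zero fun k _ => ?_
  simp only [nilPart, Matrix.of_apply]
  by_cases h : k ∈ I
  · rw [if_neg fun h' => h'.2.2 h, zero_mul]
  · rw [if_neg (fun h' : IsFree I k j => h h'.2.1), mul_zero]

theorem intMat_nilPart (I : Finset (Fin n)) (c : Fin n × Fin n → ℕ) : IntMat (nilPart p I c) := by
  intro i j
  simp only [nilPart, Matrix.of_apply]
  split_ifs
  exacts [natCast_mem _ _, zero_mem _]

/-- The unipotent part of a coset representative. -/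
def unipPart (p : ℕ) [Fact p.Prime] (I : Finset (Fin n)) (c : Fin n × Fin n → ℕ) : GLp p n where
  val := 1 + nilPart p I c
  inv := 1 - nilPart p I c
  val_inv := by rw [add_mul, mul_sub, mul_sub, nilPart_mul_nilPart]; simp
  inv_val := by rw [sub_mul, mul_add, mul_add, nilPart_mul_nilPart]; simp

theorem unipPart_mem (I : Finset (Fin n)) (c : Fin n × Fin n → ℕ) : unipPart p I c ∈ KGL p n :=
  ⟨IntMat.one.add (intMat_nilPart I c), IntMat.one.sub (intMat_nilPart I c)⟩

/-- The representative of a coset `x GL_n(ℤ_p)` with diagonal `p^I` and free entries `c`. -/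
def cosetRep (p : ℕ) [Fact p.Prime] (I : Finset (Fin n)) (c : Fin n × Fin n → ℕ) :
    GLp p n := unipPart p I c * diagPow p (ind I)

theorem cosetRep_apply (I : Finset (Fin n)) (c : Fin n × Fin n → ℕ) (i j : Fin n) :
    (cosetRep p I c : Matrix (Fin n) (Fin n) ℚ_[p]) i j
      = if i = j then (p : ℚ_[p]) ^ ind I i else if IsFree I i j then (c (i, j) : ℚ_[p]) else 0 := by
  simp only [cosetRep, Units.val_mul, coe_diagPow, mul_diagonal, unipPart, nilPart,
    Matrix.add_apply, Matrix.of_apply, Matrix.one_apply]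
  by_cases h : i = j
  · subst h
    simp [IsFree]
  · simp only [h, if_false, zero_add]
    split_ifs with h'
    · simp [ind, h'.2.2]
    · simp

/-- The free entries run through `0, …, p - 1`, the others are normalized to `0`. -/
def freeEntries (p : ℕ) (I : Finset (Fin n)) : Finset (Fin n × Fin n → ℕ) :=
  Fintype.piFinset fun ij => if IsFree I ij.1 ij.2 then range p else {0}

/-- The index of a coset representative of size `n`: a set of places on the diagonal and the
entries above the diagonal. -/
abbrev RepIx (n : ℕ) : Type := Σ _ : Finset (Fin n), Fin n × Fin n → ℕ

/-- The index set of representatives of the left cosets of `GL_n(ℤ_p)` in the double coset of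
`diag(p, …, p, 1, …, 1)`, with `m` entries `p`. -/
def repIndex (p n m : ℕ) : Finset (RepIx n) := (powersetCard m Finset.univ).sigma (freeEntries p)

theorem mem_repIndex {p m : ℕ} {x : RepIx n} : x ∈ repIndex p n m ↔ x.1.card = m ∧
      ∀ i j, (IsFree x.1 i j → x.2 (i, j) < p) ∧ (¬ IsFree x.1 i j → x.2 (i, j) = 0) := by
  simp only [repIndex, mem_sigma, mem_powersetCard, subset_univ, true_and,
    freeEntries, Fintype.mem_piFinset, Prod.forall]
  refine and_congr_right fun _ => forall_congr' fun i => forall_congr' fun j => ?_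
  by_cases h : IsFree x.1 i j <;> simp [h]

/-- The initial segment of length `m` of the set of indices. -/
def initSeg (n m : ℕ) : Finset (Fin n) := Finset.univ.filter fun i => (i : ℕ) < m

theorem card_initSeg {m : ℕ} (h : m ≤ n) : (initSeg n m).card = m := by
  rw [initSeg, Fin.card_filter_val_lt, min_eq_right h]

theorem cosetRep_mem {m : ℕ} {x : RepIx n}
    (hx : x ∈ repIndex p n m) : ∃ k ∈ KGL p n, ∃ k' ∈ KGL p n,
      cosetRep p x.1 x.2 = k * diagPow p (ind (initSeg n m)) * k' := by
  have hc := (mem_repIndex.1 hx).1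
  have hmn : m ≤ n := by rw [← hc]; simpa using card_le_univ x.1
  obtain ⟨σ, hσ⟩ : ∃ σ : Equiv.Perm (Fin n), ∀ i, i ∈ x.1 ↔ σ i ∈ initSeg n m := by
    have e : {i // i ∈ x.1} ≃ {i // i ∈ initSeg n m} :=
      equivOfCardEq (hc.trans (card_initSeg hmn).symm)
    exact ⟨e.extendSubtype, fun i => ⟨fun h => e.extendSubtype_mem i h, fun h => by
      by_contra h'
      exact e.extendSubtype_not_mem i h' h⟩⟩
  obtain ⟨k, hk, hk'⟩ := diagPow_perm (p := p) (ind (initSeg n m)) σ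
  refine ⟨unipPart p x.1 x.2 * k⁻¹, mul_mem (unipPart_mem _ _) (inv_mem hk), k, hk, ?_⟩
  have : ind x.1 = ind (initSeg n m) ∘ σ := by ext i; simp [ind, hσ i]
  rw [cosetRep, this, hk']
  group

theorem coe_inv_cosetRep (I : Finset (Fin n)) (c : Fin n × Fin n → ℕ) : ((cosetRep p I c)⁻¹).val
      = diagonal (fun i => (p : ℚ_[p]) ^ (-ind I i)) * (1 - nilPart p I c) := by
  rw [cosetRep, mul_inv_rev, ← diagPow_neg, Units.val_mul, coe_diagPow]
  rfl

theorem cosetRep_injOn {m m' : ℕ} {x y : RepIx n}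
    (hx : x ∈ repIndex p n m) (hy : y ∈ repIndex p n m')
    (h : (cosetRep p x.1 x.2)⁻¹ * cosetRep p y.1 y.2 ∈ KGL p n) : x = y := by
  obtain ⟨I, c⟩ := x
  obtain ⟨J, d⟩ := y
  have hsub : ∀ (I J : Finset (Fin n)) (c d : Fin n × Fin n → ℕ),
      (cosetRep p I c)⁻¹ * cosetRep p J d ∈ KGL p n → I ⊆ J := by
    intro I J c d h i hi
    have h1 := h.1 i i
    rw [Units.val_mul, coe_inv_cosetRep, mul_assoc, diagonal_mul, sub_mul, one_mul,
      Matrix.sub_apply, Matrix.mul_apply, Finset.sum_eq_zero, sub_zero, cosetRep_apply,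
      if_pos rfl] at h1
    · by_contra hj
      simp only [ind, hi, if_true, hj, if_false, zpow_zero, mul_one] at h1
      rw [zpow_mem_subring_iff] at h1
      omega
    · intro k _
      rw [cosetRep_apply]
      simp only [nilPart, Matrix.of_apply]
      by_cases hik : IsFree I i k
      · rw [if_neg hik.1.ne', if_neg (fun h : IsFree J k i => hik.1.not_gt h.1), mul_zero]
      · rw [if_neg hik, zero_mul]
  have hIJ : I = J := Finset.Subset.antisymm (hsub I J c d h) (hsub J I d c (by
    have := inv_mem h
    rwa [mul_inv_rev, inv_inv] at this))
  subst hIJ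
  congr 1
  have hc : ∀ i j, (IsFree I i j → c (i, j) < p) ∧ (¬ IsFree I i j → c (i, j) = 0) :=
    (mem_repIndex.1 hx).2
  have hd : ∀ i j, (IsFree I i j → d (i, j) < p) ∧ (¬ IsFree I i j → d (i, j) = 0) :=
    (mem_repIndex.1 hy).2
  ext ⟨i, j⟩
  by_cases hf : IsFree I i j
  swap
  · rw [(hc i j).2 hf, (hd i j).2 hf]
  have h1 := h.1 i j
  have e : (1 - nilPart p I c) * (1 + nilPart p I d) = 1 + (nilPart p I d - nilPart p I c) := by
    rw [sub_mul, mul_add, mul_add, nilPart_mul_nilPart]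
    simp only [mul_one, one_mul, add_zero]
    abel
  rw [Units.val_mul, coe_inv_cosetRep, cosetRep, Units.val_mul, coe_diagPow, mul_assoc,
    diagonal_mul, ← mul_assoc, mul_diagonal] at h1
  simp only [unipPart, e] at h1
  simp only [Matrix.add_apply, Matrix.sub_apply, Matrix.one_apply_ne hf.1.ne, nilPart,
    Matrix.of_apply, hf, if_true, zero_add, ind, hf.2.1, hf.2.2, if_false, zpow_zero, mul_one] at h1
  have hp0 : (p : ℚ_[p]) ≠ 0 := by exact_mod_cast hp.out.ne_zero
  have h2 : ‖(((d (i, j) : ℤ) - (c (i, j) : ℤ) : ℤ) : ℚ_[p])‖ < 1 := by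
    have : (((d (i, j) : ℤ) - (c (i, j) : ℤ) : ℤ) : ℚ_[p])
        = p * ((p : ℚ_[p]) ^ (-1 : ℤ) * ((d (i, j) : ℚ_[p]) - (c (i, j) : ℚ_[p]))) := by
      rw [← mul_assoc, zpow_neg_one, mul_inv_cancel₀ hp0, one_mul]; push_cast; ring
    rw [this, norm_mul]
    exact (mul_le_of_le_one_right (norm_nonneg _) h1).trans_lt Padic.norm_p_lt_one
  rw [Padic.norm_intCast_lt_one_iff] at h2
  have h3 := (hc i j).1 hf
  have h4 := (hd i j).1 hf
  have := Int.eq_zero_of_abs_lt_dvd h2 (by rw [abs_lt]; omega)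
  omega

theorem exists_natCast_near {x : ℚ_[p]} (hx : x ∈ subring p) :
    ∃ c : ℕ, c < p ∧ (p : ℚ_[p])⁻¹ * (x - c) ∈ subring p := by
  obtain ⟨z, rfl⟩ : ∃ z : ℤ_[p], (z : ℚ_[p]) = x := ⟨⟨x, hx⟩, rfl⟩
  obtain ⟨c, hc, hm⟩ := exists_mem_range (p := p) z
  refine ⟨c, hc, ?_⟩
  rw [maximalIdeal_eq_span_p, Ideal.mem_span_singleton] at hm
  obtain ⟨y, hy⟩ := hm
  have h2 := congrArg (fun z : ℤ_[p] => (z : ℚ_[p])) hy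
  simp only [PadicInt.coe_sub, PadicInt.coe_natCast, PadicInt.coe_mul] at h2
  rw [h2, ← mul_assoc, inv_mul_cancel₀ (by exact_mod_cast hp.out.ne_zero), one_mul]
  exact y.2

/-- The rows of `b` with non-unit diagonal entry are, modulo `p`, combinations of the rows below
with unit diagonal entry, if `b` is upper triangular and divides `p`. -/
theorem exists_row_combination {b q : Matrix (Fin n) (Fin n) ℚ_[p]} (hq : IntMat q)
    (hqt : ∀ i j, j < i → q i j = 0) (hqb : q * b = (p : ℚ_[p]) • (1 : Matrix (Fin n) (Fin n) ℚ_[p]))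
    {I : Finset (Fin n)} (hI : ∀ i ∈ I, ‖q i i‖ = 1) :
    ∀ i ∈ I, ∃ x : Fin n → ℚ_[p], (∀ j, x j ∈ subring p) ∧ (∀ j, ¬ IsFree I i j → x j = 0) ∧
      ∀ k, (p : ℚ_[p])⁻¹ * (b i k - ∑ j, x j * b j k) ∈ subring p := by
  intro i
  induction i using WellFoundedGT.induction with
  | ind i ih =>
  intro hi
  choose x hx1 hx2 hx3 using fun (l : {l : Fin n // i < l ∧ l ∈ I}) => ih l.1 l.2.1 l.2.2
  have hii : q i i ≠ 0 := fun h => by simpa [h] using hI i hi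
  have hr : ∀ l, q i l / q i i ∈ subring p := fun l => by
    rw [mem_subring_iff, norm_div, hI i hi, div_one]
    exact hq i l
  let X : Fin n → Fin n → ℚ_[p] := fun l j =>
    if h : i < l ∧ l ∈ I then x ⟨l, h⟩ j else if i < l ∧ l = j then 1 else 0
  have hX1 : ∀ l j, X l j ∈ subring p := fun l j => by
    simp only [X]; split_ifs
    exacts [hx1 _ _, one_mem _, zero_mem _]
  have hX2 : ∀ l j, ¬ IsFree I i j → X l j = 0 := fun l j h => by
    simp only [X]; split_ifs with h1 h2
    · exact hx2 _ _ fun h' => h ⟨h1.1.trans h'.1, hi, h'.2.2⟩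
    · obtain ⟨h2, rfl⟩ := h2
      exact absurd ⟨h2, hi, fun h' => h1 ⟨h2, h'⟩⟩ h
    · rfl
  have hX3 : ∀ l k, i < l → (p : ℚ_[p])⁻¹ * (b l k - ∑ j, X l j * b j k) ∈ subring p := by
    intro l k hl
    by_cases h : l ∈ I
    · have := hx3 ⟨l, hl, h⟩ k
      simpa only [X, hl, h, and_self, dif_pos] using this
    · have : ∑ j, X l j * b j k = b l k := by
        simp [X, hl, h]
      rw [this]; simp
  refine ⟨fun j => -∑ l ∈ Finset.Ioi i, q i l / q i i * X l j,
    fun j => neg_mem (sum_mem fun l _ => mul_mem (hr l) (hX1 l j)),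
    fun j h => by simp [hX2 _ j h], fun k => ?_⟩
  have hrow : (p : ℚ_[p])⁻¹ * ∑ l, q i l / q i i * b l k ∈ subring p := by
    have h1 := congrFun (congrFun hqb i) k
    rw [Matrix.mul_apply, Matrix.smul_apply, smul_eq_mul] at h1
    have h2 : ∑ l, q i l / q i i * b l k = (q i i)⁻¹ * (p * (1 : Matrix (Fin n) (Fin n) ℚ_[p]) i k) := by
      rw [← h1, mul_sum]
      exact sum_congr rfl fun l _ => by ring
    rw [h2, mul_left_comm, ← mul_assoc (p : ℚ_[p])⁻¹,
      inv_mul_cancel₀ (by exact_mod_cast hp.out.ne_zero), one_mul]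
    exact mul_mem (by rw [mem_subring_iff, norm_inv, hI i hi, inv_one]) (IntMat.one i k)
  have hsplit : ∑ l, q i l / q i i * b l k = b i k + ∑ l ∈ Finset.Ioi i, q i l / q i i * b l k := by
    rw [← add_sum_erase _ _ (mem_univ i), div_self hii, one_mul]
    congr 1
    symm
    refine sum_subset (fun l hl => ?_) fun l hl hl' => ?_
    · simp only [mem_Ioi] at hl
      simp [hl.ne']
    · simp only [mem_erase, mem_univ, and_true] at hl
      simp only [mem_Ioi, not_lt] at hl'
      rw [hqt i l (lt_of_le_of_ne hl' hl)]; simp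
  have hswap : ∑ j, (∑ l ∈ Finset.Ioi i, q i l / q i i * X l j) * b j k
      = ∑ l ∈ Finset.Ioi i, q i l / q i i * ∑ j, X l j * b j k := by
    simp only [sum_mul, mul_sum]
    rw [sum_comm]
    exact sum_congr rfl fun l _ => sum_congr rfl fun j _ => by ring
  have e : (p : ℚ_[p])⁻¹ * (b i k - ∑ j, (-∑ l ∈ Finset.Ioi i, q i l / q i i * X l j) * b j k)
      = (p : ℚ_[p])⁻¹ * (∑ l, q i l / q i i * b l k)
        - ∑ l ∈ Finset.Ioi i, q i l / q i i * ((p : ℚ_[p])⁻¹ * (b l k - ∑ j, X l j * b j k)) := by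
    simp only [neg_mul, sum_neg_distrib, sub_neg_eq_add]
    rw [hswap, hsplit]
    simp only [mul_sub, sum_sub_distrib, mul_add, mul_sum]
    have h1 : ∀ l, q i l / q i i * ((p : ℚ_[p])⁻¹ * b l k) = (p : ℚ_[p])⁻¹ * (q i l / q i i * b l k) :=
      fun l => by ring
    have h2 : ∀ l j, q i l / q i i * ((p : ℚ_[p])⁻¹ * (X l j * b j k))
        = (p : ℚ_[p])⁻¹ * (q i l / q i i * (X l j * b j k)) := fun l j => by ring
    simp only [h1, h2]
    ring
  rw [e]
  exact sub_mem hrow (sum_mem fun l hl => mul_mem (hr l) (hX3 l k (mem_Ioi.1 hl)))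

/-- The representatives exhaust the double coset: an upper triangular element of it has the exponents
`0` and `1` on the diagonal, and the entries above the diagonal can be reduced modulo `p`. -/
theorem exists_cosetRep {m : ℕ} (hm : m ≤ n) {g k k' : GLp p n}
    (hk : k ∈ KGL p n) (hk' : k' ∈ KGL p n) (hg : g = k * diagPow p (ind (initSeg n m)) * k') :
    ∃ x ∈ repIndex p n m, (cosetRep p x.1 x.2)⁻¹ * g ∈ KGL p n := by
  have hp0 : (p : ℚ_[p]) ≠ 0 := by exact_mod_cast hp.out.ne_zero
  have hp1 : (1 : ℝ) < p := by exact_mod_cast hp.out.one_lt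
  obtain ⟨l, hl, hlt⟩ := exists_upperTriangular g.val
  set b := g * l with hb
  -- The four properties of the double coset that matter.
  have hbt : ∀ i j, j < i → b.val i j = 0 := by simpa [hb] using hlt
  have hbi : IntMat b.val := by
    rw [hb, hg]
    refine ((hk.1.units_mul ?_).units_mul hk'.1).units_mul hl.1
    rw [coe_diagPow]
    intro i j
    rw [Matrix.diagonal_apply]
    split_ifs
    · exact zpow_mem_subring_iff.2 (by simp only [ind]; split_ifs <;> simp)
    · exact zero_mem _
  set q : Matrix (Fin n) (Fin n) ℚ_[p] := (p : ℚ_[p]) • (b⁻¹).val with hq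
  have hqi : IntMat q := by
    have e : q = (l⁻¹).val * (k'⁻¹).val *
        ((p : ℚ_[p]) • (diagPow p (-ind (initSeg n m)) : Matrix (Fin n) (Fin n) ℚ_[p])) *
        (k⁻¹).val := by
      rw [hq, hb, hg, Matrix.mul_smul, Matrix.smul_mul, diagPow_neg]
      simp only [mul_inv_rev, Units.val_mul, mul_assoc]
    rw [e]
    refine ((hl.2.mul hk'.2).mul ?_).mul hk.2
    intro i j
    rw [coe_diagPow, Matrix.smul_apply, Matrix.diagonal_apply]
    split_ifs
    · rw [smul_eq_mul, ← zpow_one_add₀ hp0]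
      exact zpow_mem_subring_iff.2 (by simp only [Pi.neg_apply, ind]; split_ifs <;> simp)
    · simp
  have hqt : ∀ i j, j < i → q i j = 0 := by
    have hbt' : b.val.BlockTriangular id := fun i j hij => hbt i j hij
    have : Invertible b.val := b.invertible
    have := blockTriangular_inv_of_blockTriangular hbt'
    intro i j hij
    rw [hq, Matrix.smul_apply, Matrix.coe_units_inv, this hij, smul_zero]
  have hqb : q * b.val = (p : ℚ_[p]) • 1 := by rw [hq, Matrix.smul_mul, Units.inv_mul]
  have hdiag : ∀ i, q i i * b.val i i = p := fun i => by
    have h1 := congrFun (congrFun hqb i) i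
    rw [Matrix.mul_apply, Finset.sum_eq_single i, Matrix.smul_apply, Matrix.one_apply_eq,
      smul_eq_mul, mul_one] at h1
    · exact h1
    · intro j _ hj
      rcases lt_or_gt_of_ne hj with h | h
      · rw [hqt i j h, zero_mul]
      · rw [hbt j i h, mul_zero]
    · simp
  have hdetb : ‖b.val.det‖ = (p : ℝ) ^ (-(m : ℤ)) := by
    rw [hb, hg]
    simp only [Units.val_mul, det_mul, norm_mul, norm_det_of_mem_KGL hk,
      norm_det_of_mem_KGL hk', norm_det_of_mem_KGL hl, norm_det_diagPow, sum_ind, card_initSeg hm]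
    simp
  set I : Finset (Fin n) := Finset.univ.filter fun i => ‖b.val i i‖ < 1 with hI
  have hIp : ∀ i ∈ I, ‖b.val i i‖ = (p : ℝ)⁻¹ ∧ ‖q i i‖ = 1 := by
    intro i hi
    simp only [hI, mem_filter, mem_univ, true_and] at hi
    have h1 := congrArg norm (hdiag i)
    rw [norm_mul, Padic.norm_p] at h1
    have h2 : ‖b.val i i‖ ≤ (p : ℝ)⁻¹ := by
      have := (Padic.norm_le_pow_iff_norm_lt_pow_add_one
        (b.val i i) (-1)).2 (by simpa using hi)
      simpa using this
    have h3 : ‖q i i‖ ≤ 1 := hqi i i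
    have h4 : (0 : ℝ) < (p : ℝ)⁻¹ := by positivity
    have h5 : ‖q i i‖ = 1 := by
      refine le_antisymm h3 ?_
      by_contra! h
      nlinarith [norm_nonneg (q i i)]
    rw [h5, one_mul] at h1
    exact ⟨h1, h5⟩
  have hcard : I.card = m := by
    have hut : b.val.BlockTriangular id := fun i j hij => hbt i j hij
    rw [det_of_isUpperTriangular hut, norm_prod, ← prod_filter_mul_prod_filter_not Finset.univ
        (fun i => ‖b.val i i‖ < 1), ← hI, prod_congr rfl fun i hi => (hIp i hi).1, prod_const,
      prod_eq_one, mul_one] at hdetb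
    · have : (p : ℝ) ^ (-(I.card : ℤ)) = (p : ℝ) ^ (-(m : ℤ)) := by
        rw [← hdetb, zpow_neg, zpow_natCast, inv_pow]
      have := zpow_p_injective this
      omega
    · intro i hi
      simp only [mem_filter, mem_univ, true_and, not_lt] at hi
      exact le_antisymm (hbi i i) hi
  choose! x hx1 hx2 hx3 using exists_row_combination hqi hqt hqb (fun i hi => (hIp i hi).2)
  have hc : ∀ i j, ∃ c : ℕ, (IsFree I i j → c < p ∧
      (p : ℚ_[p])⁻¹ * (x i j - c) ∈ subring p) ∧ (¬ IsFree I i j → c = 0) := by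
    intro i j
    by_cases h : IsFree I i j
    · obtain ⟨c, hc, hc'⟩ := exists_natCast_near (hx1 i h.2.1 j)
      exact ⟨c, fun _ => ⟨hc, hc'⟩, fun h' => absurd h h'⟩
    · exact ⟨0, fun h' => absurd h' h, fun _ => rfl⟩
  choose c hc1 hc2 using hc
  refine ⟨⟨I, fun ij => c ij.1 ij.2⟩, mem_repIndex.2 ⟨hcard, fun i j =>
    ⟨fun h => (hc1 i j h).1, hc2 i j⟩⟩, ?_⟩
  suffices H : (cosetRep p I fun ij => c ij.1 ij.2)⁻¹ * b ∈ KGL p n by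
    have := mul_mem H (inv_mem hl)
    rwa [hb, mul_assoc, mul_assoc, mul_inv_cancel, mul_one] at this
  refine mem_KGL_of_det ?_ ?_
  · intro i k
    rw [Units.val_mul, coe_inv_cosetRep, mul_assoc, diagonal_mul, sub_mul, one_mul,
      Matrix.sub_apply, Matrix.mul_apply]
    simp only [nilPart, Matrix.of_apply]
    by_cases hi : i ∈ I
    · have e : (p : ℚ_[p]) ^ (-ind I i) * (b.val i k - ∑ j,
          (if IsFree I i j then (c i j : ℚ_[p]) else 0) * b.val j k)
          = (p : ℚ_[p])⁻¹ * (b.val i k - ∑ j, x i j * b.val j k)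
            + ∑ j, (if IsFree I i j then (p : ℚ_[p])⁻¹ * (x i j - c i j) else 0) * b.val j k := by
        have h1 : ∀ j, (if IsFree I i j then (p : ℚ_[p])⁻¹ * (x i j - c i j) else 0)
            = (p : ℚ_[p])⁻¹ * (x i j - if IsFree I i j then (c i j : ℚ_[p]) else 0) := fun j => by
          split_ifs with h
          · rfl
          · rw [hx2 i hi j h]; simp
        simp only [h1, mul_assoc, ← mul_sum, ind, hi, if_true, zpow_neg_one, sub_mul,
          sum_sub_distrib]
        ring
      rw [e]
      refine add_mem (hx3 i hi k) (sum_mem fun j _ => mul_mem ?_ (hbi j k))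
      split_ifs with h
      exacts [(hc1 i j h).2, zero_mem _]
    · have h0 : ∀ j, ¬ IsFree I i j := fun j h => hi h.2.1
      simp only [h0, if_false, zero_mul, sum_const_zero, sub_zero, ind, hi, neg_zero,
        zpow_zero, one_mul]
      exact hbi i k
  · have h1 : ‖((cosetRep p I fun ij => c ij.1 ij.2)⁻¹).val.det‖ = (p : ℝ) ^ (m : ℤ) := by
      rw [cosetRep, mul_inv_rev, ← diagPow_neg, Units.val_mul, det_mul, norm_mul,
        norm_det_diagPow, norm_det_of_mem_KGL (inv_mem (unipPart_mem _ _)), mul_one]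
      simp only [Pi.neg_apply, sum_neg_distrib, neg_neg, sum_ind, hcard]
    rw [Units.val_mul, det_mul, norm_mul, h1, hdetb, ← zpow_add₀ (by positivity),
      add_neg_cancel, zpow_zero]

end Cosets

/-! ### Spherical functions are determined by their Hecke eigenvalues -/

section Spherical
open Finset Matrix
variable {p : ℕ} [hp : Fact p.Prime] {n : ℕ}

theorem sum_sub_ind (a : Fin n → ℤ) (I : Finset (Fin n)) :
    ∑ i, (a - ind I) i = ∑ i, a i - I.card := by simp only [Pi.sub_apply, sum_sub_distrib, sum_ind]

/-- The indices at which an exponent vector is positive. -/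
def posSet (a : Fin n → ℤ) : Finset (Fin n) := univ.filter fun i => 1 ≤ a i

theorem antitone_sub_ind {a : Fin n → ℤ} (ha : Antitone a) (h0 : ∀ i, 0 ≤ a i) :
    Antitone (a - ind (posSet a)) := by
  intro i j hij
  have h1 := ha hij
  have h2 := h0 i
  have h3 := h0 j
  simp only [Pi.sub_apply, ind, posSet, mem_filter, mem_univ, true_and]
  split_ifs <;> omega

theorem posSet_eq_of_card {a b : Fin n → ℤ} (ha : Antitone a) (hb : Antitone b)
    (h : (posSet a).card = (posSet b).card) : posSet a = posSet b := by
  have key : ∀ {a b : Fin n → ℤ}, Antitone a → Antitone b → (posSet a).card = (posSet b).card →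
      posSet a ⊆ posSet b → posSet a = posSet b := fun _ _ h h' =>
    eq_of_subset_of_card_le h' h.ge
  by_cases hs : posSet a ⊆ posSet b
  · exact key ha hb h hs
  · refine (key hb ha h.symm fun j hj => ?_).symm
    obtain ⟨i, hi, hi'⟩ := not_subset.1 hs
    simp only [posSet, mem_filter, mem_univ, true_and, not_le] at hi hi' hj ⊢
    rcases le_total j i with hji | hij
    · exact hi.trans (ha hji)
    · have := hb hij
      omega

theorem intMat_diagPow {a : Fin n → ℤ} :
    IntMat (diagPow p a : Matrix (Fin n) (Fin n) ℚ_[p]) ↔ ∀ i, 0 ≤ a i := by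
  rw [coe_diagPow]
  constructor
  · intro h i
    have := h i i
    rwa [diagonal_apply_eq, zpow_mem_subring_iff] at this
  · intro h i j
    rw [Matrix.diagonal_apply]
    split_ifs
    exacts [zpow_mem_subring_iff.2 (h i), zero_mem _]

/-- Multiplying an element `x` of type `a - 1_I`, where `I` is the set of positive entries of `a`,
by an element of the double coset of `p^I` leads to an element of type `a` or to an element whose
type has more positive entries. -/
theorem pieri {a : Fin n → ℤ} (ha : Antitone a) (h0 : ∀ i, 0 ≤ a i)
    {r k₁ k₂ : GLp p n} (hr : IntMat r.val) (hr' : IntMat ((p : ℚ_[p]) • (r⁻¹).val))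
    (hdet : ‖r.val.det‖ = (p : ℝ) ^ (-((posSet a).card : ℤ)))
    (hk₁ : k₁ ∈ KGL p n) (hk₂ : k₂ ∈ KGL p n) {b : Fin n → ℤ} (hb : Antitone b)
    (h : diagPow p (a - ind (posSet a)) * r = k₁ * diagPow p b * k₂) :
    (∀ i, 0 ≤ b i) ∧ ∑ i, b i = ∑ i, a i ∧ (b = a ∨ (posSet a).card < (posSet b).card) := by
  have hx : IntMat (diagPow p (a - ind (posSet a)) : Matrix (Fin n) (Fin n) ℚ_[p]) := by
    rw [intMat_diagPow]
    intro i
    have := h0 i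
    simp only [Pi.sub_apply, ind, posSet, mem_filter, mem_univ, true_and]
    split_ifs <;> omega
  have hb0 : ∀ i, 0 ≤ b i := by
    rw [← intMat_diagPow (p := p)]
    have : diagPow p b = k₁⁻¹ * (diagPow p (a - ind (posSet a)) * r) * k₂⁻¹ := by rw [h]; group
    rw [this]
    exact (hk₁.2.units_mul (hx.units_mul hr)).units_mul hk₂.2
  have hsum : ∑ i, b i = ∑ i, a i := by
    have := congrArg (fun g : GLp p n => ‖g.val.det‖) h
    simp only [Units.val_mul, det_mul, norm_mul, norm_det_of_mem_KGL hk₁,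
      norm_det_of_mem_KGL hk₂, norm_det_diagPow, sum_sub_ind, hdet, one_mul, mul_one] at this
    rw [← zpow_add₀ (by exact_mod_cast hp.out.ne_zero)] at this
    have := zpow_p_injective this
    omega
  refine ⟨hb0, hsum, ?_⟩
  set J := posSet b with hJ
  set z := (diagPow p (b - ind J))⁻¹ * k₁⁻¹ * diagPow p (a - ind (posSet a)) with hz
  have hz' : z = diagPow p (ind J) * k₂ * r⁻¹ := by
    have e : diagPow p (a - ind (posSet a)) = k₁ * diagPow p b * k₂ * r⁻¹ := by rw [← h]; group
    have e2 : b = (b - ind J) + ind J := by simp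
    rw [hz, e]
    conv_lhs => rw [e2]
    rw [diagPow_add]
    have e3 : b - ind J + ind J - ind J = b - ind J := by simp
    rw [e3]
    group
  have hzi : IntMat z.val := by
    intro i j
    by_cases hi : i ∈ J
    · rw [hz', mul_assoc, Units.val_mul, coe_diagPow, diagonal_mul, Units.val_mul]
      simp only [ind, hi, if_true, zpow_one]
      have := hk₂.1.mul hr' i j
      rwa [Matrix.mul_smul, Matrix.smul_apply, smul_eq_mul] at this
    · have hbi : b i = 0 := by
        have := hb0 i
        simp only [hJ, posSet, mem_filter, mem_univ, true_and, not_le] at hi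
        omega
      rw [hz, mul_assoc, ← diagPow_neg, Units.val_mul, coe_diagPow, diagonal_mul]
      simp only [Pi.neg_apply, Pi.sub_apply, hbi, ind, hi, if_false, sub_self, neg_zero, zpow_zero,
        one_mul]
      exact hk₁.2.units_mul hx i j
  have hzd : ‖z.val.det‖ = (p : ℝ) ^ (((posSet a).card : ℤ) - J.card) := by
    rw [hz, ← diagPow_neg]
    simp only [Units.val_mul, det_mul, norm_mul, norm_det_of_mem_KGL (inv_mem hk₁),
      norm_det_diagPow, sum_sub_ind, mul_one, Pi.neg_apply, sum_neg_distrib, neg_neg]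
    rw [← zpow_add₀ (by exact_mod_cast hp.out.ne_zero), hsum]
    congr 1
    ring
  have hle : (posSet a).card ≤ J.card := by
    have h1 : ‖z.val.det‖ ≤ 1 := hzi.det_mem
    rw [hzd, zpow_le_one_iff_right₀ (by exact_mod_cast hp.out.one_lt)] at h1
    omega
  rcases hle.eq_or_lt with hc | hc
  · left
    have hzK : z ∈ KGL p n := mem_KGL_of_det hzi (by rw [hzd, hc, sub_self, zpow_zero])
    have e : diagPow p (a - ind (posSet a)) = k₁ * diagPow p (b - ind J) * z := by rw [hz]; group
    have := smith_unique (antitone_sub_ind ha h0) (antitone_sub_ind hb hb0) hk₁ hzK e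
    have hJ' : posSet a = J := posSet_eq_of_card ha hb hc
    rw [hJ'] at this
    exact (sub_left_injective this).symm
  · exact Or.inr hc

theorem cosetRep_int {m : ℕ} {x : RepIx n} (hx : x ∈ repIndex p n m) :
    IntMat (cosetRep p x.1 x.2 : Matrix (Fin n) (Fin n) ℚ_[p]) ∧
    IntMat ((p : ℚ_[p]) • (((cosetRep p x.1 x.2)⁻¹ : GLp p n) : Matrix (Fin n) (Fin n) ℚ_[p])) ∧
    ‖(cosetRep p x.1 x.2 : Matrix (Fin n) (Fin n) ℚ_[p]).det‖ = (p : ℝ) ^ (-(m : ℤ)) := by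
  refine ⟨?_, ?_, ?_⟩
  · refine (unipPart_mem _ _).1.units_mul (intMat_diagPow.2 fun i => ?_)
    simp only [ind]; split_ifs <;> simp
  · rw [coe_inv_cosetRep, ← smul_mul]
    refine IntMat.mul ?_ (IntMat.one.sub (intMat_nilPart _ _))
    intro i j
    rw [Matrix.smul_apply, Matrix.diagonal_apply]
    split_ifs
    · rw [smul_eq_mul, ← zpow_one_add₀ (by exact_mod_cast hp.out.ne_zero)]
      exact zpow_mem_subring_iff.2 (by simp only [ind]; split_ifs <;> simp)
    · simp
  · rw [cosetRep, Units.val_mul, det_mul, norm_mul, norm_det_of_mem_KGL (unipPart_mem _ _),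
      one_mul, norm_det_diagPow, sum_ind, (mem_repIndex.1 hx).1]

theorem zero_mem_repIndex (I : Finset (Fin n)) : (⟨I, 0⟩ : RepIx n) ∈ repIndex p n I.card :=
  mem_repIndex.2 ⟨rfl, fun _ _ => ⟨fun _ => hp.out.pos, fun _ => rfl⟩⟩

theorem cosetRep_zero (I : Finset (Fin n)) : cosetRep p I 0 = diagPow p (ind I) := by
  have : unipPart p I 0 = 1 := by
    apply Units.ext
    ext i j
    simp [unipPart, nilPart]
  rw [cosetRep, this, one_mul]

/-- A spherical function that is an eigenfunction of the Hecke operators of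
`diag(p, …, p, 1, …, 1)` and vanishes at `1` is zero. -/
theorem spherical_eq_zero {w : GLp p n → ℂ}
    (hl : ∀ k ∈ KGL p n, ∀ g, w (k * g) = w g) (hr : ∀ k ∈ KGL p n, ∀ g, w (g * k) = w g)
    {μ : ℕ → ℂ} (hμ : ∀ m, 1 ≤ m → m ≤ n → ∀ x,
      ∑ c ∈ repIndex p n m, w (x * cosetRep p c.1 c.2) = μ m * w x)
    (hn : 1 ≤ n) (hμn : μ n ≠ 0) (h1 : w 1 = 0) (g : GLp p n) : w g = 0 := by
  -- Induction on the determinant, then on the corank modulo `p`.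
  have key : ∀ N M : ℕ, ∀ a : Fin n → ℤ, Antitone a → (∀ i, 0 ≤ a i) → ∑ i, a i = N →
      n - (posSet a).card = M → w (diagPow p a) = 0 := by
    intro N
    induction N using Nat.strong_induction_on with
    | _ N ihN =>
    intro M
    induction M using Nat.strong_induction_on with
    | _ M ihM =>
    intro a ha h0 hN hM
    have hle : (posSet a).card ≤ n := by simpa using card_le_univ (posSet a)
    rcases Nat.eq_zero_or_pos (posSet a).card with hz | hpos
    · have : a = 0 := by
        ext i
        have h2 : i ∉ posSet a := by rw [card_eq_zero.1 hz]; simp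
        have h3 := h0 i
        simp only [posSet, mem_filter, mem_univ, true_and, not_le] at h2
        simp only [Pi.zero_apply]
        omega
      rw [this, diagPow_zero, h1]
    set x := diagPow p (a - ind (posSet a)) with hx
    have hwx : w x = 0 := by
      have h00 : ∀ i, 0 ≤ (a - ind (posSet a)) i := fun i => by
        have := h0 i
        simp only [Pi.sub_apply, ind, posSet, mem_filter, mem_univ, true_and]
        split_ifs <;> omega
      have hs := sum_sub_ind a (posSet a)
      have hnn : 0 ≤ ∑ i, (a - ind (posSet a)) i := sum_nonneg fun i _ => h00 i
      exact ihN (∑ i, (a - ind (posSet a)) i).toNat (by omega) _ _ (antitone_sub_ind ha h0) h00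
        (by omega) rfl
    have hterm : ∀ c ∈ repIndex p n (posSet a).card, ∃ e : ℕ,
        w (x * cosetRep p c.1 c.2) = e * w (diagPow p a) ∧ (c = ⟨posSet a, 0⟩ → e = 1) := by
      intro c hc
      obtain ⟨hc1, hc2, hc3⟩ := cosetRep_int hc
      by_cases hca : c = ⟨posSet a, 0⟩
      · refine ⟨1, ?_, fun _ => rfl⟩
        rw [hca, cosetRep_zero, hx, ← diagPow_add, sub_add_cancel]
        simp
      obtain ⟨k₁, hk₁, k₂, hk₂, b, hb, hxb⟩ := exists_smith (x * cosetRep p c.1 c.2)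
      obtain ⟨hb0, hbs, hba⟩ := pieri ha h0 hc1 hc2 hc3 hk₁ hk₂ hb hxb
      have hw : w (x * cosetRep p c.1 c.2) = w (diagPow p b) := by rw [hxb, hr _ hk₂, hl _ hk₁]
      rcases hba with rfl | hba
      · exact ⟨1, by rw [hw]; simp, fun _ => rfl⟩
      · refine ⟨0, ?_, fun h => absurd h hca⟩
        have hle' : (posSet b).card ≤ n := by simpa using card_le_univ (posSet b)
        rw [hw, ihM _ (by omega) b hb hb0 (hbs.trans hN) rfl]
        simp
    choose! e he he1 using hterm
    have hsum := hμ _ hpos hle x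
    rw [hwx, mul_zero, sum_congr rfl he, ← sum_mul, mul_eq_zero] at hsum
    refine hsum.resolve_left ?_
    have hmem := zero_mem_repIndex (p := p) (posSet a)
    rw [← Nat.cast_sum, Nat.cast_eq_zero, ← add_sum_erase _ _ hmem, he1 _ hmem rfl]
    omega
  -- Central shift.
  have hshift : ∀ x, w (x * diagPow p 1) = μ n * w x := by
    intro x
    rw [← hμ n hn le_rfl x, sum_eq_single ⟨univ, 0⟩]
    · congr 2
      rw [cosetRep_zero]
      congr 1
      ext i
      simp [ind]
    · rintro ⟨I, c⟩ hc hne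
      exfalso
      apply hne
      obtain ⟨h2, h3⟩ := mem_repIndex.1 hc
      obtain rfl : I = univ := by rw [← card_eq_iff_eq_univ]; simpa using h2
      congr 1
      ext ⟨i, j⟩
      exact (h3 i j).2 fun h => h.2.2 (mem_univ _)
    · intro h
      refine absurd ?_ h
      simpa using zero_mem_repIndex (p := p) (univ : Finset (Fin n))
  have hshiftN : ∀ (N : ℕ) (a : Fin n → ℤ), w (diagPow p (a + (N : ℤ) • 1)) = μ n ^ N * w (diagPow p a) := by
    intro N a
    induction N with
    | zero => simp
    | succ N ih =>
      have : a + ((N + 1 : ℕ) : ℤ) • (1 : Fin n → ℤ) = a + (N : ℤ) • 1 + 1 := by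
        push_cast
        rw [add_smul, one_smul, add_assoc]
      rw [this, diagPow_add, hshift, ih, pow_succ]
      ring
  obtain ⟨k₁, hk₁, k₂, hk₂, a, ha, rfl⟩ := exists_smith g
  rw [hr _ hk₂, hl _ hk₁]
  set N : ℕ := ∑ i, (a i).natAbs with hN
  have h00 : ∀ i, 0 ≤ (a + (N : ℤ) • (1 : Fin n → ℤ)) i := by
    intro i
    have : (a i).natAbs ≤ N := single_le_sum (f := fun i => (a i).natAbs) (fun _ _ => by omega) (mem_univ i)
    simp
    omega
  have hmono : Antitone (a + (N : ℤ) • (1 : Fin n → ℤ)) := fun i j hij => by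
    have := ha hij
    simpa using this
  have hnn : 0 ≤ ∑ i, (a + (N : ℤ) • (1 : Fin n → ℤ)) i := sum_nonneg fun i _ => h00 i
  have h2 := key _ _ _ hmono h00 (Int.toNat_of_nonneg hnn).symm rfl
  rw [hshiftN] at h2
  exact (mul_eq_zero.1 h2).resolve_left (pow_ne_zero _ hμn)

end Spherical

/-! ### Spherical vectors: multiplicity one and comparison of representations -/

section Averaging
open Submodule Finset
variable {G : Type} [Group G] {K : Subgroup G}
variable {V W : Type} [AddCommGroup V] [Module ℂ V] [AddCommGroup W] [Module ℂ W]
variable {ρ : Representation ℂ G V} {σ : Representation ℂ G W}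

/-- The vector `v` is fixed by the subgroup `N` of `K`. -/
def FixedBy (ρ : Representation ℂ G V) (N : Subgroup K) (v : V) : Prop := ∀ k ∈ N, ρ (k : G) v = v

/-- `v` is fixed by a subgroup of finite index in `K`, which may be taken to be normal. -/
def IsKFinite (K : Subgroup G) (ρ : Representation ℂ G V) (v : V) : Prop :=
  ∃ N : Subgroup K, N.FiniteIndex ∧ FixedBy ρ N v

/-- The average over `K / N`; it is meaningful on vectors fixed by `N`. -/
def average (ρ : Representation ℂ G V) (N : Subgroup K) [N.FiniteIndex] : V →ₗ[ℂ] V :=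
  letI := N.fintypeQuotientOfFiniteIndex
  (N.index : ℂ)⁻¹ • ∑ q : K ⧸ N, ρ ((q.out : K) : G)

theorem average_apply (N : Subgroup K) [N.FiniteIndex] [Fintype (K ⧸ N)] (v : V) :
    average ρ N v = (N.index : ℂ)⁻¹ • ∑ q : K ⧸ N, ρ ((q.out : K) : G) v := by
  simp only [average, LinearMap.smul_apply, LinearMap.sum_apply]
  congr 2
  ext
  simp

theorem FixedBy.mk_out {N : Subgroup K} {v : V} (h : FixedBy ρ N v) (k : K) :
    ρ (((QuotientGroup.mk k : K ⧸ N).out : K) : G) v = ρ (k : G) v := by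
  obtain ⟨n, hn⟩ := QuotientGroup.mk_out_eq_mul N k
  rw [hn, Subgroup.coe_mul, map_mul, Module.End.mul_apply, h _ n.2]

theorem FixedBy.apply {N : Subgroup K} [N.Normal] {v : V} (h : FixedBy ρ N v) (k : K) :
    FixedBy ρ N (ρ (k : G) v) := by
  intro n hn
  rw [← Module.End.mul_apply, ← map_mul]
  have : ((n : K) : G) * (k : G) = (k : G) * ((k⁻¹ * n * k : K) : G) := by push_cast; group
  rw [this, map_mul, Module.End.mul_apply, h]
  have := Subgroup.Normal.conj_mem ‹N.Normal› n hn k⁻¹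
  simpa using this

theorem average_translate {N : Subgroup K} [N.FiniteIndex] [N.Normal] {v : V}
    (h : FixedBy ρ N v) (k : K) : average ρ N (ρ (k : G) v) = average ρ N v := by
  let _ := N.fintypeQuotientOfFiniteIndex
  rw [average_apply, average_apply]
  congr 1
  refine Fintype.sum_equiv (Equiv.mulRight (QuotientGroup.mk k : K ⧸ N)) _ _ fun q => ?_
  have e : q * (QuotientGroup.mk k : K ⧸ N) = QuotientGroup.mk (q.out * k) := by
    rw [QuotientGroup.mk_mul, QuotientGroup.out_eq']
  simp only [Equiv.coe_mulRight]
  rw [e, h.mk_out, Subgroup.coe_mul, map_mul, Module.End.mul_apply]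

theorem apply_average {N : Subgroup K} [N.FiniteIndex] {v : V}
    (h : FixedBy ρ N v) (k : K) : ρ (k : G) (average ρ N v) = average ρ N v := by
  let _ := N.fintypeQuotientOfFiniteIndex
  rw [average_apply, map_smul, map_sum]
  congr 1
  refine Fintype.sum_equiv (MulAction.toPerm k) _ _ fun q => ?_
  have e : MulAction.toPerm k q = (QuotientGroup.mk (k * q.out) : K ⧸ N) := by
    conv_lhs => rw [← QuotientGroup.out_eq' q]
    rfl
  rw [e, h.mk_out, Subgroup.coe_mul, map_mul, Module.End.mul_apply]

theorem average_eq_self {N : Subgroup K} [N.FiniteIndex] {v : V}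
    (h : ∀ k ∈ K, ρ k v = v) : average ρ N v = v := by
  let _ := N.fintypeQuotientOfFiniteIndex
  rw [average_apply, sum_congr rfl fun q _ => h _ (q.out : K).2, sum_const,
    card_univ, ← Nat.card_eq_fintype_card, ← Subgroup.index, ← Nat.cast_smul_eq_nsmul ℂ,
    smul_smul, inv_mul_cancel₀, one_smul]
  exact_mod_cast Subgroup.FiniteIndex.index_ne_zero

theorem map_average (f : Representation.IntertwiningMap ρ σ) (N : Subgroup K) [N.FiniteIndex]
    (v : V) : f (average ρ N v) = average σ N (f v) := by
  let _ := N.fintypeQuotientOfFiniteIndex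
  rw [average_apply, average_apply, map_smul, map_sum]
  congr 1
  exact sum_congr rfl fun q _ => f.isIntertwining ρ σ _ _

/-- The average over `K` of a `K`-finite vector does not depend on the subgroup used. -/
theorem average_eq_average {N N' : Subgroup K} [N.FiniteIndex] [N.Normal] [N'.FiniteIndex]
    {v : V} (h : FixedBy ρ N v) (h' : FixedBy ρ N' v) : average ρ N v = average ρ N' v := by
  let _ := N'.fintypeQuotientOfFiniteIndex
  have h1 : average ρ N (average ρ N' v) = average ρ N' v :=
    average_eq_self fun k hk => apply_average h' ⟨k, hk⟩
  rw [← h1, average_apply N', map_smul, map_sum]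
  simp only [average_translate h]
  rw [sum_const, card_univ, ← Nat.card_eq_fintype_card, ← Subgroup.index,
    ← Nat.cast_smul_eq_nsmul ℂ, smul_smul, inv_mul_cancel₀, one_smul]
  exact_mod_cast Subgroup.FiniteIndex.index_ne_zero

/-- Finitely many `K`-finite vectors have a common normal subgroup of finite index fixing them. -/
theorem exists_common_fixedBy {ι : Type*} (s : Finset ι) (v : ι → V)
    (h : ∀ i ∈ s, IsKFinite K ρ (v i)) :
    ∃ N : Subgroup K, N.FiniteIndex ∧ N.Normal ∧ ∀ i ∈ s, FixedBy ρ N (v i) := by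
  choose! N hN hv using h
  have : ∀ i : s, (N i).FiniteIndex := fun i => hN i i.2
  have hfi : (⨅ i : s, N i).FiniteIndex := Subgroup.finiteIndex_iInf this
  refine ⟨(⨅ i : s, N i).normalCore, inferInstance, inferInstance, fun i hi k hk => hv i hi k ?_⟩
  have := Subgroup.normalCore_le _ hk
  exact Subgroup.mem_iInf.1 this ⟨i, hi⟩

/-- In a subquotient, `K`-fixed vectors lift to `K`-fixed vectors. -/
theorem exists_fixed_lift (f : Representation.IntertwiningMap ρ σ) {v : V}
    (hv : IsKFinite K ρ v) (hfv : ∀ k ∈ K, σ k (f v) = f v) :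
    ∃ u : V, (∀ k ∈ K, ρ k u = u) ∧ f u = f v := by
  obtain ⟨N, hN, h⟩ := hv
  exact ⟨average ρ N v, fun k hk => apply_average h ⟨k, hk⟩,
    by rw [map_average, average_eq_self hfv]⟩

/-- `K` is commensurable with its conjugates, in the form: the intersection of `K` with
`g K g⁻¹` has finite index in `K`. -/
def IsHeckePair (K : Subgroup G) : Prop :=
  ∀ g : G, ((K.comap (MulAut.conj g⁻¹).toMonoidHom).subgroupOf K).FiniteIndex

theorem isKFinite_translate (hK : IsHeckePair K) {v : V} (hv : ∀ k ∈ K, ρ k v = v) (g : G) :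
    IsKFinite K ρ (ρ g v) := by
  refine ⟨_, hK g, fun k hk => ?_⟩
  have h1 : g⁻¹ * (k : G) * g ∈ K := by
    have := Subgroup.mem_subgroupOf.1 hk
    simpa using this
  rw [← Module.End.mul_apply, ← map_mul]
  have : (k : G) * g = g * (g⁻¹ * k * g) := by group
  rw [this, map_mul, Module.End.mul_apply, hv _ h1]

theorem isKFinite_of_mem_span (hK : IsHeckePair K) {v : V} (hv : ∀ k ∈ K, ρ k v = v) {u : V}
    (hu : u ∈ span ℂ (Set.range fun g : G => ρ g v)) : IsKFinite K ρ u := by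
  obtain ⟨c, rfl⟩ := (Finsupp.mem_span_range_iff_exists_finsupp).1 hu
  obtain ⟨N, hN, -, h⟩ := exists_common_fixedBy (K := K) (ρ := ρ) c.support (fun g => ρ g v)
    fun g _ => isKFinite_translate hK hv g
  refine ⟨N, hN, fun k hk => ?_⟩
  rw [Finsupp.sum, map_sum]
  refine sum_congr rfl fun g hg => ?_
  rw [map_smul]
  exact congrArg _ (h g hg k hk)

/-- The set of left cosets `x K` in the double coset `K h K`. -/
def cosetsIn (K : Subgroup G) (h : G) : Set (G ⧸ K) :=
  (fun x : G => (x : G ⧸ K)) '' DoubleCoset.doubleCoset h (K : Set G) (K : Set G)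

theorem finite_cosetsIn (hK : IsHeckePair K) (h : G) : (cosetsIn K h).Finite := by
  have := hK h
  set S := (K.comap (MulAut.conj h⁻¹).toMonoidHom).subgroupOf K
  refine (Set.finite_range fun q : K ⧸ S => ((((q.out : K) : G) * h : G) : G ⧸ K)).subset ?_
  rintro _ ⟨x, hx, rfl⟩
  obtain ⟨k, hk, k', hk', rfl⟩ := DoubleCoset.mem_doubleCoset.1 hx
  refine ⟨QuotientGroup.mk ⟨k, hk⟩, ?_⟩
  obtain ⟨s, hs⟩ := QuotientGroup.mk_out_eq_mul S ⟨k, hk⟩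
  simp only
  rw [hs, QuotientGroup.eq]
  have h1 : h⁻¹ * ((s : K) : G) * h ∈ K := by
    have := Subgroup.mem_subgroupOf.1 s.2
    simpa using this
  have e : ((((⟨k, hk⟩ : K) * (s : K) : K) : G) * h)⁻¹ * (k * h * k')
      = (h⁻¹ * ((s : K) : G) * h)⁻¹ * k' := by push_cast; group
  rw [e]
  exact mul_mem (inv_mem h1) hk'

/-- A `K`-fixed vector which generates the representation and is an eigenvector of all Hecke
operators spans the space of `K`-fixed vectors. -/
theorem fixed_eq_smul_of_eigen (hK : IsHeckePair K) {v : V} (hv : ∀ k ∈ K, ρ k v = v)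
    (heig : ∀ h : G, ∃ μ : ℂ, ∑ᶠ x ∈ cosetsIn K h, ρ x.out v = μ • v) {u : V}
    (hu : u ∈ span ℂ (Set.range fun g : G => ρ g v)) (huK : ∀ k ∈ K, ρ k u = u) :
    ∃ c : ℂ, u = c • v := by
  obtain ⟨c, rfl⟩ := (Finsupp.mem_span_range_iff_exists_finsupp).1 hu
  obtain ⟨N, hN, hNn, h⟩ := exists_common_fixedBy (K := K) (ρ := ρ) c.support (fun g => ρ g v)
    fun g _ => isKFinite_translate hK hv g
  have key : ∀ g ∈ c.support, ∃ a : ℂ, average ρ N (ρ g v) = a • v := by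
    intro g hg
    obtain ⟨μ, hμ⟩ := heig g
    have hfin := finite_cosetsIn hK g
    rw [finsum_mem_eq_finite_toFinset_sum _ hfin] at hμ
    have hone : ∀ x ∈ hfin.toFinset, average ρ N (ρ x.out v) = average ρ N (ρ g v) := by
      intro x hx
      rw [Set.Finite.mem_toFinset] at hx
      obtain ⟨y, hy, rfl⟩ := hx
      obtain ⟨k, hk, k', hk', rfl⟩ := DoubleCoset.mem_doubleCoset.1 hy
      obtain ⟨s, hs⟩ := QuotientGroup.mk_out_eq_mul K (k * g * k')
      have : ρ ((k * g * k' : G) : G ⧸ K).out v = ρ ((⟨k, hk⟩ : K) : G) (ρ g v) := by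
        rw [hs, map_mul, Module.End.mul_apply, hv _ s.2, map_mul, Module.End.mul_apply,
          hv _ hk', map_mul, Module.End.mul_apply]
      simp only [this]
      exact average_translate (h g hg) ⟨k, hk⟩
    have h2 := congrArg (average ρ N) hμ
    rw [map_sum, sum_congr rfl hone, sum_const, map_smul, average_eq_self hv,
      ← Nat.cast_smul_eq_nsmul ℂ] at h2
    have hne : (hfin.toFinset.card : ℂ) ≠ 0 := by
      rw [Nat.cast_ne_zero, card_ne_zero, Set.Finite.toFinset_nonempty]
      exact ⟨_, g, DoubleCoset.mem_doubleCoset.2 ⟨1, one_mem K, 1, one_mem K, by simp⟩, rfl⟩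
    refine ⟨(hfin.toFinset.card : ℂ)⁻¹ * μ, ?_⟩
    rw [mul_smul, ← h2, smul_smul, inv_mul_cancel₀ hne, one_smul]
  choose! a ha using key
  refine ⟨∑ g ∈ c.support, c g * a g, ?_⟩
  rw [← average_eq_self (N := N) huK, Finsupp.sum, map_sum, sum_smul]
  refine sum_congr rfl fun g hg => ?_
  rw [map_smul, ha g hg, mul_smul]

/-- Let `w` and `v` be `K`-fixed vectors in representations, `w` in an irreducible one. If the
averages of the translates of `w` and `v` are given by the same spherical function, then
`g w ↤ g v` is well defined: otherwise `(w, 0)` would lie in the representation generated by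
`(w, v)`, in which the `K`-fixed vectors are the multiples of `(w, v)`. -/
theorem isConstituent_of_spherical (hK : IsHeckePair K) (hσ : σ.IsIrreducible) {w : W} {v : V}
    (hw : ∀ k ∈ K, σ k w = w) (hv : ∀ k ∈ K, ρ k v = v) (hw0 : w ≠ 0) (hv0 : v ≠ 0)
    (h : ∀ (g : G) (N : Subgroup K) [N.FiniteIndex], FixedBy σ N (σ g w) → FixedBy ρ N (ρ g v) →
      ∃ c : ℂ, average σ N (σ g w) = c • w ∧ average ρ N (ρ g v) = c • v) : IsConstituent σ ρ := by
  refine ⟨hσ, ?_⟩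
  set M : Submodule ℂ (V × W) := span ℂ (Set.range fun g : G => (ρ g v, σ g w)) with hM
  have hstab : ∀ (g : G) (x : V × W), x ∈ M → (ρ g x.1, σ g x.2) ∈ M := by
    intro g x hx
    induction hx using span_induction with
    | mem x hx =>
      obtain ⟨k, rfl⟩ := hx
      refine subset_span ⟨g * k, ?_⟩
      simp
    | zero =>
      have : (ρ g (0 : V × W).1, σ g (0 : V × W).2) = 0 := by simp
      rw [this]
      exact M.zero_mem
    | add x y _ _ hx hy => simpa using add_mem hx hy
    | smul a x _ hx => simpa using M.smul_mem a hx
  have hMw : ∀ u : W, ((0 : V), u) ∈ M → u = 0 := by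
    let Z : Subrepresentation σ :=
      { toSubmodule := M.comap (LinearMap.inr ℂ V W)
        apply_mem_toSubmodule := fun g u hu => by
          have := hstab g _ hu
          simpa using this }
    rcases eq_bot_or_eq_top Z with hZ | hZ
    · intro u hu
      have : u ∈ Z := hu
      rw [hZ] at this
      exact (mem_bot ℂ).1 this
    · exfalso
      have hwZ : w ∈ Z := by rw [hZ]; exact mem_top
      have hwM : ((0 : V), w) ∈ M := hwZ
      obtain ⟨c, hc⟩ := (Finsupp.mem_span_range_iff_exists_finsupp).1 hwM
      obtain ⟨N, hN, hNn, h1⟩ := exists_common_fixedBy (K := K) (ρ := ρ) c.support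
        (fun g => ρ g v) fun g _ => isKFinite_translate hK hv g
      obtain ⟨N', hN', hNn', h2⟩ := exists_common_fixedBy (K := K) (ρ := σ) c.support
        (fun g => σ g w) fun g _ => isKFinite_translate hK hw g
      choose! a ha using fun g (hg : g ∈ c.support) => h g (N ⊓ N')
        (fun k hk => h2 g hg k hk.2) (fun k hk => h1 g hg k hk.1)
      have e1 : ∑ g ∈ c.support, c g • ρ g v = 0 := by
        have := congrArg Prod.fst hc
        simpa [Finsupp.sum, Prod.fst_sum] using this
      have e2 : ∑ g ∈ c.support, c g • σ g w = w := by
        have := congrArg Prod.snd hc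
        simpa [Finsupp.sum, Prod.snd_sum] using this
      have f1 : (∑ g ∈ c.support, c g * a g) • v = 0 := by
        rw [← map_zero (average ρ (N ⊓ N')), ← e1, map_sum, sum_smul]
        refine sum_congr rfl fun g hg => ?_
        rw [map_smul, (ha g hg).2, mul_smul]
      have f2 : (∑ g ∈ c.support, c g * a g) • w = w := by
        conv_rhs => rw [← average_eq_self (N := N ⊓ N') hw, ← e2, map_sum]
        rw [sum_smul]
        refine sum_congr rfl fun g hg => ?_
        rw [map_smul, (ha g hg).1, mul_smul]
      rcases smul_eq_zero.1 f1 with h0 | h0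
      · rw [h0, zero_smul] at f2
        exact hw0 f2.symm
      · exact hv0 h0
  have hM' : ∀ x ∈ M, x.1 = 0 → x.2 = 0 := by
    rintro ⟨x, y⟩ hx rfl
    exact hMw y hx
  let φ := M.toLinearPMap
  have hφ : ∀ x : φ.domain, ((x : V), φ x) ∈ M := fun x => mem_graph_toLinearPMap hM' x
  let U : Subrepresentation ρ :=
    { toSubmodule := φ.domain
      apply_mem_toSubmodule := fun g u hu => by
        obtain ⟨y, hy, rfl⟩ := hu
        exact ⟨_, hstab g _ hy, rfl⟩ }
  let f : Representation.IntertwiningMap U.toRepresentation σ :=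
    { toLinearMap := φ.toFun
      isIntertwining' := fun g => by
        refine LinearMap.ext fun u => ?_
        have h1 := hstab g _ (hφ u)
        have h2 := hφ (U.toRepresentation g u)
        have h3 := M.sub_mem h2 h1
        have : ((U.toRepresentation g u : U.toSubmodule) : V) = ρ g u := rfl
        rw [Prod.mk_sub_mk, this, sub_self] at h3
        exact sub_eq_zero.1 (hMw _ h3) }
  refine ⟨U, f, (Representation.IsIrreducible.surjective_or_eq_zero f).resolve_right ?_⟩
  intro hf
  have hvw : (v, w) ∈ M := subset_span ⟨1, by simp⟩
  have hvU : v ∈ φ.domain := ⟨_, hvw, rfl⟩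
  have h1 := M.sub_mem (hφ ⟨v, hvU⟩) hvw
  rw [Prod.mk_sub_mk, sub_self] at h1
  have h2 : φ ⟨v, hvU⟩ = w := sub_eq_zero.1 (hMw _ h1)
  have h3 : f ⟨v, hvU⟩ = 0 := by rw [hf]; rfl
  exact hw0 (h2.symm.trans h3)

/-- A representation generated by a nonzero vector has an irreducible quotient in which the image
of this vector is not zero. -/
theorem exists_irreducible_quotient {v : V} (hv0 : v ≠ 0)
    (hgen : span ℂ (Set.range fun g : G => ρ g v) = ⊤) :
    ∃ (W : Type) (_ : AddCommGroup W) (_ : Module ℂ W) (σ : Representation ℂ G W)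
      (f : Representation.IntertwiningMap ρ σ), σ.IsIrreducible ∧ Function.Surjective f ∧ f v ≠ 0 := by
  have hstab : ∀ U : Subrepresentation ρ, v ∈ U → U.toSubmodule = ⊤ := fun U hU => by
    rw [eq_top_iff, ← hgen, span_le]
    rintro _ ⟨g, rfl⟩
    exact U.apply_mem_toSubmodule g hU
  obtain ⟨U, -, hU⟩ := zorn_le_nonempty₀ {U : Subrepresentation ρ | v ∉ U} (by
    intro c hc hchain y hy
    have hdir : DirectedOn (· ≤ ·) (Subrepresentation.toSubmodule '' c) := by
      rintro _ ⟨A, hA, rfl⟩ _ ⟨B, hB, rfl⟩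
      rcases hchain.total hA hB with h | h
      · exact ⟨_, ⟨B, hB, rfl⟩, h, le_rfl⟩
      · exact ⟨_, ⟨A, hA, rfl⟩, le_rfl, h⟩
    have hne : (Subrepresentation.toSubmodule '' c).Nonempty := ⟨_, y, hy, rfl⟩
    refine ⟨⟨sSup (Subrepresentation.toSubmodule '' c), fun g u hu => ?_⟩, ?_, ?_⟩
    · rw [mem_sSup_of_directed hne hdir] at hu ⊢
      obtain ⟨_, ⟨A, hA, rfl⟩, hu⟩ := hu
      exact ⟨_, ⟨A, hA, rfl⟩, A.apply_mem_toSubmodule g hu⟩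
    · intro h
      have h' := (mem_sSup_of_directed hne hdir).1 h
      obtain ⟨_, ⟨A, hA, rfl⟩, hu⟩ := h'
      exact hc hA hu
    · intro A hA
      exact le_sSup (α := Submodule ℂ V) ⟨A, hA, rfl⟩) ⊥ (by
        intro h
        exact hv0 ((mem_bot ℂ).1 h))
  have hvU : v ∉ U := hU.1
  have hmax : ∀ A : Subrepresentation ρ, U ≤ A → v ∉ A → A ≤ U := fun A h h' => hU.2 h' h
  let σ := ρ.quotient U.toSubmodule fun g u hu => U.apply_mem_toSubmodule g hu
  let f : Representation.IntertwiningMap ρ σ :=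
    { toLinearMap := U.toSubmodule.mkQ
      isIntertwining' := fun g => rfl }
  have hf : Function.Surjective f := U.toSubmodule.mkQ_surjective
  have hfv : f v ≠ 0 := fun h => hvU ((Submodule.Quotient.mk_eq_zero _).1 h)
  refine ⟨V ⧸ U.toSubmodule, inferInstance, inferInstance, σ, f, ?_, hf, hfv⟩
  refine { exists_pair_ne := ⟨⊥, ⊤, fun h => hfv ?_⟩, eq_bot_or_eq_top := fun A => ?_ }
  · have : f v ∈ (⊤ : Subrepresentation σ) := mem_top
    rw [← h] at this
    exact (mem_bot ℂ).1 this
  · let B : Subrepresentation ρ :=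
      { toSubmodule := A.toSubmodule.comap f.toLinearMap
        apply_mem_toSubmodule := fun g u hu => by
          have := A.apply_mem_toSubmodule g hu
          rw [mem_comap]
          change f (ρ g u) ∈ A.toSubmodule
          rw [f.isIntertwining]
          exact this }
    have hUB : U ≤ B := fun u hu => by
      change f u ∈ A.toSubmodule
      have : f u = 0 := (Submodule.Quotient.mk_eq_zero _).2 hu
      rw [this]
      exact A.toSubmodule.zero_mem
    by_cases hvB : v ∈ B
    · right
      have hB := hstab B hvB
      apply Subrepresentation.toSubmodule_injective
      refine eq_top_iff.2 fun x _ => ?_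
      obtain ⟨u, rfl⟩ := hf x
      have : u ∈ B.toSubmodule := by rw [hB]; exact mem_top
      exact this
    · left
      have hBU := hmax B hUB hvB
      apply Subrepresentation.toSubmodule_injective
      refine eq_bot_iff.2 fun x hx => ?_
      obtain ⟨u, rfl⟩ := hf x
      have : u ∈ U := hBU hx
      exact (mem_bot ℂ).2 ((Submodule.Quotient.mk_eq_zero _).2 this)

end Averaging

/-! ### The unramified principal series of `GL₄(ℚ_p)` -/

section Topological
open Finset Matrix
variable {p : ℕ} [hp : Fact p.Prime] {n : ℕ}

theorem isOpen_KGL : IsOpen (KGL p n : Set (GLp p n)) := by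
  have hb : IsOpen {x : ℚ_[p] | ‖x‖ ≤ 1} := by
    have := IsUltrametricDist.isOpen_closedBall (0 : ℚ_[p]) one_ne_zero
    convert this using 1
    ext x; simp
  have h : ∀ f : GLp p n → Matrix (Fin n) (Fin n) ℚ_[p], Continuous f →
      IsOpen {g | IntMat (f g)} := fun f hf => by
    simp only [intMat_iff_norm, Set.ofPred_forall]
    exact isOpen_iInter_of_finite fun i => isOpen_iInter_of_finite fun j =>
      hb.preimage (hf.matrix_elem i j)
  exact (h _ Units.continuous_val).inter (h _ Units.continuous_coe_inv)

theorem isCompact_KGL : IsCompact (KGL p n : Set (GLp p n)) := by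
  have hc : IsCompact {M : Matrix (Fin n) (Fin n) ℚ_[p] | IntMat M} := by
    have h1 : IsCompact (Set.univ.pi fun _ : Fin n => Set.univ.pi fun _ : Fin n =>
        Metric.closedBall (0 : ℚ_[p]) 1) :=
      isCompact_univ_pi fun _ => isCompact_univ_pi fun _ => isCompact_closedBall _ _
    have e : {M : Matrix (Fin n) (Fin n) ℚ_[p] | IntMat M} = (Set.univ.pi fun _ : Fin n =>
        Set.univ.pi fun _ : Fin n => Metric.closedBall (0 : ℚ_[p]) 1) := by
      refine Set.ext fun M => ?_
      exact ⟨fun h i _ j _ => mem_closedBall_zero_iff.2 (h i j),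
        fun h i j => mem_closedBall_zero_iff.1 (h i trivial j trivial)⟩
    rw [e]
    exact h1
  have h2 := Units.isClosedEmbedding_embedProduct
    (α := Matrix (Fin n) (Fin n) ℚ_[p]).isCompact_preimage
      (hc.prod (MulOpposite.opHomeomorph.isCompact_image.2 hc))
  convert h2 using 1
  ext g
  simp only [Set.mem_preimage, Set.mem_prod, Units.embedProduct_apply, Set.mem_ofPred_eq,
    SetLike.mem_coe]
  refine and_congr Iff.rfl ⟨fun h => ⟨_, h, rfl⟩, ?_⟩
  rintro ⟨M, hM, hMg⟩
  have : M = (g⁻¹).val := MulOpposite.op_injective hMg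
  exact this ▸ hM

theorem finiteIndex_of_isOpen {U : Subgroup (GLp p n)} (hU : IsOpen (U : Set (GLp p n))) :
    (U.subgroupOf (KGL p n)).FiniteIndex := by
  have : CompactSpace (KGL p n) := isCompact_iff_compactSpace.1 isCompact_KGL
  have h1 : IsOpen (U.subgroupOf (KGL p n) : Set (KGL p n)) := hU.preimage continuous_subtype_val
  have := (U.subgroupOf (KGL p n)).quotient_finite_of_isOpen h1
  exact Subgroup.finiteIndex_of_finite_quotient

theorem isHeckePair_KGL : IsHeckePair (KGL p n) := fun _ =>
  finiteIndex_of_isOpen (isOpen_KGL.preimage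
    ((continuous_const.mul continuous_id).mul continuous_const))

end Topological

section PrincipalSeries
open Finset Matrix
variable {p : ℕ} [hp : Fact p.Prime]

/-- The matrix `b` is upper triangular with diagonal `t`. -/
def HasDiag (b : GL4 p) (t : Fin 4 → ℚ_[p]ˣ) : Prop := (∀ i, b.val i i = t i) ∧
    ∀ i j, j < i → b.val i j = 0

theorem HasDiag.mul {b b' : GL4 p} {t t' : Fin 4 → ℚ_[p]ˣ} (h : HasDiag b t) (h' : HasDiag b' t') :
    HasDiag (b * b') (t * t') := by
  refine ⟨fun i => ?_, fun i j hij => ?_⟩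
  · rw [Units.val_mul, mul_apply, sum_eq_single i]
    · rw [h.1, h'.1]; rfl
    · intro j _ hj
      rcases lt_or_gt_of_ne hj with h1 | h1
      · rw [h.2 i j h1, zero_mul]
      · rw [h'.2 j i h1, mul_zero]
    · simp
  · rw [Units.val_mul, mul_apply]
    refine sum_eq_zero fun k _ => ?_
    rcases lt_or_ge k i with h1 | h1
    · rw [h.2 i k h1, zero_mul]
    · rw [h'.2 k j (hij.trans_le h1), mul_zero]

theorem HasDiag.diag_ne_zero {b : GL4 p} (h : ∀ i j, j < i → b.val i j = 0)
    (i : Fin 4) : b.val i i ≠ 0 := by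
  have h1 : b.val.BlockTriangular id := fun i j hij => h i j hij
  have h2 := det_unit_ne_zero b
  rw [det_of_isUpperTriangular h1, prod_ne_zero_iff] at h2
  exact h2 i (mem_univ i)

theorem exists_hasDiag {b : GL4 p} (h : ∀ i j, j < i → b.val i j = 0) : ∃ t, HasDiag b t :=
  ⟨fun i => Units.mk0 _ (HasDiag.diag_ne_zero h i), fun _ => rfl, h⟩

theorem HasDiag.exists_inv {b : GL4 p} {t : Fin 4 → ℚ_[p]ˣ} (h : HasDiag b t) :
    HasDiag b⁻¹ t⁻¹ := by
  have h1 : b.val.BlockTriangular id := fun i j hij => h.2 i j hij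
  have : Invertible b.val := b.invertible
  have h2 := blockTriangular_inv_of_blockTriangular h1
  rw [← coe_units_inv] at h2
  obtain ⟨s, hs⟩ := exists_hasDiag (b := b⁻¹) fun i j hij => h2 hij
  have h3 := h.mul hs
  have : s = t⁻¹ := by
    ext i
    have := h3.1 i
    rw [mul_inv_cancel, Units.val_one, one_apply_eq] at this
    have h4 : t i * s i = 1 := Units.ext this.symm
    rw [Pi.inv_apply, eq_inv_of_mul_eq_one_right h4]
  exact this ▸ hs

/-- The character of the Borel subgroup by which the principal series is defined, as a function of
the diagonal. -/
def borelChar (χ : Fin 4 → (ℚ_[p]ˣ →* ℂˣ)) (t : Fin 4 → ℚ_[p]ˣ) : ℂ :=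
  ∏ i, (χ i (t i) : ℂ) * ((‖(t i : ℚ_[p])‖ ^ ((3 - 2 * (i : ℕ) : ℝ) / 2) : ℝ) : ℂ)

theorem borelChar_mul (χ : Fin 4 → (ℚ_[p]ˣ →* ℂˣ)) (t t' : Fin 4 → ℚ_[p]ˣ) :
    borelChar χ (t * t') = borelChar χ t * borelChar χ t' := by
  simp only [borelChar, ← prod_mul_distrib]
  refine prod_congr rfl fun i _ => ?_
  rw [Pi.mul_apply, map_mul, Units.val_mul, Units.val_mul, norm_mul,
    Real.mul_rpow (norm_nonneg _) (norm_nonneg _)]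
  push_cast
  ring

theorem borelChar_of_norm {χ : Fin 4 → (ℚ_[p]ˣ →* ℂˣ)} (hχ : ∀ i, IsUnramified (χ i))
    {t : Fin 4 → ℚ_[p]ˣ} (ht : ∀ i, ‖(t i : ℚ_[p])‖ = 1) : borelChar χ t = 1 := by
  refine prod_eq_one fun i _ => ?_
  rw [hχ i _ (ht i), ht i]
  simp

theorem HasDiag.norm_eq_one {b : GL4 p} {t : Fin 4 → ℚ_[p]ˣ} (h : HasDiag b t)
    (hb : b ∈ KGL p 4) (i : Fin 4) : ‖(t i : ℚ_[p])‖ = 1 := by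
  have h1 : ‖(t i : ℚ_[p])‖ ≤ 1 := by rw [← h.1 i]; exact hb.1 i i
  have h2 : ‖((t i)⁻¹ : ℚ_[p])‖ ≤ 1 := by
    have := h.exists_inv.1 i
    rw [Pi.inv_apply, Units.val_inv_eq_inv_val] at this
    rw [← this]
    exact hb.2 i i
  rw [norm_inv] at h2
  have h3 : 0 < ‖(t i : ℚ_[p])‖ := norm_pos_iff.2 (t i).ne_zero
  exact le_antisymm h1 ((inv_le_one₀ h3).1 h2)

theorem exists_iwasawa (g : GL4 p) : ∃ (b k : GL4 p) (t : Fin 4 → ℚ_[p]ˣ),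
    HasDiag b t ∧ k ∈ KGL p 4 ∧ g = b * k := by
  obtain ⟨k, hk, h⟩ := exists_upperTriangular g.val
  obtain ⟨t, ht⟩ := exists_hasDiag (b := g * k) (by simpa using h)
  exact ⟨g * k, k⁻¹, t, ht, inv_mem hk, by simp⟩

/-- The spherical vector of the principal series. -/
def sphericalVector (χ : Fin 4 → (ℚ_[p]ˣ →* ℂˣ)) (g : GL4 p) : ℂ :=
  borelChar χ (exists_iwasawa g).choose_spec.choose_spec.choose

theorem sphericalVector_eq {χ : Fin 4 → (ℚ_[p]ˣ →* ℂˣ)} (hχ : ∀ i, IsUnramified (χ i))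
    {b k : GL4 p} {t : Fin 4 → ℚ_[p]ˣ} (hb : HasDiag b t) (hk : k ∈ KGL p 4) :
    sphericalVector χ (b * k) = borelChar χ t := by
  set b' := (exists_iwasawa (b * k)).choose
  set k' := (exists_iwasawa (b * k)).choose_spec.choose
  set t' := (exists_iwasawa (b * k)).choose_spec.choose_spec.choose with ht'
  obtain ⟨hb', hk', e⟩ := (exists_iwasawa (b * k)).choose_spec.choose_spec.choose_spec
  have h1 : HasDiag (b'⁻¹ * b) (t'⁻¹ * t) := HasDiag.mul (HasDiag.exists_inv hb') hb
  have h2 : b'⁻¹ * b ∈ KGL p 4 := by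
    have : b'⁻¹ * b = k' * k⁻¹ := by
      have e' : b * k = b' * k' := e
      rw [inv_mul_eq_iff_eq_mul, ← mul_assoc, ← e', mul_inv_cancel_right]
    rw [this]
    exact mul_mem hk' (inv_mem hk)
  have h3 := borelChar_of_norm hχ (h1.norm_eq_one h2)
  have h4 : t = t' * (t'⁻¹ * t) := by simp
  rw [sphericalVector, ← ht', h4, borelChar_mul, h3, mul_one]

theorem hasDiag_one : HasDiag (1 : GL4 p) 1 := ⟨fun i => by simp, fun i j h => by simp [h.ne']⟩

theorem sphericalVector_one {χ : Fin 4 → (ℚ_[p]ˣ →* ℂˣ)} (hχ : ∀ i, IsUnramified (χ i)) :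
    sphericalVector χ 1 = 1 := by
  have := sphericalVector_eq hχ hasDiag_one (one_mem (KGL p 4))
  rw [mul_one] at this
  rw [this]
  exact borelChar_of_norm hχ fun i => by simp

theorem sphericalVector_mul_right {χ : Fin 4 → (ℚ_[p]ˣ →* ℂˣ)} (hχ : ∀ i, IsUnramified (χ i))
    {k : GL4 p} (hk : k ∈ KGL p 4) (g : GL4 p) :
    sphericalVector χ (g * k) = sphericalVector χ g := by
  obtain ⟨b, k', t, hb, hk', rfl⟩ := exists_iwasawa g
  rw [mul_assoc, sphericalVector_eq hχ hb (mul_mem hk' hk), sphericalVector_eq hχ hb hk']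

theorem sphericalVector_mem {χ : Fin 4 → (ℚ_[p]ˣ →* ℂˣ)} (hχ : ∀ i, IsUnramified (χ i)) :
    sphericalVector χ ∈ (principalSeries χ).toSubmodule := by
  refine ⟨fun b t ht hb g => ?_, KGL p 4, isOpen_KGL, fun k hk g =>
    sphericalVector_mul_right hχ hk g⟩
  obtain ⟨b', k', t', hb', hk', rfl⟩ := exists_iwasawa g
  rw [← mul_assoc, sphericalVector_eq hχ (HasDiag.mul ⟨ht, hb⟩ hb') hk', borelChar_mul,
    sphericalVector_eq hχ hb' hk', borelChar]

theorem principalSeries_fixed {χ : Fin 4 → (ℚ_[p]ˣ →* ℂˣ)} (hχ : ∀ i, IsUnramified (χ i))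
    {f : GL4 p → ℂ} (hf : f ∈ (principalSeries χ).toSubmodule)
    (hK : ∀ k ∈ KGL p 4, ∀ g, f (g * k) = f g) : f = f 1 • sphericalVector χ := by
  ext g
  obtain ⟨b, k, t, hb, hk, rfl⟩ := exists_iwasawa g
  have h1 := hf.1 b t hb.1 hb.2 1
  rw [mul_one] at h1
  rw [hK k hk, h1, Pi.smul_apply, sphericalVector_eq hχ hb hk, smul_eq_mul, mul_comm]
  rfl

theorem principalSeries_isKFinite {χ : Fin 4 → (ℚ_[p]ˣ →* ℂˣ)}
    (f : (principalSeries χ).toSubmodule) :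
    IsKFinite (KGL p 4) (principalSeries χ).toRepresentation f := by
  obtain ⟨-, U, hU, h⟩ := f.2
  refine ⟨U.subgroupOf (KGL p 4), finiteIndex_of_isOpen hU, fun k hk => ?_⟩
  apply Subtype.ext
  funext g
  exact h k (Subgroup.mem_subgroupOf.1 hk) g

/-- The inversion count behind the normalization of the principal series. -/
theorem free_count (I : Finset (Fin 4)) :
    2 * (univ.filter fun ij : Fin 4 × Fin 4 => IsFree I ij.1 ij.2).card
      + 2 * ∑ i ∈ I, (i : ℕ) = 3 * I.card + I.card * (4 - I.card) := by
  revert I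
  decide

theorem card_freeEntries {p n : ℕ} (I : Finset (Fin n)) : (freeEntries p I).card
    = p ^ (univ.filter fun ij : Fin n × Fin n => IsFree I ij.1 ij.2).card := by
  rw [freeEntries, Fintype.card_piFinset, ← prod_const, prod_filter]
  refine prod_congr rfl fun ij _ => ?_
  split_ifs <;> simp

theorem hasDiag_cosetRep (I : Finset (Fin 4)) (c : Fin 4 × Fin 4 → ℕ) :
    HasDiag (cosetRep p I c) fun i => if i ∈ I then pUnit p else 1 := by
  refine ⟨fun i => ?_, fun i j hij => ?_⟩
  · rw [cosetRep_apply, if_pos rfl, ind]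
    by_cases h : i ∈ I <;> simp [pUnit, h]
  · rw [cosetRep_apply, if_neg hij.ne', if_neg fun h => h.1.not_gt hij]

/-- The eigenvalues of the Hecke operators on the spherical vector are, up to powers of `p`, the
elementary symmetric functions of the Satake parameters. -/
theorem sum_sphericalVector {χ : Fin 4 → (ℚ_[p]ˣ →* ℂˣ)} (hχ : ∀ i, IsUnramified (χ i)) (m : ℕ) :
    ∑ c ∈ repIndex p 4 m, sphericalVector χ (cosetRep p c.1 c.2)
      = (Real.sqrt p : ℂ) ^ (m * (4 - m)) * ∑ I ∈ powersetCard m (univ : Finset (Fin 4)),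
          ∏ i ∈ I, (χ i (pUnit p) : ℂ) := by
  have hp0 : (0 : ℝ) < p := by exact_mod_cast hp.out.pos
  set s : ℝ := Real.sqrt p with hs
  have hs0 : 0 < s := Real.sqrt_pos.2 hp0
  have hs2 : s ^ 2 = p := Real.sq_sqrt hp0.le
  have hnorm : ∀ i : Fin 4, (‖(p : ℚ_[p])‖ ^ ((3 - 2 * (i : ℕ) : ℝ) / 2) : ℝ)
      = s ^ (2 * (i : ℕ)) * (s ^ 3)⁻¹ := by
    intro i
    rw [Padic.norm_p, ← hs2, ← Real.rpow_natCast s 2, ← Real.rpow_neg hs0.le, ← Real.rpow_mul hs0.le,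
      ← Real.rpow_natCast s 3, ← Real.rpow_neg hs0.le, ← Real.rpow_natCast s, ← Real.rpow_add hs0]
    congr 1
    push_cast
    ring
  have hval : ∀ I c, sphericalVector χ (cosetRep p I c)
      = ∏ i ∈ I, ((χ i (pUnit p) : ℂ) * ((s ^ (2 * (i : ℕ)) * (s ^ 3)⁻¹ : ℝ) : ℂ)) := by
    intro I c
    have h1 := sphericalVector_eq hχ (hasDiag_cosetRep I c) (one_mem (KGL p 4))
    rw [mul_one] at h1
    rw [h1, borelChar, ← prod_subset (subset_univ I)]
    · refine prod_congr rfl fun i hi => ?_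
      rw [if_pos hi]
      rw [← hnorm]
      rfl
    · intro i _ hi
      rw [if_neg hi]; simp
  rw [repIndex, sum_sigma, mul_sum]
  refine sum_congr rfl fun I hI => ?_
  simp only [hval]
  rw [sum_const, card_freeEntries, prod_mul_distrib, nsmul_eq_mul, mul_left_comm, mul_comm]
  congr 1
  have hm : I.card = m := (mem_powersetCard.1 hI).2
  have hc := free_count I
  rw [hm] at hc
  rw [← Complex.ofReal_prod]
  have : ((p ^ (univ.filter fun ij : Fin 4 × Fin 4 => IsFree I ij.1 ij.2).card : ℕ) : ℝ) *
      ∏ i ∈ I, (s ^ (2 * (i : ℕ)) * (s ^ 3)⁻¹) = s ^ (m * (4 - m)) := by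
    rw [prod_mul_distrib, prod_const, hm, prod_pow_eq_pow_sum, ← mul_sum]
    push_cast
    rw [← hs2, ← pow_mul, ← mul_assoc, ← pow_add, hc, pow_add, inv_pow, ← pow_mul]
    field_simp
  rw [← Complex.ofReal_natCast, ← Complex.ofReal_mul, this, Complex.ofReal_pow]

/-- Two families with the same elementary symmetric functions agree up to a permutation. -/
theorem exists_perm_of_esymm {n : ℕ} {a b : Fin n → ℂ}
    (h : ∀ m, 1 ≤ m → m ≤ n → ∑ I ∈ powersetCard m (univ : Finset (Fin n)), ∏ i ∈ I, a i
      = ∑ I ∈ powersetCard m (univ : Finset (Fin n)), ∏ i ∈ I, b i) :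
    ∃ w : Equiv.Perm (Fin n), ∀ i, a (w i) = b i := by
  have hm : (univ.val.map a : Multiset ℂ) = univ.val.map b := by
    have hpoly := Multiset.prod_X_sub_X_eq_sum_esymm (univ.val.map a : Multiset ℂ)
    have hpoly' := Multiset.prod_X_sub_X_eq_sum_esymm (univ.val.map b : Multiset ℂ)
    have he : ∀ j ∈ range (n + 1), (univ.val.map a : Multiset ℂ).esymm j
        = (univ.val.map b : Multiset ℂ).esymm j := by
      intro j hj
      rw [esymm_map_val, esymm_map_val]
      rcases Nat.eq_zero_or_pos j with rfl | hj0
      · simp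
      · exact h j hj0 (Nat.lt_succ_iff.1 (mem_range.1 hj))
    simp only [Multiset.card_map, card_val, card_univ, Fintype.card_fin] at hpoly hpoly'
    rw [sum_congr rfl fun j hj => by rw [he j hj], ← hpoly'] at hpoly
    have := congrArg Polynomial.roots hpoly
    rwa [Polynomial.roots_multiset_prod_X_sub_C, Polynomial.roots_multiset_prod_X_sub_C] at this
  have hcard : ∀ c, Fintype.card {i // b i = c} = Fintype.card {i // a i = c} := by
    intro c
    have := congrArg (Multiset.count c) hm
    rw [Multiset.count_map, Multiset.count_map] at this
    rw [Fintype.card_subtype, Fintype.card_subtype]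
    simp only [card, filter_val]
    simpa only [eq_comm] using this.symm
  exact ⟨Equiv.ofFiberEquiv fun c => Fintype.equivOfCardEq (hcard c),
    fun i => Equiv.ofFiberEquiv_map _ i⟩

end PrincipalSeries

/-! ### Spherical representations as constituents of the principal series -/

section Comparison
open Real Finset
variable {p : ℕ} [hp : Fact p.Prime] {n : ℕ}

theorem exists_cosetRep_translate {m : ℕ} {c : RepIx n}
    (hc : c ∈ repIndex p n m) {k : GLp p n} (hk : k ∈ KGL p n) :
    ∃ c' ∈ repIndex p n m, (cosetRep p c'.1 c'.2)⁻¹ * (k * cosetRep p c.1 c.2) ∈ KGL p n := by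
  obtain ⟨k₁, hk₁, k₂, hk₂, h⟩ := cosetRep_mem hc
  have hm : m ≤ n := by rw [← (mem_repIndex.1 hc).1]; simpa using card_le_univ c.1
  exact exists_cosetRep hm (mul_mem hk hk₁) hk₂ (by rw [h]; group)

theorem sum_cosetRep_translate {E : Type} [AddCommMonoid E] {m : ℕ}
    {f : GLp p n → E} (hf : ∀ k ∈ KGL p n, ∀ g, f (g * k) = f g)
    {k : GLp p n} (hk : k ∈ KGL p n) : ∑ c ∈ repIndex p n m, f (k * cosetRep p c.1 c.2)
      = ∑ c ∈ repIndex p n m, f (cosetRep p c.1 c.2) := by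
  choose! φ hφ hφK using fun c (hc : c ∈ repIndex p n m) => exists_cosetRep_translate hc hk
  refine sum_bij (fun c _ => φ c) hφ (fun a ha b hb hab => ?_) (fun b hb => ?_)
    fun c hc => ?_
  · have h1 := mul_mem (inv_mem (hφK a ha)) (hab ▸ hφK b hb)
    refine cosetRep_injOn ha hb ?_
    convert h1 using 1
    group
  · obtain ⟨a, ha, haK⟩ := exists_cosetRep_translate hb (inv_mem hk)
    refine ⟨a, ha, cosetRep_injOn (hφ a ha) hb ?_⟩
    have h1 := mul_mem (hφK a ha) haK
    convert h1 using 1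
    group
  · have := hf _ (hφK c hc) (cosetRep p (φ c).1 (φ c).2)
    rwa [mul_inv_cancel_left] at this

/-- The sum over the left cosets in the double coset of `diag(p, …, p, 1, …, 1)`. -/
theorem finsum_cosetsIn {E : Type} [AddCommMonoid E] {m : ℕ} (hm : m ≤ n)
    {f : GLp p n → E} (hf : ∀ k ∈ KGL p n, ∀ g, f (g * k) = f g) :
    ∑ᶠ x ∈ cosetsIn (KGL p n) (diagPow p (ind (initSeg n m))), f x.out
      = ∑ c ∈ repIndex p n m, f (cosetRep p c.1 c.2) := by
  rw [← finsum_mem_coe_finset]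
  symm
  refine finsum_mem_eq_of_bijOn (fun c => ((cosetRep p c.1 c.2 : GLp p n) : GLp p n ⧸ KGL p n))
    ⟨fun c hc => ?_, fun a ha b hb hab => ?_, ?_⟩ fun c _ => ?_
  · obtain ⟨k₁, hk₁, k₂, hk₂, h⟩ := cosetRep_mem hc
    exact ⟨_, DoubleCoset.mem_doubleCoset.2 ⟨k₁, hk₁, k₂, hk₂, h⟩, rfl⟩
  · exact cosetRep_injOn ha hb (QuotientGroup.eq.1 hab)
  · rintro _ ⟨g, hg, rfl⟩
    obtain ⟨k₁, hk₁, k₂, hk₂, h⟩ := DoubleCoset.mem_doubleCoset.1 hg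
    obtain ⟨c, hc, hcK⟩ := exists_cosetRep hm hk₁ hk₂ h
    exact ⟨c, hc, QuotientGroup.eq.2 hcK⟩
  · obtain ⟨k, hk⟩ := QuotientGroup.mk_out_eq_mul (KGL p n) (cosetRep p c.1 c.2)
    simp only [hk, hf _ k.2]

/-- The spherical function of a `K`-fixed vector that spans the `K`-fixed vectors and is an
eigenvector of the Hecke operators of `diag(p, …, p, 1, …, 1)`. -/
theorem exists_sphericalFunction {W : Type} [AddCommGroup W] [Module ℂ W]
    {σ : Representation ℂ (GLp p n) W} {w : W} (hw0 : w ≠ 0) (hw : ∀ k ∈ KGL p n, σ k w = w)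
    (hone : ∀ u : W, (∀ k ∈ KGL p n, σ k u = u) → ∃ c : ℂ, u = c • w) {μ : ℕ → ℂ}
    (hμ : ∀ m, 1 ≤ m → m ≤ n → ∑ c ∈ repIndex p n m, σ (cosetRep p c.1 c.2) w = μ m • w) :
    ∃ sph : GLp p n → ℂ, (∀ g (N : Subgroup (KGL p n)) [N.FiniteIndex], FixedBy σ N (σ g w) →
        average σ N (σ g w) = sph g • w) ∧
      (∀ k ∈ KGL p n, ∀ g, sph (k * g) = sph g) ∧ (∀ k ∈ KGL p n, ∀ g, sph (g * k) = sph g) ∧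
      sph 1 = 1 ∧ ∀ m, 1 ≤ m → m ≤ n → ∀ x,
        ∑ c ∈ repIndex p n m, sph (x * cosetRep p c.1 c.2) = μ m * sph x := by
  have hfin := fun g => isKFinite_translate (ρ := σ) isHeckePair_KGL hw g
  have hex : ∀ g, ∃ a : ℂ, ∀ (N : Subgroup (KGL p n)) [N.FiniteIndex], FixedBy σ N (σ g w) →
      average σ N (σ g w) = a • w := by
    intro g
    obtain ⟨N₀, hN₀, hn, h₀⟩ := exists_common_fixedBy (K := KGL p n) (ρ := σ) {g}
      (fun g => σ g w) fun g _ => hfin g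
    have h₀' := h₀ g (mem_singleton_self g)
    obtain ⟨a, ha⟩ := hone _ fun k hk => apply_average h₀' ⟨k, hk⟩
    exact ⟨a, fun N _ hN => by rw [← average_eq_average h₀' hN, ha]⟩
  choose sph hsph using hex
  have hinj : ∀ {a b : ℂ}, a • w = b • w → a = b := fun h => smul_left_injective ℂ hw0 h
  refine ⟨sph, hsph, fun k hk g => ?_, fun k hk g => ?_, ?_, fun m h1 h2 x => ?_⟩
  · obtain ⟨N, hN, hn, h⟩ := exists_common_fixedBy (K := KGL p n) (ρ := σ) {g}
      (fun g => σ g w) fun g _ => hfin g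
    have h' := h g (mem_singleton_self g)
    have e : σ (k * g) w = σ ((⟨k, hk⟩ : KGL p n) : GLp p n) (σ g w) := by rw [map_mul]; rfl
    have hk' : FixedBy σ N (σ (k * g) w) := by rw [e]; exact h'.apply _
    apply hinj
    rw [← hsph _ N hk', ← hsph _ N h', e, average_translate h']
  · obtain ⟨N, hN, h⟩ := hfin g
    have e : σ (g * k) w = σ g w := by rw [map_mul, Module.End.mul_apply, hw k hk]
    apply hinj
    rw [← hsph _ N h, ← e, hsph _ N (by rwa [e])]
  · have h : FixedBy σ (⊤ : Subgroup (KGL p n)) (σ 1 w) := fun k _ => by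
      rw [map_one, Module.End.one_apply, hw _ k.2]
    apply hinj
    rw [← hsph 1 ⊤ h, map_one, Module.End.one_apply, average_eq_self hw, one_smul]
  · obtain ⟨N, hN, hn, h⟩ := exists_common_fixedBy (K := KGL p n) (ρ := σ) (repIndex p n m)
      (fun c => σ (x * cosetRep p c.1 c.2) w) fun c _ => hfin _
    obtain ⟨N', hN', h'⟩ := hfin x
    apply hinj
    rw [sum_smul, sum_congr rfl fun c hc => (hsph _ (N ⊓ N')
      fun k hk => h c hc k hk.1).symm, ← map_sum, mul_smul, ← hsph x (N ⊓ N') fun k hk => h' k hk.2,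
      ← map_smul, ← map_smul, ← hμ m h1 h2]
    simp only [map_mul, Module.End.mul_apply, map_sum]

/-- The Hecke eigenvalues of the spherical vector of the principal series are elementary symmetric
functions of the Satake parameters. -/
theorem hecke_principalSeries {χ : Fin 4 → (ℚ_[p]ˣ →* ℂˣ)} (hχ : ∀ i, IsUnramified (χ i)) (m : ℕ)
    {f : GL4 p → ℂ} (hf : f ∈ (principalSeries χ).toSubmodule)
    (hK : ∀ k ∈ KGL p 4, ∀ g, f (g * k) = f g) (g : GL4 p) :
    ∑ c ∈ repIndex p 4 m, f (g * cosetRep p c.1 c.2) = ((sqrt p : ℂ) ^ (m * (4 - m)) *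
        ∑ I ∈ powersetCard m (univ : Finset (Fin 4)), ∏ i ∈ I, (χ i (pUnit p) : ℂ)) * f g := by
  obtain ⟨b, k, t, hb, hk, rfl⟩ := exists_iwasawa g
  have h1 : ∀ x, f (b * k * x) = borelChar χ t * f (k * x) := fun x => by
    rw [mul_assoc]
    exact hf.1 b t hb.1 hb.2 _
  have h2 : f (b * k) = borelChar χ t * f 1 := by
    have := h1 1
    rw [mul_one, mul_one] at this
    rw [this, ← one_mul k, hK k hk]
  simp only [h1, h2]
  rw [← mul_sum, sum_cosetRep_translate hK hk, principalSeries_fixed hχ hf hK]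
  simp only [Pi.smul_apply, smul_eq_mul]
  rw [← mul_sum, sum_sphericalVector hχ, sphericalVector_one hχ]
  ring

/-- An irreducible representation with a spherical vector on which the Hecke algebra acts through
the parameters `β` is a constituent of exactly those unramified principal series representations
whose Satake parameters are `β` up to a permutation. -/
theorem isConstituent_principalSeries_iff {W : Type} [AddCommGroup W] [Module ℂ W]
    {σ : Representation ℂ (GL4 p) W} (hσ : σ.IsIrreducible) {w : W} (hw0 : w ≠ 0)
    (hw : ∀ k ∈ KGL p 4, σ k w = w)
    (hone : ∀ u : W, (∀ k ∈ KGL p 4, σ k u = u) → ∃ c : ℂ, u = c • w)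
    {β : Fin 4 → ℂ} (hβ : ∏ i, β i ≠ 0)
    (hμ : ∀ m, 1 ≤ m → m ≤ 4 → ∑ c ∈ repIndex p 4 m, σ (cosetRep p c.1 c.2) w
      = ((sqrt p : ℂ) ^ (m * (4 - m)) *
        ∑ I ∈ powersetCard m (univ : Finset (Fin 4)), ∏ i ∈ I, β i) • w)
    {χ : Fin 4 → (ℚ_[p]ˣ →* ℂˣ)} (hχ : ∀ i, IsUnramified (χ i)) :
    IsConstituent σ (principalSeries χ).toRepresentation ↔
      ∃ s : Equiv.Perm (Fin 4), ∀ i, (χ (s i) (pUnit p) : ℂ) = β i := by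
  have hs0 : (sqrt p : ℂ) ≠ 0 := by
    rw [Complex.ofReal_ne_zero, sqrt_ne_zero']
    exact_mod_cast hp.out.pos
  constructor
  · rintro ⟨-, U, f, hf⟩
    obtain ⟨u, rfl⟩ := hf w
    have hu : IsKFinite (KGL p 4) U.toRepresentation u := by
      obtain ⟨N, hN, h⟩ := principalSeries_isKFinite u.1
      exact ⟨N, hN, fun k hk => Subtype.ext (h k hk)⟩
    obtain ⟨v, hv, hvu⟩ := exists_fixed_lift f hu hw
    rw [← hvu] at hw0 hμ
    have hvK : ∀ k ∈ KGL p 4, ∀ g, v.1.1 (g * k) = v.1.1 g := fun k hk g =>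
      congrFun (congrArg (fun x : U.toSubmodule => x.1.1) (hv k hk)) g
    refine exists_perm_of_esymm (n := 4) (a := fun i => (χ i (pUnit p) : ℂ)) (b := β)
      fun m h1 h4 => ?_
    have hv2 : ∑ c ∈ repIndex p 4 m, U.toRepresentation (cosetRep p c.1 c.2) v
        = ((sqrt p : ℂ) ^ (m * (4 - m)) * ∑ I ∈ powersetCard m (univ : Finset (Fin 4)),
            ∏ i ∈ I, (χ i (pUnit p) : ℂ)) • v := by
      apply Subtype.ext
      apply Subtype.ext
      funext g
      have := hecke_principalSeries hχ m v.1.2 hvK g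
      rw [SetLike.val_smul, SetLike.val_smul, Pi.smul_apply, smul_eq_mul, ← this,
        AddSubmonoidClass.coe_finsetSum, AddSubmonoidClass.coe_finsetSum, Finset.sum_apply]
      rfl
    have h2 := congrArg f hv2
    rw [map_sum, map_smul] at h2
    simp only [f.isIntertwining] at h2
    rw [hμ m h1 h4] at h2
    have h3 := smul_left_injective ℂ hw0 h2
    exact (mul_left_cancel₀ (pow_ne_zero _ hs0) h3).symm
  · rintro ⟨s, hs⟩
    have he : ∀ m, ∑ I ∈ powersetCard m (univ : Finset (Fin 4)), ∏ i ∈ I, (χ i (pUnit p) : ℂ)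
        = ∑ I ∈ powersetCard m (univ : Finset (Fin 4)), ∏ i ∈ I, β i := by
      intro m
      rw [← esymm_map_val, ← esymm_map_val]
      congr 1
      conv_lhs => rw [← Multiset.map_univ_val_equiv s, Multiset.map_map]
      exact Multiset.map_congr rfl fun i _ => hs i
    let v : (principalSeries χ).toSubmodule := ⟨sphericalVector χ, sphericalVector_mem hχ⟩
    have hv0 : v ≠ 0 := fun h => by
      have := congrFun (congrArg Subtype.val h) 1
      rw [show v.1 = sphericalVector χ from rfl, sphericalVector_one hχ] at this
      exact one_ne_zero this
    have hv : ∀ k ∈ KGL p 4, (principalSeries χ).toRepresentation k v = v := fun k hk =>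
      Subtype.ext (funext fun g => sphericalVector_mul_right hχ hk g)
    have honev : ∀ u : (principalSeries χ).toSubmodule,
        (∀ k ∈ KGL p 4, (principalSeries χ).toRepresentation k u = u) → ∃ c : ℂ, u = c • v :=
      fun u hu => ⟨u.1 1, Subtype.ext (principalSeries_fixed hχ u.2 fun k hk g =>
        congrFun (congrArg Subtype.val (hu k hk)) g)⟩
    obtain ⟨s₁, h1, h1l, h1r, h11, h1e⟩ := exists_sphericalFunction hw0 hw hone hμ
    obtain ⟨s₂, h2, h2l, h2r, h21, h2e⟩ := exists_sphericalFunction (n := 4) hv0 hv honev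
      (μ := fun m => (sqrt p : ℂ) ^ (m * (4 - m)) *
        ∑ I ∈ powersetCard m (univ : Finset (Fin 4)), ∏ i ∈ I, β i)
      fun m _ _ => by
        rw [← he]
        apply Subtype.ext
        funext g
        have := hecke_principalSeries hχ m v.2 (fun k hk g => sphericalVector_mul_right hχ hk g) g
        rw [SetLike.val_smul, Pi.smul_apply, smul_eq_mul, ← this,
          AddSubmonoidClass.coe_finsetSum, Finset.sum_apply]
        rfl
    have heq : ∀ g, s₁ g = s₂ g := by
      intro g
      have := spherical_eq_zero (w := fun g => s₁ g - s₂ g)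
        (μ := fun m => (sqrt p : ℂ) ^ (m * (4 - m)) *
          ∑ I ∈ powersetCard m (univ : Finset (Fin 4)), ∏ i ∈ I, β i) (fun k hk g => by rw [h1l k hk, h2l k hk])
        (fun k hk g => by rw [h1r k hk, h2r k hk]) (fun m hm hm' x => by
          rw [sum_sub_distrib, h1e m hm hm', h2e m hm hm', mul_sub]) (by norm_num)
        (mul_ne_zero (pow_ne_zero _ hs0) (by
          have : powersetCard 4 (univ : Finset (Fin 4)) = {univ} := by
            exact powersetCard_self (univ : Finset (Fin 4))
          rw [this, sum_singleton]
          exact hβ)) (by rw [h11, h21, sub_self]) g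
      exact sub_eq_zero.1 this
    refine isConstituent_of_spherical isHeckePair_KGL hσ hw hv hw0 hv0 fun g N _ hN hN' =>
      ⟨s₁ g, h1 g N hN, ?_⟩
    rw [heq g]
    exact h2 g N hN'

/-- The elementary symmetric functions of the parameters `satakeParam p l`. -/
theorem satakeParam_esymm (p : ℕ) [hp : Fact p.Prime] (l : ℂ) : (∏ i, satakeParam p l i = 1) ∧
    (sqrt p : ℂ) ^ (1 * (4 - 1)) * ∑ I ∈ powersetCard 1 (univ : Finset (Fin 4)),
      ∏ i ∈ I, satakeParam p l i = p * (p + 1) * l ∧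
    (sqrt p : ℂ) ^ (2 * (4 - 2)) * ∑ I ∈ powersetCard 2 (univ : Finset (Fin 4)),
      ∏ i ∈ I, satakeParam p l i = p ^ 2 * l ^ 2 + p ^ 3 + p ∧
    (sqrt p : ℂ) ^ (3 * (4 - 3)) * ∑ I ∈ powersetCard 3 (univ : Finset (Fin 4)),
      ∏ i ∈ I, satakeParam p l i = p * (p + 1) * l := by
  set s : ℂ := (sqrt p : ℂ) with hs
  have hs2 : (p : ℂ) = s ^ 2 := by
    rw [hs, ← Complex.ofReal_pow, sq_sqrt (Nat.cast_nonneg p), Complex.ofReal_natCast]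
  have hs0 : s ≠ 0 := by
    rw [hs, Complex.ofReal_ne_zero, sqrt_ne_zero']
    exact_mod_cast hp.out.pos
  set d : ℂ := (l ^ 2 - 4) ^ (1 / 2 : ℂ) with hd
  have hd2 : d ^ 2 = l ^ 2 - 4 := by
    rw [hd, ← Complex.cpow_nat_mul]
    norm_num
  have e1 : powersetCard 1 (univ : Finset (Fin 4)) = {{0}, {1}, {2}, {3}} := by decide
  have e2 : powersetCard 2 (univ : Finset (Fin 4))
      = {{0, 1}, {0, 2}, {0, 3}, {1, 2}, {1, 3}, {2, 3}} := by decide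
  have e3 : powersetCard 3 (univ : Finset (Fin 4))
      = {{0, 1, 2}, {0, 1, 3}, {0, 2, 3}, {1, 2, 3}} := by decide
  have s1 : ∀ f : Finset (Fin 4) → ℂ, ∑ I ∈ ({{0}, {1}, {2}, {3}} : Finset (Finset (Fin 4))), f I
      = f {0} + (f {1} + (f {2} + f {3})) := fun f => by
    rw [sum_insert (by decide), sum_insert (by decide), sum_insert (by decide), sum_singleton]
  have s2 : ∀ f : Finset (Fin 4) → ℂ, ∑ I ∈ ({{0, 1}, {0, 2}, {0, 3}, {1, 2}, {1, 3}, {2, 3}} :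
      Finset (Finset (Fin 4))), f I
      = f {0, 1} + (f {0, 2} + (f {0, 3} + (f {1, 2} + (f {1, 3} + f {2, 3})))) := fun f => by
    rw [sum_insert (by decide), sum_insert (by decide), sum_insert (by decide),
      sum_insert (by decide), sum_insert (by decide), sum_singleton]
  have s3 : ∀ f : Finset (Fin 4) → ℂ, ∑ I ∈ ({{0, 1, 2}, {0, 1, 3}, {0, 2, 3}, {1, 2, 3}} :
      Finset (Finset (Fin 4))), f I
      = f {0, 1, 2} + (f {0, 1, 3} + (f {0, 2, 3} + f {1, 2, 3})) := fun f => by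
    rw [sum_insert (by decide), sum_insert (by decide), sum_insert (by decide), sum_singleton]
  have p1 : ∀ (f : Fin 4 → ℂ) a b, a ≠ b → ∏ i ∈ ({a, b} : Finset (Fin 4)), f i = f a * f b :=
    fun f a b h => prod_pair h
  have p2 : ∀ (f : Fin 4 → ℂ) a b c, a ≠ b → a ≠ c → b ≠ c →
      ∏ i ∈ ({a, b, c} : Finset (Fin 4)), f i = f a * (f b * f c) := fun f a b c h h' h'' => by
    rw [prod_insert (by simp [h, h']), prod_pair h'']
  have v0 : satakeParam p l 0 = s * ((l + d) / 2) := rfl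
  have v1 : satakeParam p l 1 = s * ((l - d) / 2) := rfl
  have v2 : satakeParam p l 2 = s⁻¹ * ((l + d) / 2) := rfl
  have v3 : satakeParam p l 3 = s⁻¹ * ((l - d) / 2) := rfl
  refine ⟨?_, ?_, ?_, ?_⟩
  · rw [Fin.prod_univ_four, v0, v1, v2, v3]
    field_simp
    linear_combination (-(l + d) * (l - d) - 4) * hd2
  · rw [e1, s1]
    simp only [prod_singleton, v0, v1, v2, v3, hs2]
    field_simp
    ring
  · rw [e2, s2]
    simp only [p1 _ _ _ (show (0 : Fin 4) ≠ 1 by decide), p1 _ _ _ (show (0 : Fin 4) ≠ 2 by decide),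
      p1 _ _ _ (show (0 : Fin 4) ≠ 3 by decide), p1 _ _ _ (show (1 : Fin 4) ≠ 2 by decide),
      p1 _ _ _ (show (1 : Fin 4) ≠ 3 by decide), p1 _ _ _ (show (2 : Fin 4) ≠ 3 by decide),
      v0, v1, v2, v3, hs2]
    field_simp
    ring_nf
    simp only [show d ^ 2 = l ^ 2 - 4 from hd2]
    ring
  · rw [e3, s3]
    rw [p2 _ _ _ _ (show (0 : Fin 4) ≠ 1 by decide) (show (0 : Fin 4) ≠ 2 by decide)
        (show (1 : Fin 4) ≠ 2 by decide),
      p2 _ _ _ _ (show (0 : Fin 4) ≠ 1 by decide) (show (0 : Fin 4) ≠ 3 by decide)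
        (show (1 : Fin 4) ≠ 3 by decide),
      p2 _ _ _ _ (show (0 : Fin 4) ≠ 2 by decide) (show (0 : Fin 4) ≠ 3 by decide)
        (show (2 : Fin 4) ≠ 3 by decide),
      p2 _ _ _ _ (show (1 : Fin 4) ≠ 2 by decide) (show (1 : Fin 4) ≠ 3 by decide)
        (show (2 : Fin 4) ≠ 3 by decide)]
    simp only [v0, v1, v2, v3, hs2]
    field_simp
    ring_nf
    simp only [show d ^ 2 = l ^ 2 - 4 from hd2]
    ring

end Comparison

/-! ### The modified Bessel function -/

section Bessel
open Real MeasureTheory Set Filter Topology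
open Complex hiding dist_eq exp_add exp_nat_mul

theorem norm_cosh_mul_le (s : ℂ) {t : ℝ} (ht : 0 ≤ t) :
    ‖Complex.cosh (s * t)‖ ≤ Real.exp (‖s‖ * t) := by
  have h1 : ∀ w : ℂ, ‖w‖ ≤ ‖s‖ * t → ‖Complex.exp w‖ ≤ Real.exp (‖s‖ * t) := fun w hw => by
    rw [norm_exp]
    exact exp_le_exp.2 ((re_le_norm w).trans hw)
  have h2 : ‖s * (t : ℂ)‖ = ‖s‖ * t := by rw [norm_mul, norm_real, Real.norm_of_nonneg ht]
  have := norm_add_le (Complex.exp (s * t)) (Complex.exp (-(s * t)))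
  have h3 := h1 _ h2.le
  have h4 := h1 (-(s * t)) (by rw [norm_neg, h2])
  rw [Complex.cosh, norm_div, Complex.norm_ofNat]
  linarith

/-- The function that dominates the integrand of the Bessel function and of its derivatives. -/
def besselBound (σ : ℝ) (j : ℕ) (z t : ℝ) : ℝ :=
  Real.cosh t ^ j * Real.exp (-z * Real.cosh t) * Real.exp (σ * t)

theorem continuous_besselBound (σ : ℝ) (j : ℕ) (z : ℝ) : Continuous (besselBound σ j z) := by
  unfold besselBound
  have := Real.continuous_cosh
  fun_prop

theorem besselBound_le {σ : ℝ} {j : ℕ} {z t : ℝ} (hσ : 0 ≤ σ) (hz : 0 < z)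
    (ht : 4 * (j + σ + 1) / z ≤ t) : besselBound σ j z t ≤ Real.exp (-t) := by
  have ht0 : 0 ≤ t := le_trans (by positivity) ht
  have h1 : Real.cosh t ≤ Real.exp t := by
    rw [cosh_eq]
    have := exp_le_exp.2 (show -t ≤ t by linarith)
    linarith
  have h2 : t ^ 2 / 4 ≤ Real.cosh t := by
    rw [cosh_eq]
    have := quadratic_le_exp_of_nonneg ht0
    have := exp_pos (-t)
    linarith
  have h3 : Real.cosh t ^ j ≤ Real.exp (j * t) := by
    rw [exp_nat_mul]
    exact pow_le_pow_left₀ (Real.cosh_pos t).le h1 j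
  calc besselBound σ j z t ≤ Real.exp (j * t) * Real.exp (-z * (t ^ 2 / 4)) * Real.exp (σ * t) := by
        unfold besselBound
        have h4 := mul_le_mul_of_nonpos_left h2 (neg_nonpos.2 hz.le)
        gcongr
    _ = Real.exp (j * t + -z * (t ^ 2 / 4) + σ * t) := by rw [exp_add, exp_add]
    _ ≤ Real.exp (-t) := by
        apply exp_le_exp.2
        rw [div_le_iff₀ hz] at ht
        nlinarith

theorem integrableOn_besselBound {σ : ℝ} (j : ℕ) {z : ℝ} (hσ : 0 ≤ σ) (hz : 0 < z) :
    IntegrableOn (besselBound σ j z) (Ioi 0) := by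
  refine integrable_of_isBigO_exp_neg (b := 1) one_pos (continuous_besselBound σ j z).continuousOn
    (Asymptotics.IsBigO.of_bound 1 ?_)
  filter_upwards [eventually_ge_atTop (4 * (j + σ + 1) / z)] with t ht
  rw [Real.norm_of_nonneg (by unfold besselBound; have := Real.cosh_pos t; positivity),
    Real.norm_of_nonneg (exp_pos _).le, one_mul, neg_one_mul]
  exact besselBound_le hσ hz ht

/-- The integrand of the `j`-th derivative of the Bessel function, up to sign. -/
def besselIntegrand (s : ℂ) (j : ℕ) (z t : ℝ) : ℂ :=
  ((Real.cosh t ^ j * Real.exp (-z * Real.cosh t) : ℝ) : ℂ) * Complex.cosh (s * t)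

theorem continuous_besselIntegrand (s : ℂ) (j : ℕ) (z : ℝ) :
    Continuous (besselIntegrand s j z) := by
  unfold besselIntegrand
  have := Real.continuous_cosh
  have := Complex.continuous_cosh
  fun_prop

theorem norm_besselIntegrand_le (s : ℂ) (j : ℕ) (z : ℝ) {t : ℝ} (ht : 0 ≤ t) :
    ‖besselIntegrand s j z t‖ ≤ besselBound ‖s‖ j z t := by
  have h : 0 ≤ Real.cosh t ^ j * Real.exp (-z * Real.cosh t) := by
    have := Real.cosh_pos t
    positivity
  rw [besselIntegrand, norm_mul, norm_real, Real.norm_of_nonneg h, besselBound]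
  exact mul_le_mul_of_nonneg_left (norm_cosh_mul_le s ht) h

theorem integrableOn_besselIntegrand (s : ℂ) (j : ℕ) {z : ℝ} (hz : 0 < z) :
    IntegrableOn (besselIntegrand s j z) (Ioi 0) := by
  refine (integrableOn_besselBound j (norm_nonneg s) hz).mono'
    (continuous_besselIntegrand s j z).aestronglyMeasurable ?_
  exact (ae_restrict_iff' measurableSet_Ioi).2 (Eventually.of_forall fun t ht =>
    norm_besselIntegrand_le s j z (le_of_lt ht))

/-- `∫_0^∞ (cosh t)^j e^{-z cosh t} cosh(st) dt`, up to sign the `j`-th derivative of `K_s`. -/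
def besselMoment (s : ℂ) (j : ℕ) (z : ℝ) : ℂ := ∫ t in Ioi (0 : ℝ), besselIntegrand s j z t

theorem besselK_eq (s : ℂ) (z : ℝ) : besselK s z = besselMoment s 0 z := by
  simp [besselK, besselMoment, besselIntegrand]

theorem hasDerivAt_besselIntegrand (s : ℂ) (j : ℕ) (z t : ℝ) :
    HasDerivAt (fun z => besselIntegrand s j z t) (-besselIntegrand s (j + 1) z t) z := by
  have h : HasDerivAt (fun z : ℝ => Real.cosh t ^ j * Real.exp (-z * Real.cosh t))
      (Real.cosh t ^ j * (Real.exp (-z * Real.cosh t) * (-1 * Real.cosh t))) z :=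
    (((hasDerivAt_id z).neg.mul_const _).exp).const_mul _
  refine HasDerivAt.congr_deriv (h.ofReal_comp.mul_const (Complex.cosh (s * t))) ?_
  simp only [besselIntegrand]
  push_cast
  ring

theorem hasDerivAt_besselMoment (s : ℂ) (j : ℕ) {z : ℝ} (hz : 0 < z) :
    HasDerivAt (besselMoment s j) (-besselMoment s (j + 1) z) z := by
  have := (hasDerivAt_integral_of_dominated_loc_of_deriv_le (μ := volume.restrict (Ioi (0 : ℝ)))
    (s := Ioi (z / 2)) (F := besselIntegrand s j) (F' := fun z t => -besselIntegrand s (j + 1) z t)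
    (bound := besselBound ‖s‖ (j + 1) (z / 2)) (x₀ := z) (Ioi_mem_nhds (by linarith))
    (Eventually.of_forall fun x => (continuous_besselIntegrand s j x).aestronglyMeasurable)
    (integrableOn_besselIntegrand s j hz)
    (continuous_besselIntegrand s (j + 1) z).neg.aestronglyMeasurable
    ((ae_restrict_iff' measurableSet_Ioi).2 (Eventually.of_forall fun t ht x hx => ?_))
    (integrableOn_besselBound (j + 1) (norm_nonneg s) (by linarith))
    (Eventually.of_forall fun t x _ => hasDerivAt_besselIntegrand s j x t)).2
  · rw [integral_neg] at this
    exact this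
  · rw [norm_neg]
    refine (norm_besselIntegrand_le s (j + 1) x (le_of_lt ht)).trans ?_
    unfold besselBound
    have := Real.cosh_pos t
    have hx' : z / 2 < x := hx
    gcongr

theorem norm_besselMoment_le (s : ℂ) (j : ℕ) : ∃ C : ℝ, 0 ≤ C ∧ ∀ z : ℝ, 1 ≤ z →
    ‖besselMoment s j z‖ ≤ C * Real.exp (-z) := by
  have hnn : ∀ t, 0 ≤ besselBound ‖s‖ j 1 t := fun t => by
    unfold besselBound
    have := Real.cosh_pos t
    positivity
  refine ⟨Real.exp 1 * ∫ t in Ioi (0 : ℝ), besselBound ‖s‖ j 1 t,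
    mul_nonneg (exp_pos _).le (integral_nonneg hnn), fun z hz => ?_⟩
  have h := norm_integral_le_of_norm_le (μ := volume.restrict (Ioi (0 : ℝ)))
    (f := besselIntegrand s j z) (g := fun t => Real.exp (1 - z) * besselBound ‖s‖ j 1 t)
    ((integrableOn_besselBound j (norm_nonneg s) one_pos).const_mul _)
    ((ae_restrict_iff' measurableSet_Ioi).2 (Eventually.of_forall fun t ht => by
      refine (norm_besselIntegrand_le s j z (le_of_lt ht)).trans ?_
      have h1 := one_le_cosh t
      have h2 : Real.exp (-z * Real.cosh t) ≤ Real.exp (1 - z) * Real.exp (-1 * Real.cosh t) := by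
        rw [← exp_add]
        apply exp_le_exp.2
        nlinarith
      unfold besselBound
      calc _ ≤ Real.cosh t ^ j * (Real.exp (1 - z) * Real.exp (-1 * Real.cosh t))
            * Real.exp (‖s‖ * t) := by gcongr
        _ = _ := by ring))
  rw [integral_const_mul] at h
  refine h.trans (le_of_eq ?_)
  rw [sub_eq_add_neg, exp_add]
  ring

/-- Bessel's differential equation `z² K'' + z K' = (z² + s²) K`. -/
theorem besselMoment_ode (s : ℂ) {z : ℝ} (hz : 0 < z) :
    (z : ℂ) ^ 2 * besselMoment s 2 z - z * besselMoment s 1 z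
      = ((z : ℂ) ^ 2 + s ^ 2) * besselMoment s 0 z := by
  -- The difference of the two sides is the integral of the derivative of `G`.
  set G : ℝ → ℂ := fun t => ((Real.exp (-z * Real.cosh t) : ℝ) : ℂ) *
    (-(z : ℂ) * (Real.sinh t : ℂ) * Complex.cosh (s * t) - s * Complex.sinh (s * t)) with hG
  have hderiv : ∀ t ∈ Ici (0 : ℝ), HasDerivAt G ((z : ℂ) ^ 2 * besselIntegrand s 2 z t
      - z * besselIntegrand s 1 z t - ((z : ℂ) ^ 2 + s ^ 2) * besselIntegrand s 0 z t) t := by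
    intro t _
    have e1 : HasDerivAt (fun t : ℝ => ((Real.exp (-z * Real.cosh t) : ℝ) : ℂ)) _ t :=
      (((Real.hasDerivAt_cosh t).const_mul (-z)).exp).ofReal_comp
    have e2 : HasDerivAt (fun t : ℝ => (Real.sinh t : ℂ)) _ t :=
      (Real.hasDerivAt_sinh t).ofReal_comp
    have e0 : HasDerivAt (fun w : ℂ => s * w) (s * 1) (t : ℂ) := (hasDerivAt_id _).const_mul s
    have e3 : HasDerivAt (fun t : ℝ => Complex.cosh (s * t)) _ t := e0.ccosh.comp_ofReal
    have e4 : HasDerivAt (fun t : ℝ => Complex.sinh (s * t)) _ t := e0.csinh.comp_ofReal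
    refine HasDerivAt.congr_deriv
      (e1.mul (((e2.const_mul (-(z : ℂ))).mul e3).sub (e4.const_mul s))) ?_
    have h1 : (Real.sinh t : ℂ) ^ 2 = (Real.cosh t : ℂ) ^ 2 - 1 := by exact_mod_cast Real.sinh_sq t
    simp only [besselIntegrand]
    push_cast at h1 ⊢
    linear_combination ((z : ℂ) ^ 2 * Complex.exp (-z * Complex.cosh t) * Complex.cosh (s * t)) * h1
  have i2 : IntegrableOn (fun t => (z : ℂ) ^ 2 * besselIntegrand s 2 z t) (Ioi 0) :=
    (integrableOn_besselIntegrand s 2 hz).const_mul _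
  have i1 : IntegrableOn (fun t => (z : ℂ) * besselIntegrand s 1 z t) (Ioi 0) :=
    (integrableOn_besselIntegrand s 1 hz).const_mul _
  have i0 : IntegrableOn (fun t => ((z : ℂ) ^ 2 + s ^ 2) * besselIntegrand s 0 z t) (Ioi 0) :=
    (integrableOn_besselIntegrand s 0 hz).const_mul _
  have i21 : IntegrableOn (fun t => (z : ℂ) ^ 2 * besselIntegrand s 2 z t
      - z * besselIntegrand s 1 z t) (Ioi 0) := i2.sub i1
  have hlim : Tendsto G atTop (𝓝 0) := by
    have hb : ∀ t : ℝ, 0 ≤ t → ‖G t‖ ≤ z * besselBound ‖s‖ 1 z t + ‖s‖ * besselBound ‖s‖ 0 z t := by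
      intro t ht
      have h1 : |Real.sinh t| ≤ Real.cosh t := by
        rw [abs_of_nonneg (sinh_nonneg_iff.2 ht)]
        exact (sinh_lt_cosh t).le
      have h2 := norm_cosh_mul_le s ht
      have h3 : ‖Complex.sinh (s * t)‖ ≤ Real.exp (‖s‖ * t) := by
        have h1 : ∀ w : ℂ, ‖w‖ ≤ ‖s‖ * t → ‖Complex.exp w‖ ≤ Real.exp (‖s‖ * t) := fun w hw => by
          rw [norm_exp]
          exact exp_le_exp.2 ((re_le_norm w).trans hw)
        have h2 : ‖s * (t : ℂ)‖ = ‖s‖ * t := by rw [norm_mul, norm_real, Real.norm_of_nonneg ht]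
        have := norm_sub_le (Complex.exp (s * t)) (Complex.exp (-(s * t)))
        have h3 := h1 _ h2.le
        have h4 := h1 (-(s * t)) (by rw [norm_neg, h2])
        rw [Complex.sinh, norm_div, Complex.norm_ofNat]
        linarith
      rw [hG]
      simp only [norm_mul, norm_real, Real.norm_of_nonneg (exp_pos _).le]
      calc _ ≤ Real.exp (-z * Real.cosh t) *
            (z * Real.cosh t * Real.exp (‖s‖ * t) + ‖s‖ * Real.exp (‖s‖ * t)) := by
            refine mul_le_mul_of_nonneg_left ((norm_sub_le _ _).trans ?_) (exp_pos _).le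
            simp only [norm_mul, norm_neg, norm_real, norm_eq_abs, abs_of_pos hz]
            gcongr
        _ = _ := by unfold besselBound; ring
    have hbb : ∀ j : ℕ, Tendsto (besselBound ‖s‖ j z) atTop (𝓝 0) := fun j => by
      refine squeeze_zero' (Eventually.of_forall fun t => ?_) ?_
        (tendsto_exp_atBot.comp tendsto_neg_atTop_atBot)
      · unfold besselBound
        have := Real.cosh_pos t
        positivity
      · filter_upwards [eventually_ge_atTop (4 * (j + ‖s‖ + 1) / z)] with t ht
        exact besselBound_le (norm_nonneg s) hz ht
    refine squeeze_zero_norm' (a := fun t => z * besselBound ‖s‖ 1 z t + ‖s‖ * besselBound ‖s‖ 0 z t)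
      ?_ ?_
    · filter_upwards [eventually_ge_atTop 0] with t ht using hb t ht
    · simpa using ((hbb 1).const_mul z).add ((hbb 0).const_mul ‖s‖)
  have := integral_Ioi_of_hasDerivAt_of_tendsto' hderiv (i21.sub i0) hlim
  rw [integral_sub i21 i0, integral_sub i2 i1, integral_const_mul, integral_const_mul,
    integral_const_mul] at this
  have h0 : G 0 = 0 := by simp [hG]
  rw [h0, sub_zero] at this
  exact sub_eq_zero.1 this

/-- The Bessel function does not vanish identically: for large `z` the integral is dominated by
small `t`, where `cosh(st)` is close to `1`. -/
theorem exists_besselK_ne_zero (s : ℂ) : ∃ z : ℝ, 0 < z ∧ besselK s z ≠ 0 := by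
  by_contra! hz
  obtain ⟨δ, hδ, hre⟩ : ∃ δ > 0, ∀ t : ℝ, |t| ≤ δ → 1 / 2 ≤ (Complex.cosh (s * t)).re := by
    have hc : Continuous fun t : ℝ => (Complex.cosh (s * t)).re := by
      have := Complex.continuous_cosh
      fun_prop
    have := (hc.continuousAt (x := 0)).eventually (lt_mem_nhds (a := 1 / 2) (by simp; norm_num))
    obtain ⟨ε, hε, h⟩ := Metric.eventually_nhds_iff.1 this
    refine ⟨ε / 2, by positivity, fun t ht => (h ?_).le⟩
    rw [dist_eq, sub_zero]
    linarith
  set C := ∫ t in Ioi (0 : ℝ), besselBound ‖s‖ 0 1 t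
  set c₁ := Real.cosh (δ / 2)
  set c₂ := Real.cosh δ
  have hc : c₁ < c₂ := cosh_lt_cosh.2 (by
    rw [abs_of_pos hδ, abs_of_pos (by positivity : 0 < δ / 2)]
    linarith)
  have key : ∀ z : ℝ, 1 ≤ z → Real.exp (-z * c₁) * (δ / 4) ≤ Real.exp (-(z - 1) * c₂) * C := by
    intro z hz1
    have h0 := hz z (by linarith)
    rw [besselK_eq, besselMoment] at h0
    have hint := integrableOn_besselIntegrand s 0 (show 0 < z by linarith)
    have h1 : ∫ t in Ioi (0 : ℝ), (besselIntegrand s 0 z t).re = 0 := by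
      have := integral_re hint
      simp only [RCLike.re_eq_complex_re] at this
      rw [this, h0, zero_re]
    have hi1 : IntegrableOn ((Ioc 0 (δ / 2)).indicator fun _ : ℝ => Real.exp (-z * c₁) / 2) (Ioi 0) :=
      ((integrable_indicator_iff measurableSet_Ioc).2 (by simp)).integrableOn
    have hi2 := (integrableOn_besselBound 0 (norm_nonneg s) one_pos).const_mul
      (Real.exp (-(z - 1) * c₂))
    have h2 := setIntegral_mono_on (hi1.sub hi2) hint.re measurableSet_Ioi
      (fun t (ht : 0 < t) => ?_)
    · have h3 : ∫ t in Ioi (0 : ℝ), (Ioc 0 (δ / 2)).indicator (fun _ : ℝ => Real.exp (-z * c₁) / 2) t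
          = Real.exp (-z * c₁) * (δ / 4) := by
        rw [integral_indicator measurableSet_Ioc, Measure.restrict_restrict measurableSet_Ioc,
          inter_eq_left.2 Ioc_subset_Ioi_self, setIntegral_const, measureReal_def, volume_Ioc,
          ENNReal.toReal_ofReal (by linarith), smul_eq_mul]
        ring
      simp only [Pi.sub_apply, RCLike.re_eq_complex_re] at h2
      rw [h1, integral_sub hi1 hi2, h3, integral_const_mul] at h2
      linarith
    · have hre' : (besselIntegrand s 0 z t).re
          = Real.exp (-z * Real.cosh t) * (Complex.cosh (s * t)).re := by
        rw [besselIntegrand, re_ofReal_mul, pow_zero, one_mul]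
      have hB : 0 ≤ Real.exp (-(z - 1) * c₂) * besselBound ‖s‖ 0 1 t := by
        unfold besselBound
        have := Real.cosh_pos t
        positivity
      simp only [Pi.sub_apply, RCLike.re_eq_complex_re]
      rcases le_or_gt t δ with h | h
      · have h3 := hre t (by rwa [abs_of_pos ht])
        by_cases h4 : t ∈ Ioc 0 (δ / 2)
        · rw [indicator_of_mem h4, hre']
          have : Real.exp (-z * c₁) ≤ Real.exp (-z * Real.cosh t) := by
            apply exp_le_exp.2
            have : Real.cosh t ≤ c₁ := cosh_le_cosh.2 (by
              rw [abs_of_pos ht, abs_of_pos (by positivity : 0 < δ / 2)]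
              exact h4.2)
            nlinarith
          nlinarith [exp_pos (-z * c₁)]
        · rw [indicator_of_notMem h4, hre']
          nlinarith [exp_pos (-z * Real.cosh t)]
      · rw [indicator_of_notMem (fun h4 => by linarith [h4.2])]
        have h3 := norm_besselIntegrand_le s 0 z ht.le
        have h5 := (abs_le.1 (abs_re_le_norm (besselIntegrand s 0 z t))).1
        have h6 : besselBound ‖s‖ 0 z t ≤ Real.exp (-(z - 1) * c₂) * besselBound ‖s‖ 0 1 t := by
          have h7 : c₂ ≤ Real.cosh t := cosh_le_cosh.2 (by
            rw [abs_of_pos ht, abs_of_pos hδ]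
            exact h.le)
          have h8 : Real.exp (-z * Real.cosh t)
              ≤ Real.exp (-(z - 1) * c₂) * Real.exp (-1 * Real.cosh t) := by
            rw [← exp_add]
            apply exp_le_exp.2
            nlinarith
          unfold besselBound
          calc _ = Real.exp (-z * Real.cosh t) * Real.exp (‖s‖ * t) := by ring
            _ ≤ Real.exp (-(z - 1) * c₂) * Real.exp (-1 * Real.cosh t) * Real.exp (‖s‖ * t) := by
              gcongr
            _ = _ := by ring
        linarith
  have hC : 0 ≤ C := integral_nonneg fun t => by
    simp only [besselBound, Pi.zero_apply]
    positivity
  have hlim : Tendsto (fun z : ℝ => Real.exp (-((c₂ - c₁) * z)) * (Real.exp c₂ * C)) atTop (𝓝 0) := by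
    have h : Tendsto (fun z : ℝ => (c₂ - c₁) * z) atTop atTop :=
      tendsto_id.const_mul_atTop (sub_pos.2 hc)
    simpa using (tendsto_exp_neg_atTop_nhds_zero.comp h).mul_const (Real.exp c₂ * C)
  obtain ⟨z, hz1, hz2⟩ := ((hlim.eventually (gt_mem_nhds (show 0 < δ / 4 by positivity))).and
    (eventually_ge_atTop 1)).exists
  have h := key z hz2
  have h2 : Real.exp (-(z - 1) * c₂) * C
      = Real.exp (-z * c₁) * (Real.exp (-((c₂ - c₁) * z)) * (Real.exp c₂ * C)) := by
    rw [← mul_assoc, ← mul_assoc, ← exp_add, ← exp_add]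
    congr 2
    ring
  rw [h2] at h
  have := le_of_mul_le_mul_left h (exp_pos _)
  linarith

end Bessel

/-! ### Solutions of moderate growth of the radial differential equation -/

section RadialEquation
open Complex MeasureTheory Set Filter Topology
open Real hiding norm_ofNat

/-- `W`, with derivatives `W'` and `W''`, solves
`y² W'' - 3 y W' + (4 - s² - κ² y²) W = 0` on the positive half line. -/
structure IsRadialSolution (s : ℂ) (κ : ℝ) (W W' W'' : ℝ → ℂ) : Prop where
  deriv₁ : ∀ y, 0 < y → HasDerivAt W (W' y) y
  deriv₂ : ∀ y, 0 < y → HasDerivAt W' (W'' y) y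
  eqn : ∀ y : ℝ, 0 < y → (y : ℂ) ^ 2 * W'' y - 3 * y * W' y + (4 - s ^ 2 - κ ^ 2 * y ^ 2) * W y = 0

/-- `y² K_s(κ y)`. -/
def radialBessel (s : ℂ) (κ y : ℝ) : ℂ := (y : ℂ) ^ 2 * besselMoment s 0 (κ * y)

/-- The derivative of `y² K_s(κ y)`. -/
def radialBesselDeriv (s : ℂ) (κ y : ℝ) : ℂ :=
  2 * y * besselMoment s 0 (κ * y) - κ * y ^ 2 * besselMoment s 1 (κ * y)

theorem isRadialSolution_bessel (s : ℂ) {κ : ℝ} (hκ : 0 < κ) :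
    IsRadialSolution s κ (radialBessel s κ) (radialBesselDeriv s κ) fun y =>
      2 * besselMoment s 0 (κ * y) - 4 * κ * y * besselMoment s 1 (κ * y)
        + κ ^ 2 * y ^ 2 * besselMoment s 2 (κ * y) := by
  have hm : ∀ (j : ℕ) (y : ℝ), 0 < y → HasDerivAt (fun y => besselMoment s j (κ * y))
      (-(κ : ℂ) * besselMoment s (j + 1) (κ * y)) y := fun j y hy => by
    have h := (hasDerivAt_besselMoment s j (mul_pos hκ hy)).scomp y
      ((hasDerivAt_id y).const_mul κ)
    refine h.congr_deriv ?_
    rw [real_smul]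
    push_cast
    ring
  have hy1 : ∀ y : ℝ, HasDerivAt (fun y : ℝ => (y : ℂ)) 1 y := fun y => by
    simpa using (hasDerivAt_id y).ofReal_comp
  have hy2 : ∀ y : ℝ, HasDerivAt (fun y : ℝ => (y : ℂ) ^ 2) (2 * y) y := fun y => by
    refine ((hy1 y).pow 2).congr_deriv ?_
    simp
  refine ⟨fun y hy => ?_, fun y hy => ?_, fun y hy => ?_⟩
  · refine ((hy2 y).mul (hm 0 y hy)).congr_deriv ?_
    simp only [radialBesselDeriv]
    ring
  · refine ((((hy1 y).const_mul 2).mul (hm 0 y hy)).sub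
      (((hy2 y).const_mul (κ : ℂ)).mul (hm 1 y hy))).congr_deriv ?_
    ring
  · have := besselMoment_ode s (mul_pos hκ hy)
    push_cast at this
    simp only [radialBessel, radialBesselDeriv]
    linear_combination (y : ℂ) ^ 2 * this

theorem IsRadialSolution.sub {s : ℂ} {κ : ℝ} {W W' W'' B B' B'' : ℝ → ℂ}
    (hW : IsRadialSolution s κ W W' W'') (hB : IsRadialSolution s κ B B' B'') (a : ℂ) :
    IsRadialSolution s κ (fun y => W y - a * B y) (fun y => W' y - a * B' y)
      fun y => W'' y - a * B'' y where
  deriv₁ y hy := (hW.deriv₁ y hy).sub ((hB.deriv₁ y hy).const_mul a)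
  deriv₂ y hy := (hW.deriv₂ y hy).sub ((hB.deriv₂ y hy).const_mul a)
  eqn y hy := by linear_combination hW.eqn y hy - a * hB.eqn y hy

/-- A solution is determined by its value and its derivative at one point. -/
theorem IsRadialSolution.eq_zero {s : ℂ} {κ : ℝ} {W W' W'' : ℝ → ℂ}
    (hW : IsRadialSolution s κ W W' W'') {y₀ : ℝ} (hy₀ : 0 < y₀) (h0 : W y₀ = 0) (h1 : W' y₀ = 0)
    {y : ℝ} (hy : 0 < y) : W y = 0 := by
  set a := min y₀ y / 2
  set b := max y₀ y + 1
  have ha : 0 < a := by positivity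
  have hmem : ∀ z : ℝ, min y₀ y ≤ z → z ≤ max y₀ y → z ∈ Ioo a b := fun z h h' =>
    ⟨by have : 0 < min y₀ y := lt_min hy₀ hy
        change min y₀ y / 2 < z
        linarith, by change z < max y₀ y + 1; linarith⟩
  set q : ℝ → ℂ := fun t => (4 - s ^ 2 - κ ^ 2 * t ^ 2) / (t : ℂ) ^ 2
  set v : ℝ → ℂ × ℂ → ℂ × ℂ := fun t w => (w.2, 3 / (t : ℂ) * w.2 - q t * w.1)
  have hb1 : ∃ P : ℝ, ∀ t ∈ Icc a b, ‖3 / (t : ℂ)‖ ≤ P := by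
    refine isCompact_Icc.exists_bound_of_continuousOn (ContinuousOn.div (by fun_prop) (by fun_prop) ?_)
    intro t ht
    exact_mod_cast (ha.trans_le ht.1).ne'
  have hb2 : ∃ Q : ℝ, ∀ t ∈ Icc a b, ‖q t‖ ≤ Q := by
    refine isCompact_Icc.exists_bound_of_continuousOn (ContinuousOn.div (by fun_prop) (by fun_prop) ?_)
    intro t ht
    exact pow_ne_zero _ (by exact_mod_cast (ha.trans_le ht.1).ne')
  obtain ⟨P, hP⟩ := hb1
  obtain ⟨Q, hQ⟩ := hb2
  have hv : ∀ t ∈ Ioo a b, LipschitzOnWith (toNNReal (1 + P + Q)) (v t) univ := by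
    intro t ht
    have hP' := hP t (Ioo_subset_Icc_self ht)
    have hQ' := hQ t (Ioo_subset_Icc_self ht)
    have hP0 := (norm_nonneg _).trans hP'
    have hQ0 := (norm_nonneg _).trans hQ'
    refine (LipschitzWith.of_dist_le_mul fun w w' => ?_).lipschitzOnWith
    rw [coe_toNNReal _ (by positivity), dist_eq_norm, dist_eq_norm]
    have h3 : v t w - v t w' = ((w - w').2, 3 / (t : ℂ) * (w - w').2 - q t * (w - w').1) := by
      refine Prod.ext rfl ?_
      change 3 / (t : ℂ) * w.2 - q t * w.1 - (3 / (t : ℂ) * w'.2 - q t * w'.1)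
        = 3 / (t : ℂ) * (w.2 - w'.2) - q t * (w.1 - w'.1)
      ring
    have hn1 := norm_fst_le (w - w')
    have hn2 := norm_snd_le (w - w')
    have hn := norm_nonneg (w - w')
    rw [h3, Prod.norm_mk]
    refine max_le ?_ ((norm_sub_le _ _).trans ?_)
    · nlinarith
    · rw [norm_mul, norm_mul]
      have e1 := mul_le_mul hP' hn2 (norm_nonneg _) hP0
      have e2 := mul_le_mul hQ' hn1 (norm_nonneg _) hQ0
      nlinarith
  have hf : ∀ t ∈ Ioo a b, HasDerivAt (fun t => (W t, W' t)) (v t (W t, W' t)) t ∧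
      (W t, W' t) ∈ (univ : Set (ℂ × ℂ)) := by
    intro t ht
    have ht0 : 0 < t := ha.trans ht.1
    refine ⟨((hW.deriv₁ t ht0).prodMk (hW.deriv₂ t ht0)).congr_deriv ?_, mem_univ _⟩
    have ht1 : (t : ℂ) ≠ 0 := by exact_mod_cast ht0.ne'
    refine Prod.ext rfl ?_
    change W'' t = 3 / (t : ℂ) * W' t - (4 - s ^ 2 - κ ^ 2 * t ^ 2) / (t : ℂ) ^ 2 * W t
    field_simp
    linear_combination hW.eqn t ht0
  have hg : ∀ t ∈ Ioo a b, HasDerivAt (fun _ : ℝ => ((0, 0) : ℂ × ℂ)) (v t (0, 0)) t ∧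
      ((0, 0) : ℂ × ℂ) ∈ (univ : Set (ℂ × ℂ)) := by
    intro t _
    refine ⟨(hasDerivAt_const t _).congr_deriv ?_, mem_univ _⟩
    simp [v]
    rfl
  have := ODE_solution_unique_of_mem_Ioo hv (hmem y₀ (min_le_left _ _) (le_max_left _ _)) hf hg
    (by simp [h0, h1]) (hmem y (min_le_right _ _) (le_max_right _ _))
  exact congrArg Prod.fst this

/-- The solutions of moderate growth are the multiples of `y² K_s(κ y)`: their Wronskian with this
function is a constant multiple of `y³`, and the constant is zero because `K_s` decays. -/
theorem IsRadialSolution.exists_eq_bessel {s : ℂ} {κ : ℝ} (hκ : 0 < κ) {W W' W'' : ℝ → ℂ}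
    (hW : IsRadialSolution s κ W W' W'') {C : ℝ} {N : ℕ} (hC : ∀ y, 1 ≤ y → ‖W y‖ ≤ C * y ^ N) :
    ∃ a : ℂ, ∀ y : ℝ, 0 < y → W y = a * (y : ℂ) ^ 2 * besselK s (κ * y) := by
  have hB := isRadialSolution_bessel s hκ
  set B := radialBessel s κ with hBdef
  set B' := radialBesselDeriv s κ with hB'def
  set B'' : ℝ → ℂ := fun y => 2 * besselMoment s 0 (κ * y) - 4 * κ * y * besselMoment s 1 (κ * y)
        + κ ^ 2 * y ^ 2 * besselMoment s 2 (κ * y)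
  -- The Wronskian divided by `y³` is constant.
  set w : ℝ → ℂ := fun y => (W y * B' y - W' y * B y) with hw
  have hwd : ∀ y : ℝ, 0 < y → HasDerivAt w (3 / (y : ℂ) * w y) y := by
    intro y hy
    have hy' : (y : ℂ) ≠ 0 := by exact_mod_cast hy.ne'
    refine (((hW.deriv₁ y hy).mul (hB.deriv₂ y hy)).sub
      ((hW.deriv₂ y hy).mul (hB.deriv₁ y hy))).congr_deriv ?_
    have e1 := hW.eqn y hy
    have e2 := hB.eqn y hy
    have e3 : (y : ℂ) ^ 2 * (3 / (y : ℂ) * w y) = 3 * y * w y := by field_simp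
    apply mul_left_cancel₀ (pow_ne_zero 2 hy')
    rw [e3]
    simp only [hw]
    linear_combination W y * e2 - B y * e1
  have hconst : ∀ y : ℝ, 0 < y → w y = w 1 * (y : ℂ) ^ 3 := by
    have hd : ∀ y ∈ Ioi (0 : ℝ), HasDerivWithinAt (fun y => w y / (y : ℂ) ^ 3) 0 (Ioi 0) y := by
      intro y hy
      have hy' : (y : ℂ) ≠ 0 := by exact_mod_cast (ne_of_gt hy)
      have h3 := ((hasDerivAt_id y).ofReal_comp).pow 3
      refine (((hwd y hy).div h3 (pow_ne_zero _ hy')).congr_deriv ?_).hasDerivWithinAt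
      simp only [Pi.pow_apply, id_eq, Nat.cast_ofNat, ofReal_one, mul_one]
      field_simp
      ring
    intro y hy
    have hy' : (y : ℂ) ≠ 0 := by exact_mod_cast hy.ne'
    have := (convex_Ioi (0 : ℝ)).norm_image_sub_le_of_norm_hasDerivWithin_le hd
      (fun _ _ => norm_zero.le) (mem_Ioi.2 one_pos) hy
    rw [zero_mul, norm_le_zero_iff, sub_eq_zero, ofReal_one, one_pow, div_one] at this
    rw [← this]
    field_simp
  have hw1 : w 1 = 0 := by
    obtain ⟨C0, hC0, hm0⟩ := norm_besselMoment_le s 0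
    obtain ⟨C1, hC1, hm1⟩ := norm_besselMoment_le s 1
    have hC' : 0 ≤ C := by simpa using (norm_nonneg _).trans (hC 1 le_rfl)
    -- Both `B` and its derivative are `O(y² e^{-κ y})`.
    have hsmall : ∀ (V : ℝ → ℂ) (K : ℝ), (∀ y : ℝ, 1 ≤ y → 1 ≤ κ * y →
        ‖V y‖ ≤ K * (y ^ 2 * Real.exp (-(κ * y)))) → ∀ ε > 0, ∀ᶠ y in atTop, ‖W y * V y‖ ≤ ε := by
      intro V K hV ε hε
      have h2 := ((tendsto_pow_mul_exp_neg_atTop_nhds_zero (N + 2)).comp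
        (tendsto_id.const_mul_atTop hκ)).const_mul (C * K / κ ^ (N + 2))
      rw [mul_zero] at h2
      filter_upwards [h2.eventually_lt_const hε, eventually_ge_atTop (max 1 (1 / κ))] with y h hy
      have hy1 := (le_max_left _ _).trans hy
      have hy2 := (le_max_right _ _).trans hy
      rw [div_le_iff₀' hκ] at hy2
      rw [norm_mul]
      refine (mul_le_mul (hC y hy1) (hV y hy1 hy2) (norm_nonneg _) (by positivity)).trans
        (le_of_eq_of_le ?_ h.le)
      simp only [Function.comp_apply, id_eq]
      rw [mul_pow]
      field_simp
      ring
    have hWB := hsmall B C0 fun y hy hy' => by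
      rw [hBdef, radialBessel, norm_mul, norm_pow, norm_real, norm_of_nonneg (by linarith)]
      have := hm0 _ hy'
      calc _ ≤ y ^ 2 * (C0 * Real.exp (-(κ * y))) := by gcongr
        _ = _ := by ring
    have hWB' := hsmall B' (2 * C0 + κ * C1) fun y hy hy' => by
      rw [hB'def, radialBesselDeriv]
      refine (norm_sub_le _ _).trans ?_
      simp only [norm_mul, norm_pow, norm_real, norm_ofNat]
      rw [norm_of_nonneg hκ.le, norm_of_nonneg (show 0 ≤ y by linarith)]
      have h0 := hm0 _ hy'
      have h1 := hm1 _ hy'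
      have hyy : y ≤ y ^ 2 := by nlinarith
      calc _ ≤ 2 * y ^ 2 * (C0 * Real.exp (-(κ * y))) + κ * y ^ 2 * (C1 * Real.exp (-(κ * y))) := by
            gcongr
        _ = _ := by ring
    by_contra hne
    have hε : 0 < ‖w 1‖ / 5 := by positivity
    obtain ⟨Y, hY⟩ := eventually_atTop.1 ((hWB _ hε).and (hWB' _ hε))
    set y := max Y 1
    have hy1 : 1 ≤ y := le_max_right _ _
    have hYy : Y ≤ y := le_max_left _ _
    -- The derivative of `W B + w(1) y⁴ / 4` is `2 W B'`.
    have hd : ∀ x ∈ Ici y, HasDerivWithinAt (fun x => W x * B x + w 1 * ((x : ℂ) ^ 4 / 4))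
        (2 * (W x * B' x)) (Ici y) x := fun x hx => by
      have hx0 : 0 < x := one_pos.trans_le (hy1.trans hx)
      refine ((((hW.deriv₁ x hx0).mul (hB.deriv₁ x hx0)).add
        ((((hasDerivAt_id x).ofReal_comp.pow 4).div_const 4).const_mul (w 1))).congr_deriv
          ?_).hasDerivWithinAt
      have := hconst x hx0
      simp only [hw] at this ⊢
      simp
      linear_combination -this
    have hmv := (convex_Ici y).norm_image_sub_le_of_norm_hasDerivWithin_le hd (fun x hx => by
      rw [norm_mul, norm_ofNat]
      exact mul_le_mul_of_nonneg_left (hY x (hYy.trans hx)).2 two_pos.le) self_mem_Ici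
      (show y + 1 ∈ Ici y by simp)
    have e : w 1 * (((y + 1) ^ 4 - y ^ 4) / 4 : ℝ) = (W (y + 1) * B (y + 1) + w 1 *
        (((y + 1 : ℝ) : ℂ) ^ 4 / 4) - (W y * B y + w 1 * ((y : ℂ) ^ 4 / 4)))
          - (W (y + 1) * B (y + 1) - W y * B y) := by push_cast; ring
    have h1 : (1 : ℝ) ≤ ‖(((y + 1) ^ 4 - y ^ 4) / 4 : ℝ)‖ := by
      refine le_trans ?_ (le_abs_self _)
      have : 1 ≤ y ^ 3 := one_le_pow₀ hy1
      nlinarith [sq_nonneg y]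
    have h2 := mul_le_mul_of_nonneg_left h1 (norm_nonneg (w 1))
    rw [mul_one, ← norm_real, ← norm_mul, e] at h2
    have h3 := h2.trans ((norm_sub_le _ _).trans (add_le_add hmv (norm_sub_le _ _)))
    have h4 := (hY y hYy).1
    have h5 := (hY (y + 1) (by linarith)).1
    rw [add_sub_cancel_left, norm_one] at h3
    linarith [norm_pos_iff.2 hne]
  obtain ⟨z, hz, hKz⟩ := exists_besselK_ne_zero s
  have hy₀ : 0 < z / κ := div_pos hz hκ
  have hB0 : B (z / κ) ≠ 0 := by
    rw [hBdef, radialBessel, mul_div_cancel₀ _ hκ.ne', ← besselK_eq]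
    exact mul_ne_zero (pow_ne_zero _ (by exact_mod_cast hy₀.ne')) hKz
  set a := W (z / κ) / B (z / κ)
  have h0 : W (z / κ) - a * B (z / κ) = 0 := by
    simp only [a]
    field_simp
    ring
  have h1 : W' (z / κ) - a * B' (z / κ) = 0 := by
    have h2 : w (z / κ) = 0 := by rw [hconst _ hy₀, hw1, zero_mul]
    simp only [hw] at h2
    apply mul_left_cancel₀ hB0
    rw [mul_zero]
    linear_combination -h2 + B' (z / κ) * h0
  refine ⟨a, fun y hy => ?_⟩
  have := (hW.sub hB a).eq_zero hy₀ h0 h1 hy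
  rw [sub_eq_zero] at this
  rw [this, hBdef, radialBessel, ← besselK_eq, mul_assoc]

end RadialEquation

/-! ### Fourier analysis on `ℍ / 𝒪` -/

section FourierAnalysis
open Quaternion MeasureTheory Set Filter Topology

theorem mem_hurwitz_iff {R : Type} [Field R] [NeZero (2 : R)] {Z : Subring R} {x : ℍ[R]} :
    x ∈ hurwitz Z ↔ x.re - x.imK ∈ Z ∧ x.imI - x.imK ∈ Z ∧ x.imJ - x.imK ∈ Z ∧ 2 * x.imK ∈ Z := by
  have h2 : (2 : R) ≠ 0 := NeZero.ne 2
  constructor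
  · rintro ⟨a, b, c, d, h1, h3, h4, h5⟩
    rw [h1, h3, h4, h5]
    refine ⟨?_, ?_, ?_, ?_⟩
    · simp
    · simp
    · simp
    · rw [mul_div_cancel₀ _ h2]; exact d.2
  · rintro ⟨h1, h3, h4, h5⟩
    refine ⟨⟨_, h1⟩, ⟨_, h3⟩, ⟨_, h4⟩, ⟨_, h5⟩, ?_, ?_, ?_, ?_⟩ <;> simp only <;> field_simp <;> ring

theorem mem_intRange {a : ℚ} : a ∈ (Int.castRingHom ℚ).range ↔ ∃ n : ℤ, a = n := by
  constructor
  · rintro ⟨n, rfl⟩; exact ⟨n, rfl⟩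
  · rintro ⟨n, rfl⟩; exact ⟨n, rfl⟩

theorem re_mul_comm {R : Type} [CommRing R] (x y : ℍ[R]) : (x * y).re = (y * x).re := by
  simp only [re_mul]
  ring

theorem quatMap_re {R S : Type} [CommRing R] [CommRing S] (f : R →+* S) (x : ℍ[R]) :
    (quatMap f x).re = f x.re := rfl

theorem quatMap_eq_zero {R S : Type} [Field R] [Field S] (f : R →+* S) {x : ℍ[R]} :
    quatMap f x = 0 ↔ x = 0 := by
  refine ⟨fun h => ?_, fun h => by rw [h, map_zero]⟩
  have h1 := congrArg (fun y : ℍ[S] => y.re) h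
  have h2 := congrArg (fun y : ℍ[S] => y.imI) h
  have h3 := congrArg (fun y : ℍ[S] => y.imJ) h
  have h4 := congrArg (fun y : ℍ[S] => y.imK) h
  exact Quaternion.ext _ _ ((map_eq_zero f).1 h1) ((map_eq_zero f).1 h2) ((map_eq_zero f).1 h3)
    ((map_eq_zero f).1 h4)

/-- The coordinates of a quaternion in the basis of `𝒪`. -/
def latticeInv (x : ℍ[ℝ]) : Fin 4 → ℝ := ![x.re - x.imK, x.imI - x.imK, x.imJ - x.imK, 2 * x.imK]

theorem latticeCoord_latticeInv (x : ℍ[ℝ]) : latticeCoord (latticeInv x) = x := by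
  apply Quaternion.ext <;> simp [latticeCoord, latticeInv]

theorem latticeCoord_eq (t : Fin 4 → ℝ) : latticeCoord t = t 0 • quat 1 0 0 0 + t 1 • quat 0 1 0 0
    + t 2 • quat 0 0 1 0 + t 3 • quat (1 / 2) (1 / 2) (1 / 2) (1 / 2) := by
  apply Quaternion.ext <;> simp [latticeCoord] <;> ring

theorem continuous_latticeCoord : Continuous latticeCoord := by
  simp only [funext latticeCoord_eq]
  fun_prop

theorem latticeCoord_add (t t' : Fin 4 → ℝ) :
    latticeCoord (t + t') = latticeCoord t + latticeCoord t' := by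
  simp only [latticeCoord_eq, Pi.add_apply, add_smul]
  abel

theorem mem_order_iff {x : ℍ[ℚ]} :
    x ∈ order ↔ ∃ n : Fin 4 → ℤ, toQuatReal x = latticeCoord fun i => n i := by
  rw [order, mem_hurwitz_iff]
  simp only [mem_intRange]
  constructor
  · rintro ⟨⟨a, ha⟩, ⟨b, hb⟩, ⟨c, hc⟩, ⟨d, hd⟩⟩
    refine ⟨![a, b, c, d], ?_⟩
    have e1 : x.re = a + d / 2 := by linarith
    have e2 : x.imI = b + d / 2 := by linarith
    have e3 : x.imJ = c + d / 2 := by linarith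
    have e4 : x.imK = d / 2 := by linarith
    apply Quaternion.ext <;> simp [toQuatReal, quatMap, latticeCoord, e1, e2, e3, e4]
  · rintro ⟨n, hn⟩
    have h1 := congrArg (fun y : ℍ[ℝ] => y.re) hn
    have h2 := congrArg (fun y : ℍ[ℝ] => y.imI) hn
    have h3 := congrArg (fun y : ℍ[ℝ] => y.imJ) hn
    have h4 := congrArg (fun y : ℍ[ℝ] => y.imK) hn
    simp only [toQuatReal, quatMap, latticeCoord, RingHom.coe_mk, MonoidHom.coe_mk, OneHom.coe_mk,
      quat_re, quat_imI, quat_imJ, quat_imK, eq_ratCast] at h1 h2 h3 h4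
    refine ⟨⟨n 0, ?_⟩, ⟨n 1, ?_⟩, ⟨n 2, ?_⟩, ⟨n 3, ?_⟩⟩ <;> (rify; linarith)

/-- The additive character `x ↦ e^{2π√-1 Re(βx)}` of `ℍ`. -/
def char (β : ℍ[ℚ]) (x : ℍ[ℝ]) : ℂ := Complex.exp (2 * Real.pi * Complex.I * ((toQuatReal β * x).re : ℝ))

theorem continuous_char (β : ℍ[ℚ]) : Continuous (char β) := by
  unfold char
  have : Continuous fun x : ℍ[ℝ] => (toQuatReal β * x).re :=
    continuous_re.comp (continuous_const.mul continuous_id)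
  fun_prop

theorem char_add (β : ℍ[ℚ]) (x y : ℍ[ℝ]) : char β (x + y) = char β x * char β y := by
  rw [char, char, char, ← Complex.exp_add, mul_add, re_add]
  push_cast
  ring_nf

theorem char_zero (x : ℍ[ℝ]) : char 0 x = 1 := by simp [char]

theorem char_neg (β : ℍ[ℚ]) (x : ℍ[ℝ]) : char (-β) x
    = Complex.exp (-2 * Real.pi * Complex.I * ((toQuatReal β * x).re : ℝ)) := by
  rw [char, map_neg, neg_mul, re_neg]
  push_cast
  ring_nf

theorem char_mul_char_neg (β : ℍ[ℚ]) (x : ℍ[ℝ]) : char β x * char (-β) x = 1 := by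
  rw [char_neg, char, ← Complex.exp_add]
  ring_nf
  exact Complex.exp_zero

theorem char_conj (β : ℍ[ℚ]) (x y : ℍ[ℝ]) (u v : ℍ[ℚ]) :
    char β (toQuatReal u * x * toQuatReal v + y) = char (v * β * u) x * char β y := by
  rw [char_add]
  congr 1
  have h : (toQuatReal β * (toQuatReal u * x * toQuatReal v)).re
      = (toQuatReal v * toQuatReal β * toQuatReal u * x).re := by
    rw [← mul_assoc, re_mul_comm]
    simp only [mul_assoc]
  rw [char, char, map_mul, map_mul, h]

theorem norm_char (β : ℍ[ℚ]) (x : ℍ[ℝ]) : ‖char β x‖ = 1 := by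
  rw [char, show (2 * Real.pi * Complex.I * ((toQuatReal β * x).re : ℝ) : ℂ)
    = ((2 * Real.pi * (toQuatReal β * x).re : ℝ) : ℂ) * Complex.I by push_cast; ring]
  exact Complex.norm_exp_ofReal_mul_I _

theorem char_order {β : ℍ[ℚ]} (hβ : β ∈ dualLattice) {o : ℍ[ℚ]} (ho : o ∈ order) :
    char β (toQuatReal o) = 1 := by
  obtain ⟨m, hm⟩ := hβ o ho
  rw [char, ← map_mul, toQuatReal, quatMap_re, hm, Complex.exp_eq_one_iff]
  refine ⟨m, ?_⟩
  simp only [eq_ratCast, Rat.cast_intCast, Complex.ofReal_intCast]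
  ring

/-- `f` is a function on `ℍ / 𝒪`. -/
def IsPeriodic (f : ℍ[ℝ] → ℂ) : Prop := ∀ o ∈ order, ∀ x, f (x + toQuatReal o) = f x

/-- The mean value of a function on `ℍ / 𝒪`. -/
def cubeMean (f : ℍ[ℝ] → ℂ) : ℂ := ∫ t in Icc (0 : Fin 4 → ℝ) 1, f (latticeCoord t)

theorem fourierIntegral_eq (F : GReal → ℂ) (β : ℍ[ℚ]) (g : GReal) :
    fourierIntegral F β g = cubeMean fun x => F (nUnip x * g) * char (-β) x := by
  simp only [fourierIntegral, cubeMean, char_neg]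

theorem isPeriodic_char {β : ℍ[ℚ]} (hβ : β ∈ dualLattice) : IsPeriodic (char β) := fun o ho x => by
  rw [char_add, char_order hβ ho, mul_one]

theorem integrableOn_cube {f : ℍ[ℝ] → ℂ} (hf : Continuous f) :
    IntegrableOn (fun t => f (latticeCoord t)) (Icc (0 : Fin 4 → ℝ) 1) :=
  (hf.comp continuous_latticeCoord).continuousOn.integrableOn_compact isCompact_Icc

theorem cubeMean_add {f g : ℍ[ℝ] → ℂ} (hf : Continuous f) (hg : Continuous g) :
    cubeMean (fun x => f x + g x) = cubeMean f + cubeMean g :=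
  integral_add (integrableOn_cube hf) (integrableOn_cube hg)

theorem cubeMean_sub {f g : ℍ[ℝ] → ℂ} (hf : Continuous f) (hg : Continuous g) :
    cubeMean (fun x => f x - g x) = cubeMean f - cubeMean g :=
  integral_sub (integrableOn_cube hf) (integrableOn_cube hg)

theorem cubeMean_const_mul (c : ℂ) (f : ℍ[ℝ] → ℂ) :
    cubeMean (fun x => c * f x) = c * cubeMean f := integral_const_mul _ _

theorem cubeMean_sum {ι : Type} (s : Finset ι) {f : ι → ℍ[ℝ] → ℂ} (hf : ∀ i ∈ s, Continuous (f i)) :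
    cubeMean (fun x => ∑ i ∈ s, f i x) = ∑ i ∈ s, cubeMean (f i) :=
  integral_finsetSum _ fun i hi => integrableOn_cube (hf i hi)

theorem volume_cube : volume (Icc (0 : Fin 4 → ℝ) 1) = 1 := by
  rw [Real.volume_Icc_pi]
  simp

theorem norm_cubeMean_le {f : ℍ[ℝ] → ℂ} {C : ℝ}
    (h : ∀ t ∈ Icc (0 : Fin 4 → ℝ) 1, ‖f (latticeCoord t)‖ ≤ C) : ‖cubeMean f‖ ≤ C := by
  have := norm_setIntegral_le_of_norm_le_const (μ := volume) (s := Icc (0 : Fin 4 → ℝ) 1)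
    (by rw [volume_cube]; exact ENNReal.one_lt_top) h
  simpa [measureReal_def, volume_cube, cubeMean] using this

theorem exists_dual_coord (n : Fin 4 → ℤ) : ∃ β ∈ dualLattice, (β = 0 → n = 0) ∧
    ∀ t, (toQuatReal β * latticeCoord t).re = ∑ i, n i * t i := by
  have h : ∀ t, (toQuatReal (quat (n 0 : ℚ) (-n 1) (-n 2) (n 0 + n 1 + n 2 - 2 * n 3))
      * latticeCoord t).re = ∑ i, n i * t i := fun t => by
    rw [re_mul, Fin.sum_univ_four]
    simp only [toQuatReal, quatMap, latticeCoord, RingHom.coe_mk, MonoidHom.coe_mk, OneHom.coe_mk,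
      quat_re, quat_imI, quat_imJ, quat_imK, eq_ratCast]
    push_cast
    ring
  refine ⟨_, fun x hx => ?_, fun h0 => ?_, h⟩
  · obtain ⟨m, hm⟩ := mem_order_iff.1 hx
    refine ⟨∑ i, n i * m i, ?_⟩
    have h1 := h fun i => m i
    rw [← hm, ← map_mul, toQuatReal, quatMap_re, eq_ratCast] at h1
    rify
    exact_mod_cast h1
  · have h1 := congrArg (fun y : ℍ[ℚ] => y.re) h0
    have h2 := congrArg (fun y : ℍ[ℚ] => y.imI) h0
    have h3 := congrArg (fun y : ℍ[ℚ] => y.imJ) h0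
    have h4 := congrArg (fun y : ℍ[ℚ] => y.imK) h0
    simp only [quat_re, quat_imI, quat_imJ, quat_imK, re_zero, imI_zero,
      imJ_zero, imK_zero] at h1 h2 h3 h4
    have k1 : n 0 = 0 := by exact_mod_cast h1
    have k2 : n 1 = 0 := by exact_mod_cast neg_eq_zero.1 h2
    have k3 : n 2 = 0 := by exact_mod_cast neg_eq_zero.1 h3
    have k4 : n 3 = 0 := by
      rw [k1, k2, k3] at h4
      norm_num at h4
      exact h4
    funext i
    fin_cases i <;> assumption

theorem exists_coord_of_dual {β : ℍ[ℚ]} (hβ : β ∈ dualLattice) : ∃ n : Fin 4 → ℤ,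
    (n = 0 → β = 0) ∧ ∀ t, (toQuatReal β * latticeCoord t).re = ∑ i, n i * t i := by
  have hmem : ∀ m : Fin 4 → ℤ, (quat (m 0 + m 3 / 2 : ℚ) (m 1 + m 3 / 2) (m 2 + m 3 / 2) (m 3 / 2))
      ∈ order := fun m => by
    refine mem_order_iff.2 ⟨m, ?_⟩
    apply Quaternion.ext <;> simp [toQuatReal, quatMap, latticeCoord]
  obtain ⟨a, ha⟩ := hβ _ (hmem ![1, 0, 0, 0])
  obtain ⟨b, hb⟩ := hβ _ (hmem ![0, 1, 0, 0])
  obtain ⟨c, hc⟩ := hβ _ (hmem ![0, 0, 1, 0])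
  obtain ⟨d, hd⟩ := hβ _ (hmem ![0, 0, 0, 1])
  simp [re_mul] at ha hb hc hd
  refine ⟨![a, b, c, d], fun h => ?_, fun t => ?_⟩
  · have h0 : a = 0 := congrFun h 0
    have h1 : b = 0 := congrFun h 1
    have h2 : c = 0 := congrFun h 2
    have h3 : d = 0 := congrFun h 3
    rw [h0, Int.cast_zero] at ha
    rw [h1, Int.cast_zero, neg_eq_zero] at hb
    rw [h2, Int.cast_zero, neg_eq_zero] at hc
    rw [h3, Int.cast_zero, ha, hb, hc] at hd
    refine Quaternion.ext _ _ ha hb hc ?_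
    rw [imK_zero]
    linarith
  · rw [re_mul, Fin.sum_univ_four]
    simp only [toQuatReal, quatMap, latticeCoord, RingHom.coe_mk, MonoidHom.coe_mk, OneHom.coe_mk,
      quat_re, quat_imI, quat_imJ, quat_imK, eq_ratCast, Matrix.cons_val]
    have ha' : (β.re : ℝ) = a := by exact_mod_cast ha
    have hb' : (-β.imI : ℝ) = b := by exact_mod_cast hb
    have hc' : (-β.imJ : ℝ) = c := by exact_mod_cast hc
    have hd' : (β.re * 2⁻¹ - β.imI * 2⁻¹ - β.imJ * 2⁻¹ - β.imK * 2⁻¹ : ℝ) = d := by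
      rw [← Rat.cast_intCast d, ← hd]
      push_cast
      ring
    rw [← ha', ← hb', ← hc', ← hd']
    ring

theorem integral_exp_int (n : ℤ) : ∫ x in Icc (0 : ℝ) 1, Complex.exp (2 * Real.pi * Complex.I * n * x)
    = if n = 0 then 1 else 0 := by
  rw [integral_Icc_eq_integral_Ioc, ← intervalIntegral.integral_of_le zero_le_one]
  split_ifs with h
  · simp [h]
  · have h0 : (2 * Real.pi * Complex.I * n : ℂ) ≠ 0 := by
      simp [Real.pi_ne_zero, h]
    rw [integral_exp_mul_complex h0]
    have : Complex.exp (2 * Real.pi * Complex.I * n * (1 : ℝ)) = 1 :=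
      Complex.exp_eq_one_iff.2 ⟨n, by push_cast; ring⟩
    rw [this]
    simp

theorem cubeMean_char {β : ℍ[ℚ]} (hβ : β ∈ dualLattice) (h : β ≠ 0) : cubeMean (char β) = 0 := by
  obtain ⟨n, hn0, hn⟩ := exists_coord_of_dual hβ
  have h1 : ∃ i, n i ≠ 0 := by
    by_contra! h'
    exact h (hn0 (funext h'))
  obtain ⟨i, hi⟩ := h1
  have h2 : ∀ t, char β (latticeCoord t)
      = ∏ i, Complex.exp (2 * Real.pi * Complex.I * n i * t i) := fun t => by
    rw [char, hn, ← Complex.exp_sum]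
    push_cast
    rw [Finset.mul_sum]
    simp only [mul_assoc]
  rw [cubeMean]
  simp only [h2]
  rw [← Set.pi_univ_Icc, volume_pi, Measure.restrict_pi_pi]
  simp only [Pi.zero_apply, Pi.one_apply]
  rw [integral_fintype_prod_eq_prod (fun i (x : ℝ) =>
    Complex.exp (2 * Real.pi * Complex.I * n i * x)) (μ := fun _ => volume.restrict (Icc 0 1))]
  refine Finset.prod_eq_zero (Finset.mem_univ i) ?_
  rw [integral_exp_int, if_neg hi]

/-- Continuous functions on `ℍ / 𝒪` are uniform limits of trigonometric polynomials. -/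
theorem exists_trigPolynomial {f : ℍ[ℝ] → ℂ} (hf : Continuous f) (hp : IsPeriodic f) {ε : ℝ}
    (hε : 0 < ε) : ∃ P ∈ Submodule.span ℂ (char '' dualLattice), ∀ x, ‖f x - P x‖ ≤ ε := by
  set π : (Fin 4 → ℝ) → UnitAddTorus (Fin 4) := Pi.map fun _ (x : ℝ) => (x : UnitAddCircle) with hπ
  have hq : IsOpenQuotientMap π := IsOpenQuotientMap.piMap fun _ =>
    QuotientAddGroup.isOpenQuotientMap_mk
  have hper : ∀ t t' : Fin 4 → ℝ, π t = π t' → f (latticeCoord t) = f (latticeCoord t') := by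
    intro t t' h
    have h1 : ∀ i, ∃ m : ℤ, t i = t' i + m := fun i => by
      have := QuotientAddGroup.eq.1 (congrFun h i)
      obtain ⟨m, hm⟩ := AddSubgroup.mem_zmultiples_iff.1 this
      refine ⟨-m, ?_⟩
      push_cast
      simp only [zsmul_eq_mul, mul_one] at hm
      linarith
    choose m hm using h1
    have h2 : t = t' + fun i => (m i : ℝ) := funext hm
    have h3 : (quat (m 0 + m 3 / 2 : ℚ) (m 1 + m 3 / 2) (m 2 + m 3 / 2) (m 3 / 2)) ∈ order := by
      refine mem_order_iff.2 ⟨m, ?_⟩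
      apply Quaternion.ext <;> simp [toQuatReal, quatMap, latticeCoord]
    have h4 : toQuatReal (quat (m 0 + m 3 / 2 : ℚ) (m 1 + m 3 / 2) (m 2 + m 3 / 2) (m 3 / 2))
        = latticeCoord fun i => m i := by
      apply Quaternion.ext <;> simp [toQuatReal, quatMap, latticeCoord]
    rw [h2, latticeCoord_add, ← h4, hp _ h3]
  let s := Function.surjInv hq.surjective
  have hs : ∀ x, π (s x) = x := Function.surjInv_eq hq.surjective
  let g : C(UnitAddTorus (Fin 4), ℂ) := ⟨fun x => f (latticeCoord (s x)), by
    refine hq.isQuotientMap.continuous_iff.2 ?_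
    have : (fun x => f (latticeCoord (s x))) ∘ π = fun t => f (latticeCoord t) :=
      funext fun t => hper _ _ (hs _)
    rw [this]
    exact hf.comp continuous_latticeCoord⟩
  have hg : g ∈ (Submodule.span ℂ (range (UnitAddTorus.mFourier (d := Fin 4)))).topologicalClosure := by
    rw [UnitAddTorus.span_mFourier_closure_eq_top]
    exact Submodule.mem_top
  obtain ⟨P, hP, hPg⟩ := Metric.mem_closure_iff.1 hg ε hε
  have key : ∀ P ∈ Submodule.span ℂ (range (UnitAddTorus.mFourier (d := Fin 4))),
      (fun x => P (π (latticeInv x))) ∈ Submodule.span ℂ (char '' dualLattice) := by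
    intro P hP
    induction hP using Submodule.span_induction with
    | mem P hP =>
      obtain ⟨n, rfl⟩ := hP
      obtain ⟨β, hβ, -, h⟩ := exists_dual_coord n
      refine Submodule.subset_span ⟨β, hβ, funext fun x => ?_⟩
      rw [char]
      nth_rewrite 1 [← latticeCoord_latticeInv x]
      rw [h, UnitAddTorus.mFourier]
      simp only [ContinuousMap.coe_mk, hπ, Pi.map_apply, fourier_coe_apply]
      rw [← Complex.exp_sum]
      push_cast
      rw [Finset.mul_sum]
      congr 1
      refine Finset.sum_congr rfl fun i _ => ?_
      ring
    | zero => exact Submodule.zero_mem _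
    | add P Q _ _ hP hQ => exact Submodule.add_mem _ hP hQ
    | smul c P _ hP => exact Submodule.smul_mem _ c hP
  refine ⟨_, key P hP, fun x => ?_⟩
  have h1 : f x = g (π (latticeInv x)) := by
    change f x = f (latticeCoord (s (π (latticeInv x))))
    rw [hper _ _ (hs _), latticeCoord_latticeInv]
  rw [h1, ← dist_eq_norm]
  exact (ContinuousMap.dist_apply_le_dist _).trans hPg.le

theorem continuous_of_mem_span {P : ℍ[ℝ] → ℂ} (hP : P ∈ Submodule.span ℂ (char '' dualLattice)) :
    Continuous P := by
  induction hP using Submodule.span_induction with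
  | mem P hP =>
    obtain ⟨β, _, rfl⟩ := hP
    exact continuous_char β
  | zero => exact continuous_const
  | add P Q _ _ hP hQ => exact hP.add hQ
  | smul c P _ hP => exact hP.const_smul c

/-- Invariance of the mean under endomorphisms of `ℍ / 𝒪` followed by translations. -/
theorem cubeMean_comp {f : ℍ[ℝ] → ℂ} (hf : Continuous f) (hp : IsPeriodic f) {u v : ℍ[ℚ]}
    (hu : u ≠ 0) (hv : v ≠ 0) (huv : ∀ o ∈ order, u * o * v ∈ order) (w : ℍ[ℝ]) :
    cubeMean (fun x => f (toQuatReal u * x * toQuatReal v + w)) = cubeMean f := by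
  have hc : Continuous fun x : ℍ[ℝ] => toQuatReal u * x * toQuatReal v + w := by fun_prop
  have hspan : ∀ P ∈ Submodule.span ℂ (char '' dualLattice),
      cubeMean (fun x => P (toQuatReal u * x * toQuatReal v + w)) = cubeMean P := by
    intro P hP
    induction hP using Submodule.span_induction with
    | mem P hP =>
      obtain ⟨β, hβ, rfl⟩ := hP
      have hβ' : v * β * u ∈ dualLattice := fun x hx => by
        obtain ⟨m, hm⟩ := hβ _ (huv x hx)
        refine ⟨m, ?_⟩
        rw [← hm, mul_assoc v, mul_assoc v, re_mul_comm]
        simp only [mul_assoc]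
      simp only [char_conj]
      rw [show (fun x => char (v * β * u) x * char β w) = fun x => char β w * char (v * β * u) x from
        funext fun x => mul_comm _ _, cubeMean_const_mul]
      by_cases h : β = 0
      · simp [h, char_zero]
      · rw [cubeMean_char hβ' (mul_ne_zero (mul_ne_zero hv h) hu), cubeMean_char hβ h, mul_zero]
    | zero => rfl
    | add P Q hP' hQ' hP hQ =>
      have h1 := cubeMean_add ((continuous_of_mem_span hP').comp hc)
        ((continuous_of_mem_span hQ').comp hc)
      have h2 := cubeMean_add (continuous_of_mem_span hP') (continuous_of_mem_span hQ')
      exact h1.trans ((congrArg₂ (· + ·) hP hQ).trans h2.symm)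
    | smul c P _ hP =>
      have h1 := cubeMean_const_mul c fun x => P (toQuatReal u * x * toQuatReal v + w)
      have h2 := cubeMean_const_mul c P
      exact h1.trans ((congrArg (c * ·) hP).trans h2.symm)
  refine eq_of_forall_dist_le fun ε hε => ?_
  obtain ⟨P, hP, hfP⟩ := exists_trigPolynomial hf hp (half_pos hε)
  have hPc := continuous_of_mem_span hP
  have e1 : ‖cubeMean (fun x => f (toQuatReal u * x * toQuatReal v + w))
      - cubeMean (fun x => P (toQuatReal u * x * toQuatReal v + w))‖ ≤ ε / 2 := by
    have := cubeMean_sub (hf.comp hc) (hPc.comp hc)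
    simp only [Function.comp_def] at this
    rw [← this]
    exact norm_cubeMean_le fun t _ => hfP _
  have e2 : ‖cubeMean f - cubeMean P‖ ≤ ε / 2 := by
    rw [← cubeMean_sub hf hPc]
    exact norm_cubeMean_le fun t _ => hfP _
  rw [hspan P hP] at e1
  rw [dist_eq_norm]
  calc _ = ‖(cubeMean (fun x => f (toQuatReal u * x * toQuatReal v + w)) - cubeMean P)
        - (cubeMean f - cubeMean P)‖ := by congr 1; ring
    _ ≤ _ := norm_sub_le _ _
    _ ≤ ε := by linarith

theorem cubeMean_translate {f : ℍ[ℝ] → ℂ} (hf : Continuous f) (hp : IsPeriodic f) (w : ℍ[ℝ]) :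
    cubeMean (fun x => f (x + w)) = cubeMean f := by
  simpa using cubeMean_comp hf hp (one_ne_zero) (one_ne_zero) (fun o ho => by simpa using ho) w

theorem neg_mem_dualLattice {β : ℍ[ℚ]} (hβ : β ∈ dualLattice) : -β ∈ dualLattice := fun x hx => by
  obtain ⟨m, hm⟩ := hβ x hx
  exact ⟨-m, by rw [neg_mul, re_neg, hm, Int.cast_neg]⟩

/-- A continuous function on `ℍ / 𝒪` whose Fourier coefficients vanish is zero. -/
theorem eq_zero_of_cubeMean {f : ℍ[ℝ] → ℂ} (hf : Continuous f) (hp : IsPeriodic f)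
    (h : ∀ β ∈ dualLattice, cubeMean (fun x => f x * char β x) = 0) (x : ℍ[ℝ]) : f x = 0 := by
  -- It suffices to treat the centre of the cube, by translation.
  suffices key : ∀ f : ℍ[ℝ] → ℂ, Continuous f → IsPeriodic f →
      (∀ β ∈ dualLattice, cubeMean (fun x => f x * char β x) = 0) →
      f (latticeCoord fun _ => 1 / 2) = 0 by
    set w := x - latticeCoord fun _ => 1 / 2 with hw
    have := key (fun y => f (y + w)) (by fun_prop) (fun o ho y => by
      have := hp o ho (y + w)
      rwa [add_right_comm] at this) fun β hβ => by
        have h1 := cubeMean_translate (f := fun x => f x * char β x) (hf.mul (continuous_char β))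
          (fun o ho x => by simp only [hp o ho, isPeriodic_char hβ o ho]) w
        simp only [char_add] at h1
        rw [h β hβ, show (fun x => f (x + w) * (char β x * char β w))
          = fun x => char β w * (f (x + w) * char β x) from funext fun x => by ring,
          cubeMean_const_mul] at h1
        refine (mul_eq_zero.1 h1).resolve_left fun h2 => ?_
        have := norm_char β w
        rw [h2, norm_zero] at this
        exact zero_ne_one this
    simpa [hw] using this
  clear! f
  intro f hf hp h
  have hconj : Continuous fun x => star (f x) := continuous_star.comp hf
  have hint : cubeMean (fun x => f x * star (f x)) = 0 := by
    have hb : ∃ C : ℝ, ∀ t ∈ Icc (0 : Fin 4 → ℝ) 1, ‖f (latticeCoord t)‖ ≤ C :=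
      isCompact_Icc.exists_bound_of_continuousOn (hf.comp continuous_latticeCoord).continuousOn
    obtain ⟨C, hC⟩ := hb
    have hC0 : 0 ≤ C := (norm_nonneg _).trans (hC 0 ⟨le_rfl, zero_le_one⟩)
    refine eq_of_forall_dist_le fun ε hε => ?_
    obtain ⟨P, hP, hfP⟩ := exists_trigPolynomial hconj (fun o ho x => by simp only [hp o ho])
      (show 0 < ε / (C + 1) by positivity)
    have hPc := continuous_of_mem_span hP
    have h0 : cubeMean (fun x => f x * P x) = 0 := by
      clear hfP hPc
      induction hP using Submodule.span_induction with
      | mem P hP =>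
        obtain ⟨β, hβ, rfl⟩ := hP
        exact h β hβ
      | zero => simp [cubeMean]
      | add P Q hP' hQ' hP hQ =>
        have h1 := cubeMean_add (hf.mul (continuous_of_mem_span hP'))
          (hf.mul (continuous_of_mem_span hQ'))
        rw [show cubeMean (f * P) = 0 from hP, show cubeMean (f * Q) = 0 from hQ, add_zero] at h1
        rw [← h1]
        congr 1
        funext x
        exact mul_add _ _ _
      | smul c P _ hP =>
        have h1 := cubeMean_const_mul c fun x => f x * P x
        rw [hP, mul_zero] at h1
        rw [← h1]
        congr 1
        funext x
        exact mul_left_comm _ _ _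
    rw [dist_eq_norm]
    nth_rewrite 1 [← h0]
    have := cubeMean_sub (f := fun x => f x * star (f x)) (g := fun x => f x * P x)
      (hf.mul hconj) (hf.mul hPc)
    rw [← this]
    refine norm_cubeMean_le fun t ht => ?_
    rw [← mul_sub, norm_mul]
    calc _ ≤ C * (ε / (C + 1)) := mul_le_mul (hC t ht) (hfP _) (norm_nonneg _) hC0
      _ ≤ ε := by
        rw [mul_div_assoc', div_le_iff₀ (by positivity)]
        nlinarith
  have hre : ∀ z : ℂ, z * star z = ((‖z‖ ^ 2 : ℝ) : ℂ) := fun z => by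
    rw [Complex.star_def, Complex.mul_conj, Complex.normSq_eq_norm_sq]
  have hcont : Continuous fun t => ‖f (latticeCoord t)‖ ^ 2 :=
    ((hf.comp continuous_latticeCoord).norm).pow 2
  have h1 : ∫ t in Icc (0 : Fin 4 → ℝ) 1, ‖f (latticeCoord t)‖ ^ 2 = 0 := by
    simp only [cubeMean, hre] at hint
    rw [integral_complex_ofReal] at hint
    exact_mod_cast hint
  rw [setIntegral_eq_zero_iff_of_nonneg_ae (Eventually.of_forall fun t => by positivity)
    (hcont.continuousOn.integrableOn_compact isCompact_Icc)] at h1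
  have h2 : (fun t => ‖f (latticeCoord t)‖ ^ 2) =ᵐ[volume.restrict (interior (Icc (0 : Fin 4 → ℝ) 1))]
      fun _ => 0 := ae_restrict_of_ae_restrict_of_subset interior_subset h1
  have h3 := Measure.eqOn_open_of_ae_eq h2 isOpen_interior hcont.continuousOn continuousOn_const
  have h4 : (fun _ => 1 / 2 : Fin 4 → ℝ) ∈ interior (Icc (0 : Fin 4 → ℝ) 1) := by
    rw [← Set.pi_univ_Icc, interior_pi_set finite_univ]
    intro i _
    change (1 / 2 : ℝ) ∈ interior (Icc (0 : ℝ) 1)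
    rw [interior_Icc]
    norm_num
  simpa using h3 h4

end FourierAnalysis

/-! ### Invariant differential operators and the radial equation of the Fourier coefficients -/

section Casimir
open Real Quaternion Matrix MeasureTheory Set Filter Topology

/-- The underlying real vector space of `M₂(ℍ)`, with the supremum norm. -/
abbrev MatSpace : Type := Fin 2 → Fin 2 → ℍ[ℝ]

/-- A function on `GL₂(ℍ)` in the coordinates of the open set of invertible matrices. -/
def coordFn (F : GReal → ℂ) (m : MatSpace) : ℂ := extendZero F (of m)

/-- The invertible matrices. -/
def unitSet : Set MatSpace := {m | IsUnit (of m)}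

theorem isOpen_unitSet : IsOpen unitSet := by
  have : IsOpen {m : Matrix (Fin 2) (Fin 2) ℍ[ℝ] | IsUnit m} := by
    let _ : NormedRing (Matrix (Fin 2) (Fin 2) ℍ[ℝ]) := Matrix.linftyOpNormedRing
    let _ : NormedAlgebra ℝ (Matrix (Fin 2) (Fin 2) ℍ[ℝ]) := Matrix.linftyOpNormedAlgebra
    have : CompleteSpace (Matrix (Fin 2) (Fin 2) ℍ[ℝ]) := FiniteDimensional.complete ℝ _
    exact Units.isOpen
  exact this

/-- The coordinates of an invertible matrix. -/
def coords (g : GReal) : MatSpace := of.symm g.val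

theorem coords_mem (g : GReal) : coords g ∈ unitSet := g.isUnit

theorem extendZero_coe (F : GReal → ℂ) (g : GReal) : extendZero F g.val = F g := by
  rw [extendZero, dif_pos g.isUnit]
  congr 1
  exact Units.ext rfl

theorem coordFn_coords (F : GReal → ℂ) (g : GReal) : coordFn F (coords g) = F g :=
  extendZero_coe F g

/-- Right multiplication by `X`. -/
def rightMul (X : Matrix (Fin 2) (Fin 2) ℍ[ℝ]) : MatSpace →L[ℝ] MatSpace :=
  LinearMap.toContinuousLinearMap
    { toFun := fun m => of.symm (of m * X)
      map_add' := fun m m' => by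
        change of.symm ((of m + of m') * X) = _
        rw [add_mul]
        rfl
      map_smul' := fun c m => by
        change of.symm ((c • of m) * X) = _
        rw [smul_mul]
        rfl }

theorem rightMul_apply (X : Matrix (Fin 2) (Fin 2) ℍ[ℝ]) (m : MatSpace) :
    rightMul X m = of.symm (of m * X) := rfl

/-- Left multiplication by `m`, as a linear map. -/
def leftMul (m : MatSpace) : Matrix (Fin 2) (Fin 2) ℍ[ℝ] →ₗ[ℝ] MatSpace where
  toFun X := rightMul X m
  map_add' X Y := by
    rw [rightMul_apply, mul_add]
    rfl
  map_smul' c X := by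
    rw [rightMul_apply, Matrix.mul_smul]
    rfl

variable {F : GReal → ℂ}

theorem IsSmooth.contDiffAt (hF : IsSmooth F) {m : MatSpace} (hm : m ∈ unitSet) :
    ContDiffAt ℝ ∞ (coordFn F) m := ContDiffOn.contDiffAt hF (isOpen_unitSet.mem_nhds hm)

theorem IsSmooth.hasFDerivAt (hF : IsSmooth F) {m : MatSpace} (hm : m ∈ unitSet) :
    HasFDerivAt (coordFn F) (fderiv ℝ (coordFn F) m) m :=
  ((hF.contDiffAt hm).differentiableAt (by simp)).hasFDerivAt

theorem IsSmooth.contDiffOn_fderiv (hF : IsSmooth F) :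
    ContDiffOn ℝ ∞ (fderiv ℝ (coordFn F)) unitSet :=
  ContDiffOn.fderiv_of_isOpen hF isOpen_unitSet (by simp)

theorem IsSmooth.hasFDerivAt_fderiv (hF : IsSmooth F) {m : MatSpace} (hm : m ∈ unitSet) :
    HasFDerivAt (fderiv ℝ (coordFn F)) (fderiv ℝ (fderiv ℝ (coordFn F)) m) m :=
  ((hF.contDiffOn_fderiv.contDiffAt (isOpen_unitSet.mem_nhds hm)).differentiableAt
    (by simp)).hasFDerivAt

theorem IsSmooth.hasFDerivAt_fderiv_apply (hF : IsSmooth F) {m : MatSpace} (hm : m ∈ unitSet)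
    (v : MatSpace) : HasFDerivAt (fun m => fderiv ℝ (coordFn F) m v)
      ((fderiv ℝ (fderiv ℝ (coordFn F)) m).flip v) m := by
  refine ((hF.hasFDerivAt_fderiv hm).clm_apply (hasFDerivAt_const v m)).congr_fderiv ?_
  ext
  simp

theorem hasDerivAt_line (g : GReal) (X : Matrix (Fin 2) (Fin 2) ℍ[ℝ]) :
    HasDerivAt (fun t : ℝ => coords g + t • rightMul X (coords g)) (rightMul X (coords g)) 0 := by
  simpa using ((hasDerivAt_id (0 : ℝ)).smul_const (rightMul X (coords g))).const_add (coords g)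

theorem coords_line (g : GReal) (X : Matrix (Fin 2) (Fin 2) ℍ[ℝ]) (t : ℝ) : g.val * (1 + t • X)
      = of (coords g + t • rightMul X (coords g)) := by
  rw [mul_add, mul_one, Matrix.mul_smul]
  rfl

theorem lieDeriv_eq (hF : IsSmooth F) (X : Matrix (Fin 2) (Fin 2) ℍ[ℝ]) (g : GReal) :
    lieDeriv X F g = fderiv ℝ (coordFn F) (coords g) (rightMul X (coords g)) := by
  rw [lieDeriv]
  simp only [coords_line]
  exact ((hF.hasFDerivAt (m := coords g) (coords_mem g)).comp_hasDerivAt_of_eq 0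
    (hasDerivAt_line g X) (by simp)).deriv

theorem extendZero_lieDeriv (hF : IsSmooth F) (X : Matrix (Fin 2) (Fin 2) ℍ[ℝ]) {m : MatSpace}
    (hm : m ∈ unitSet) :
    extendZero (lieDeriv X F) (of m) = fderiv ℝ (coordFn F) m (rightMul X m) := by
  obtain ⟨g, hg⟩ := hm
  rw [← hg, extendZero_coe, lieDeriv_eq hF]
  have : m = coords g := by
    rw [coords, hg]
    rfl
  rw [this]

theorem lieDeriv_lieDeriv (hF : IsSmooth F) (X Y : Matrix (Fin 2) (Fin 2) ℍ[ℝ]) (g : GReal) :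
    lieDeriv Y (lieDeriv X F) g
      = fderiv ℝ (fderiv ℝ (coordFn F)) (coords g) (rightMul Y (coords g)) (rightMul X (coords g))
        + fderiv ℝ (coordFn F) (coords g) (rightMul (Y * X) (coords g)) := by
  rw [lieDeriv]
  simp only [coords_line]
  have h1 := ((hF.hasFDerivAt_fderiv (coords_mem g)).clm_apply
    ((rightMul X).hasFDerivAt (x := coords g)))
  have h2 := (h1.comp_hasDerivAt_of_eq 0 (hasDerivAt_line g Y) (by simp))
  have h3 : (fun t : ℝ => extendZero (lieDeriv X F)
      (of (coords g + t • rightMul Y (coords g)))) =ᶠ[𝓝 0]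
      (fun m => fderiv ℝ (coordFn F) m (rightMul X m)) ∘
        fun t : ℝ => coords g + t • rightMul Y (coords g) := by
    have hc := (hasDerivAt_line g Y).continuousAt
    have h0 : coords g + (0 : ℝ) • rightMul Y (coords g) ∈ unitSet := by simpa using coords_mem g
    filter_upwards [hc.eventually (isOpen_unitSet.mem_nhds h0)] with t ht
    exact extendZero_lieDeriv hF X ht
  rw [h3.deriv_eq, h2.deriv]
  simp only [_root_.add_apply, ContinuousLinearMap.comp_apply, ContinuousLinearMap.flip_apply]
  have h4 : rightMul X (rightMul Y (coords g)) = rightMul (Y * X) (coords g) := by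
    simp only [rightMul_apply, Equiv.apply_symm_apply, mul_assoc]
  rw [h4]
  ring

/-- The rotation `cos t + sin t X`, where `X² = -1` and `X` is skew-Hermitian. -/
def rotation {X : Matrix (Fin 2) (Fin 2) ℍ[ℝ]} (h2 : X * X = -1) (t : ℝ) : GReal where
  val := cos t • 1 + sin t • X
  inv := cos t • 1 - sin t • X
  val_inv := by
    simp only [add_mul, mul_sub, smul_mul_smul_comm, mul_one, one_mul, h2]
    rw [mul_comm (sin t) (cos t)]
    have := cos_sq_add_sin_sq t
    rw [smul_neg]
    rw [show cos t * cos t = 1 - sin t * sin t by nlinarith]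
    module
  inv_val := by
    simp only [sub_mul, mul_add, smul_mul_smul_comm, mul_one, one_mul, h2]
    rw [mul_comm (sin t) (cos t)]
    have := cos_sq_add_sin_sq t
    rw [smul_neg]
    rw [show cos t * cos t = 1 - sin t * sin t by nlinarith]
    module

theorem rotation_unitary {X : Matrix (Fin 2) (Fin 2) ℍ[ℝ]} (h2 : X * X = -1) (hX : Xᴴ = -X) (t : ℝ) :
    (rotation h2 t).valᴴ * (rotation h2 t).val = 1 := by
  have : (rotation h2 t).valᴴ = (rotation h2 t).inv := by
    refine ext fun i j => ?_
    have h1 : star (X j i) = -X i j := congrFun (congrFun hX i) j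
    have h3 : star ((1 : Matrix (Fin 2) (Fin 2) ℍ[ℝ]) j i) = (1 : Matrix (Fin 2) (Fin 2) ℍ[ℝ]) i j :=
      congrFun (congrFun conjTranspose_one i) j
    simp only [rotation, Matrix.conjTranspose_apply, Matrix.add_apply, Matrix.sub_apply,
      Matrix.smul_apply, star_add, Quaternion.star_smul, h1, h3]
    rw [smul_neg, sub_eq_add_neg]
  rw [this]
  exact (rotation h2 t).inv_val

theorem lieDeriv_skew (hF : IsSmooth F) (hK : ∀ k : GReal,
    k.valᴴ * (k : Matrix _ _ ℍ[ℝ]) = 1 → ∀ g, F (g * k) = F g)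
    {X : Matrix (Fin 2) (Fin 2) ℍ[ℝ]} (h2 : X * X = -1) (hX : Xᴴ = -X) (g : GReal) :
    lieDeriv X F g = 0 := by
  rw [lieDeriv_eq hF]
  have h1 : HasDerivAt (fun t : ℝ => cos t • coords g + sin t • rightMul X (coords g))
      (rightMul X (coords g)) 0 := by
    refine HasDerivAt.congr_deriv (((hasDerivAt_cos 0).smul_const (coords g)).add
      ((hasDerivAt_sin 0).smul_const (rightMul X (coords g)))) ?_
    simp
  have h3 := (hF.hasFDerivAt (coords_mem g)).comp_hasDerivAt_of_eq 0 h1 (by simp)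
  have h4 : coordFn F ∘ (fun t : ℝ => cos t • coords g + sin t • rightMul X (coords g))
      = fun _ => F g := by
    funext t
    rw [← hK _ (rotation_unitary h2 hX t) g, ← coordFn_coords F]
    change coordFn F _ = coordFn F _
    congr 1
    change _ = of.symm (g.val * (cos t • 1 + sin t • X))
    rw [mul_add, Matrix.mul_smul, Matrix.mul_smul, mul_one]
    rfl
  rw [h4] at h3
  exact h3.unique (hasDerivAt_const 0 _)

theorem coe_realDiag (s t : ℝˣ) : (realDiag s t).val
    = !![((s : ℝ) : ℍ[ℝ]), 0; 0, ((t : ℝ) : ℍ[ℝ])] := rfl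

theorem realDiag_mul_eq_smul (c : ℝˣ) (g : GReal) : (realDiag c c * g).val = (c : ℝ) • g.val := by
  rw [Units.val_mul, coe_realDiag]
  refine ext fun i j => ?_
  fin_cases i <;> simp [mul_apply, Fin.sum_univ_two, coe_mul_eq_smul]

theorem lieDeriv_one (hF : IsSmooth F)
    (hZ : ∀ c : ℝˣ, 0 < (c : ℝ) → ∀ g, F (realDiag c c * g) = F g) (g : GReal) :
    lieDeriv 1 F g = 0 := by
  rw [lieDeriv_eq hF]
  have e1 : rightMul 1 (coords g) = coords g := by
    rw [rightMul_apply, mul_one]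
    rfl
  rw [e1]
  have h1 : HasDerivAt (fun t : ℝ => exp t • coords g) (coords g) 0 := by
    simpa using (hasDerivAt_exp 0).smul_const (coords g)
  have h3 := (hF.hasFDerivAt (coords_mem g)).comp_hasDerivAt_of_eq 0 h1 (by simp)
  have h4 : coordFn F ∘ (fun t : ℝ => exp t • coords g) = fun _ => F g := by
    funext t
    rw [← hZ (Units.mk0 _ (exp_pos t).ne') (exp_pos t) g, ← coordFn_coords F]
    change coordFn F _ = coordFn F _
    congr 1
    exact (realDiag_mul_eq_smul (Units.mk0 _ (exp_pos t).ne') g).symm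
  rw [h4] at h3
  exact h3.unique (hasDerivAt_const 0 _)

/-- The algebra behind the radial part of the Casimir operator: `D₁` and `D₂` stand for the first
and second derivatives at a point in the directions of left-invariant vector fields, and the
invariance under the maximal compact subgroup and the centre is used to eliminate the lower
triangular and the compact directions. -/
theorem casimir_reduction (D₁ : Matrix (Fin 2) (Fin 2) ℍ[ℝ] →ₗ[ℝ] ℂ)
    (D₂ : Matrix (Fin 2) (Fin 2) ℍ[ℝ] →ₗ[ℝ] Matrix (Fin 2) (Fin 2) ℍ[ℝ] →ₗ[ℝ] ℂ)
    (hsymm : ∀ X Y, D₂ X Y = D₂ Y X)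
    (h1 : ∀ X, (X = 1 ∨ (X * X = -1 ∧ Xᴴ = -X)) → D₁ X = 0 ∧ ∀ Y, D₂ Y X + D₁ (Y * X) = 0) :
    (1 / 32 : ℂ) * (D₂ !![1, 0; 0, -1] !![1, 0; 0, -1] + D₁ (!![1, 0; 0, -1] * !![1, 0; 0, -1]))
      + (1 / 16 : ℂ) * ∑ q : Fin 4, ((D₂ !![0, quatBasis q; 0, 0] !![0, 0; star (quatBasis q), 0]
            + D₁ (!![0, quatBasis q; 0, 0] * !![0, 0; star (quatBasis q), 0]))
          + (D₂ !![0, 0; star (quatBasis q), 0] !![0, quatBasis q; 0, 0]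
            + D₁ (!![0, 0; star (quatBasis q), 0] * !![0, quatBasis q; 0, 0])))
      - (1 / 16 : ℂ) * ∑ q : Fin 3, ((D₂ !![quatBasis q.succ, 0; 0, 0] !![quatBasis q.succ, 0; 0, 0]
            + D₁ (!![quatBasis q.succ, 0; 0, 0] * !![quatBasis q.succ, 0; 0, 0]))
          + (D₂ !![0, 0; 0, quatBasis q.succ] !![0, 0; 0, quatBasis q.succ]
            + D₁ (!![0, 0; 0, quatBasis q.succ] * !![0, 0; 0, quatBasis q.succ])))
    = (1 / 8 : ℂ) * D₂ !![1, 0; 0, 0] !![1, 0; 0, 0] - (3 / 8 : ℂ) * D₁ !![1, 0; 0, 0]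
      + (1 / 8 : ℂ) * ∑ q : Fin 4, D₂ !![0, quatBasis q; 0, 0] !![0, quatBasis q; 0, 0] := by
  set E : Matrix (Fin 2) (Fin 2) ℍ[ℝ] := !![1, 0; 0, 0] with hE
  have hstar : ∀ q, star (quatBasis q) * quatBasis q = 1 ∧ quatBasis q * star (quatBasis q) = 1 := by
    intro q
    fin_cases q <;> constructor <;> apply Quaternion.ext <;>
      simp [quatBasis, re_mul, imI_mul, imJ_mul, imK_mul]
  have hstar' : ∀ q : Fin 3, star (quatBasis q.succ) = -quatBasis q.succ := by
    intro q
    fin_cases q <;> apply Quaternion.ext <;> simp [quatBasis]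
  have hsq : ∀ q : Fin 3, quatBasis q.succ * quatBasis q.succ = -1 := by
    intro q
    have := (hstar q.succ).1
    rw [hstar', neg_mul] at this
    rw [← this, neg_neg]
  obtain ⟨z1, z2⟩ := h1 1 (Or.inl rfl)
  have hH : (!![1, 0; 0, -1] : Matrix (Fin 2) (Fin 2) ℍ[ℝ]) = (2 : ℝ) • E - 1 := by
    refine ext fun i j => ?_
    fin_cases i <;> fin_cases j <;> simp [hE]
    rw [two_smul]
    abel
  have hHH : (!![1, 0; 0, -1] * !![1, 0; 0, -1] : Matrix (Fin 2) (Fin 2) ℍ[ℝ]) = 1 := by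
    refine ext fun i j => ?_
    fin_cases i <;> fin_cases j <;> simp [mul_apply, Fin.sum_univ_two]
  have t1 : D₂ !![1, 0; 0, -1] !![1, 0; 0, -1] + D₁ (!![1, 0; 0, -1] * !![1, 0; 0, -1])
      = 4 * (D₂ E E + D₁ E) := by
    rw [hHH, z1, hH]
    simp only [map_sub, map_smul, LinearMap.sub_apply, LinearMap.smul_apply]
    have e1 := z2 E
    have e2 := z2 1
    rw [mul_one] at e1 e2
    rw [z1] at e2
    rw [hsymm 1 E]
    simp only [Complex.real_smul]
    push_cast
    linear_combination -4 * e1 + e2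
  have t2 : ∀ q, (D₂ !![0, quatBasis q; 0, 0] !![0, 0; star (quatBasis q), 0]
            + D₁ (!![0, quatBasis q; 0, 0] * !![0, 0; star (quatBasis q), 0]))
          + (D₂ !![0, 0; star (quatBasis q), 0] !![0, quatBasis q; 0, 0]
            + D₁ (!![0, 0; star (quatBasis q), 0] * !![0, quatBasis q; 0, 0]))
      = 2 * D₂ !![0, quatBasis q; 0, 0] !![0, quatBasis q; 0, 0] - 2 * D₁ E := by
    intro q
    set A : Matrix (Fin 2) (Fin 2) ℍ[ℝ] := !![0, quatBasis q; 0, 0] with hA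
    set B : Matrix (Fin 2) (Fin 2) ℍ[ℝ] := !![0, 0; star (quatBasis q), 0] with hB
    have hAA : A * A = 0 := by
      refine ext fun i j => ?_
      fin_cases i <;> fin_cases j <;> simp [hA, mul_apply, Fin.sum_univ_two]
    have hBB : B * B = 0 := by
      refine ext fun i j => ?_
      fin_cases i <;> fin_cases j <;> simp [hB, mul_apply, Fin.sum_univ_two]
    have hAB : A * B = E := by
      refine ext fun i j => ?_
      fin_cases i <;> fin_cases j <;> simp [hA, hB, hE, mul_apply, Fin.sum_univ_two, (hstar q).2]
    have hBA : B * A = 1 - E := by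
      refine ext fun i j => ?_
      fin_cases i <;> fin_cases j <;> simp [hA, hB, hE, mul_apply, Fin.sum_univ_two, (hstar q).1]
    obtain ⟨-, y2⟩ := h1 (A - B) (Or.inr ⟨by
        rw [sub_mul, mul_sub, mul_sub, hAA, hBB, hAB, hBA]
        abel, by
        refine ext fun i j => ?_
        fin_cases i <;> fin_cases j <;> simp [hA, hB, Matrix.conjTranspose_apply]⟩)
    have e1 := y2 A
    rw [mul_sub, hAA, hAB, map_sub, map_sub, map_zero] at e1
    rw [hAB, hBA, hsymm B A, map_sub, z1]
    linear_combination -2 * e1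
  have hlin : ∀ X Y, (X * X = -1 ∧ Xᴴ = -X) → (Y * Y = -1 ∧ Yᴴ = -Y) → ∀ c : ℝ,
      D₂ (c • (X + Y)) (c • (X + Y)) + D₁ ((c • (X + Y)) * (c • (X + Y))) = 0 := by
    intro X Y hX hY c
    have e1 := (h1 X (Or.inr hX)).2 (c • (X + Y))
    have e2 := (h1 Y (Or.inr hY)).2 (c • (X + Y))
    have e3 : (c • (X + Y)) * (c • (X + Y)) = c • ((c • (X + Y)) * X) + c • ((c • (X + Y)) * Y) := by
      rw [Matrix.mul_smul, mul_add, smul_add]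
    rw [e3, map_add, map_smul D₁, map_smul D₁]
    nth_rewrite 2 [smul_add]
    rw [map_add (D₂ _), map_smul (D₂ _), map_smul (D₂ _)]
    simp only [Complex.real_smul]
    linear_combination (c : ℂ) * e1 + (c : ℂ) * e2
  have t3 : ∀ q : Fin 3, (D₂ !![quatBasis q.succ, 0; 0, 0] !![quatBasis q.succ, 0; 0, 0]
            + D₁ (!![quatBasis q.succ, 0; 0, 0] * !![quatBasis q.succ, 0; 0, 0]))
          + (D₂ !![0, 0; 0, quatBasis q.succ] !![0, 0; 0, quatBasis q.succ]
            + D₁ (!![0, 0; 0, quatBasis q.succ] * !![0, 0; 0, quatBasis q.succ])) = 0 := by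
    intro q
    have hd : ∀ a b : ℍ[ℝ], a * a = -1 → b * b = -1 → star a = -a → star b = -b →
        (!![a, 0; 0, b] : Matrix (Fin 2) (Fin 2) ℍ[ℝ]) * !![a, 0; 0, b] = -1 ∧
        (!![a, 0; 0, b] : Matrix (Fin 2) (Fin 2) ℍ[ℝ])ᴴ = -!![a, 0; 0, b] := by
      intro a b h1 h2 h3 h4
      constructor
      · refine ext fun i j => ?_
        fin_cases i <;> fin_cases j <;> simp [mul_apply, Fin.sum_univ_two, h1, h2]
      · refine ext fun i j => ?_
        fin_cases i <;> fin_cases j <;> simp [Matrix.conjTranspose_apply, h3, h4]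
    set a := quatBasis q.succ
    have p1 := hd a a (hsq q) (hsq q) (hstar' q) (hstar' q)
    have p2 := hd a (-a) (hsq q) (by rw [neg_mul_neg]; exact hsq q) (hstar' q)
      (by rw [star_neg, hstar' q])
    have p3 := hd (-a) a (by rw [neg_mul_neg]; exact hsq q) (hsq q)
      (by rw [star_neg, hstar' q]) (hstar' q)
    have q1 : (!![a, 0; 0, 0] : Matrix (Fin 2) (Fin 2) ℍ[ℝ])
        = (1 / 2 : ℝ) • (!![a, 0; 0, a] + !![a, 0; 0, -a]) := by
      refine ext fun i j => ?_
      fin_cases i <;> fin_cases j <;> simp [← two_smul ℝ, smul_smul]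
    have q2 : (!![0, 0; 0, a] : Matrix (Fin 2) (Fin 2) ℍ[ℝ])
        = (1 / 2 : ℝ) • (!![a, 0; 0, a] + !![-a, 0; 0, a]) := by
      refine ext fun i j => ?_
      fin_cases i <;> fin_cases j <;> simp [← two_smul ℝ, smul_smul]
    rw [q1, q2, hlin _ _ p1 p2, hlin _ _ p1 p3, add_zero]
  rw [t1, Finset.sum_congr rfl fun q _ => t2 q, Finset.sum_eq_zero fun q _ => t3 q,
    Finset.sum_sub_distrib, ← Finset.mul_sum]
  simp
  ring

theorem casimir_eq_radial (hF : IsSmooth F) (hK : ∀ k : GReal,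
    k.valᴴ * (k : Matrix _ _ ℍ[ℝ]) = 1 → ∀ g, F (g * k) = F g)
    (hZ : ∀ c : ℝˣ, 0 < (c : ℝ) → ∀ g, F (realDiag c c * g) = F g) (g : GReal) :
    casimir F g = (1 / 8 : ℂ) * fderiv ℝ (fderiv ℝ (coordFn F)) (coords g)
        (rightMul !![1, 0; 0, 0] (coords g)) (rightMul !![1, 0; 0, 0] (coords g))
      - (3 / 8 : ℂ) * fderiv ℝ (coordFn F) (coords g) (rightMul !![1, 0; 0, 0] (coords g))
      + (1 / 8 : ℂ) * ∑ q : Fin 4, fderiv ℝ (fderiv ℝ (coordFn F)) (coords g)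
        (rightMul !![0, quatBasis q; 0, 0] (coords g)) (rightMul !![0, quatBasis q; 0, 0] (coords g)) := by
  set L := leftMul (coords g)
  set D₁ : Matrix (Fin 2) (Fin 2) ℍ[ℝ] →ₗ[ℝ] ℂ := (fderiv ℝ (coordFn F) (coords g)).toLinearMap ∘ₗ L
  set D₂ : Matrix (Fin 2) (Fin 2) ℍ[ℝ] →ₗ[ℝ] Matrix (Fin 2) (Fin 2) ℍ[ℝ] →ₗ[ℝ] ℂ :=
    LinearMap.mk₂ ℝ (fun X Y => fderiv ℝ (fderiv ℝ (coordFn F)) (coords g) (L X) (L Y))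
      (fun X X' Y => by simp) (fun c X Y => by simp) (fun X Y Y' => by simp) (fun c X Y => by simp)
  have hs : IsSymmSndFDerivAt ℝ (coordFn F) (coords g) :=
    (hF.contDiffAt (coords_mem g)).isSymmSndFDerivAt (by
      rw [minSmoothness_of_isRCLikeNormedField]; exact WithTop.coe_le_coe.2 le_top)
  have h0 : ∀ X, (X = 1 ∨ (X * X = -1 ∧ Xᴴ = -X)) → ∀ g, lieDeriv X F g = 0 := by
    rintro X (rfl | ⟨h2, hX⟩) g
    · exact lieDeriv_one hF hZ g
    · exact lieDeriv_skew hF hK h2 hX g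
  have := casimir_reduction D₁ D₂ (fun X Y => hs _ _) fun X hX => by
    refine ⟨?_, fun Y => ?_⟩
    · rw [← h0 X hX g, lieDeriv_eq hF]
      rfl
    · have h1 := lieDeriv_lieDeriv hF X Y g
      have h2 : lieDeriv Y (lieDeriv X F) g = 0 := by
        rw [show lieDeriv X F = 0 from funext (h0 X hX), lieDeriv]
        simp [extendZero]
      rw [h2] at h1
      exact h1.symm
  rw [casimir]
  simp only [lieDeriv_lieDeriv hF]
  exact this

end Casimir

/-! ### The differential equation of the Fourier coefficients -/

section FourierCoefficients
open Quaternion Matrix Real MeasureTheory Set Filter Topology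

/-- The matrix `[y, x; 0, 1]`. -/
def upper (y : ℝ) (x : ℍ[ℝ]) : MatSpace := of.symm !![(y : ℍ[ℝ]), x; 0, 1]

/-- The tangent vector `[a, x; 0, 0]`. -/
def tangent (a x : ℍ[ℝ]) : MatSpace := of.symm !![a, x; 0, 0]

theorem upper_eq (y : ℝ) (x : ℍ[ℝ]) : upper y x = upper 0 x + y • tangent 1 0 := by
  refine ext fun i j => ?_
  change _ = upper 0 x i j + y • tangent 1 0 i j
  fin_cases i <;> fin_cases j <;> simp [upper, tangent, ← Algebra.algebraMap_eq_smul_one]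

theorem upper_shift (y : ℝ) (x : ℍ[ℝ]) (s : ℝ) (q : ℍ[ℝ]) :
    upper y (x + s • q) = upper y x + s • tangent 0 q := by
  refine ext fun i j => ?_
  change _ = upper y x i j + s • tangent 0 q i j
  fin_cases i <;> fin_cases j <;> simp [upper, tangent]

theorem hasDerivAt_upper (x : ℍ[ℝ]) (y : ℝ) : HasDerivAt (fun y => upper y x) (tangent 1 0) y := by
  rw [show (fun y => upper y x) = fun y => upper 0 x + y • tangent 1 0 from
    funext fun y => upper_eq y x]
  refine (((hasDerivAt_id y).smul_const (tangent 1 0)).const_add _).congr_deriv ?_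
  rw [one_smul]

theorem hasDerivAt_upper_shift (y : ℝ) (x q : ℍ[ℝ]) (s : ℝ) :
    HasDerivAt (fun s : ℝ => upper y (x + s • q)) (tangent 0 q) s := by
  rw [show (fun s : ℝ => upper y (x + s • q)) = fun s => upper y x + s • tangent 0 q from
    funext fun s => upper_shift y x s q]
  refine (((hasDerivAt_id s).smul_const (tangent 0 q)).const_add _).congr_deriv ?_
  rw [one_smul]

theorem continuous_upper : Continuous fun z : ℝ × ℍ[ℝ] => upper z.1 z.2 := by
  refine continuous_pi fun i => continuous_pi fun j => ?_
  fin_cases i <;> fin_cases j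
  · exact continuous_coe.comp continuous_fst
  · exact continuous_snd
  · exact continuous_const
  · exact continuous_const

/-- The element `[y, x; 0, 1]` of `GL₂(ℍ)`. -/
def upperUnit (y : ℝˣ) (x : ℍ[ℝ]) : GReal := nUnip x * realDiag y 1

theorem coe_nUnip (x : ℍ[ℝ]) : (nUnip x).val = !![1, x; 0, 1] := rfl

theorem coords_upperUnit (y : ℝˣ) (x : ℍ[ℝ]) : coords (upperUnit y x) = upper y x := by
  rw [coords, upperUnit, Units.val_mul, coe_nUnip, coe_realDiag]
  refine ext fun i j => ?_
  fin_cases i <;> fin_cases j <;> simp [upper]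

theorem upper_mem {y : ℝ} (hy : y ≠ 0) (x : ℍ[ℝ]) : upper y x ∈ unitSet := by
  rw [← Units.val_mk0 hy, ← coords_upperUnit]
  exact coords_mem _

theorem realDiag_mul (s t s' t' : ℝˣ) : realDiag s t * realDiag s' t' = realDiag (s * s') (t * t') := by
  refine Units.ext (ext fun i j => ?_)
  rw [Units.val_mul, coe_realDiag, coe_realDiag, coe_realDiag]
  fin_cases i <;> fin_cases j <;> simp [mul_apply, Fin.sum_univ_two]

theorem realDiag_comm (c : ℝˣ) (g : GReal) : realDiag c c * g = g * realDiag c c := by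
  refine Units.ext (ext fun i j => ?_)
  rw [realDiag_mul_eq_smul, Units.val_mul, coe_realDiag]
  fin_cases j <;> simp [mul_apply, Fin.sum_univ_two, mul_coe_eq_smul]

variable {F : GReal → ℂ} {r : ℂ}

theorem IsMaassForm.upperUnit_eq (hF : IsMaassForm r F) (y : Set.Ioi (0 : ℝ)) (x : ℍ[ℝ]) :
    F (nUnip x * aDiag y) = coordFn F (upper y x) := by
  have h : nUnip x * aDiag y = realDiag (sqrtUnit y)⁻¹ (sqrtUnit y)⁻¹
      * upperUnit (Units.mk0 (y : ℝ) (ne_of_gt y.2)) x := by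
    rw [upperUnit, ← mul_assoc, realDiag_comm, mul_assoc, realDiag_mul, aDiag, mul_one]
    congr 2
    rw [eq_inv_mul_iff_mul_eq]
    refine Units.ext ?_
    exact mul_self_sqrt (le_of_lt y.2)
  rw [h, hF.center_inv _ (by
    rw [Units.val_inv_eq_inv_val]
    exact inv_pos.2 (sqrt_pos.2 y.2)), ← coordFn_coords F, coords_upperUnit, Units.val_mk0]

/-- The differential equation of a Maass form on the upper half space. -/
theorem IsMaassForm.pde (hF : IsMaassForm r F) {y : ℝ} (hy : 0 < y) (x : ℍ[ℝ]) :
    (y : ℂ) ^ 2 * fderiv ℝ (fderiv ℝ (coordFn F)) (upper y x) (tangent 1 0) (tangent 1 0)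
      - 3 * y * fderiv ℝ (coordFn F) (upper y x) (tangent 1 0)
      + (y : ℂ) ^ 2 * ∑ q : Fin 4, fderiv ℝ (fderiv ℝ (coordFn F)) (upper y x)
        (tangent 0 (quatBasis q)) (tangent 0 (quatBasis q))
      + (r ^ 2 + 4) * coordFn F (upper y x) = 0 := by
  have h := casimir_eq_radial hF.smooth hF.right_inv hF.center_inv (upperUnit (Units.mk0 y hy.ne') x)
  rw [hF.casimir_eq, ← coordFn_coords F, coords_upperUnit, Units.val_mk0] at h
  have e1 : rightMul !![1, 0; 0, 0] (upper y x) = y • tangent 1 0 := by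
    refine ext fun i j => ?_
    change (of (upper y x) * (!![1, 0; 0, 0] : Matrix (Fin 2) (Fin 2) ℍ[ℝ])) i j = y • tangent 1 0 i j
    fin_cases i <;> fin_cases j <;>
      simp [upper, tangent, mul_apply, Fin.sum_univ_two, ← Algebra.algebraMap_eq_smul_one]
  have e2 : ∀ q, rightMul !![0, q; 0, 0] (upper y x) = y • tangent 0 q := by
    intro q
    refine ext fun i j => ?_
    change (of (upper y x) * (!![0, q; 0, 0] : Matrix (Fin 2) (Fin 2) ℍ[ℝ])) i j = y • tangent 0 q i j
    fin_cases i <;> fin_cases j <;>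
      simp [upper, tangent, mul_apply, Fin.sum_univ_two, coe_mul_eq_smul]
  simp only [e1, e2, map_smul, _root_.smul_apply, Complex.real_smul] at h
  simp only [← mul_assoc, ← Finset.mul_sum] at h
  linear_combination -8 * h

/-- Differentiation under the integral sign, for means over `ℍ / 𝒪`. -/
theorem hasDerivAt_cubeMean {H H' : ℝ → ℍ[ℝ] → ℂ} {I : Set ℝ} (hI : IsOpen I)
    (hd : ∀ s ∈ I, ∀ x, HasDerivAt (fun s => H s x) (H' s x) s) (hc : ∀ s ∈ I, Continuous (H s))
    (hc' : ContinuousOn (fun z : ℝ × ℍ[ℝ] => H' z.1 z.2) (I ×ˢ univ)) {s : ℝ} (hs : s ∈ I) :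
    HasDerivAt (fun s => cubeMean (H s)) (cubeMean (H' s)) s := by
  obtain ⟨ε, hε, hball⟩ := Metric.isOpen_iff.1 hI s hs
  have hsub : Metric.closedBall s (ε / 2) ⊆ I :=
    (Metric.closedBall_subset_ball (by linarith)).trans hball
  have hcont : ContinuousOn (fun z : ℝ × (Fin 4 → ℝ) => H' z.1 (latticeCoord z.2))
      (Metric.closedBall s (ε / 2) ×ˢ Icc (0 : Fin 4 → ℝ) 1) := by
    refine hc'.comp (f := fun z : ℝ × (Fin 4 → ℝ) => (z.1, latticeCoord z.2))
      (continuous_fst.prodMk (continuous_latticeCoord.comp continuous_snd)).continuousOn ?_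
    exact fun z hz => ⟨hsub hz.1, mem_univ _⟩
  obtain ⟨C, hC⟩ := ((isCompact_closedBall s (ε / 2)).prod
    (isCompact_Icc (a := (0 : Fin 4 → ℝ)) (b := 1))).exists_bound_of_continuousOn hcont
  have hcs : Continuous (H' s) := by
    rw [← continuousOn_univ]
    exact hc'.comp (f := fun x : ℍ[ℝ] => (s, x)) (by fun_prop) fun x _ => ⟨hs, mem_univ _⟩
  refine (hasDerivAt_integral_of_dominated_loc_of_deriv_le
    (μ := volume.restrict (Icc (0 : Fin 4 → ℝ) 1)) (s := Metric.ball s (ε / 2))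
    (F := fun s t => H s (latticeCoord t)) (F' := fun s t => H' s (latticeCoord t))
    (bound := fun _ => C) (Metric.ball_mem_nhds _ (by linarith)) ?_ (integrableOn_cube (hc s hs))
    (integrableOn_cube hcs).aestronglyMeasurable ?_ ?_ ?_).2
  · filter_upwards [hI.mem_nhds hs] with s' hs'
    exact (integrableOn_cube (hc s' hs')).aestronglyMeasurable
  · refine (ae_restrict_iff' measurableSet_Icc).2 (Eventually.of_forall fun t ht s' hs' => ?_)
    exact hC (s', t) ⟨Metric.ball_subset_closedBall hs', ht⟩
  · exact (continuous_const (y := C)).continuousOn.integrableOn_compact isCompact_Icc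
  · exact Eventually.of_forall fun t s' hs' => hd s' (hsub (Metric.ball_subset_closedBall hs')) _

theorem IsMaassForm.nUnip_order (hF : IsMaassForm r F) {o : ℍ[ℚ]} (ho : o ∈ order) (g : GReal) :
    F (nUnip (toQuatReal o) * g) = F g := by
  let γ : GL2 order :=
    { val := !![1, ⟨o, ho⟩; 0, 1]
      inv := !![1, -⟨o, ho⟩; 0, 1]
      val_inv := by
        refine ext fun i j => ?_
        fin_cases i <;> fin_cases j <;> simp [mul_apply, Fin.sum_univ_two]
      inv_val := by
        refine ext fun i j => ?_
        fin_cases i <;> fin_cases j <;> simp [mul_apply, Fin.sum_univ_two] }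
  have := hF.left_inv (glMap order.subtype γ) ⟨γ, rfl⟩ g
  rw [← this]
  congr 2
  refine Units.ext (ext fun i j => ?_)
  fin_cases i <;> fin_cases j <;> simp [nUnip, toReal, glMap, γ]

theorem nUnip_add (x y : ℍ[ℝ]) : nUnip (x + y) = nUnip x * nUnip y := by
  refine Units.ext (ext fun i j => ?_)
  rw [Units.val_mul, coe_nUnip, coe_nUnip, coe_nUnip]
  fin_cases i <;> fin_cases j <;> simp [mul_apply, Fin.sum_univ_two, add_comm]

theorem IsMaassForm.isPeriodic (hF : IsMaassForm r F) (g : GReal) :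
    IsPeriodic fun x => F (nUnip x * g) := fun o ho x => by
  simp only
  rw [add_comm, nUnip_add, mul_assoc, hF.nUnip_order ho]

theorem IsMaassForm.continuous_nUnip (hF : IsMaassForm r F) (g : GReal) :
    Continuous fun x => F (nUnip x * g) := by
  have h1 : Continuous fun x : ℍ[ℝ] => coords (nUnip x * g) := by
    refine continuous_pi fun i => continuous_pi fun j => ?_
    change Continuous fun x : ℍ[ℝ] => (nUnip x * g).val i j
    simp only [Units.val_mul, mul_apply, Fin.sum_univ_two, coe_nUnip]
    fin_cases i
    · simp only [Fin.zero_eta, of_apply, cons_val_zero, cons_val]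
      fun_prop
    · simp only [Fin.mk_one, of_apply, cons_val]
      fun_prop
  rw [show (fun x => F (nUnip x * g)) = fun x => coordFn F (coords (nUnip x * g)) from
    funext fun x => (coordFn_coords F _).symm, continuous_iff_continuousAt]
  intro x
  exact ((hF.smooth.contDiffAt (coords_mem (nUnip x * g))).continuousAt).comp
    (f := fun x => coords (nUnip x * g)) h1.continuousAt

/-- The Fourier coefficients as functions of `y`. -/
def radialPart (F : GReal → ℂ) (β : ℍ[ℚ]) (y : ℝ) : ℂ :=
  cubeMean fun x => coordFn F (upper y x) * char (-β) x

theorem IsMaassForm.fourierIntegral_aDiag (hF : IsMaassForm r F) (β : ℍ[ℚ]) (y : Set.Ioi (0 : ℝ)) :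
    fourierIntegral F β (aDiag y) = radialPart F β y := by
  rw [fourierIntegral_eq, radialPart]
  simp only [hF.upperUnit_eq]

theorem continuousOn_coordFn (hF : IsSmooth F) : ContinuousOn (coordFn F) unitSet :=
  ContDiffOn.continuousOn hF

theorem char_smul (β : ℍ[ℚ]) (s : ℝ) (x : ℍ[ℝ]) : char β (s • x)
    = Complex.exp (s * (2 * Real.pi * Complex.I * ((toQuatReal β * x).re : ℝ))) := by
  rw [char, mul_smul_comm, re_smul]
  congr 1
  rw [smul_eq_mul]
  push_cast
  ring

theorem continuousOn_value (hs : IsSmooth F) (β : ℍ[ℚ]) :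
    ContinuousOn (fun z : ℝ × ℍ[ℝ] => coordFn F (upper z.1 z.2) * char β z.2) (Ioi 0 ×ˢ univ) :=
  ((continuousOn_coordFn hs).comp continuous_upper.continuousOn
    fun _ hz => upper_mem (ne_of_gt hz.1) _).mul ((continuous_char β).comp continuous_snd).continuousOn

theorem continuousOn_first (hs : IsSmooth F) (β : ℍ[ℚ]) (v : MatSpace) :
    ContinuousOn (fun z : ℝ × ℍ[ℝ] => fderiv ℝ (coordFn F) (upper z.1 z.2) v * char β z.2)
      (Ioi 0 ×ˢ univ) :=
  ((hs.contDiffOn_fderiv.continuousOn.comp continuous_upper.continuousOn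
    fun _ hz => upper_mem (ne_of_gt hz.1) _).clm_apply continuousOn_const).mul
    ((continuous_char β).comp continuous_snd).continuousOn

theorem continuousOn_second (hs : IsSmooth F) (β : ℍ[ℚ]) (v : MatSpace) :
    ContinuousOn (fun z : ℝ × ℍ[ℝ] => fderiv ℝ (fderiv ℝ (coordFn F)) (upper z.1 z.2) v v * char β z.2)
      (Ioi 0 ×ˢ univ) := by
  have hc2 : ContinuousOn (fderiv ℝ (fderiv ℝ (coordFn F))) unitSet :=
    (ContDiffOn.fderiv_of_isOpen (m := ∞) hs.contDiffOn_fderiv isOpen_unitSet (by simp)).continuousOn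
  exact (((hc2.comp continuous_upper.continuousOn
    fun _ hz => upper_mem (ne_of_gt hz.1) _).clm_apply continuousOn_const).clm_apply
    continuousOn_const).mul ((continuous_char β).comp continuous_snd).continuousOn

theorem continuous_slice {f : ℝ × ℍ[ℝ] → ℂ} (hf : ContinuousOn f (Ioi 0 ×ˢ univ)) {y : ℝ}
    (hy : 0 < y) : Continuous fun x => f (y, x) := by
  rw [← continuousOn_univ]
  exact hf.comp (f := fun x : ℍ[ℝ] => (y, x)) (by fun_prop) fun x _ => ⟨hy, mem_univ _⟩

/-- The second derivatives in `x` act on the Fourier coefficients through the character. -/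
theorem IsMaassForm.cubeMean_second (hF : IsMaassForm r F) {β : ℍ[ℚ]} (hβ : β ∈ dualLattice) {y : ℝ}
    (hy : 0 < y) (q : ℍ[ℝ]) : cubeMean (fun x => fderiv ℝ (fderiv ℝ (coordFn F)) (upper y x)
        (tangent 0 q) (tangent 0 q) * char (-β) x)
        = (2 * Real.pi * Complex.I * ((toQuatReal β * q).re : ℝ)) ^ 2 * radialPart F β y := by
  have hs := hF.smooth
  set G₀ : ℍ[ℝ] → ℂ := fun x => coordFn F (upper y x) with hG₀
  set G₁ : ℍ[ℝ] → ℂ := fun x => fderiv ℝ (coordFn F) (upper y x) (tangent 0 q)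
  set G₂ : ℍ[ℝ] → ℂ := fun x => fderiv ℝ (fderiv ℝ (coordFn F)) (upper y x) (tangent 0 q) (tangent 0 q)
  have c0 : Continuous G₀ := by simpa [char] using continuous_slice (continuousOn_value hs 0) hy
  have c1 : Continuous G₁ := by
    simpa [char] using continuous_slice (continuousOn_first hs 0 (tangent 0 q)) hy
  have c2 : Continuous G₂ := by
    simpa [char] using continuous_slice (continuousOn_second hs 0 (tangent 0 q)) hy
  have hchar := continuous_char (-β)
  set c : ℂ := 2 * Real.pi * Complex.I * ((toQuatReal β * q).re : ℝ)
  have kk : ∀ {G : ℍ[ℝ] → ℂ}, Continuous G → Continuous fun z : ℝ × ℍ[ℝ] =>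
    G (z.2 + z.1 • q) * char (-β) z.2 := fun hG => by fun_prop
  have hG : ∀ s : ℝ, cubeMean (fun x => G₀ (x + s • q) * char (-β) x)
      = radialPart F β y * Complex.exp (s * c) := by
    intro s
    have hper : IsPeriodic fun x => G₀ x * char (-β) x := fun o ho x => by
      have h1 := hF.isPeriodic (aDiag ⟨y, hy⟩) o ho x
      simp only [hF.upperUnit_eq] at h1
      simp only [hG₀, h1, isPeriodic_char (neg_mem_dualLattice hβ) o ho x]
    have h2 := cubeMean_translate (c0.mul hchar) hper (s • q)
    change _ = cubeMean (G₀ * char (-β)) * _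
    rw [← h2, mul_comm, ← cubeMean_const_mul]
    congr 1
    funext x
    have hch : char (-β) (x + s • q) * Complex.exp (s * c) = char (-β) x := by
      rw [char_add, mul_assoc, ← char_smul, mul_comm (char (-β) (s • q)), char_mul_char_neg, mul_one]
    rw [Pi.mul_apply, ← hch]
    ring
  have hexp : ∀ (a : ℂ) (s : ℝ), HasDerivAt (fun s : ℝ => a * Complex.exp (s * c))
      (a * c * Complex.exp (s * c)) s := by
    intro a s
    have h1 : HasDerivAt (fun w : ℂ => a * Complex.exp (w * c)) (a * (Complex.exp (s * c) * (1 * c)))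
        (s : ℂ) := (((hasDerivAt_id (s : ℂ)).mul_const c).cexp).const_mul a
    refine h1.comp_ofReal.congr_deriv ?_
    ring
  -- A derivative in the direction `q` multiplies the mean against the character by `c`.
  have step : ∀ {G G' : ℍ[ℝ] → ℂ} {a : ℂ}, Continuous G → Continuous G' →
      (∀ (s : ℝ) x, HasDerivAt (fun s : ℝ => G (x + s • q)) (G' (x + s • q)) s) →
      (∀ s : ℝ, cubeMean (fun x => G (x + s • q) * char (-β) x) = a * Complex.exp (s * c)) →
      ∀ s : ℝ, cubeMean (fun x => G' (x + s • q) * char (-β) x) = a * c * Complex.exp (s * c) := by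
    intro G G' a hGc hGc' hd hG s
    refine HasDerivAt.unique ?_ (hexp a s)
    rw [← funext hG]
    exact hasDerivAt_cubeMean (H := fun s x => G (x + s • q) * char (-β) x)
      (H' := fun s x => G' (x + s • q) * char (-β) x) isOpen_univ
      (fun s _ x => (hd s x).mul_const _) (fun s _ => (kk hGc).comp (f := fun x => (s, x))
        (by fun_prop)) (kk hGc').continuousOn (mem_univ s)
  have d0 := fun (s : ℝ) x => (hs.hasFDerivAt (upper_mem hy.ne' _)).comp_hasDerivAt s
    (hasDerivAt_upper_shift y x q s)
  have d1 := fun (s : ℝ) x => (hs.hasFDerivAt_fderiv_apply (upper_mem hy.ne' (x + s • q))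
    (tangent 0 q)).comp_hasDerivAt s (hasDerivAt_upper_shift y x q s)
  have h3 := step c1 c2 d1 (step c0 c1 d0 hG) 0
  simp only [zero_smul, add_zero, Complex.ofReal_zero, zero_mul, Complex.exp_zero, mul_one] at h3
  rw [h3]
  ring

theorem cubeMean_linear {f₀ f₁ f₂ f₃ : ℍ[ℝ] → ℂ} (c0 : Continuous f₀) (c1 : Continuous f₁)
    (c2 : Continuous f₂) (c3 : Continuous f₃) {a b c d : ℂ}
    (h : ∀ x, a * f₂ x - b * f₁ x + c * f₃ x + d * f₀ x = 0) :
    a * cubeMean f₂ - b * cubeMean f₁ + c * cubeMean f₃ + d * cubeMean f₀ = 0 := by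
  have k0 : Continuous fun x => d * f₀ x := by fun_prop
  have k1 : Continuous fun x => b * f₁ x := by fun_prop
  have k2 : Continuous fun x => a * f₂ x := by fun_prop
  have k3 : Continuous fun x => c * f₃ x := by fun_prop
  simp only [← cubeMean_const_mul]
  have k21 : Continuous fun x => a * f₂ x - b * f₁ x := by fun_prop
  have k213 : Continuous fun x => a * f₂ x - b * f₁ x + c * f₃ x := by fun_prop
  rw [← cubeMean_sub k2 k1, ← cubeMean_add k21 k3, ← cubeMean_add k213 k0]
  simp [h, cubeMean]

/-- The Casimir equation becomes the Bessel equation for each Fourier coefficient. -/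
theorem IsMaassForm.isRadialSolution (hF : IsMaassForm r F) {β : ℍ[ℚ]} (hβ : β ∈ dualLattice) :
    IsRadialSolution (Complex.I * r) (2 * Real.pi * quatAbs β) (radialPart F β)
      (fun y => cubeMean fun x => fderiv ℝ (coordFn F) (upper y x) (tangent 1 0) * char (-β) x)
      (fun y => cubeMean fun x => fderiv ℝ (fderiv ℝ (coordFn F)) (upper y x) (tangent 1 0)
        (tangent 1 0) * char (-β) x) := by
  have hs := hF.smooth
  have cont0 := continuousOn_value hs (-β)
  have cont1 := continuousOn_first hs (-β)
  have cont2 := continuousOn_second hs (-β)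
  refine ⟨fun y hy => ?_, fun y hy => ?_, fun y hy => ?_⟩
  · refine hasDerivAt_cubeMean (H := fun y x => coordFn F (upper y x) * char (-β) x)
      (H' := fun y x => fderiv ℝ (coordFn F) (upper y x) (tangent 1 0) * char (-β) x) isOpen_Ioi
      (fun y hy x => ?_) (fun y hy => continuous_slice cont0 hy) (cont1 _) hy
    exact ((hs.hasFDerivAt (upper_mem (ne_of_gt hy) x)).comp_hasDerivAt y
      (hasDerivAt_upper x y)).mul_const _
  · refine hasDerivAt_cubeMean (H := fun y x => fderiv ℝ (coordFn F) (upper y x) (tangent 1 0)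
      * char (-β) x) (H' := fun y x => fderiv ℝ (fderiv ℝ (coordFn F)) (upper y x) (tangent 1 0)
        (tangent 1 0) * char (-β) x) isOpen_Ioi
      (fun y hy x => ?_) (fun y hy => continuous_slice (cont1 _) hy) (cont2 _) hy
    exact ((hs.hasFDerivAt_fderiv_apply (upper_mem (ne_of_gt hy) x)
      (tangent 1 0)).comp_hasDerivAt y (hasDerivAt_upper x y)).mul_const _
  · have c0 := continuous_slice cont0 hy
    have c1 := continuous_slice (cont1 (tangent 1 0)) hy
    have c2 := continuous_slice (cont2 (tangent 1 0)) hy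
    have c3 : ∀ q : Fin 4, Continuous fun x => fderiv ℝ (fderiv ℝ (coordFn F)) (upper y x)
        (tangent 0 (quatBasis q)) (tangent 0 (quatBasis q)) * char (-β) x := fun q =>
      continuous_slice (cont2 (tangent 0 (quatBasis q))) hy
    have c3' : Continuous fun x => ∑ q : Fin 4, fderiv ℝ (fderiv ℝ (coordFn F)) (upper y x)
        (tangent 0 (quatBasis q)) (tangent 0 (quatBasis q)) * char (-β) x :=
      continuous_finsetSum _ fun q _ => c3 q
    have hint := cubeMean_linear c0 c1 c2 c3' (a := (y : ℂ) ^ 2) (b := 3 * y) (c := (y : ℂ) ^ 2)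
      (d := r ^ 2 + 4) fun x => by
        rw [← Finset.sum_mul]
        linear_combination char (-β) x * hF.pde hy x
    rw [cubeMean_sum Finset.univ fun q _ => c3 q,
      Finset.sum_congr rfl fun q _ => hF.cubeMean_second hβ hy (quatBasis q)] at hint
    have hnorm : ∑ q : Fin 4, (2 * Real.pi * Complex.I * ((toQuatReal β * quatBasis q).re : ℝ) : ℂ) ^ 2
        * radialPart F β y = -((2 * Real.pi * quatAbs β : ℝ) : ℂ) ^ 2 * radialPart F β y := by
      rw [← Finset.sum_mul]
      congr 1
      have h4 : ((quatAbs β : ℝ) : ℂ) ^ 2 = ∑ q : Fin 4, (((toQuatReal β * quatBasis q).re : ℝ) : ℂ) ^ 2 := by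
        rw [← Complex.ofReal_pow, quatAbs, sq_sqrt (by
          exact_mod_cast normSq_nonneg), normSq_def', Fin.sum_univ_four]
        simp only [quatBasis, re_mul, cons_val, quat_re, quat_imI, quat_imJ,
          quat_imK, toQuatReal, quatMap, RingHom.coe_mk, MonoidHom.coe_mk, OneHom.coe_mk, eq_ratCast]
        push_cast
        ring
      simp only [mul_pow, Complex.I_sq, ← Finset.mul_sum]
      rw [← h4]
      push_cast
      ring
    rw [hnorm] at hint
    rw [mul_pow, Complex.I_sq]
    change _ * cubeMean _ - _ * cubeMean _ + _ * radialPart F β y = 0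
    have hrad : radialPart F β y = cubeMean (fun x => coordFn F (upper y x) * char (-β) x) := rfl
    rw [← hrad] at hint
    linear_combination hint

end FourierCoefficients

/-! ### The Fourier expansion -/

section FourierGrowth
open Real MeasureTheory Set Filter Topology

variable {F : GReal → ℂ} {r : ℂ}

theorem coe_nUnip_inv (x : ℍ[ℝ]) : ((nUnip x)⁻¹).val = !![1, -x; 0, 1] := rfl

theorem realDiag_inv (s t : ℝˣ) : (realDiag s t)⁻¹ = realDiag s⁻¹ t⁻¹ := by
  rw [inv_eq_iff_mul_eq_one, realDiag_mul, mul_inv_cancel, mul_inv_cancel]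
  refine Units.ext (Matrix.ext fun i j => ?_)
  rw [coe_realDiag]
  fin_cases i <;> fin_cases j <;> simp

theorem coe_sqrtUnit (y : Ioi (0 : ℝ)) : ((sqrtUnit y : ℝˣ) : ℝ) = sqrt y := rfl

theorem size_upper_le {M : ℝ} {x : ℍ[ℝ]} (hx : ‖x‖ ≤ M) (y : Ioi (0 : ℝ)) (hy : 1 ≤ (y : ℝ)) :
    ∑ i, ∑ j, (‖(nUnip x * aDiag y).val i j‖ + ‖((nUnip x * aDiag y)⁻¹).val i j‖)
      ≤ (2 * M + 4) * y := by
  have hs1 : 1 ≤ sqrt y := one_le_sqrt.2 hy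
  have hsy : sqrt y ≤ y := sqrt_le_iff.2 ⟨by linarith, by nlinarith⟩
  have hi : (sqrt y)⁻¹ ≤ 1 := inv_le_one_of_one_le₀ hs1
  have hi0 : 0 ≤ (sqrt y)⁻¹ := by positivity
  have hM : 0 ≤ M := (norm_nonneg x).trans hx
  rw [mul_inv_rev, aDiag, realDiag_inv, Units.val_mul, Units.val_mul, coe_realDiag, coe_realDiag,
    coe_nUnip, coe_nUnip_inv]
  simp [Fin.sum_univ_two, coe_sqrtUnit, norm_mul, abs_of_nonneg, sqrt_nonneg]
  nlinarith [norm_nonneg x, mul_le_mul hx hi hi0 hM]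

theorem IsMaassForm.norm_radialPart_le (hF : IsMaassForm r F) (β : ℍ[ℚ]) :
    ∃ (C : ℝ) (N : ℕ), ∀ y, 1 ≤ y → ‖radialPart F β y‖ ≤ C * y ^ N := by
  obtain ⟨C, N, hC⟩ := hF.growth
  obtain ⟨M, hM⟩ := (isCompact_Icc (a := (0 : Fin 4 → ℝ)) (b := 1)).exists_bound_of_continuousOn
    continuous_latticeCoord.continuousOn
  have hM0 : 0 ≤ M := (norm_nonneg _).trans (hM 0 ⟨le_rfl, zero_le_one⟩)
  refine ⟨|C| * (2 * M + 4) ^ N, N, fun y hy => norm_cubeMean_le fun t ht => ?_⟩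
  have hy0 : 0 < y := by linarith
  rw [norm_mul, norm_char, mul_one, ← hF.upperUnit_eq ⟨y, hy0⟩, mul_assoc, ← mul_pow]
  refine (hC _).trans ?_
  refine mul_le_mul (le_abs_self C) (pow_le_pow_left₀ (by positivity)
    (size_upper_le (hM t ht) ⟨y, hy0⟩ hy) N) (by positivity) (abs_nonneg C)

theorem quatAbs_pos {β : ℍ[ℚ]} (hβ : β ≠ 0) : 0 < quatAbs β := by
  refine sqrt_pos.2 ?_
  exact_mod_cast lt_of_le_of_ne Quaternion.normSq_nonneg (Ne.symm (Quaternion.normSq_ne_zero.2 hβ))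

/-- The Fourier expansion: the coefficient at `β ≠ 0` is a multiple of `y² K_{√-1 r}(2π|β|y)`. -/
theorem IsMaassForm.fourierIntegral_eq_fourierCoeff (hF : IsMaassForm r F) {β : ℍ[ℚ]}
    (hβ : β ∈ dualLattice) (h0 : β ≠ 0) (y : Ioi (0 : ℝ)) :
    fourierIntegral F β (aDiag y) = fourierCoeff r F β * ((y : ℝ) : ℂ) ^ 2 *
      besselK (Complex.I * r) (2 * Real.pi * quatAbs β * y) := by
  have h : ∃ a : ℂ, ∀ y : Ioi (0 : ℝ), fourierIntegral F β (aDiag y) =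
      a * ((y : ℝ) : ℂ) ^ 2 * besselK (Complex.I * r) (2 * Real.pi * quatAbs β * y) := by
    obtain ⟨C, N, hC⟩ := hF.norm_radialPart_le β
    have hκ : 0 < 2 * Real.pi * quatAbs β := by
      have := quatAbs_pos h0
      have := pi_pos
      positivity
    obtain ⟨a, ha⟩ := (hF.isRadialSolution hβ).exists_eq_bessel hκ hC
    exact ⟨a, fun y => by rw [hF.fourierIntegral_aDiag, ha y y.2]⟩
  rw [fourierCoeff, dif_pos h]
  exact h.choose_spec y

end FourierGrowth

/-! ### Arithmetic of the Hurwitz order -/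

section HurwitzOrder
open Quaternion

/-- Membership in the Hurwitz order, in coordinates. -/
theorem mem_order_iff_coord {x : ℍ[ℚ]} : x ∈ order ↔ (∃ n : ℤ, x.re - x.imK = n) ∧
    (∃ n : ℤ, x.imI - x.imK = n) ∧ (∃ n : ℤ, x.imJ - x.imK = n) ∧ ∃ n : ℤ, 2 * x.imK = n := by
  rw [order, mem_hurwitz_iff]
  simp only [mem_intRange]

theorem mem_order_iff_exists {x : ℍ[ℚ]} : x ∈ order ↔ ∃ a b c d : ℤ,
    x = quat ((a : ℚ) + d / 2) ((b : ℚ) + d / 2) ((c : ℚ) + d / 2) ((d : ℚ) / 2) := by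
  rw [mem_order_iff_coord]
  constructor
  · rintro ⟨⟨a, ha⟩, ⟨b, hb⟩, ⟨c, hc⟩, ⟨d, hd⟩⟩
    refine ⟨a, b, c, d, ?_⟩
    apply ext <;> simp <;> linarith
  · rintro ⟨a, b, c, d, rfl⟩
    exact ⟨⟨a, by simp⟩, ⟨b, by simp⟩, ⟨c, by simp⟩, ⟨d, by simp; ring⟩⟩

theorem natCast_mem_order (n : ℕ) : (n : ℍ[ℚ]) ∈ order := natCast_mem _ n

theorem star_mem_order {x : ℍ[ℚ]} (hx : x ∈ order) : star x ∈ order := by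
  obtain ⟨a, b, c, d, rfl⟩ := mem_order_iff_exists.1 hx
  rw [mem_order_iff_coord]
  exact ⟨⟨a + d, by simp; ring⟩, ⟨-b, by simp⟩, ⟨-c, by simp⟩, ⟨-d, by simp; ring⟩⟩

theorem exists_normSq_eq {x : ℍ[ℚ]} (hx : x ∈ order) : ∃ n : ℕ, normSq x = n := by
  obtain ⟨a, b, c, d, rfl⟩ := mem_order_iff_exists.1 hx
  have h : normSq (quat ((a : ℚ) + d / 2) ((b : ℚ) + d / 2) ((c : ℚ) + d / 2) ((d : ℚ) / 2))
      = ((a ^ 2 + b ^ 2 + c ^ 2 + a * d + b * d + c * d + d ^ 2 : ℤ) : ℚ) := by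
    rw [normSq_def']
    push_cast
    simp
    ring
  have h0 : (0 : ℚ) ≤ ((a ^ 2 + b ^ 2 + c ^ 2 + a * d + b * d + c * d + d ^ 2 : ℤ) : ℚ) := by
    rw [← h]; exact normSq_nonneg
  obtain ⟨n, hn⟩ := Int.eq_ofNat_of_zero_le (Int.cast_nonneg_iff.1 h0)
  exact ⟨n, by rw [h, hn]; simp⟩

/-- The Hurwitz order is Euclidean: each quaternion is at distance less than one from it. -/
theorem exists_near (x : ℍ[ℚ]) : ∃ q ∈ order, normSq (x - q) < 1 := by
  set d : ℤ := round (2 * x.imK) with hd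
  have h4 := abs_le.1 (abs_sub_round (2 * x.imK))
  have h1 := abs_le.1 (abs_sub_round (x.re - d / 2))
  have h2 := abs_le.1 (abs_sub_round (x.imI - d / 2))
  have h3 := abs_le.1 (abs_sub_round (x.imJ - d / 2))
  rw [← hd] at h4
  refine ⟨_, mem_order_iff_exists.2 ⟨round (x.re - d / 2), round (x.imI - d / 2),
    round (x.imJ - d / 2), d, rfl⟩, ?_⟩
  rw [normSq_def']
  simp only [re_sub, imI_sub, imJ_sub, imK_sub, quat_re, quat_imI, quat_imJ, quat_imK]
  nlinarith

/-- An element of a lattice divided by coprime integers. -/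
theorem mem_of_coprime {E : Type} [AddCommGroup E] (L : AddSubgroup E) {m n : ℕ} (h : m.Coprime n)
    {x : E} (hm : m • x ∈ L) (hn : n • x ∈ L) : x ∈ L := by
  have h1 := Nat.gcd_eq_gcd_ab m n
  rw [h] at h1
  have h2 : x = m.gcdA n • (m • x) + m.gcdB n • (n • x) := by
    rw [← natCast_zsmul, ← natCast_zsmul, smul_smul, smul_smul, ← add_smul, mul_comm _ (m : ℤ),
      mul_comm _ (n : ℤ), ← h1]
    simp
  rw [h2]
  exact L.add_mem (L.zsmul_mem hm _) (L.zsmul_mem hn _)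

/-- The dual lattice as an additive group. -/
def dualGroup : AddSubgroup ℍ[ℚ] where
  carrier := dualLattice
  zero_mem' := fun x _ => ⟨0, by simp⟩
  add_mem' := fun {a b} ha hb x hx => by
    obtain ⟨m, hm⟩ := ha x hx
    obtain ⟨n, hn⟩ := hb x hx
    exact ⟨m + n, by rw [add_mul, re_add, hm, hn, Int.cast_add]⟩
  neg_mem' := fun h => neg_mem_dualLattice h

theorem dualLattice_mul {β x : ℍ[ℚ]} (hβ : β ∈ dualLattice) (hx : x ∈ order) : β * x ∈ dualLattice :=
  fun y hy => by
    rw [mul_assoc]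
    exact hβ _ (mul_mem hx hy)

theorem mul_dualLattice {β x : ℍ[ℚ]} (hβ : β ∈ dualLattice) (hx : x ∈ order) : x * β ∈ dualLattice :=
  fun y hy => by
    rw [mul_assoc, re_mul_comm, mul_assoc]
    exact hβ _ (mul_mem hy hx)

/-- The dual lattice consists of the integral quaternions with even coordinate sum. -/
theorem mem_dualLattice_iff {β : ℍ[ℚ]} : β ∈ dualLattice ↔ ∃ a b c d : ℤ,
    β = quat (a : ℚ) b c d ∧ Even (a + b + c + d) := by
  constructor
  · intro h
    obtain ⟨a, ha⟩ := h (quat 1 0 0 0) (mem_order_iff_exists.2 ⟨1, 0, 0, 0, by simp⟩)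
    obtain ⟨b, hb⟩ := h (quat 0 1 0 0) (mem_order_iff_exists.2 ⟨0, 1, 0, 0, by simp⟩)
    obtain ⟨c, hc⟩ := h (quat 0 0 1 0) (mem_order_iff_exists.2 ⟨0, 0, 1, 0, by simp⟩)
    obtain ⟨d, hd⟩ := h (quat (1 / 2) (1 / 2) (1 / 2) (1 / 2))
      (mem_order_iff_exists.2 ⟨0, 0, 0, 1, by simp⟩)
    simp only [re_mul, quat_re, quat_imI, quat_imJ, quat_imK] at ha hb hc hd
    refine ⟨a, -b, -c, a + b + c - 2 * d, ?_, ⟨a - d, by ring⟩⟩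
    apply ext <;> simp <;> linarith
  · rintro ⟨a, b, c, d, rfl, n, hn⟩ x hx
    obtain ⟨a', b', c', d', rfl⟩ := mem_order_iff_exists.1 hx
    refine ⟨a * a' - b * b' - c * c' + (n - b - c - d) * d', ?_⟩
    have hn' : (a : ℚ) + b + c + d = n + n := by exact_mod_cast hn
    simp only [re_mul, quat_re, quat_imI, quat_imJ, quat_imK]
    push_cast
    linear_combination (d' : ℚ) / 2 * hn'

theorem dualLattice_subset {β : ℍ[ℚ]} (h : β ∈ dualLattice) : β ∈ order := by
  obtain ⟨a, b, c, d, rfl, -⟩ := mem_dualLattice_iff.1 h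
  exact mem_order_iff_exists.2 ⟨a - d, b - d, c - d, 2 * d, by push_cast; congr 1 <;> ring⟩

theorem normSq_varpi : normSq varpi = 2 := by
  rw [normSq_def', varpi]
  norm_num

theorem varpi_mem : varpi ∈ dualLattice :=
  mem_dualLattice_iff.2 ⟨1, 1, 0, 0, by simp [varpi], 1, by norm_num⟩

theorem exists_varpi_mul {β : ℍ[ℚ]} (h : β ∈ dualLattice) : ∃ x ∈ order, β = varpi * x := by
  obtain ⟨a, b, c, d, rfl, n, hn⟩ := mem_dualLattice_iff.1 h
  have hn' : (a : ℚ) + b + c + d = n + n := by exact_mod_cast hn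
  refine ⟨quat ((a + b) / 2) ((b - a) / 2) ((c + d) / 2) ((d - c) / 2), ?_, ?_⟩
  · refine mem_order_iff_coord.2 ⟨⟨n - d, ?_⟩, ⟨n - a - d, ?_⟩, ⟨c, ?_⟩, ⟨d - c, ?_⟩⟩
    all_goals
      simp only [quat_re, quat_imI, quat_imJ, quat_imK]
      push_cast
      linarith
  · apply ext
    all_goals
      simp only [varpi, re_mul, imI_mul, imJ_mul, imK_mul, quat_re, quat_imI, quat_imJ, quat_imK]
      ring

/-- An element of the Hurwitz order of even norm lies in the dual lattice. -/
theorem mem_dualLattice_of_even {x : ℍ[ℚ]} (hx : x ∈ order) {n : ℤ}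
    (hn : normSq x = 2 * n) : x ∈ dualLattice := by
  obtain ⟨a, b, c, d, rfl⟩ := mem_order_iff_exists.1 hx
  have h : a ^ 2 + b ^ 2 + c ^ 2 + a * d + b * d + c * d + d ^ 2 = 2 * n := by
    rw [normSq_def'] at hn
    simp only [quat_re, quat_imI, quat_imJ, quat_imK] at hn
    have : ((a ^ 2 + b ^ 2 + c ^ 2 + a * d + b * d + c * d + d ^ 2 : ℤ) : ℚ) = ((2 * n : ℤ) : ℚ) := by
      push_cast
      linarith
    exact_mod_cast this
  have hpar : Even d ∧ Even (a + b + c) := by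
    have h2 : Even (a ^ 2 + b ^ 2 + c ^ 2 + a * d + b * d + c * d + d ^ 2) := by
      rw [h]; exact even_two_mul n
    simp only [Int.even_add, Int.even_mul, Int.even_pow, ne_eq, OfNat.ofNat_ne_zero,
      not_false_eq_true, and_true] at h2 ⊢
    tauto
  obtain ⟨⟨e, rfl⟩, f, hf⟩ := hpar
  refine mem_dualLattice_iff.2 ⟨a + e, b + e, c + e, e, ?_, f + 2 * e, ?_⟩
  · push_cast
    congr 1 <;> ring
  · linarith

end HurwitzOrder

/-! ### Invariants of lattice vectors and the Maass relations -/

section Invariants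
open Quaternion
open Finset hiding coe_pow

/-- Division by a positive integer. -/
def divNat (x : ℍ[ℚ]) (m : ℕ) : ℍ[ℚ] := (m : ℚ)⁻¹ • x

theorem natCast_mul_eq_smul (m : ℕ) (x : ℍ[ℚ]) : (m : ℍ[ℚ]) * x = (m : ℚ) • x := by
  rw [Nat.cast_smul_eq_nsmul, nsmul_eq_mul]

theorem natCast_mul_divNat {m : ℕ} (hm : m ≠ 0) (x : ℍ[ℚ]) : (m : ℍ[ℚ]) * divNat x m = x := by
  rw [natCast_mul_eq_smul, divNat, smul_smul, mul_inv_cancel₀ (by exact_mod_cast hm), one_smul]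

theorem divNat_natCast_mul {m : ℕ} (hm : m ≠ 0) (x : ℍ[ℚ]) : divNat ((m : ℍ[ℚ]) * x) m = x := by
  rw [natCast_mul_eq_smul, divNat, smul_smul, inv_mul_cancel₀ (by exact_mod_cast hm), one_smul]

theorem divNat_mem_iff {m : ℕ} (hm : m ≠ 0) {x : ℍ[ℚ]} :
    divNat x m ∈ order ↔ ∃ y ∈ order, x = (m : ℍ[ℚ]) * y :=
  ⟨fun h => ⟨_, h, (natCast_mul_divNat hm x).symm⟩, by
    rintro ⟨y, hy, rfl⟩
    rwa [divNat_natCast_mul hm]⟩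

theorem mul_divNat (x y : ℍ[ℚ]) (m : ℕ) : x * divNat y m = divNat (x * y) m := by
  rw [divNat, divNat, mul_smul_comm]

theorem divNat_mul (x y : ℍ[ℚ]) (m : ℕ) : divNat x m * y = divNat (x * y) m := by
  rw [divNat, divNat, smul_mul_assoc]

theorem normSq_divNat (x : ℍ[ℚ]) (m : ℕ) :
    Quaternion.normSq (divNat x m) = Quaternion.normSq x / (m : ℚ) ^ 2 := by
  rw [divNat, normSq_smul]
  ring

theorem normSq_natCast (m : ℕ) : Quaternion.normSq (m : ℍ[ℚ]) = (m : ℚ) ^ 2 := by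
  rw [Quaternion.normSq_natCast]

theorem natCast_ne_zero {m : ℕ} (hm : m ≠ 0) : (m : ℍ[ℚ]) ≠ 0 := by
  rw [← normSq_ne_zero, normSq_natCast]
  exact pow_ne_zero 2 (by exact_mod_cast hm)

theorem order_mem_of_coprime {m n : ℕ} (h : m.Coprime n) {x : ℍ[ℚ]} (hm : (m : ℍ[ℚ]) * x ∈ order)
    (hn : (n : ℍ[ℚ]) * x ∈ order) : x ∈ order :=
  mem_of_coprime order.toAddSubgroup h (by rwa [nsmul_eq_mul]) (by rwa [nsmul_eq_mul])

theorem dual_mem_of_coprime {m n : ℕ} (h : m.Coprime n) {x : ℍ[ℚ]}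
    (hm : (m : ℍ[ℚ]) * x ∈ dualLattice) (hn : (n : ℍ[ℚ]) * x ∈ dualLattice) : x ∈ dualLattice :=
  mem_of_coprime dualGroup h (by rwa [nsmul_eq_mul]) (by rwa [nsmul_eq_mul])

theorem two_mul_mem {x : ℍ[ℚ]} (hx : x ∈ order) : ((2 : ℕ) : ℍ[ℚ]) * x ∈ dualLattice := by
  have h : ((2 : ℕ) : ℍ[ℚ]) = varpi * star varpi := by
    rw [self_mul_star, normSq_varpi, ← coe_natCast]
    norm_num
  rw [h, mul_assoc]
  exact dualLattice_mul varpi_mem (mul_mem (star_mem_order (dualLattice_subset varpi_mem)) hx)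

theorem natCast_comm (m : ℕ) (x : ℍ[ℚ]) : (m : ℍ[ℚ]) * x = x * m := Nat.cast_comm m x

theorem HasInvariants.varpi_mul {β : ℍ[ℚ]} {K : ℚ} {u n : ℕ} (h : HasInvariants β K u n) :
    HasInvariants (varpi * β) (2 * K) (u + 1) n := by
  obtain ⟨hn, ⟨β₀, h0, rfl⟩, rfl⟩ := h
  refine ⟨hn, ⟨β₀, h0, by rw [pow_succ']; noncomm_ring⟩, ?_⟩
  rw [map_mul _ varpi, normSq_varpi]

theorem HasInvariants.natCast_mul {β : ℍ[ℚ]} {K : ℚ} {u n m : ℕ} (h : HasInvariants β K u n)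
    (hm : Odd m) : HasInvariants ((m : ℍ[ℚ]) * β) ((m : ℚ) ^ 2 * K) u (m * n) := by
  obtain ⟨hn, ⟨β₀, h0, rfl⟩, rfl⟩ := h
  refine ⟨hm.mul hn, ⟨β₀, h0, ?_⟩, by rw [map_mul _ (m : ℍ[ℚ]), normSq_natCast]⟩
  rw [Nat.cast_mul, ← mul_assoc, ← mul_assoc, ← mul_assoc, natCast_comm m (varpi ^ u)]

/-- Every nonzero element of the dual lattice has invariants. -/
theorem exists_hasInvariants {β : ℍ[ℚ]} (hβ : β ∈ dualLattice) (h0 : β ≠ 0) :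
    ∃ u n, HasInvariants β (Quaternion.normSq β) u n := by
  suffices H : ∀ N : ℕ, ∀ β ∈ dualLattice, β ≠ 0 → Quaternion.normSq β = N →
      ∃ u n, HasInvariants β (Quaternion.normSq β) u n by
    obtain ⟨N, hN⟩ := exists_normSq_eq (dualLattice_subset hβ)
    exact H N β hβ h0 hN
  intro N
  induction N using Nat.strong_induction_on with
  | _ N ih =>
    intro β hβ h0 hN
    have hpos : (0 : ℚ) < Quaternion.normSq β :=
      lt_of_le_of_ne normSq_nonneg (Ne.symm (normSq_ne_zero.2 h0))
    obtain ⟨x, hx, hxβ⟩ := exists_varpi_mul hβ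
    by_cases h2 : ∃ y ∈ order, β = varpi ^ 2 * y
    · obtain ⟨y, hy, rfl⟩ := h2
      have hm : varpi * y ∈ dualLattice := dualLattice_mul varpi_mem hy
      obtain ⟨M, hM⟩ := exists_normSq_eq (dualLattice_subset hm)
      have hmul : varpi ^ 2 * y = varpi * (varpi * y) := by rw [pow_two, mul_assoc]
      have hlt : M < N := by
        rw [hmul, map_mul, normSq_varpi, hM] at hN hpos
        have : (M : ℚ) < N := by linarith
        exact_mod_cast this
      obtain ⟨u, n, h⟩ := ih M hlt _ hm (fun h => h0 (by rw [hmul, h, mul_zero])) hM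
      refine ⟨u + 1, n, ?_⟩
      have := h.varpi_mul
      rwa [hmul, map_mul, normSq_varpi]
    by_cases hodd : ∃ n : ℕ, Odd n ∧ 1 < n ∧ ∃ y ∈ order, β = (n : ℍ[ℚ]) * y
    · obtain ⟨n, hn, hn1, y, hy, rfl⟩ := hodd
      have hm : y ∈ dualLattice := dual_mem_of_coprime (m := n) (n := 2)
        (Nat.coprime_two_right.2 hn) hβ (two_mul_mem hy)
      obtain ⟨M, hM⟩ := exists_normSq_eq hy
      have hlt : M < N := by
        rw [map_mul, normSq_natCast, hM] at hN hpos
        have h1 : (1 : ℚ) < n := by exact_mod_cast hn1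
        have h3 : (0 : ℚ) < M := pos_of_mul_pos_right hpos (by positivity)
        have h4 : (1 : ℚ) < (n : ℚ) ^ 2 := by nlinarith
        have : (M : ℚ) < N := by nlinarith
        exact_mod_cast this
      obtain ⟨u, n', h⟩ := ih M hlt _ hm (fun h => h0 (by rw [h, mul_zero])) hM
      refine ⟨u, n * n', ?_⟩
      rw [map_mul, normSq_natCast]
      exact h.natCast_mul hn
    · exact ⟨0, 1, odd_one, ⟨β, ⟨hβ, h0, ⟨x, hx, hxβ⟩, h2, fun n hn hn1 h => hodd ⟨n, hn, hn1, h⟩⟩,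
        by simp⟩, rfl⟩

/-- The exponent `u` is determined by the norm. -/
theorem HasInvariants.exists_odd {β : ℍ[ℚ]} {K : ℚ} {u n : ℕ} (h : HasInvariants β K u n) :
    ∃ m : ℕ, Odd m ∧ K = ((2 ^ (u + 1) * m : ℕ) : ℚ) := by
  obtain ⟨hn, ⟨β₀, ⟨hβ₀, -, ⟨x, hx, rfl⟩, h2, -⟩, rfl⟩, rfl⟩ := h
  obtain ⟨N, hN⟩ := exists_normSq_eq hx
  have hNodd : Odd N := by
    by_contra hev
    obtain ⟨c, hc⟩ := Nat.not_odd_iff_even.1 hev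
    have : x ∈ dualLattice := mem_dualLattice_of_even (n := c) hx (by rw [hN, hc]; push_cast; ring)
    obtain ⟨y, hy, rfl⟩ := exists_varpi_mul this
    exact h2 ⟨y, hy, by rw [pow_two, mul_assoc]⟩
  refine ⟨n ^ 2 * N, (hn.pow).mul hNodd, ?_⟩
  rw [map_mul, map_mul, map_pow, normSq_varpi, normSq_natCast, map_mul, normSq_varpi, hN]
  push_cast
  ring

theorem two_pow_injective {u u' m m' : ℕ} (hm : Odd m) (hm' : Odd m')
    (h : 2 ^ (u + 1) * m = 2 ^ (u' + 1) * m') : u = u' := by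
  have key : ∀ {u u' m m' : ℕ}, Odd m' → 2 ^ (u + 1) * m = 2 ^ (u' + 1) * m' → u ≤ u' := by
    intro u u' m m' hm' h
    have h1 : 2 ^ (u + 1) ∣ 2 ^ (u' + 1) * m' := ⟨m, h.symm⟩
    have h2 : (2 ^ (u + 1)).Coprime m' := Nat.Coprime.pow_left _ (Nat.coprime_two_left.2 hm')
    have := (Nat.pow_dvd_pow_iff_le_right (by norm_num)).1 (h2.dvd_of_dvd_mul_right h1)
    omega
  exact le_antisymm (key hm' h) (key hm h.symm)

/-- The invariant `n` is the odd content: an odd integer divides `β` in the Hurwitz order if and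
only if it divides `n`. -/
theorem HasInvariants.divNat_mem_iff {β : ℍ[ℚ]} {K : ℚ} {u n m : ℕ} (h : HasInvariants β K u n)
    (hm : Odd m) : divNat β m ∈ order ↔ m ∣ n := by
  have hm0 : m ≠ 0 := hm.pos.ne'
  obtain ⟨hn, ⟨β₀, ⟨hβ₀, -, -, -, hprim⟩, rfl⟩, rfl⟩ := h
  set γ := varpi ^ u * β₀ with hγ
  have hγm : γ ∈ order := mul_mem (pow_mem (dualLattice_subset varpi_mem) u) (dualLattice_subset hβ₀)
  have e : varpi ^ u * (n : ℍ[ℚ]) * β₀ = (n : ℍ[ℚ]) * γ := by rw [hγ, ← natCast_comm, mul_assoc]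
  rw [e]
  constructor
  · intro h
    obtain ⟨g, hg⟩ : ∃ g, g = m.gcd n := ⟨_, rfl⟩
    have hg0 : g ≠ 0 := by rw [hg]; exact (Nat.gcd_pos_of_pos_left n hm.pos).ne'
    obtain ⟨m₁, n₁, hcop, hm1, hn1⟩ := Nat.exists_coprime m n
    rw [← hg] at hm1 hn1
    have hm10 : m₁ ≠ 0 := fun h => hm0 (by rw [hm1, h, zero_mul])
    have hm1odd : Odd m₁ := by
      rw [hm1] at hm
      exact Nat.Odd.of_mul_left hm
    have h1 : (n₁ : ℍ[ℚ]) * divNat γ m₁ ∈ order := by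
      convert h using 1
      have hg' : (g : ℚ) ≠ 0 := by exact_mod_cast hg0
      have hm' : (m₁ : ℚ) ≠ 0 := by exact_mod_cast hm10
      rw [natCast_mul_eq_smul, natCast_mul_eq_smul, divNat, divNat, smul_smul, smul_smul, hm1, hn1]
      congr 1
      push_cast
      field_simp
    have h2 : divNat γ m₁ ∈ order := order_mem_of_coprime hcop
      (by rwa [natCast_mul_divNat hm10]) h1
    have h3 : divNat β₀ m₁ ∈ order := by
      refine order_mem_of_coprime (m := m₁) (n := 2 ^ u)
        (Nat.Coprime.pow_right u (Nat.coprime_two_right.2 hm1odd))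
        (by rw [natCast_mul_divNat hm10]; exact dualLattice_subset hβ₀) ?_
      have e2 : ((2 ^ u : ℕ) : ℍ[ℚ]) = star varpi ^ u * varpi ^ u := by
        have hc : Commute (star varpi) varpi := by
          change _ = _
          rw [star_mul_self, self_mul_star]
        rw [← hc.mul_pow, star_mul_self, normSq_varpi, ← coe_natCast, ← coe_pow]
        norm_num
      rw [e2, mul_assoc, mul_divNat]
      exact mul_mem (pow_mem (star_mem_order (dualLattice_subset varpi_mem)) u) h2
    have h4 : m₁ = 1 := by
      by_contra hne
      exact hprim m₁ hm1odd (by omega) ((MaassLift.divNat_mem_iff hm10).1 h3)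
    rw [hm1, h4, one_mul, hn1]
    exact dvd_mul_left _ _
  · rintro ⟨k, rfl⟩
    rw [Nat.cast_mul, mul_assoc, divNat_natCast_mul hm0]
    exact mul_mem (natCast_mem_order k) hγm

theorem dvd_eq_of_iff {n n' : ℕ} (hn : Odd n) (hn' : Odd n') (h : ∀ m, Odd m → (m ∣ n ↔ m ∣ n')) :
    n = n' :=
  Nat.dvd_antisymm ((h n hn).1 dvd_rfl) ((h n' hn').2 dvd_rfl)

/-- A coefficient of a family with Maass relations depends only on the norm and the odd content. -/
theorem MaassRelations.eq_of_content {A : ℍ[ℚ] → ℂ} (hA : MaassRelations A) {β γ : ℍ[ℚ]}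
    (hβ : β ∈ dualLattice) (hβ0 : β ≠ 0) (hγ : γ ∈ dualLattice)
    (hnorm : Quaternion.normSq γ = Quaternion.normSq β)
    (hcont : ∀ m : ℕ, Odd m → (divNat β m ∈ order ↔ divNat γ m ∈ order)) : A γ = A β := by
  obtain ⟨a, ha, -⟩ := hA
  have hγ0 : γ ≠ 0 := by
    rintro rfl
    rw [map_zero] at hnorm
    exact normSq_ne_zero.2 hβ0 hnorm.symm
  obtain ⟨u, n, h⟩ := exists_hasInvariants hβ hβ0
  obtain ⟨u', n', h'⟩ := exists_hasInvariants hγ hγ0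
  obtain ⟨m, hm, e⟩ := h.exists_odd
  obtain ⟨m', hm', e'⟩ := h'.exists_odd
  have hu : u' = u := two_pow_injective hm' hm (by
    rw [hnorm, e] at e'
    exact_mod_cast e'.symm)
  have hn : n' = n := dvd_eq_of_iff h'.1 h.1 fun m hm => by
    rw [← h'.divNat_mem_iff hm, ← h.divNat_mem_iff hm, hcont m hm]
  rw [ha _ _ _ _ h, ha _ _ _ _ h', hnorm, hu, hn]

theorem sum_divisors_prime_mul {p k n' : ℕ} (hp : p.Prime) (hn' : n' ≠ 0) (hpn : ¬ p ∣ n')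
    (f : ℕ → ℂ) : ∑ d ∈ (p * (p ^ k * n')).divisors, f d
      = ∑ d ∈ n'.divisors, f d + ∑ d ∈ (p ^ k * n').divisors, f (p * d) := by
  have hn : p ^ k * n' ≠ 0 := mul_ne_zero (pow_ne_zero _ hp.ne_zero) hn'
  rw [← sum_filter_add_sum_filter_not _ (fun d => ¬ p ∣ d)]
  congr 1
  · refine sum_congr (ext fun d => ?_) fun _ _ => rfl
    simp only [mem_filter, Nat.mem_divisors]
    constructor
    · rintro ⟨⟨h1, -⟩, h2⟩
      refine ⟨?_, hn'⟩
      rw [← mul_assoc, ← pow_succ'] at h1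
      exact (Nat.Coprime.pow_right _ ((Nat.Prime.coprime_iff_not_dvd hp).2 h2).symm).dvd_of_dvd_mul_left
        h1
    · rintro ⟨h1, -⟩
      exact ⟨⟨(h1.mul_left _).mul_left _, mul_ne_zero hp.ne_zero hn⟩, fun h => hpn (h.trans h1)⟩
  · rw [← sum_image (s := (p ^ k * n').divisors) (g := fun d => p * d)
      fun a _ b _ h => Nat.eq_of_mul_eq_mul_left hp.pos h]
    refine sum_congr (ext fun d => ?_) fun _ _ => rfl
    simp only [mem_filter, Nat.mem_divisors, not_not, mem_image]
    constructor
    · rintro ⟨⟨h1, -⟩, d, rfl⟩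
      exact ⟨d, ⟨Nat.dvd_of_mul_dvd_mul_left hp.pos h1, hn⟩, rfl⟩
    · rintro ⟨d, ⟨h1, -⟩, rfl⟩
      exact ⟨⟨Nat.mul_dvd_mul_left p h1, mul_ne_zero hp.ne_zero hn⟩, dvd_mul_right p d⟩

/-- The relation `A(pβ) = A(γ) + p A(β)`, where `γ` has the norm of `pβ` and its odd content is the
part of the odd content of `β` that is prime to `p`. -/
theorem MaassRelations.prime_mul {A : ℍ[ℚ] → ℂ} (hA : MaassRelations A) {p : ℕ} (hp : p.Prime)
    (hp2 : p ≠ 2) {β γ : ℍ[ℚ]} (hβ : β ∈ dualLattice) (hβ0 : β ≠ 0) (hγ : γ ∈ dualLattice)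
    (hnorm : Quaternion.normSq γ = (p : ℚ) ^ 2 * Quaternion.normSq β)
    (hcont : ∀ m : ℕ, Odd m → (divNat γ m ∈ order ↔ ¬ p ∣ m ∧ divNat β m ∈ order)) :
    A ((p : ℍ[ℚ]) * β) = A γ + p * A β := by
  obtain ⟨a, ha, -, -, hrel⟩ := hA
  have hpodd : Odd p := hp.odd_of_ne_two hp2
  have hp0 : (p : ℚ) ≠ 0 := by exact_mod_cast hp.ne_zero
  have hγ0 : γ ≠ 0 := by
    rintro rfl
    rw [map_zero] at hnorm
    exact mul_ne_zero (pow_ne_zero 2 hp0) (normSq_ne_zero.2 hβ0) hnorm.symm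
  obtain ⟨u, n, h⟩ := exists_hasInvariants hβ hβ0
  obtain ⟨u', n', h'⟩ := exists_hasInvariants hγ hγ0
  obtain ⟨m, hm, e⟩ := h.exists_odd
  obtain ⟨m', hm', e'⟩ := h'.exists_odd
  obtain rfl : u' = u := two_pow_injective hm' ((hpodd.pow (n := 2)).mul hm) (by
    rw [hnorm, e] at e'
    have : ((2 ^ (u' + 1) * m' : ℕ) : ℚ) = ((2 ^ (u + 1) * (p ^ 2 * m) : ℕ) : ℚ) := by
      rw [← e']; push_cast; ring
    exact_mod_cast this)
  have hdvd : ∀ m : ℕ, Odd m → (m ∣ n' ↔ ¬ p ∣ m ∧ m ∣ n) := fun m hm => by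
    rw [← h'.divNat_mem_iff hm, ← h.divNat_mem_iff hm, hcont m hm]
  have hpn' := ((hdvd n' h'.1).1 dvd_rfl).1
  obtain ⟨k, n₀, hn₀, hn⟩ := Nat.exists_eq_pow_mul_and_not_dvd (n := n) h.1.pos.ne' p hp.ne_one
  have hn₀odd : Odd n₀ := by
    have := h.1
    rw [hn] at this
    exact Nat.Odd.of_mul_right this
  obtain rfl : n' = n₀ := by
    refine Nat.dvd_antisymm ?_ ((hdvd n₀ hn₀odd).2 ⟨hn₀, by rw [hn]; exact dvd_mul_left _ _⟩)
    have h1 := ((hdvd n' h'.1).1 dvd_rfl).2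
    rw [hn] at h1
    exact (Nat.Coprime.pow_right k ((Nat.Prime.coprime_iff_not_dvd hp).2 hpn').symm).dvd_of_dvd_mul_left
      h1
  have hpβ := h.natCast_mul hpodd
  rw [ha _ _ _ _ hpβ, hrel _ _ _ _ hpβ, hn, sum_divisors_prime_mul hp h'.1.pos.ne' hn₀,
    ha _ _ _ _ h', hrel _ _ _ _ h', ha _ _ _ _ h, hrel _ _ _ _ h, hnorm, mul_sum, hn]
  congr 1
  refine sum_congr rfl fun d _ => ?_
  push_cast
  rw [mul_assoc]
  congr 3
  rw [mul_pow, mul_div_mul_left _ _ (pow_ne_zero 2 hp0)]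

end Invariants

/-! ### Localization at an odd prime -/

section Localization
open Quaternion
open Matrix hiding zpow_neg

variable {p : ℕ} [hp : Fact p.Prime]

theorem mem_closure_inv_iff {q : ℚ} : q ∈ Subring.closure {(p : ℚ)⁻¹} ↔
    ∃ (k : ℕ) (n : ℤ), (p : ℚ) ^ k * q = n := by
  have hp0 : (p : ℚ) ≠ 0 := by exact_mod_cast hp.out.ne_zero
  constructor
  · intro h
    induction h using Subring.closure_induction with
    | mem x hx =>
      rw [Set.mem_singleton_iff] at hx
      exact ⟨1, 1, by rw [hx, pow_one, mul_inv_cancel₀ hp0, Int.cast_one]⟩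
    | zero => exact ⟨0, 0, by simp⟩
    | one => exact ⟨0, 1, by simp⟩
    | add x y _ _ hx hy =>
      obtain ⟨k, m, hm⟩ := hx
      obtain ⟨l, n, hn⟩ := hy
      exact ⟨k + l, p ^ l * m + p ^ k * n, by push_cast; rw [← hm, ← hn]; ring⟩
    | neg x _ hx =>
      obtain ⟨k, m, hm⟩ := hx
      exact ⟨k, -m, by push_cast; rw [← hm]; ring⟩
    | mul x y _ _ hx hy =>
      obtain ⟨k, m, hm⟩ := hx
      obtain ⟨l, n, hn⟩ := hy
      exact ⟨k + l, m * n, by push_cast; rw [← hm, ← hn]; ring⟩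
  · rintro ⟨k, n, h⟩
    have : q = ((p : ℚ)⁻¹) ^ k * n := by
      rw [← h, ← mul_assoc, ← mul_pow, inv_mul_cancel₀ hp0, one_pow, one_mul]
    rw [this]
    exact mul_mem (pow_mem (Subring.subset_closure (Set.mem_singleton _)) k) (intCast_mem _ n)

theorem order_le_orderAway {p : ℕ} {x : ℍ[ℚ]} (h : x ∈ order) : x ∈ orderAway p := by
  rw [mem_order_iff_coord] at h
  obtain ⟨⟨a, ha⟩, ⟨b, hb⟩, ⟨c, hc⟩, ⟨d, hd⟩⟩ := h
  rw [orderAway, mem_hurwitz_iff, ha, hb, hc, hd]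
  exact ⟨intCast_mem _ _, intCast_mem _ _, intCast_mem _ _, intCast_mem _ _⟩

theorem smul_inv_pow_mem {p : ℕ} (k : ℕ) {x : ℍ[ℚ]} (h : x ∈ orderAway p) :
    ((p : ℚ) ^ k)⁻¹ • x ∈ orderAway p := by
  rw [orderAway, mem_hurwitz_iff] at h ⊢
  have hq : ((p : ℚ) ^ k)⁻¹ ∈ Subring.closure {(p : ℚ)⁻¹} := by
    rw [← inv_pow]
    exact pow_mem (Subring.subset_closure (Set.mem_singleton _)) k
  simp only [re_smul, imI_smul, imJ_smul, imK_smul, smul_eq_mul, ← mul_sub]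
  rw [mul_left_comm]
  exact ⟨mul_mem hq h.1, mul_mem hq h.2.1, mul_mem hq h.2.2.1, mul_mem hq h.2.2.2⟩

theorem mem_orderAway_iff {x : ℍ[ℚ]} : x ∈ orderAway p ↔
    ∃ k : ℕ, ((p ^ k : ℕ) : ℍ[ℚ]) * x ∈ order := by
  have hp0 : (p : ℚ) ≠ 0 := by exact_mod_cast hp.out.ne_zero
  constructor
  · intro h
    rw [orderAway, mem_hurwitz_iff] at h
    simp only [mem_closure_inv_iff] at h
    obtain ⟨⟨k₁, a, ha⟩, ⟨k₂, b, hb⟩, ⟨k₃, c, hc⟩, ⟨k₄, d, hd⟩⟩ := h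
    refine ⟨k₁ + k₂ + k₃ + k₄, mem_order_iff_coord.2 ⟨⟨p ^ (k₂ + k₃ + k₄) * a, ?_⟩,
      ⟨p ^ (k₁ + k₃ + k₄) * b, ?_⟩, ⟨p ^ (k₁ + k₂ + k₄) * c, ?_⟩, ⟨p ^ (k₁ + k₂ + k₃) * d, ?_⟩⟩⟩
    all_goals
      rw [natCast_mul_eq_smul]
      simp only [re_smul, imI_smul, imJ_smul, imK_smul, smul_eq_mul]
      push_cast
    · rw [← ha]; ring
    · rw [← hb]; ring
    · rw [← hc]; ring
    · rw [← hd]; ring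
  · rintro ⟨k, h⟩
    have e : x = ((p : ℚ) ^ k)⁻¹ • (((p ^ k : ℕ) : ℍ[ℚ]) * x) := by
      rw [natCast_mul_eq_smul, smul_smul]
      push_cast
      rw [inv_mul_cancel₀ (pow_ne_zero k hp0), one_smul]
    rw [e]
    exact smul_inv_pow_mem k (order_le_orderAway h)

theorem int_of_norm_le_one {q : ℚ} (h : q ∈ Subring.closure {(p : ℚ)⁻¹}) (h1 : ‖(q : ℚ_[p])‖ ≤ 1) :
    ∃ n : ℤ, q = n := by
  have hp0 : (p : ℚ) ≠ 0 := by exact_mod_cast hp.out.ne_zero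
  obtain ⟨k, n, h⟩ := mem_closure_inv_iff.1 h
  have h2 : ‖(n : ℚ_[p])‖ ≤ (p : ℝ) ^ (-k : ℤ) := by
    have e : (n : ℚ_[p]) = (p : ℚ_[p]) ^ k * (q : ℚ_[p]) := by
      have := congrArg (fun t : ℚ => (t : ℚ_[p])) h.symm
      push_cast at this
      exact this
    rw [e, norm_mul, Padic.norm_p_pow]
    exact mul_le_of_le_one_right (by positivity) h1
  obtain ⟨m, rfl⟩ := (Padic.norm_int_le_pow_iff_dvd n k).1 h2
  refine ⟨m, mul_left_cancel₀ (pow_ne_zero k hp0) ?_⟩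
  rw [h]
  push_cast
  rfl

theorem mem_order_of_mem_orderLoc {x : ℍ[ℚ]} (h : x ∈ orderAway p)
    (h' : quatMap (algebraMap ℚ ℚ_[p]) x ∈ orderLoc p) : x ∈ order := by
  rw [orderAway, mem_hurwitz_iff] at h
  rw [orderLoc, mem_hurwitz_iff] at h'
  simp only [quatMap, RingHom.coe_mk, MonoidHom.coe_mk, OneHom.coe_mk, eq_ratCast, quat_re, quat_imI,
    quat_imJ, quat_imK] at h'
  refine mem_order_iff_coord.2 ⟨int_of_norm_le_one h.1 ?_, int_of_norm_le_one h.2.1 ?_,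
    int_of_norm_le_one h.2.2.1 ?_, int_of_norm_le_one h.2.2.2 ?_⟩
  · exact_mod_cast h'.1
  · exact_mod_cast h'.2.1
  · exact_mod_cast h'.2.2.1
  · exact_mod_cast h'.2.2.2

theorem mem_orderLoc_of_mem_order {x : ℍ[ℚ]} (h : x ∈ order) :
    quatMap (algebraMap ℚ ℚ_[p]) x ∈ orderLoc p := by
  obtain ⟨a, b, c, d, rfl⟩ := mem_order_iff_exists.1 h
  exact ⟨a, b, c, d, by simp [quatMap], by simp [quatMap], by simp [quatMap], by simp [quatMap]⟩

theorem exists_int_near {z : ℚ_[p]} (hz : z ∈ PadicInt.subring p) (N : ℕ) :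
    ∃ c : ℤ, ∃ w ∈ PadicInt.subring p, z = c + (p : ℚ_[p]) ^ N * w := by
  obtain ⟨Z, rfl⟩ : ∃ Z : ℤ_[p], (Z : ℚ_[p]) = z := ⟨⟨z, hz⟩, rfl⟩
  obtain ⟨w, hw⟩ := Ideal.mem_span_singleton.1 (PadicInt.appr_spec N Z)
  refine ⟨(Z.appr N : ℤ), w, w.2, ?_⟩
  have h2 := congrArg (fun t : ℤ_[p] => (t : ℚ_[p])) hw
  simp only [PadicInt.coe_sub, PadicInt.coe_mul, PadicInt.coe_pow, PadicInt.coe_natCast] at h2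
  rw [Int.cast_natCast, ← h2]
  ring

theorem exists_order_near {x : ℍ[ℚ_[p]]} (hx : x ∈ orderLoc p) (N : ℕ) :
    ∃ y ∈ order, ∃ w ∈ orderLoc p, x = quatMap (algebraMap ℚ ℚ_[p]) y + (p : ℚ_[p]) ^ N • w := by
  obtain ⟨a, b, c, d, h1, h2, h3, h4⟩ := hx
  obtain ⟨a₀, a₁, ha, ha'⟩ := exists_int_near a.2 N
  obtain ⟨b₀, b₁, hb, hb'⟩ := exists_int_near b.2 N
  obtain ⟨c₀, c₁, hc, hc'⟩ := exists_int_near c.2 N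
  obtain ⟨d₀, d₁, hd, hd'⟩ := exists_int_near d.2 N
  refine ⟨_, mem_order_iff_exists.2 ⟨a₀, b₀, c₀, d₀, rfl⟩,
    quat (a₁ + d₁ / 2) (b₁ + d₁ / 2) (c₁ + d₁ / 2) (d₁ / 2),
    ⟨⟨a₁, ha⟩, ⟨b₁, hb⟩, ⟨c₁, hc⟩, ⟨d₁, hd⟩, rfl, rfl, rfl, rfl⟩, ?_⟩
  have e : ∀ q : ℚ, (algebraMap ℚ ℚ_[p]) q = q := fun _ => rfl
  apply Quaternion.ext <;>
    simp only [quatMap, RingHom.coe_mk, MonoidHom.coe_mk, OneHom.coe_mk, e, quat_re, quat_imI,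
      quat_imJ, quat_imK, re_add, imI_add, imJ_add, imK_add, re_smul, imI_smul, imJ_smul,
      imK_smul, smul_eq_mul, h1, h2, h3, h4, ha', hb', hc', hd'] <;>
    push_cast <;> ring

/-- The image of a rational quaternion in `M₂(ℚ_p)`. -/
def Splitting.mat (θ : Splitting p) : ℍ[ℚ] →+* Matrix (Fin 2) (Fin 2) ℚ_[p] :=
  (θ.equiv : ℍ[ℚ_[p]] →+* Matrix (Fin 2) (Fin 2) ℚ_[p]).comp (quatMap (algebraMap ℚ ℚ_[p]))

theorem Splitting.mat_apply (θ : Splitting p) (x : ℍ[ℚ]) :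
    θ.mat x = θ.equiv (quatMap (algebraMap ℚ ℚ_[p]) x) := rfl

theorem quatMap_smul (q : ℚ) (x : ℍ[ℚ]) : quatMap (algebraMap ℚ ℚ_[p]) (q • x)
    = (q : ℚ_[p]) • quatMap (algebraMap ℚ ℚ_[p]) x := by
  have e : ∀ q : ℚ, (algebraMap ℚ ℚ_[p]) q = q := fun _ => rfl
  apply Quaternion.ext <;> simp [quatMap, e]

theorem Splitting.mat_smul (θ : Splitting p) (q : ℚ) (x : ℍ[ℚ]) :
    θ.mat (q • x) = (q : ℚ_[p]) • θ.mat x := by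
  rw [θ.mat_apply, quatMap_smul, map_smul, θ.mat_apply]

theorem Splitting.intMat_mat (θ : Splitting p) {x : ℍ[ℚ]} (h : x ∈ order) : IntMat (θ.mat x) :=
  (θ.mem_order_iff _).1 (mem_orderLoc_of_mem_order h)

theorem Splitting.mem_order_of_intMat (θ : Splitting p) {x : ℍ[ℚ]} (h : x ∈ orderAway p)
    (h' : IntMat (θ.mat x)) : x ∈ order :=
  mem_order_of_mem_orderLoc h ((θ.mem_order_iff _).2 h')

theorem Splitting.exists_near (θ : Splitting p) {X : Matrix (Fin 2) (Fin 2) ℚ_[p]} (hX : IntMat X)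
    (N : ℕ) : ∃ y ∈ order, ∃ W, IntMat W ∧ X = θ.mat y + (p : ℚ_[p]) ^ N • W := by
  have h1 : θ.equiv.symm X ∈ orderLoc p := by
    rw [θ.mem_order_iff, AlgEquiv.apply_symm_apply]
    exact hX
  obtain ⟨y, hy, w, hw, h⟩ := exists_order_near h1 N
  refine ⟨y, hy, θ.equiv w, (θ.mem_order_iff w).1 hw, ?_⟩
  have := congrArg θ.equiv h
  rwa [AlgEquiv.apply_symm_apply, map_add, map_smul] at this

/-- An isomorphism `B_p ≅ M₂(ℚ_p)` carries the reduced norm to the determinant. -/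
theorem Splitting.det_equiv (θ : Splitting p) (x : ℍ[ℚ_[p]]) : (θ.equiv x).det = normSq x := by
  have h1 : x * x - (2 * x.re) • x + normSq x • (1 : ℍ[ℚ_[p]]) = 0 := by
    rw [normSq_def']
    apply Quaternion.ext <;> simp <;> ring
  have h2 := congrArg θ.equiv h1
  simp only [map_add, map_sub, map_mul, map_smul, map_one, map_zero] at h2
  set X := θ.equiv x with hX
  have h3 : X * X - X.trace • X + X.det • (1 : Matrix (Fin 2) (Fin 2) ℚ_[p]) = 0 := by
    rw [trace_fin_two, det_fin_two]
    ext i j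
    fin_cases i <;> fin_cases j <;> simp [mul_apply, Fin.sum_univ_two] <;> ring
  have h4 : (X.trace - 2 * x.re) • X = (X.det - normSq x) • (1 : Matrix _ _ ℚ_[p]) := by
    rw [sub_smul, sub_smul]
    rw [← sub_eq_zero]; rw [← sub_eq_zero.2 (h2.trans h3.symm)]; abel
  by_cases ht : X.trace - 2 * x.re = 0
  · rw [ht, zero_smul] at h4
    have := congrFun (congrFun h4 0) 0
    simp only [Matrix.zero_apply, Matrix.smul_apply, Matrix.one_apply_eq, smul_eq_mul, mul_one] at this
    exact sub_eq_zero.1 this.symm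
  · -- A scalar matrix comes from a scalar.
    obtain ⟨c, hc⟩ : ∃ c : ℚ_[p], X = c • (1 : Matrix _ _ ℚ_[p]) :=
      ⟨(X.trace - 2 * x.re)⁻¹ * (X.det - normSq x), by
        rw [mul_smul, ← h4, smul_smul, inv_mul_cancel₀ ht, one_smul]⟩
    have hx : x = c • (1 : ℍ[ℚ_[p]]) := by
      apply θ.equiv.injective
      rw [map_smul, map_one, ← hc]
    rw [hX] at hc ⊢
    rw [hc, det_smul, det_one, hx, normSq_smul, map_one]
    simp

theorem Splitting.det_mat (θ : Splitting p) (x : ℍ[ℚ]) :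
    (θ.mat x).det = ((normSq x : ℚ) : ℚ_[p]) := by
  rw [θ.mat_apply, θ.det_equiv, normSq_def', normSq_def']
  have e : ∀ q : ℚ, (algebraMap ℚ ℚ_[p]) q = q := fun _ => rfl
  simp [quatMap, e]

/-- `a` is a global representative of the coset `X GL₂(ℤ_p)`: it is a unit of `𝒪[1/p]` whose image
lies in this coset. -/
structure IsGlobalRep (θ : Splitting p) (X : (Matrix (Fin 2) (Fin 2) ℚ_[p])ˣ) (a : ℍ[ℚ]) : Prop where
  ne_zero : a ≠ 0
  mem : a ∈ orderAway p
  inv_mem : a⁻¹ ∈ orderAway p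
  int_left : IntMat ((X⁻¹ : (Matrix (Fin 2) (Fin 2) ℚ_[p])ˣ).val * θ.mat a)
  int_right : IntMat (θ.mat a⁻¹ * X.val)

theorem Splitting.mat_inv_mul (θ : Splitting p) {a : ℍ[ℚ]} (ha : a ≠ 0) :
    θ.mat a⁻¹ * θ.mat a = 1 := by rw [← map_mul, inv_mul_cancel₀ ha, map_one]

theorem exists_pow_smul_int {m n : Type} [Fintype m] [Fintype n] (M : Matrix m n ℚ_[p]) :
    ∃ N : ℕ, IntMat ((p : ℚ_[p]) ^ N • M) := by
  have h1 : ∀ z : ℚ_[p], ∃ N : ℕ, ∀ k, N ≤ k → ‖(p : ℚ_[p]) ^ k * z‖ ≤ 1 := fun z => by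
    obtain ⟨N, hN⟩ := exists_nat_gt ‖z‖
    refine ⟨N, fun k hk => ?_⟩
    have hpk : (k : ℝ) < (p : ℝ) ^ k := by exact_mod_cast Nat.lt_pow_self hp.out.one_lt
    have hk' : (N : ℝ) ≤ k := by exact_mod_cast hk
    rw [norm_mul, Padic.norm_p_pow, zpow_neg, zpow_natCast]
    have hpos : (0 : ℝ) < (p : ℝ) ^ k := by
      have := hp.out.pos
      positivity
    rw [inv_mul_le_iff₀ hpos]
    linarith
  choose N hN using h1
  refine ⟨∑ i, ∑ j, N (M i j), fun i j => hN (M i j) _ ?_⟩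
  exact (Finset.single_le_sum (f := fun j => N (M i j)) (fun _ _ => Nat.zero_le _)
    (Finset.mem_univ j)).trans (Finset.single_le_sum (f := fun i => ∑ j, N (M i j))
      (fun _ _ => Nat.zero_le _) (Finset.mem_univ i))

/-- Right ideals of the Hurwitz order are principal, here for the right ideal of the elements whose
image lies in `X M₂(ℤ_p)`. -/
theorem exists_isGlobalRep (θ : Splitting p) (X : (Matrix (Fin 2) (Fin 2) ℚ_[p])ˣ) :
    ∃ a, IsGlobalRep θ X a := by
  have hp0 : (p : ℚ_[p]) ≠ 0 := by exact_mod_cast hp.out.ne_zero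
  have hpq : (p : ℚ) ≠ 0 := by exact_mod_cast hp.out.ne_zero
  -- By scaling, `X` may be assumed to be integral.
  suffices H : ∀ X : (Matrix (Fin 2) (Fin 2) ℚ_[p])ˣ, IntMat X.val → ∃ a, IsGlobalRep θ X a by
    obtain ⟨N, hN⟩ := exists_pow_smul_int X.val
    have hpN' : (p : ℚ_[p]) ^ N ≠ 0 := pow_ne_zero N hp0
    obtain ⟨a, ha⟩ := H
      { val := (p : ℚ_[p]) ^ N • X.val
        inv := ((p : ℚ_[p]) ^ N)⁻¹ • (X⁻¹ : (Matrix (Fin 2) (Fin 2) ℚ_[p])ˣ).val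
        val_inv := by
          rw [Matrix.smul_mul, Matrix.mul_smul, smul_smul, mul_inv_cancel₀ hpN', one_smul,
            ← Units.val_mul, mul_inv_cancel, Units.val_one]
        inv_val := by
          rw [Matrix.smul_mul, Matrix.mul_smul, smul_smul, inv_mul_cancel₀ hpN', one_smul,
            ← Units.val_mul, inv_mul_cancel, Units.val_one] } hN
    have hpN : (p : ℚ) ^ N ≠ 0 := pow_ne_zero N hpq
    have hmem' : ∀ k : ℕ, ∀ x ∈ orderAway p, ((p : ℚ) ^ k) • x ∈ orderAway p := fun k x hx => by
      have : ((p : ℚ) ^ k) • x = ((p ^ k : ℕ) : ℍ[ℚ]) * x := by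
        rw [natCast_mul_eq_smul]; push_cast; rfl
      rw [this]
      exact mul_mem (natCast_mem _ _) hx
    have hinv : (((p : ℚ) ^ N)⁻¹ • a)⁻¹ = (p : ℚ) ^ N • a⁻¹ := by
      rw [inv_eq_iff_eq_inv]
      refine eq_inv_of_mul_eq_one_left ?_
      rw [smul_mul_smul_comm, inv_mul_cancel₀ hpN, mul_inv_cancel₀ ha.ne_zero, one_smul]
    refine ⟨((p : ℚ) ^ N)⁻¹ • a, smul_ne_zero (inv_ne_zero hpN) ha.ne_zero, smul_inv_pow_mem N ha.mem, ?_, ?_, ?_⟩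
    · rw [hinv]
      exact hmem' N _ ha.inv_mem
    · convert ha.int_left using 1
      rw [θ.mat_smul, Matrix.mul_smul]
      change _ = (((p : ℚ_[p]) ^ N)⁻¹ • (X⁻¹ : (Matrix (Fin 2) (Fin 2) ℚ_[p])ˣ).val) * _
      rw [Matrix.smul_mul]
      push_cast
      rfl
    · convert ha.int_right using 1
      rw [hinv, θ.mat_smul, Matrix.smul_mul]
      change _ = _ * ((p : ℚ_[p]) ^ N • X.val)
      rw [Matrix.mul_smul]
      push_cast
      rfl
  intro X hX
  obtain ⟨N, hN⟩ := exists_pow_smul_int (X⁻¹ : (Matrix (Fin 2) (Fin 2) ℚ_[p])ˣ).val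
  set Y := (X⁻¹ : (Matrix (Fin 2) (Fin 2) ℚ_[p])ˣ).val with hY
  have hYX : Y * X.val = 1 := by rw [hY, ← Units.val_mul, inv_mul_cancel, Units.val_one]
  have hXY : X.val * Y = 1 := by rw [hY, ← Units.val_mul, mul_inv_cancel, Units.val_one]
  let J : Set ℍ[ℚ] := {y | y ∈ order ∧ IntMat (Y * θ.mat y)}
  have hpJ : ((p ^ N : ℕ) : ℍ[ℚ]) ∈ J := by
    refine ⟨natCast_mem_order _, ?_⟩
    rw [map_natCast]
    convert hN using 1
    ext i j
    rw [← nsmul_eq_mul', ← Nat.cast_smul_eq_nsmul ℚ_[p]]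
    push_cast
    rfl
  have hne : ∃ n : ℕ, ∃ y ∈ J, y ≠ 0 ∧ normSq y = n := by
    obtain ⟨n, hn⟩ := exists_normSq_eq hpJ.1
    exact ⟨n, _, hpJ, natCast_ne_zero (pow_ne_zero N hp.out.ne_zero), hn⟩
  classical
  obtain ⟨a, haJ, ha0, han⟩ := Nat.find_spec hne
  have hmin : ∀ y ∈ J, y ≠ 0 → normSq a ≤ normSq y := fun y hy hy0 => by
    obtain ⟨n, hn⟩ := exists_normSq_eq hy.1
    rw [han, hn]
    exact_mod_cast Nat.find_min' hne ⟨y, hy, hy0, hn⟩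
  -- An element of least norm divides the other ones, by division with remainder.
  have hdiv : ∀ y ∈ J, ∃ q ∈ order, y = a * q := fun y hy => by
    obtain ⟨q, hq, hlt⟩ := MaassLift.exists_near (a⁻¹ * y)
    refine ⟨q, hq, ?_⟩
    by_contra hne
    have h1 : y - a * q ∈ J := by
      refine ⟨sub_mem hy.1 (mul_mem haJ.1 hq), ?_⟩
      rw [map_sub, map_mul, mul_sub, ← mul_assoc]
      exact hy.2.sub (haJ.2.mul (θ.intMat_mat hq))
    have h2 := hmin _ h1 (sub_ne_zero.2 hne)
    have h3 : y - a * q = a * (a⁻¹ * y - q) := by rw [mul_sub, mul_inv_cancel_left₀ ha0]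
    have h4 : 0 < normSq a := lt_of_le_of_ne normSq_nonneg (Ne.symm (normSq_ne_zero.2 ha0))
    rw [h3, map_mul] at h2
    nlinarith
  refine ⟨a, ha0, order_le_orderAway haJ.1, ?_, haJ.2, ?_⟩
  · obtain ⟨q, hq, h⟩ := hdiv _ hpJ
    refine mem_orderAway_iff.2 ⟨N, ?_⟩
    rw [natCast_comm, h, inv_mul_cancel_left₀ ha0]
    exact hq
  · obtain ⟨N', hN'⟩ := exists_pow_smul_int (θ.mat a⁻¹)
    obtain ⟨y, hy, W, hW, e⟩ := θ.exists_near hX (N + N')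
    have hyJ : y ∈ J := by
      refine ⟨hy, ?_⟩
      have e1 : θ.mat y = X.val - (p : ℚ_[p]) ^ (N + N') • W := by rw [e]; abel
      rw [e1, mul_sub, hYX, Matrix.mul_smul, pow_add, mul_comm, mul_smul, ← Matrix.smul_mul]
      exact IntMat.one.sub ((hN.mul hW).smul (pow_mem (natCast_mem _ p) N'))
    obtain ⟨q, hq, rfl⟩ := hdiv y hyJ
    rw [e, mul_add, map_mul, ← mul_assoc, θ.mat_inv_mul ha0, one_mul, Matrix.mul_smul, pow_add,
      mul_smul, ← Matrix.smul_mul]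
    exact (θ.intMat_mat hq).add ((hN'.mul hW).smul (pow_mem (natCast_mem _ p) N))

end Localization

/-! ### Hecke operators in terms of coset representatives -/

section HeckeReps
open Matrix

theorem mem_glOver_iff {D : Type} [Ring D] {O : Subring D} {g : GL2 D} : g ∈ glOver O ↔
    (∀ i j, g.val i j ∈ O) ∧ ∀ i j, (g⁻¹).val i j ∈ O := by
  constructor
  · rintro ⟨γ, rfl⟩
    exact ⟨fun i j => ((γ : Matrix (Fin 2) (Fin 2) O) i j).2,
      fun i j => (((γ⁻¹ : GL2 O) : Matrix (Fin 2) (Fin 2) O) i j).2⟩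
  · rintro ⟨h1, h2⟩
    have hinj : Function.Injective (O.subtype.mapMatrix : Matrix (Fin 2) (Fin 2) O →+* _) :=
      map_injective Subtype.val_injective
    refine ⟨⟨of fun i j => ⟨_, h1 i j⟩, of fun i j => ⟨_, h2 i j⟩, hinj ?_, hinj ?_⟩, Units.ext rfl⟩
    · rw [map_mul, map_one]
      exact g.mul_inv
    · rw [map_mul, map_one]
      exact g.inv_mul

/-- `n(b) diag(a, d)`. -/
def borel {D : Type} [Ring D] (a d : Dˣ) (b : D) : GL2 D where
  val := !![(a : D), b * d; 0, (d : D)]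
  inv := !![((a⁻¹ : Dˣ) : D), -(((a⁻¹ : Dˣ) : D) * b); 0, ((d⁻¹ : Dˣ) : D)]
  val_inv := by
    refine ext fun i j => ?_
    fin_cases i <;> fin_cases j <;> simp [mul_apply, Fin.sum_univ_two, mul_assoc]
  inv_val := by
    refine ext fun i j => ?_
    fin_cases i <;> fin_cases j <;> simp [mul_apply, Fin.sum_univ_two, mul_assoc]

variable {D E : Type} [Ring D] [Ring E]

theorem coe_borel (a d : Dˣ) (b : D) :
    (borel a d b : Matrix (Fin 2) (Fin 2) D) = !![(a : D), b * d; 0, (d : D)] := rfl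

theorem coe_borel_inv (a d : Dˣ) (b : D) : ((borel a d b)⁻¹).val
    = !![((a⁻¹ : Dˣ) : D), -(((a⁻¹ : Dˣ) : D) * b); 0, ((d⁻¹ : Dˣ) : D)] := rfl

theorem glMap_borel (f : D →+* E) (a d : Dˣ) (b : D) :
    glMap f (borel a d b) = borel (Units.map f.toMonoidHom a) (Units.map f.toMonoidHom d) (f b) := by
  refine Units.ext (ext fun i j => ?_)
  fin_cases i <;> fin_cases j <;> simp [glMap, borel]

theorem borel_inv_mul (a d a' d' : Dˣ) (b b' : D) : (borel a d b)⁻¹ * borel a' d' b'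
    = borel (a⁻¹ * a') (d⁻¹ * d') (((a⁻¹ : Dˣ) : D) * (b' - b) * d) := by
  refine Units.ext (ext fun i j => ?_)
  rw [Units.val_mul, coe_borel, coe_borel, coe_borel_inv]
  fin_cases i <;> fin_cases j <;> simp [mul_apply, Fin.sum_univ_two, mul_assoc]
  noncomm_ring

theorem borel_mem_glOver {O : Subring D} {a d : Dˣ} {b : D} (ha : (a : D) ∈ O)
    (ha' : ((a⁻¹ : Dˣ) : D) ∈ O) (hd : (d : D) ∈ O) (hd' : ((d⁻¹ : Dˣ) : D) ∈ O) (hb : b ∈ O) :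
    borel a d b ∈ glOver O := by
  rw [mem_glOver_iff, coe_borel, coe_borel_inv]
  refine ⟨fun i j => ?_, fun i j => ?_⟩
  · fin_cases i <;> fin_cases j
    exacts [ha, mul_mem hb hd, zero_mem _, hd]
  · fin_cases i <;> fin_cases j
    exacts [ha', neg_mem (mul_mem ha' hb), zero_mem _, hd']

variable {p : ℕ} [hp : Fact p.Prime] {F : GReal → ℂ} {r : ℂ}

theorem mem_glOver_order {γ : GL2 ℍ[ℚ]} (h : γ ∈ glOver (orderAway p)) (h' : toLoc p γ ∈ KLoc p) :
    γ ∈ glOver order := by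
  rw [mem_glOver_iff] at h
  rw [KLoc, mem_glOver_iff] at h'
  exact mem_glOver_iff.2 ⟨fun i j => mem_order_of_mem_orderLoc (h.1 i j) (h'.1 i j),
    fun i j => mem_order_of_mem_orderLoc (h.2 i j) (h'.2 i j)⟩

theorem IsMaassForm.adelize_eq (hF : IsMaassForm r F) {x : GLoc p} {γ : GL2 ℍ[ℚ]}
    (hγ : γ ∈ glOver (orderAway p)) (hx : (toLoc p γ)⁻¹ * x ∈ KLoc p) (g : GReal) :
    adelize p F x g = F ((toReal γ)⁻¹ * g) := by
  have h : ∃ γ : GL2 ℍ[ℚ], γ ∈ glOver (orderAway p) ∧ (toLoc p γ)⁻¹ * x ∈ KLoc p := ⟨γ, hγ, hx⟩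
  rw [adelize, dif_pos h]
  obtain ⟨h1, h2⟩ := h.choose_spec
  set γ' := h.choose
  have h3 : γ⁻¹ * γ' ∈ glOver order := by
    refine mem_glOver_order (mul_mem (inv_mem hγ) h1) ?_
    have : toLoc p (γ⁻¹ * γ') = (toLoc p γ)⁻¹ * x * ((toLoc p γ')⁻¹ * x)⁻¹ := by
      rw [map_mul, map_inv]
      group
    rw [this]
    exact mul_mem hx (inv_mem h2)
  rw [← hF.left_inv _ h3 ((toReal γ')⁻¹ * g), map_mul, map_inv]
  congr 1
  group

theorem IsMaassForm.adelize_mul (hF : IsMaassForm r F) {k : GLoc p} (hk : k ∈ KLoc p) (x : GLoc p) :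
    adelize p F (x * k) = adelize p F x := by
  funext g
  by_cases h : ∃ γ : GL2 ℍ[ℚ], γ ∈ glOver (orderAway p) ∧ (toLoc p γ)⁻¹ * x ∈ KLoc p
  · obtain ⟨γ, h1, h2⟩ := h
    rw [hF.adelize_eq h1 h2, hF.adelize_eq h1 (by rw [← mul_assoc]; exact mul_mem h2 hk)]
  · have h' : ¬ ∃ γ : GL2 ℍ[ℚ], γ ∈ glOver (orderAway p) ∧ (toLoc p γ)⁻¹ * (x * k) ∈ KLoc p := by
      rintro ⟨γ, h1, h2⟩
      refine h ⟨γ, h1, ?_⟩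
      have := mul_mem h2 (inv_mem hk)
      rwa [← mul_assoc, mul_assoc, mul_inv_cancel, mul_one] at this
    rw [adelize, adelize, dif_neg h, dif_neg h']

theorem IsMaassForm.adelize_one (hF : IsMaassForm r F) : adelize p F 1 = F := by
  funext g
  rw [hF.adelize_eq (γ := 1) (one_mem _) (by simp)]
  simp

/-- Sums over the left cosets in a double coset are transported by isomorphisms. -/
theorem finsum_cosetsIn_mulEquiv {G G' M : Type} [Group G] [Group G'] [AddCommMonoid M] (e : G ≃* G')
    {K : Subgroup G} {K' : Subgroup G'} (hK : ∀ g, e g ∈ K' ↔ g ∈ K) {f : G → M}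
    (hf : ∀ k ∈ K, ∀ g, f (g * k) = f g) (h : G) :
    ∑ᶠ x ∈ cosetsIn K h, f x.out = ∑ᶠ x ∈ cosetsIn K' (e h), f (e.symm x.out) := by
  have hsymm : ∀ k ∈ K', e.symm k ∈ K := fun k hk => by rwa [← hK, e.apply_symm_apply]
  refine finsum_mem_eq_of_bijOn (fun x => ((e x.out : G') : G' ⧸ K'))
    ⟨?_, fun a _ b _ hab => ?_, ?_⟩ fun x _ => ?_
  · rintro _ ⟨x, hx, rfl⟩
    obtain ⟨k₁, hk₁, k₂, hk₂, rfl⟩ := DoubleCoset.mem_doubleCoset.1 hx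
    obtain ⟨k, hk⟩ := QuotientGroup.mk_out_eq_mul K (k₁ * h * k₂)
    refine ⟨e (k₁ * h * k₂ * k), DoubleCoset.mem_doubleCoset.2 ⟨e k₁, (hK _).2 hk₁, e (k₂ * k),
      (hK _).2 (mul_mem hk₂ k.2), by simp [mul_assoc]⟩, ?_⟩
    simp only
    rw [hk]
  · have h1 : e (a.out⁻¹ * b.out) ∈ K' := by
      rw [map_mul, map_inv]
      exact QuotientGroup.eq.1 hab
    rw [← Quotient.out_eq' a, ← Quotient.out_eq' b]
    exact QuotientGroup.eq.2 ((hK _).1 h1)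
  · rintro _ ⟨x, hx, rfl⟩
    obtain ⟨k₁, hk₁, k₂, hk₂, rfl⟩ := DoubleCoset.mem_doubleCoset.1 hx
    have h1 : e.symm (k₁ * e h * k₂) = e.symm k₁ * h * e.symm k₂ := by simp
    refine ⟨((e.symm (k₁ * e h * k₂) : G) : G ⧸ K), ⟨_, DoubleCoset.mem_doubleCoset.2
      ⟨e.symm k₁, hsymm _ hk₁, e.symm k₂, hsymm _ hk₂, h1⟩, rfl⟩, ?_⟩
    obtain ⟨k, hk⟩ := QuotientGroup.mk_out_eq_mul K (e.symm (k₁ * e h * k₂))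
    simp only
    rw [hk, map_mul, e.apply_symm_apply]
    exact QuotientGroup.mk_mul_of_mem _ ((hK _).2 k.2)
  · obtain ⟨k, hk⟩ := QuotientGroup.mk_out_eq_mul K' (e x.out)
    rw [hk, map_mul, e.symm_apply_apply, hf _ (hsymm _ k.2)]

/-- The index in `Fin 4` of the `k`-th place in the `i`-th block. -/
def blockIndex (i k : Fin 2) : Fin 4 := (finProdFinEquiv (i, k) : Fin (2 * 2))

theorem toGL4_apply (θ : Splitting p) (g : GLoc p) (i j k l : Fin 2) :
    (θ.toGL4 g : Matrix (Fin 4) (Fin 4) ℚ_[p]) (blockIndex i k) (blockIndex j l)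
      = θ.equiv (g.val i j) k l := by
  change (θ.equiv (g.val (finProdFinEquiv.symm (finProdFinEquiv (i, k))).1
    (finProdFinEquiv.symm (finProdFinEquiv (j, l))).1)) (finProdFinEquiv.symm (finProdFinEquiv (i, k))).2
    (finProdFinEquiv.symm (finProdFinEquiv (j, l))).2 = _
  rw [Equiv.symm_apply_apply, Equiv.symm_apply_apply]

theorem exists_blockIndex (i : Fin 4) : ∃ a k, blockIndex a k = i := by
  revert i
  decide

theorem ext_blocks {R : Type} {M N : Matrix (Fin 4) (Fin 4) R} (h : ∀ i j k l,
    M (blockIndex i k) (blockIndex j l) = N (blockIndex i k) (blockIndex j l)) : M = N := by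
  ext i j
  obtain ⟨a, k, rfl⟩ := exists_blockIndex i
  obtain ⟨b, l, rfl⟩ := exists_blockIndex j
  exact h a b k l

theorem intMat_toGL4 (θ : Splitting p) (g : GLoc p) :
    IntMat (θ.toGL4 g : Matrix (Fin 4) (Fin 4) ℚ_[p]) ↔ ∀ i j, g.val i j ∈ orderLoc p := by
  simp only [θ.mem_order_iff]
  constructor
  · intro h i j k l
    rw [← toGL4_apply]
    exact h _ _
  · intro h i j
    obtain ⟨a, k, rfl⟩ := exists_blockIndex i
    obtain ⟨b, l, rfl⟩ := exists_blockIndex j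
    rw [toGL4_apply]
    exact h a b k l

theorem toGL4_mem_iff (θ : Splitting p) (g : GLoc p) : θ.toGL4 g ∈ KGL p 4 ↔ g ∈ KLoc p := by
  rw [KLoc, mem_glOver_iff, ← intMat_toGL4 θ, ← intMat_toGL4 θ, map_inv]
  rfl

theorem diagP_eq (m : ℕ) : diagP p m = diagPow p (ind (initSeg 4 m)) := by
  rw [diagP, diagPow]
  congr 2
  funext i
  simp only [ind, initSeg, Finset.mem_filter, Finset.mem_univ, true_and]
  split_ifs <;> simp

/-- The Hecke operators as sums over the representatives of left cosets. -/
theorem IsMaassForm.heckeOp_eq (hF : IsMaassForm r F) (θ : Splitting p) {m : ℕ} (hm : m ≤ 4)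
    (g : GReal) : heckeOp p (θ.toGL4.symm (diagP p m)) F g
      = ∑ c ∈ repIndex p 4 m, adelize p F (θ.toGL4.symm (cosetRep p c.1 c.2)) g := by
  have hf : ∀ k ∈ KLoc p, ∀ x : GLoc p, adelize p F (x * k) g = adelize p F x g :=
    fun k hk x => by rw [hF.adelize_mul hk]
  have h1 := finsum_cosetsIn_mulEquiv θ.toGL4 (toGL4_mem_iff θ) (f := fun x => adelize p F x g) hf
    (θ.toGL4.symm (diagP p m))
  rw [MulEquiv.apply_symm_apply, diagP_eq, finsum_cosetsIn hm (f := fun x =>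
    adelize p F (θ.toGL4.symm x) g)] at h1
  · rw [diagP_eq]
    exact h1
  · intro k hk x
    rw [map_mul, hF.adelize_mul]
    rw [← toGL4_mem_iff θ, MulEquiv.apply_symm_apply]
    exact hk

end HeckeReps

/-! ### Block decomposition of the coset representatives -/

section Blocks
open Finset
open Matrix hiding mul_inv_rev

variable {p : ℕ} [hp : Fact p.Prime] {F : GReal → ℂ} {r : ℂ}

/-- The index of the `i`-th diagonal block. -/
def blockPart (c : RepIx 4) (i : Fin 2) : RepIx 2 :=
  ⟨univ.filter fun k => blockIndex i k ∈ c.1, fun kl => c.2 (blockIndex i kl.1, blockIndex i kl.2)⟩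

theorem blockIndex_inj (i j k l : Fin 2) : blockIndex i k = blockIndex j l ↔ i = j ∧ k = l := by
  revert i j k l
  decide

theorem blockIndex_lt (i k l : Fin 2) : blockIndex i k < blockIndex i l ↔ k < l := by
  revert i k l
  decide

theorem blockIndex_lt_cross (k l : Fin 2) : blockIndex 0 k < blockIndex 1 l := by
  revert k l
  decide

theorem isFree_blockIndex (c : RepIx 4) (i k l : Fin 2) :
    IsFree c.1 (blockIndex i k) (blockIndex i l) ↔ IsFree (blockPart c i).1 k l := by
  simp [IsFree, blockPart, blockIndex_lt]

theorem isFree_cross (c : RepIx 4) (k l : Fin 2) :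
    IsFree c.1 (blockIndex 0 k) (blockIndex 1 l) ↔ k ∈ (blockPart c 0).1 ∧ l ∉ (blockPart c 1).1 := by
  simp [IsFree, blockPart, blockIndex_lt_cross]

theorem card_blocks (I : Finset (Fin 4)) : (univ.filter fun k => blockIndex 0 k ∈ I).card
      + (univ.filter fun k => blockIndex 1 k ∈ I).card = I.card := by
  revert I
  decide

theorem blockPart_mem {p m : ℕ} {c : RepIx 4} (hc : c ∈ repIndex p 4 m) (i : Fin 2) :
    blockPart c i ∈ repIndex p 2 (blockPart c i).1.card := by
  refine mem_repIndex.2 ⟨rfl, fun k l => ?_⟩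
  rw [← isFree_blockIndex]
  exact (mem_repIndex.1 hc).2 _ _

/-- The upper right block. -/
def crossPart (p : ℕ) [Fact p.Prime] (c : RepIx 4) : Matrix (Fin 2) (Fin 2) ℚ_[p] :=
  of fun k l => if IsFree c.1 (blockIndex 0 k) (blockIndex 1 l)
    then (c.2 (blockIndex 0 k, blockIndex 1 l) : ℚ_[p]) else 0

theorem intMat_crossPart_mul (c : RepIx 4) : IntMat (crossPart p c *
    (((cosetRep p (blockPart c 1).1 (blockPart c 1).2)⁻¹ : (Matrix (Fin 2) (Fin 2) ℚ_[p])ˣ) :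
      Matrix (Fin 2) (Fin 2) ℚ_[p])) := by
  have e : crossPart p c * diagonal (fun i => (p : ℚ_[p]) ^ (-ind (blockPart c 1).1 i))
      = crossPart p c := by
    ext k l
    rw [mul_diagonal]
    by_cases h : IsFree c.1 (blockIndex 0 k) (blockIndex 1 l)
    · have := ((isFree_cross c k l).1 h).2
      simp [ind, this]
    · simp [crossPart, h]
  rw [coe_inv_cosetRep, ← mul_assoc, e]
  refine IntMat.mul (fun k l => ?_) (IntMat.one.sub (intMat_nilPart _ _))
  simp only [crossPart, of_apply]
  split_ifs
  exacts [natCast_mem _ _, zero_mem _]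

/-- The representatives are of the form `n(B) diag(X₁, X₂)`, in blocks. -/
theorem toGL4_symm_cosetRep (θ : Splitting p) (c : RepIx 4) :
    ∃ B ∈ orderLoc p, θ.toGL4.symm (cosetRep p c.1 c.2) = borel
      (Units.map (θ.equiv.symm : Matrix (Fin 2) (Fin 2) ℚ_[p] →* ℍ[ℚ_[p]])
        (cosetRep p (blockPart c 0).1 (blockPart c 0).2))
      (Units.map (θ.equiv.symm : Matrix (Fin 2) (Fin 2) ℚ_[p] →* ℍ[ℚ_[p]])
        (cosetRep p (blockPart c 1).1 (blockPart c 1).2)) B := by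
  refine ⟨θ.equiv.symm (crossPart p c *
    (((cosetRep p (blockPart c 1).1 (blockPart c 1).2)⁻¹ : (Matrix (Fin 2) (Fin 2) ℚ_[p])ˣ) :
      Matrix (Fin 2) (Fin 2) ℚ_[p])), ?_, ?_⟩
  · rw [θ.mem_order_iff, AlgEquiv.apply_symm_apply]
    exact intMat_crossPart_mul c
  rw [MulEquiv.symm_apply_eq]
  refine Units.ext (ext_blocks fun i j k l => ?_)
  rw [toGL4_apply, coe_borel]
  fin_cases i <;> fin_cases j
  · change cosetRep p c.1 c.2 (blockIndex 0 k) (blockIndex 0 l) = θ.equiv (θ.equiv.symm _) k l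
    rw [AlgEquiv.apply_symm_apply, cosetRep_apply, cosetRep_apply]
    simp only [blockIndex_inj, isFree_blockIndex, true_and]
    congr 1
    simp [ind, blockPart]
  · change cosetRep p c.1 c.2 (blockIndex 0 k) (blockIndex 1 l)
      = θ.equiv (θ.equiv.symm _ * θ.equiv.symm _) k l
    rw [← map_mul, AlgEquiv.apply_symm_apply, mul_assoc, ← Units.val_mul, inv_mul_cancel,
      Units.val_one, mul_one, cosetRep_apply, if_neg (by rw [blockIndex_inj]; simp)]
    rfl
  · change cosetRep p c.1 c.2 (blockIndex 1 k) (blockIndex 0 l) = θ.equiv 0 k l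
    rw [map_zero, cosetRep_apply, if_neg (by rw [blockIndex_inj]; simp),
      if_neg fun h => h.1.not_gt (blockIndex_lt_cross l k)]
    rfl
  · change cosetRep p c.1 c.2 (blockIndex 1 k) (blockIndex 1 l) = θ.equiv (θ.equiv.symm _) k l
    rw [AlgEquiv.apply_symm_apply, cosetRep_apply, cosetRep_apply]
    simp only [blockIndex_inj, isFree_blockIndex, true_and]
    congr 1
    simp [ind, blockPart]

/-- The product `n(B) diag(X, Y)` lies in the coset of `n(b) diag(a, d)` for global representatives
`a, d` of `X, Y` and `b` close to `B`. -/
theorem toLoc_borel_inv_mul_mem (θ : Splitting p) {X Y : (Matrix (Fin 2) (Fin 2) ℚ_[p])ˣ} {a d : ℍ[ℚ]}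
    (ha : IsGlobalRep θ X a) (hd : IsGlobalRep θ Y d) {b : ℍ[ℚ]} {B : ℍ[ℚ_[p]]}
    (h : IntMat (θ.mat a⁻¹ * θ.equiv (B - quatMap (algebraMap ℚ ℚ_[p]) b) * θ.mat d)) :
    (toLoc p (borel (Units.mk0 a ha.ne_zero) (Units.mk0 d hd.ne_zero) b))⁻¹ *
      borel (Units.map (θ.equiv.symm : Matrix (Fin 2) (Fin 2) ℚ_[p] →* ℍ[ℚ_[p]]) X)
        (Units.map (θ.equiv.symm : Matrix (Fin 2) (Fin 2) ℚ_[p] →* ℍ[ℚ_[p]]) Y) B ∈ KLoc p := by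
  rw [toLoc, glMap_borel, borel_inv_mul]
  -- It suffices to check the integrality of the entries in `M₂(ℚ_p)`.
  have hθ : ∀ z : ℍ[ℚ_[p]], IntMat (θ.equiv z) → z ∈ orderLoc p := fun z hz => (θ.mem_order_iff z).2 hz
  have e1 : ∀ (u : ℍ[ℚ]ˣ), (((Units.map ((quatMap (algebraMap ℚ ℚ_[p])).toMonoidHom) u)⁻¹ :
      ℍ[ℚ_[p]]ˣ) : ℍ[ℚ_[p]]) = quatMap (algebraMap ℚ ℚ_[p]) ((u : ℍ[ℚ])⁻¹) := fun u => by
    rw [← map_inv, Units.coe_map]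
    simp
  refine borel_mem_glOver (hθ _ ?_) (hθ _ ?_) (hθ _ ?_) (hθ _ ?_) (hθ _ ?_)
  · rw [Units.val_mul, e1, map_mul]
    change IntMat (θ.mat a⁻¹ * θ.equiv (θ.equiv.symm X.val))
    rw [AlgEquiv.apply_symm_apply]
    exact ha.int_right
  · rw [mul_inv_rev, inv_inv, ← map_inv, Units.val_mul, map_mul]
    change IntMat (θ.equiv (θ.equiv.symm (X⁻¹).val) * θ.mat a)
    rw [AlgEquiv.apply_symm_apply]
    exact ha.int_left
  · rw [Units.val_mul, e1, map_mul]
    change IntMat (θ.mat d⁻¹ * θ.equiv (θ.equiv.symm Y.val))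
    rw [AlgEquiv.apply_symm_apply]
    exact hd.int_right
  · rw [mul_inv_rev, inv_inv, ← map_inv, Units.val_mul, map_mul]
    change IntMat (θ.equiv (θ.equiv.symm (Y⁻¹).val) * θ.mat d)
    rw [AlgEquiv.apply_symm_apply]
    exact hd.int_left
  · rw [e1, map_mul, map_mul]
    exact h

/-- The value of the adelization at a coset representative; the unipotent part may be chosen in
`𝒪`. -/
theorem IsMaassForm.adelize_cosetRep (hF : IsMaassForm r F) (θ : Splitting p) {m : ℕ} {c : RepIx 4}
    (hc : c ∈ repIndex p 4 m) {a d : ℍ[ℚ]}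
    (ha : IsGlobalRep θ (cosetRep p (blockPart c 0).1 (blockPart c 0).2) a)
    (hd : IsGlobalRep θ (cosetRep p (blockPart c 1).1 (blockPart c 1).2) d) :
    ∃ b ∈ order, ∀ g, adelize p F (θ.toGL4.symm (cosetRep p c.1 c.2)) g
      = F ((toReal (borel (Units.mk0 a ha.ne_zero) (Units.mk0 d hd.ne_zero) b))⁻¹ * g) := by
  obtain ⟨B, hB, hx⟩ := toGL4_symm_cosetRep θ c
  obtain ⟨b, hb, w, hw, hBw⟩ := exists_order_near hB 1
  refine ⟨b, hb, hF.adelize_eq (borel_mem_glOver ha.mem ha.inv_mem hd.mem hd.inv_mem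
    (order_le_orderAway hb)) ?_⟩
  rw [hx]
  refine toLoc_borel_inv_mul_mem θ ha hd ?_
  set X := cosetRep p (blockPart c 0).1 (blockPart c 0).2
  set Y := cosetRep p (blockPart c 1).1 (blockPart c 1).2
  have hX := (cosetRep_int (blockPart_mem hc 0)).2.1
  have hY := (cosetRep_int (blockPart_mem hc 1)).1
  have hXinv : θ.mat a⁻¹ = θ.mat a⁻¹ * X.val * (X⁻¹).val := by
    rw [mul_assoc, ← Units.val_mul, mul_inv_cancel, Units.val_one, mul_one]
  have hYd : θ.mat d = Y.val * ((Y⁻¹).val * θ.mat d) := by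
    rw [← mul_assoc, ← Units.val_mul, mul_inv_cancel, Units.val_one, one_mul]
  rw [hBw, add_sub_cancel_left, map_smul, pow_one, hXinv, hYd, Matrix.mul_smul, mul_assoc _ (X⁻¹).val,
    ← Matrix.mul_smul, ← smul_mul]
  exact ((ha.int_right.mul (hX.mul ((θ.mem_order_iff w).1 hw))).mul (hY.mul hd.int_left))

/-- The block and the place in the block of an index. -/
def blockOf (i : Fin 4) : Fin 2 × Fin 2 := (finProdFinEquiv (m := 2) (n := 2)).symm i

theorem blockOf_blockIndex (i k : Fin 2) : blockOf (blockIndex i k) = (i, k) := by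
  revert i k
  decide

theorem cross_count (I : Finset (Fin 4)) :
    (univ.filter fun ij : Fin 4 × Fin 4 => (blockOf ij.1).1 ≠ (blockOf ij.2).1 ∧
        IsFree I ij.1 ij.2).card = (univ.filter fun k => blockIndex 0 k ∈ I).card
        * (2 - (univ.filter fun k => blockIndex 1 k ∈ I).card) := by
  revert I
  decide

/-- The set of places that is composed of two blocks. -/
def glue (I J : Finset (Fin 2)) : Finset (Fin 4) :=
  univ.filter fun i => if (blockOf i).1 = 0 then (blockOf i).2 ∈ I else (blockOf i).2 ∈ J

theorem mem_glue_zero (I J : Finset (Fin 2)) (k : Fin 2) : blockIndex 0 k ∈ glue I J ↔ k ∈ I := by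
  simp [glue, blockOf_blockIndex]

theorem mem_glue_one (I J : Finset (Fin 2)) (k : Fin 2) : blockIndex 1 k ∈ glue I J ↔ k ∈ J := by
  simp [glue, blockOf_blockIndex]

/-- The number of representatives with given diagonal blocks. -/
theorem card_fibre {p k l : ℕ} {x y : RepIx 2} (hx : x ∈ repIndex p 2 k) (hy : y ∈ repIndex p 2 l) :
    ((repIndex p 4 (k + l)).filter fun c => (blockPart c 0, blockPart c 1) = (x, y)).card
      = p ^ (k * (2 - l)) := by
  have hk := (mem_repIndex.1 hx).1
  have hl := (mem_repIndex.1 hy).1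
  set I := glue x.1 y.1 with hI
  have hI0 : (univ.filter fun k => blockIndex 0 k ∈ I) = x.1 := by ext k; simp [hI, mem_glue_zero]
  have hI1 : (univ.filter fun k => blockIndex 1 k ∈ I) = y.1 := by ext k; simp [hI, mem_glue_one]
  set S : Fin 4 × Fin 4 → Finset ℕ := fun ij => if (blockOf ij.1).1 = (blockOf ij.2).1 then
      {(if (blockOf ij.1).1 = 0 then x.2 else y.2) ((blockOf ij.1).2, (blockOf ij.2).2)}
    else if IsFree I ij.1 ij.2 then range p else {0} with hS
  have hcard : (Fintype.piFinset S).card = p ^ (k * (2 - l)) := by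
    rw [← hk, ← hl, ← hI0, ← hI1, ← cross_count, Fintype.card_piFinset, ← prod_const, prod_filter]
    refine prod_congr rfl fun ij _ => ?_
    simp only [hS]
    by_cases h : (blockOf ij.1).1 = (blockOf ij.2).1
    · simp [h]
    · by_cases h' : IsFree I ij.1 ij.2 <;> simp [h, h']
  rw [← hcard]
  refine (card_bij (fun f _ => (⟨I, f⟩ : RepIx 4)) (fun f hf => ?_) (fun f _ f' _ h => ?_)
    fun c hc => ?_).symm
  · have hf' := fun i j => (Fintype.mem_piFinset.1 hf) (i, j)
    have h0 : blockPart ⟨I, f⟩ 0 = x := by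
      refine Sigma.ext hI0 (heq_of_eq (funext fun ⟨i, j⟩ => ?_))
      have := hf' (blockIndex 0 i) (blockIndex 0 j)
      simpa [hS, blockOf_blockIndex, blockPart] using this
    have h1 : blockPart ⟨I, f⟩ 1 = y := by
      refine Sigma.ext hI1 (heq_of_eq (funext fun ⟨i, j⟩ => ?_))
      have := hf' (blockIndex 1 i) (blockIndex 1 j)
      simpa [hS, blockOf_blockIndex, blockPart] using this
    refine mem_filter.2 ⟨mem_repIndex.2 ⟨?_, fun i j => ?_⟩, by rw [h0, h1]⟩
    · rw [← card_blocks, hI0, hI1, hk, hl]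
    · obtain ⟨a, i, rfl⟩ := exists_blockIndex i
      obtain ⟨b, j, rfl⟩ := exists_blockIndex j
      by_cases hab : a = b
      · subst hab
        have hfree := isFree_blockIndex ⟨I, f⟩ a i j
        have hval : f (blockIndex a i, blockIndex a j) = (blockPart ⟨I, f⟩ a).2 (i, j) := rfl
        rw [show IsFree (⟨I, f⟩ : RepIx 4).1 (blockIndex a i) (blockIndex a j) ↔ _ from hfree]
        change (_ → f _ < p) ∧ (_ → f _ = 0)
        rw [hval]
        fin_cases a
        · change (IsFree (blockPart ⟨I, f⟩ 0).1 i j → _) ∧ (¬ IsFree (blockPart ⟨I, f⟩ 0).1 i j → _)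
          simp only [Fin.zero_eta, h0]
          exact (mem_repIndex.1 hx).2 i j
        · change (IsFree (blockPart ⟨I, f⟩ 1).1 i j → _) ∧ (¬ IsFree (blockPart ⟨I, f⟩ 1).1 i j → _)
          simp only [Fin.mk_one, h1]
          exact (mem_repIndex.1 hy).2 i j
      · have := hf' (blockIndex a i) (blockIndex b j)
        simp only [hS, blockOf_blockIndex, if_neg hab] at this
        constructor
        · intro hfr
          rw [if_pos hfr] at this
          exact mem_range.1 this
        · intro hfr
          rw [if_neg hfr] at this
          exact mem_singleton.1 this
  · exact eq_of_heq (Sigma.ext_iff.1 h).2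
  · obtain ⟨hc1, hc2⟩ := mem_filter.1 hc
    obtain ⟨rfl, rfl⟩ := Prod.mk.inj hc2
    have hIc : I = c.1 := by
      ext i
      obtain ⟨a, i, rfl⟩ := exists_blockIndex i
      fin_cases a
      · exact (mem_glue_zero _ _ i).trans (by simp [blockPart])
      · exact (mem_glue_one _ _ i).trans (by simp [blockPart])
    refine ⟨c.2, Fintype.mem_piFinset.2 fun ⟨i, j⟩ => ?_, Sigma.ext hIc HEq.rfl⟩
    obtain ⟨a, i, rfl⟩ := exists_blockIndex i
    obtain ⟨b, j, rfl⟩ := exists_blockIndex j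
    simp only [hS, blockOf_blockIndex]
    by_cases hab : a = b
    · subst hab
      rw [if_pos rfl, mem_singleton]
      fin_cases a <;> simp [blockPart]
    · rw [if_neg hab, hIc]
      have := (mem_repIndex.1 hc1).2 (blockIndex a i) (blockIndex b j)
      split_ifs with h
      · exact mem_range.2 (this.1 h)
      · exact mem_singleton.2 (this.2 h)

theorem card_lt_three (x : RepIx 2) : x.1.card < 3 := by
  have := card_le_univ x.1
  rw [Fintype.card_fin] at this
  omega

/-- A sum over representatives, arranged by their diagonal blocks. -/
theorem sum_blocks {p : ℕ} (m : ℕ) (φ : RepIx 2 → RepIx 2 → ℂ) :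
    ∑ c ∈ repIndex p 4 m, φ (blockPart c 0) (blockPart c 1)
      = ∑ kl ∈ (range 3 ×ˢ range 3).filter (fun kl => kl.1 + kl.2 = m),
        (p : ℂ) ^ (kl.1 * (2 - kl.2)) *
          ∑ x ∈ repIndex p 2 kl.1, ∑ y ∈ repIndex p 2 kl.2, φ x y := by
  classical
  set P := (range 3 ×ˢ range 3).filter (fun kl : ℕ × ℕ => kl.1 + kl.2 = m)
  set T := P.biUnion fun kl => repIndex p 2 kl.1 ×ˢ repIndex p 2 kl.2 with hT
  have hmaps : ∀ c ∈ repIndex p 4 m, (blockPart c 0, blockPart c 1) ∈ T := fun c hc => by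
    refine mem_biUnion.2 ⟨((blockPart c 0).1.card, (blockPart c 1).1.card),
      mem_filter.2 ⟨mem_product.2 ⟨mem_range.2 (card_lt_three (blockPart c 0)),
        mem_range.2 (card_lt_three (blockPart c 1))⟩, ?_⟩,
      mem_product.2 ⟨blockPart_mem hc 0, blockPart_mem hc 1⟩⟩
    rw [← (mem_repIndex.1 hc).1]
    exact card_blocks c.1
  have hdisj : Set.PairwiseDisjoint (P : Set (ℕ × ℕ))
      fun kl => repIndex p 2 kl.1 ×ˢ repIndex p 2 kl.2 := by
    intro kl _ kl' _ hne
    refine disjoint_left.2 fun xy h h' => hne ?_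
    rw [mem_product] at h h'
    exact Prod.ext ((mem_repIndex.1 h.1).1.symm.trans (mem_repIndex.1 h'.1).1)
      ((mem_repIndex.1 h.2).1.symm.trans (mem_repIndex.1 h'.2).1)
  rw [← sum_fiberwise_of_maps_to hmaps, hT, sum_biUnion hdisj]
  refine sum_congr rfl fun kl hkl => ?_
  rw [← sum_product', mul_sum]
  refine sum_congr rfl fun xy hxy => ?_
  rw [mem_product] at hxy
  rw [sum_congr rfl (g := fun _ => φ xy.1 xy.2) fun c hc => by
    rw [← (mem_filter.1 hc).2], sum_const, ← (mem_filter.1 hkl).2,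
    card_fibre hxy.1 hxy.2, nsmul_eq_mul]
  push_cast
  rfl

end Blocks

/-! ### Fourier coefficients of the translates by coset representatives -/

section TranslateFourier
open Quaternion Matrix

variable {F : GReal → ℂ} {r : ℂ}

theorem normSq_toQuatReal (a : ℍ[ℚ]) : normSq (toQuatReal a) = ((normSq a : ℚ) : ℝ) := by
  rw [normSq_def', normSq_def']
  simp [toQuatReal, quatMap]

theorem quatAbs_sq (a : ℍ[ℚ]) : quatAbs a ^ 2 = normSq (toQuatReal a) := by
  rw [normSq_toQuatReal, quatAbs, Real.sq_sqrt]
  exact_mod_cast normSq_nonneg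

theorem toQuatReal_ne_zero {a : ℍ[ℚ]} (ha : a ≠ 0) : toQuatReal a ≠ 0 := fun h =>
  ha ((quatMap_eq_zero _).1 h)

theorem toQuatReal_inv (a : ℍ[ℚ]) : toQuatReal a⁻¹ = (toQuatReal a)⁻¹ := map_inv₀ _ _

/-- The height `y|d|/|a|`. -/
def scaleHeight {a d : ℍ[ℚ]} (ha : a ≠ 0) (hd : d ≠ 0) (y : Set.Ioi (0 : ℝ)) : Set.Ioi (0 : ℝ) :=
  ⟨y * quatAbs d / quatAbs a, div_pos (mul_pos y.2 (quatAbs_pos hd)) (quatAbs_pos ha)⟩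

/-- The vector `|a|a⁻¹` of norm one. -/
theorem star_mul_normalize {a : ℍ[ℚ]} (ha : a ≠ 0) :
    star (quatAbs a • (toQuatReal a)⁻¹) * (quatAbs a • (toQuatReal a)⁻¹) = 1 := by
  have h : normSq (toQuatReal a) ≠ 0 := normSq_ne_zero.2 (toQuatReal_ne_zero ha)
  rw [star_mul_self, normSq_smul, map_inv₀, quatAbs_sq, mul_inv_cancel₀ h, coe_one]

theorem IsMaassForm.borel_apply (hF : IsMaassForm r F) {a d : ℍ[ℚ]} (ha : a ≠ 0) (hd : d ≠ 0)
    (b : ℍ[ℚ]) (x : ℍ[ℝ]) (y : Set.Ioi (0 : ℝ)) :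
    F ((toReal (borel (Units.mk0 a ha) (Units.mk0 d hd) b))⁻¹ * (nUnip x * aDiag y))
      = F (nUnip (toQuatReal a⁻¹ * (x - toQuatReal b) * toQuatReal d) * aDiag (scaleHeight ha hd y)) := by
  have hA := toQuatReal_ne_zero ha
  have hD := toQuatReal_ne_zero hd
  have ha' := quatAbs_pos ha
  have hd' := quatAbs_pos hd
  set A := toQuatReal a with hAdef
  set D := toQuatReal d with hDdef
  set B := toQuatReal b
  set y' := scaleHeight ha hd y with hy'
  have hk1 := star_mul_normalize ha
  have hk2 := star_mul_normalize hd
  set k : GReal := borel (Units.mk0 (quatAbs a • A⁻¹) (smul_ne_zero ha'.ne' (inv_ne_zero hA)))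
    (Units.mk0 (quatAbs d • D⁻¹) (smul_ne_zero hd'.ne' (inv_ne_zero hD))) 0 with hk
  have hkmem : k.valᴴ * (k : Matrix _ _ ℍ[ℝ]) = 1 := by
    rw [hk, coe_borel]
    refine ext fun i j => ?_
    fin_cases i <;> fin_cases j
    · simpa [Matrix.mul_apply, Fin.sum_univ_two] using hk1
    · simp [Matrix.mul_apply, Fin.sum_univ_two]
    · simp [Matrix.mul_apply, Fin.sum_univ_two]
    · simpa [Matrix.mul_apply, Fin.sum_univ_two] using hk2
  set s := sqrtUnit y with hs
  set s' := sqrtUnit y' with hs'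
  set z : ℝˣ := s * (Units.mk0 (quatAbs a) ha'.ne')⁻¹ * s'⁻¹ with hz
  have hspos : 0 < (s : ℝ) := Real.sqrt_pos.2 y.2
  have hs'pos : 0 < (s' : ℝ) := Real.sqrt_pos.2 y'.2
  have hzval : (z : ℝ) = s / quatAbs a / s' := by
    rw [hz]
    simp [div_eq_mul_inv]
  have hzpos : 0 < (z : ℝ) := by
    rw [hzval]
    positivity
  have hss : (s : ℝ) * s = y := Real.mul_self_sqrt (le_of_lt y.2)
  have hss' : (s' : ℝ) * s' = y * quatAbs d / quatAbs a := Real.mul_self_sqrt (le_of_lt y'.2)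
  have e1 : (z : ℝ) * s' * quatAbs a = s := by
    rw [hzval]
    field_simp
  have e2 : (z : ℝ) * (s' : ℝ)⁻¹ * quatAbs d = (s : ℝ)⁻¹ := by
    have h3 : (z : ℝ) * (s' : ℝ)⁻¹ = s / quatAbs a / (s' * s') := by
      rw [hzval]
      field_simp
    have hy0 : (y : ℝ) ≠ 0 := ne_of_gt y.2
    rw [h3, hss', ← hss]
    field_simp
  clear_value z
  rw [← hF.center_inv z hzpos (nUnip (toQuatReal a⁻¹ * (x - B) * D) * aDiag y'),
    ← hF.right_inv k hkmem
      (realDiag z z * (nUnip (toQuatReal a⁻¹ * (x - B) * D) * aDiag y'))]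
  congr 1
  refine Units.ext (ext fun i j => ?_)
  have hγ : ((toReal (borel (Units.mk0 a ha) (Units.mk0 d hd) b))⁻¹).val = !![A⁻¹, -(A⁻¹ * B); 0, D⁻¹] := by
    rw [toReal, glMap_borel, coe_borel_inv, ← map_inv, ← map_inv, Units.coe_map, Units.coe_map,
      Units.val_inv_eq_inv_val, Units.val_inv_eq_inv_val]
    simp only [Units.val_mk0]
    change !![toQuatReal a⁻¹, -(toQuatReal a⁻¹ * B); 0, toQuatReal d⁻¹] = _
    rw [toQuatReal_inv, toQuatReal_inv]
  rw [Units.val_mul, hγ, Units.val_mul, Units.val_mul, realDiag_mul_eq_smul, Units.val_mul, aDiag,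
    aDiag, ← hs, ← hs', coe_realDiag, coe_realDiag, coe_nUnip, coe_nUnip, hk, coe_borel, toQuatReal_inv]
  fin_cases i <;> fin_cases j
  · simp only [Fin.zero_eta, Matrix.mul_apply, Fin.sum_univ_two, Matrix.of_apply, Matrix.cons_val_zero,
      Matrix.cons_val_one, Matrix.smul_apply, Units.val_mk0, Quaternion.mul_coe_eq_smul,
      coe_mul_eq_smul, mul_smul_comm, smul_mul_assoc, smul_smul, mul_zero, zero_mul,
      add_zero, smul_zero, mul_one, one_mul]
    rw [← e1]
    congr 1
    ring
  · simp [Matrix.mul_apply, Fin.sum_univ_two, -coe_inv, Quaternion.mul_coe_eq_smul, smul_smul]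
    rw [← hAdef, mul_inv_cancel_right₀ hD, ← e2, mul_sub, smul_sub, ← sub_eq_add_neg]
    congr 2 <;> ring
  · simp [Matrix.mul_apply, Fin.sum_univ_two]
  · simp [Matrix.mul_apply, Fin.sum_univ_two, -coe_inv, Quaternion.mul_coe_eq_smul,
      coe_mul_eq_smul, smul_smul]
    rw [← e2]
    congr 1
    ring

theorem char_natCast_mul (β : ℍ[ℚ]) (M : ℕ) (x : ℍ[ℝ]) :
    char β (toQuatReal M * x) = char (β * M) x := by rw [char, char, ← mul_assoc, map_mul]

theorem isPeriodic_mul {f g : ℍ[ℝ] → ℂ} (hf : IsPeriodic f) (hg : IsPeriodic g) :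
    IsPeriodic fun x => f x * g x := fun o ho x => by simp only [hf o ho x, hg o ho x]

/-- The contribution of a coset representative to a Fourier coefficient. The variable is scaled by
an integer `M`, to make the function periodic. -/
theorem IsMaassForm.cubeMean_borel (hF : IsMaassForm r F) {a d b β : ℍ[ℚ]} (ha : a ≠ 0) (hd : d ≠ 0)
    (hb : b ∈ order) (hβ : β ∈ dualLattice) {M : ℕ} (hM : M ≠ 0)
    (hMa : (M : ℍ[ℚ]) * a⁻¹ ∈ order) (hdO : d ∈ order) (y : Set.Ioi (0 : ℝ)) :
    cubeMean (fun x => F ((toReal (borel (Units.mk0 a ha) (Units.mk0 d hd) b))⁻¹ *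
        (nUnip (toQuatReal M * x) * aDiag y)) * char (-β) (toQuatReal M * x))
      = open Classical in if d⁻¹ * β * a ∈ dualLattice
        then fourierIntegral F (d⁻¹ * β * a) (aDiag (scaleHeight ha hd y)) else 0 := by
  set β' := d⁻¹ * β * a with hβ'
  set u := (M : ℍ[ℚ]) * a⁻¹ with hu
  have hu0 : u ≠ 0 := mul_ne_zero (natCast_ne_zero hM) (inv_ne_zero ha)
  set w := toQuatReal (-(a⁻¹ * b * d)) with hw
  set Φ : ℍ[ℝ] → ℂ := fun x => F (nUnip x * aDiag (scaleHeight ha hd y)) with hΦ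
  have hΦc : Continuous Φ := hF.continuous_nUnip _
  have hΦp : IsPeriodic Φ := hF.isPeriodic _
  have harg : ∀ x : ℍ[ℝ], toQuatReal a⁻¹ * (toQuatReal M * x - toQuatReal b) * toQuatReal d
      = toQuatReal u * x * toQuatReal d + w := fun x => by
    rw [hw, hu, natCast_comm, map_neg, map_mul, map_mul, map_mul]
    noncomm_ring
  -- The character of `β` at `M x` is the character of `β'` at the argument of `Φ`.
  have hchar : ∀ x : ℍ[ℝ], char (-β) (toQuatReal M * x)
      = char (-β') (toQuatReal u * x * toQuatReal d + w) := fun x => by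
    rw [char_conj, char_natCast_mul]
    have e1 : d * -β' * u = -β * M := by
      rw [hβ', hu, mul_neg, neg_mul, neg_mul, natCast_comm M a⁻¹, mul_assoc d⁻¹,
        mul_inv_cancel_left₀ hd, mul_assoc β, mul_inv_cancel_left₀ ha]
    have e2 : char (-β') w = 1 := by
      have e3 : (-β' * -(a⁻¹ * b * d)).re = (β * b).re := by
        rw [neg_mul_neg, hβ', re_mul_comm, show a⁻¹ * b * d * (d⁻¹ * β * a) = a⁻¹ * (b * β * a) by
          rw [mul_assoc (a⁻¹ * b), mul_assoc d⁻¹, mul_inv_cancel_left₀ hd, mul_assoc, mul_assoc],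
          re_mul_comm, mul_assoc, mul_inv_cancel₀ ha, mul_one, re_mul_comm]
      obtain ⟨m, hm⟩ := hβ b hb
      rw [hw, char, ← map_mul, toQuatReal, quatMap_re, e3, hm, Complex.exp_eq_one_iff]
      exact ⟨m, by simp; ring⟩
    rw [e1, e2, mul_one]
  have hfun : (fun x => F ((toReal (borel (Units.mk0 a ha) (Units.mk0 d hd) b))⁻¹ *
        (nUnip (toQuatReal M * x) * aDiag y)) * char (-β) (toQuatReal M * x))
      = fun x => (fun z => Φ z * char (-β') z) (toQuatReal u * x * toQuatReal d + w) := by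
    funext x
    rw [hF.borel_apply ha hd, harg, hchar]
  have hcont : Continuous fun z => Φ z * char (-β') z := hΦc.mul (continuous_char _)
  rw [hfun]
  split_ifs with h
  · rw [cubeMean_comp hcont (isPeriodic_mul hΦp (isPeriodic_char (neg_mem_dualLattice h))) hu0 hd
      (fun o ho => mul_mem (mul_mem hMa ho) hdO) w, fourierIntegral_eq]
  · -- A translation multiplies the function by a number different from one.
    obtain ⟨o, ho, hne⟩ : ∃ o ∈ order, ¬ ∃ m : ℤ, (β' * o).re = m := by
      by_contra! hcon
      exact h fun o ho => hcon o ho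
    set h : ℍ[ℝ] → ℂ := fun x => (fun z => Φ z * char (-β') z) (toQuatReal u * x * toQuatReal d + w)
      with hh
    have hhc : Continuous h := hcont.comp (by fun_prop)
    have hhp : IsPeriodic h := by
      have h1 : IsPeriodic fun x => Φ (toQuatReal u * x * toQuatReal d + w) := fun o ho x => by
        have : toQuatReal u * (x + toQuatReal o) * toQuatReal d + w
            = (toQuatReal u * x * toQuatReal d + w) + toQuatReal (u * o * d) := by
          rw [map_mul toQuatReal (u * o) d, map_mul toQuatReal u o]
          noncomm_ring
        simp only
        rw [this, hΦp _ (mul_mem (mul_mem hMa ho) hdO)]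
      have h2 : IsPeriodic fun x => char (-β') (toQuatReal u * x * toQuatReal d + w) := by
        have := isPeriodic_char (β := -β * M)
          (dualLattice_mul (neg_mem_dualLattice hβ) (natCast_mem_order M))
        simp only [← hchar, char_natCast_mul]
        exact this
      exact isPeriodic_mul h1 h2
    have hx0 : ∀ x, h (x + toQuatReal (u⁻¹ * o * d⁻¹)) = char (-β') (toQuatReal o) * h x := fun x => by
      have : toQuatReal u * (x + toQuatReal (u⁻¹ * o * d⁻¹)) * toQuatReal d + w
          = (toQuatReal u * x * toQuatReal d + w) + toQuatReal o := by
        have e4 : toQuatReal o = toQuatReal u * toQuatReal (u⁻¹ * o * d⁻¹) * toQuatReal d := by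
          rw [← map_mul, ← map_mul]
          congr 1
          rw [mul_assoc u⁻¹, mul_inv_cancel_left₀ hu0, inv_mul_cancel_right₀ hd]
        rw [e4]
        noncomm_ring
      simp only [hh]
      rw [this, hΦp o ho, char_add]
      ring
    have h3 := cubeMean_translate hhc hhp (toQuatReal (u⁻¹ * o * d⁻¹))
    simp only [hx0] at h3
    rw [cubeMean_const_mul] at h3
    have h4 : char (-β') (toQuatReal o) ≠ 1 := by
      rw [char, ← map_mul, toQuatReal, quatMap_re, Ne, Complex.exp_eq_one_iff]
      rintro ⟨m, hm⟩
      refine hne ⟨-m, ?_⟩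
      have hpi : (2 * Real.pi * Complex.I : ℂ) ≠ 0 := Complex.two_pi_I_ne_zero
      rw [mul_comm (m : ℂ)] at hm
      have h5 := mul_left_cancel₀ hpi hm
      rw [neg_mul, re_neg, eq_ratCast] at h5
      have h6 : -(β' * o).re = m := by exact_mod_cast h5
      push_cast
      linarith
    have h7 : (char (-β') (toQuatReal o) - 1) * cubeMean h = 0 := by rw [sub_mul, one_mul, h3, sub_self]
    exact (mul_eq_zero.1 h7).resolve_left (sub_ne_zero.2 h4)

end TranslateFourier

/-! ### The action of the Hecke operators on Fourier coefficients -/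

section HeckeFourier
open Finset Quaternion

variable {p : ℕ} [hp : Fact p.Prime] {F : GReal → ℂ} {r : ℂ}

theorem IsGlobalRep.mem_order {θ : Splitting p} {k : ℕ} {x : RepIx 2} (hx : x ∈ repIndex p 2 k)
    {a : ℍ[ℚ]} (ha : IsGlobalRep θ (cosetRep p x.1 x.2) a) : a ∈ order := by
  refine θ.mem_order_of_intMat ha.mem ?_
  have e : θ.mat a = (cosetRep p x.1 x.2).val * (((cosetRep p x.1 x.2)⁻¹).val * θ.mat a) := by
    rw [← mul_assoc, ← Units.val_mul, mul_inv_cancel, Units.val_one, one_mul]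
  rw [e]
  exact (cosetRep_int hx).1.mul ha.int_left

theorem IsGlobalRep.p_mul_inv_mem {θ : Splitting p} {k : ℕ} {x : RepIx 2} (hx : x ∈ repIndex p 2 k)
    {a : ℍ[ℚ]} (ha : IsGlobalRep θ (cosetRep p x.1 x.2) a) : (p : ℍ[ℚ]) * a⁻¹ ∈ order := by
  refine θ.mem_order_of_intMat (mul_mem (natCast_mem _ p) ha.inv_mem) ?_
  have e : θ.mat a⁻¹ = θ.mat a⁻¹ * (cosetRep p x.1 x.2).val * ((cosetRep p x.1 x.2)⁻¹).val := by
    rw [mul_assoc, ← Units.val_mul, mul_inv_cancel, Units.val_one, mul_one]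
  rw [natCast_mul_eq_smul, θ.mat_smul, e, ← Matrix.mul_smul]
  exact ha.int_right.mul (by exact_mod_cast (cosetRep_int hx).2.1)

/-- The norm of a unit of `𝒪[1/p]` that lies in `𝒪` is a power of `p`. -/
theorem exists_normSq_eq_pow {a : ℍ[ℚ]} (ha0 : a ≠ 0) (ha : a ∈ order) (hinv : a⁻¹ ∈ orderAway p) :
    ∃ i : ℕ, normSq a = ((p ^ i : ℕ) : ℚ) := by
  obtain ⟨n, hn⟩ := exists_normSq_eq ha
  obtain ⟨j, hj⟩ := mem_orderAway_iff.1 hinv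
  obtain ⟨n', hn'⟩ := exists_normSq_eq hj
  have hn0 : (n : ℚ) ≠ 0 := by rw [← hn]; exact normSq_ne_zero.2 ha0
  rw [map_mul, map_inv₀, normSq_natCast, hn] at hn'
  have h1 : n * n' = p ^ (j * 2) := by
    have : (n : ℚ) * n' = (p : ℚ) ^ (j * 2) := by
      rw [← hn', mul_left_comm, mul_inv_cancel₀ hn0, mul_one, pow_mul]
      push_cast
      rfl
    exact_mod_cast this
  obtain ⟨i, -, hi⟩ := (Nat.dvd_prime_pow hp.out).1 ⟨n', h1.symm⟩
  exact ⟨i, by rw [hn, hi]⟩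

theorem IsGlobalRep.norm_det {θ : Splitting p} {X : (Matrix (Fin 2) (Fin 2) ℚ_[p])ˣ} {a : ℍ[ℚ]}
    (ha : IsGlobalRep θ X a) : ‖(θ.mat a).det‖ = ‖X.val.det‖ := by
  have h1 : ‖(X⁻¹.val * θ.mat a).det‖ ≤ 1 := ha.int_left.det_mem
  have h2 : ‖(θ.mat a⁻¹ * X.val).det‖ ≤ 1 := ha.int_right.det_mem
  have h3 : (θ.mat a⁻¹ * X.val) * (X⁻¹.val * θ.mat a) = 1 := by
    rw [mul_assoc, ← mul_assoc X.val, ← Units.val_mul, mul_inv_cancel, Units.val_one, one_mul,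
      θ.mat_inv_mul ha.ne_zero]
  have h4 : ‖(θ.mat a⁻¹ * X.val).det‖ * ‖(X⁻¹.val * θ.mat a).det‖ = 1 := by
    rw [← norm_mul, ← Matrix.det_mul, h3, Matrix.det_one, norm_one]
  have h5 : ‖(X⁻¹.val * θ.mat a).det‖ = 1 := by
    refine le_antisymm h1 ?_
    by_contra! hlt
    nlinarith [norm_nonneg (θ.mat a⁻¹ * X.val).det, norm_nonneg (X⁻¹.val * θ.mat a).det]
  have h6 : θ.mat a = X.val * (X⁻¹.val * θ.mat a) := by
    rw [← mul_assoc, ← Units.val_mul, mul_inv_cancel, Units.val_one, one_mul]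
  rw [h6, Matrix.det_mul, norm_mul, h5, mul_one]

theorem IsGlobalRep.normSq_eq {θ : Splitting p} {k : ℕ} {x : RepIx 2} (hx : x ∈ repIndex p 2 k)
    {a : ℍ[ℚ]} (ha : IsGlobalRep θ (cosetRep p x.1 x.2) a) : normSq a = (p : ℚ) ^ k := by
  obtain ⟨i, hi⟩ := exists_normSq_eq_pow ha.ne_zero (ha.mem_order hx) ha.inv_mem
  have h1 := ha.norm_det
  rw [θ.det_mat, hi, (cosetRep_int hx).2.2] at h1
  have h2 : ((p : ℝ) ^ (-(i : ℤ))) = (p : ℝ) ^ (-(k : ℤ)) := by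
    rw [← h1, ← Padic.norm_p_pow]
    push_cast
    rfl
  have h3 := zpow_p_injective h2
  have h4 : i = k := by omega
  rw [hi, h4]
  push_cast
  rfl

theorem quatAbs_mul (x y : ℍ[ℚ]) : quatAbs (x * y) = quatAbs x * quatAbs y := by
  rw [quatAbs, quatAbs, quatAbs, map_mul, ← Real.sqrt_mul (by exact_mod_cast normSq_nonneg)]
  push_cast
  rfl

theorem quatAbs_inv (x : ℍ[ℚ]) : quatAbs x⁻¹ = (quatAbs x)⁻¹ := by
  rw [quatAbs, quatAbs, map_inv₀, ← Real.sqrt_inv]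
  push_cast
  rfl

/-- The contribution of a coset representative, in terms of the Fourier coefficients. -/
theorem IsMaassForm.fourierIntegral_scale (hF : IsMaassForm r F) {a d β : ℍ[ℚ]} (ha : a ≠ 0)
    (hd : d ≠ 0) (hβ : β ≠ 0) (hβ' : d⁻¹ * β * a ∈ dualLattice) (y : Set.Ioi (0 : ℝ)) :
    fourierIntegral F (d⁻¹ * β * a) (aDiag (scaleHeight ha hd y))
      = ((normSq d / normSq a : ℚ) : ℂ) * fourierCoeff r F (d⁻¹ * β * a) *
        (((y : ℝ) : ℂ) ^ 2 * besselK (Complex.I * r) (2 * Real.pi * quatAbs β * y)) := by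
  have ha' := quatAbs_pos ha
  have hd' := quatAbs_pos hd
  rw [hF.fourierIntegral_eq_fourierCoeff hβ'
    (mul_ne_zero (mul_ne_zero (inv_ne_zero hd) hβ) ha)]
  have e1 : 2 * Real.pi * quatAbs (d⁻¹ * β * a) * (scaleHeight ha hd y : ℝ)
      = 2 * Real.pi * quatAbs β * y := by
    rw [quatAbs_mul, quatAbs_mul, quatAbs_inv]
    change _ * (y * quatAbs d / quatAbs a) = _
    field_simp
  have e2 : (((scaleHeight ha hd y : Set.Ioi (0 : ℝ)) : ℝ) : ℂ) ^ 2
      = ((normSq d / normSq a : ℚ) : ℂ) * ((y : ℝ) : ℂ) ^ 2 := by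
    have : ((scaleHeight ha hd y : Set.Ioi (0 : ℝ)) : ℝ) ^ 2
        = ((normSq d / normSq a : ℚ) : ℝ) * (y : ℝ) ^ 2 := by
      change (y * quatAbs d / quatAbs a) ^ 2 = _
      rw [div_pow, mul_pow, quatAbs_sq, quatAbs_sq, normSq_toQuatReal, normSq_toQuatReal]
      push_cast
      ring
    exact_mod_cast congrArg (fun t : ℝ => (t : ℂ)) this
  rw [e1, e2]
  ring

theorem IsMaassForm.continuous_borel (hF : IsMaassForm r F) {a d : ℍ[ℚ]} (ha : a ≠ 0) (hd : d ≠ 0)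
    (b β : ℍ[ℚ]) (M : ℕ) (y : Set.Ioi (0 : ℝ)) : Continuous fun x : ℍ[ℝ] =>
      F ((toReal (borel (Units.mk0 a ha) (Units.mk0 d hd) b))⁻¹ *
        (nUnip (toQuatReal M * x) * aDiag y)) * char β (toQuatReal M * x) := by
  simp only [hF.borel_apply ha hd]
  have hM : Continuous fun x : ℍ[ℝ] => toQuatReal M * x := continuous_const.mul continuous_id
  have h1 := hF.continuous_nUnip (aDiag (scaleHeight ha hd y))
  have h2 : Continuous fun x : ℍ[ℝ] =>
      toQuatReal a⁻¹ * (toQuatReal M * x - toQuatReal b) * toQuatReal d :=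
    (continuous_const.mul (hM.sub continuous_const)).mul continuous_const
  exact (h1.comp h2).mul ((continuous_char β).comp hM)

open Classical in
/-- The Hecke operators on the Fourier coefficients. -/
theorem IsMaassForm.hecke_fourierCoeff (hF : IsMaassForm r F) (θ : Splitting p) {m : ℕ} (hm : m ≤ 4)
    {μ : ℂ} (hμ : heckeOp p (θ.toGL4.symm (diagP p m)) F = μ • F) {a : RepIx 2 → ℍ[ℚ]}
    (ha : ∀ k, ∀ x ∈ repIndex p 2 k, IsGlobalRep θ (cosetRep p x.1 x.2) (a x)) {β : ℍ[ℚ]}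
    (hβ : β ∈ dualLattice) (hβ0 : β ≠ 0) : μ * fourierCoeff r F β
      = ∑ kl ∈ (range 3 ×ˢ range 3).filter (fun kl => kl.1 + kl.2 = m),
        (p : ℂ) ^ (kl.1 * (2 - kl.2)) * ∑ x ∈ repIndex p 2 kl.1, ∑ y ∈ repIndex p 2 kl.2,
          if (a y)⁻¹ * β * a x ∈ dualLattice
          then (p : ℂ) ^ kl.2 / (p : ℂ) ^ kl.1 * fourierCoeff r F ((a y)⁻¹ * β * a x) else 0 := by
  have hκ : 0 < 2 * Real.pi * quatAbs β := by
    have := quatAbs_pos hβ0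
    have := Real.pi_pos
    positivity
  obtain ⟨y, hy, hK⟩ : ∃ y : ℝ, 0 < y ∧ besselK (Complex.I * r) (2 * Real.pi * quatAbs β * y) ≠ 0 := by
    obtain ⟨z, hz, h⟩ := exists_besselK_ne_zero (Complex.I * r)
    refine ⟨z / (2 * Real.pi * quatAbs β), div_pos hz hκ, ?_⟩
    rwa [mul_div_cancel₀ _ hκ.ne']
  set Y : Set.Ioi (0 : ℝ) := ⟨y, hy⟩ with hY
  set κ : ℂ := ((Y : ℝ) : ℂ) ^ 2 * besselK (Complex.I * r) (2 * Real.pi * quatAbs β * Y) with hκdef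
  have hκ0 : κ ≠ 0 := mul_ne_zero (pow_ne_zero 2 (by exact_mod_cast hy.ne')) hK
  refine mul_right_cancel₀ hκ0 ?_
  set ψ : RepIx 2 → RepIx 2 → ℂ := fun x y =>
    if (a y)⁻¹ * β * a x ∈ dualLattice then ((normSq (a y) / normSq (a x) : ℚ) : ℂ)
      * fourierCoeff r F ((a y)⁻¹ * β * a x) else 0 with hψ
  have hterm : ∀ c ∈ repIndex p 4 m, cubeMean (fun x => adelize p F (θ.toGL4.symm (cosetRep p c.1 c.2))
      (nUnip (toQuatReal p * x) * aDiag Y) * char (-β) (toQuatReal p * x))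
      = ψ (blockPart c 0) (blockPart c 1) * κ ∧
      Continuous fun x => adelize p F (θ.toGL4.symm (cosetRep p c.1 c.2))
        (nUnip (toQuatReal p * x) * aDiag Y) * char (-β) (toQuatReal p * x) := by
    intro c hc
    have h0 := blockPart_mem hc 0
    have h1 := blockPart_mem hc 1
    obtain ⟨b, hb, hbc⟩ := hF.adelize_cosetRep θ hc (ha _ _ h0) (ha _ _ h1)
    simp only [hbc]
    refine ⟨?_, hF.continuous_borel _ _ _ _ _ _⟩
    rw [hF.cubeMean_borel _ _ hb hβ hp.out.ne_zero ((ha _ _ h0).p_mul_inv_mem h0)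
      ((ha _ _ h1).mem_order h1), hψ]
    simp only
    split_ifs with h
    · rw [hF.fourierIntegral_scale (ha _ _ h0).ne_zero (ha _ _ h1).ne_zero hβ0 h]
    · rw [zero_mul]
  have hmain : μ * fourierCoeff r F β * κ
      = ∑ c ∈ repIndex p 4 m, ψ (blockPart c 0) (blockPart c 1) * κ := by
    rw [mul_assoc, hκdef, ← mul_assoc (fourierCoeff r F β),
      ← hF.fourierIntegral_eq_fourierCoeff hβ hβ0 Y, ← hκdef, fourierIntegral_eq, ← cubeMean_const_mul,
      ← sum_congr rfl fun c hc => (hterm c hc).1, ← cubeMean_sum _ fun c hc => (hterm c hc).2]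
    have hcont : Continuous fun x : ℍ[ℝ] => μ * (F (nUnip x * aDiag Y) * char (-β) x) :=
      continuous_const.mul ((hF.continuous_nUnip _).mul (continuous_char _))
    have hper : IsPeriodic fun x : ℍ[ℝ] => μ * (F (nUnip x * aDiag Y) * char (-β) x) := fun o ho x => by
      have h1 := hF.isPeriodic (aDiag Y) o ho x
      have h2 := isPeriodic_char (neg_mem_dualLattice hβ) o ho x
      simp only [h1, h2]
    rw [← cubeMean_comp hcont hper (natCast_ne_zero hp.out.ne_zero) one_ne_zero (fun o ho => by
      rw [mul_one]; exact mul_mem (natCast_mem_order p) ho) 0]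
    congr 1
    funext x
    simp only [map_one, mul_one, add_zero]
    rw [← sum_mul, ← hF.heckeOp_eq θ hm, hμ, Pi.smul_apply, smul_eq_mul, mul_assoc]
  rw [hmain, ← sum_mul, sum_blocks]
  congr 1
  refine sum_congr rfl fun kl _ => ?_
  congr 1
  refine sum_congr rfl fun x hx => sum_congr rfl fun y hy => ?_
  rw [hψ]
  simp only
  split_ifs with h
  · rw [(ha _ x hx).normSq_eq hx, (ha _ y hy).normSq_eq hy]
    push_cast
    rfl
  · rfl

end HeckeFourier

/-! ### Elements of the dual lattice up to units of `𝒪[1/p]` -/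

section AwayEquiv

variable {p : ℕ} [hp : Fact p.Prime]

/-- `u` is a unit of `𝒪[1/p]`. -/
def IsAwayUnit (p : ℕ) (u : ℍ[ℚ]) : Prop := u ≠ 0 ∧ u ∈ orderAway p ∧ u⁻¹ ∈ orderAway p

theorem IsAwayUnit.inv {p : ℕ} {u : ℍ[ℚ]} (h : IsAwayUnit p u) : IsAwayUnit p u⁻¹ :=
  ⟨inv_ne_zero h.1, h.2.2, by rw [inv_inv]; exact h.2.1⟩

theorem IsAwayUnit.mul {p : ℕ} {u v : ℍ[ℚ]} (hu : IsAwayUnit p u) (hv : IsAwayUnit p v) :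
    IsAwayUnit p (u * v) :=
  ⟨mul_ne_zero hu.1 hv.1, mul_mem hu.2.1 hv.2.1, by rw [mul_inv_rev]; exact mul_mem hv.2.2 hu.2.2⟩

theorem IsAwayUnit.one {p : ℕ} : IsAwayUnit p 1 :=
  ⟨one_ne_zero, one_mem _, by rw [inv_one]; exact one_mem _⟩

/-- `β` and `γ` generate the same two-sided orbit under the units of `𝒪[1/p]`. -/
def AwayEquiv (p : ℕ) (β γ : ℍ[ℚ]) : Prop := ∃ u v, IsAwayUnit p u ∧ IsAwayUnit p v ∧ γ = u * β * v

theorem AwayEquiv.refl {p : ℕ} (β : ℍ[ℚ]) : AwayEquiv p β β :=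
  ⟨1, 1, .one, .one, by rw [one_mul, mul_one]⟩

theorem AwayEquiv.symm {p : ℕ} {β γ : ℍ[ℚ]} (h : AwayEquiv p β γ) : AwayEquiv p γ β := by
  obtain ⟨u, v, hu, hv, rfl⟩ := h
  refine ⟨u⁻¹, v⁻¹, hu.inv, hv.inv, ?_⟩
  rw [mul_assoc u, inv_mul_cancel_left₀ hu.1, mul_inv_cancel_right₀ hv.1]

theorem AwayEquiv.trans {p : ℕ} {β γ δ : ℍ[ℚ]} (h : AwayEquiv p β γ) (h' : AwayEquiv p γ δ) :
    AwayEquiv p β δ := by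
  obtain ⟨u, v, hu, hv, rfl⟩ := h
  obtain ⟨u', v', hu', hv', rfl⟩ := h'
  exact ⟨u' * u, v * v', hu'.mul hu, hv.mul hv', by simp only [mul_assoc]⟩

theorem AwayEquiv.mul_left {p : ℕ} {β γ u : ℍ[ℚ]} (h : AwayEquiv p β γ) (hu : IsAwayUnit p u) :
    AwayEquiv p β (u * γ) := h.trans ⟨u, 1, hu, .one, by rw [mul_one]⟩

theorem AwayEquiv.mul_right {p : ℕ} {β γ u : ℍ[ℚ]} (h : AwayEquiv p β γ) (hu : IsAwayUnit p u) :
    AwayEquiv p β (γ * u) := h.trans ⟨1, u, .one, hu, by rw [one_mul]⟩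

theorem AwayEquiv.ne_zero {p : ℕ} {β γ : ℍ[ℚ]} (h : AwayEquiv p β γ) (h0 : β ≠ 0) : γ ≠ 0 := by
  obtain ⟨u, v, hu, hv, rfl⟩ := h
  exact mul_ne_zero (mul_ne_zero hu.1 h0) hv.1

theorem AwayEquiv.exists_pow_mul {β γ : ℍ[ℚ]} (h : AwayEquiv p β γ) : ∃ k : ℕ, ∃ x ∈ order, ∃ y ∈ order,
    ∀ m : ℕ, ((p ^ k : ℕ) : ℍ[ℚ]) * divNat γ m = x * divNat β m * y := by
  obtain ⟨u, v, hu, hv, rfl⟩ := h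
  obtain ⟨k, hk⟩ := mem_orderAway_iff.1 hu.2.1
  obtain ⟨l, hl⟩ := mem_orderAway_iff.1 hv.2.1
  refine ⟨k + l, _, hk, _, hl, fun m => ?_⟩
  rw [← divNat_mul, ← mul_divNat, pow_add, Nat.cast_mul]
  simp only [mul_assoc]
  rw [← mul_assoc (divNat β m), ← natCast_comm (p ^ l) (divNat β m)]
  simp only [mul_assoc]
  rw [← mul_assoc _ u, natCast_comm (p ^ l) u, mul_assoc]

theorem AwayEquiv.mem_dualLattice (hp2 : p ≠ 2) {β γ : ℍ[ℚ]} (h : AwayEquiv p β γ)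
    (hβ : β ∈ dualLattice) (hγ : γ ∈ order) : γ ∈ dualLattice := by
  obtain ⟨k, x, hx, y, hy, e⟩ := h.exists_pow_mul
  have e1 := e 1
  simp only [divNat, Nat.cast_one, inv_one, one_smul] at e1
  refine dual_mem_of_coprime (m := p ^ k) (n := 2) ?_ ?_ (two_mul_mem hγ)
  · exact Nat.Coprime.pow_left _ ((Nat.coprime_primes hp.out Nat.prime_two).2 hp2)
  · rw [e1]
    exact dualLattice_mul (mul_dualLattice hβ hx) hy

theorem AwayEquiv.divNat_mem {β γ : ℍ[ℚ]} (h : AwayEquiv p β γ) (hγ : γ ∈ order) {m : ℕ}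
    (hm0 : m ≠ 0) (hm : ¬ p ∣ m) (hβ : divNat β m ∈ order) : divNat γ m ∈ order := by
  obtain ⟨k, x, hx, y, hy, e⟩ := h.exists_pow_mul
  refine order_mem_of_coprime (m := p ^ k) (n := m)
    (Nat.Coprime.pow_left _ ((Nat.Prime.coprime_iff_not_dvd hp.out).2 hm)) ?_ ?_
  · rw [e]
    exact mul_mem (mul_mem hx hβ) hy
  · rwa [natCast_mul_divNat hm0]

theorem divNat_not_mem_of_dvd {β : ℍ[ℚ]} (h : divNat β p ∉ order) {m : ℕ} (hm0 : m ≠ 0)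
    (hm : p ∣ m) : divNat β m ∉ order := by
  obtain ⟨n, rfl⟩ := hm
  intro h'
  obtain ⟨y, hy, rfl⟩ := (divNat_mem_iff hm0).1 h'
  refine h ((divNat_mem_iff hp.out.ne_zero).2 ⟨n * y, mul_mem (natCast_mem _ n) hy, ?_⟩)
  rw [Nat.cast_mul, mul_assoc]

variable {A : ℍ[ℚ] → ℂ}

/-- Coefficients of a Maass form at equivalent elements of the same norm that are not divisible
by `p` agree. -/
theorem MaassRelations.eq_of_awayEquiv (hA : MaassRelations A) (hp2 : p ≠ 2) {β γ : ℍ[ℚ]}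
    (h : AwayEquiv p β γ) (hβ : β ∈ dualLattice) (hβ0 : β ≠ 0) (hγ : γ ∈ order)
    (hβp : divNat β p ∉ order) (hγp : divNat γ p ∉ order)
    (hnorm : Quaternion.normSq γ = Quaternion.normSq β) : A γ = A β := by
  refine hA.eq_of_content hβ hβ0 (h.mem_dualLattice hp2 hβ hγ) hnorm fun m hm => ?_
  have hm0 : m ≠ 0 := by rintro rfl; simp at hm
  by_cases hpm : p ∣ m
  · exact iff_of_false (divNat_not_mem_of_dvd hβp hm0 hpm) (divNat_not_mem_of_dvd hγp hm0 hpm)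
  · exact ⟨h.divNat_mem hγ hm0 hpm, h.symm.divNat_mem (dualLattice_subset hβ) hm0 hpm⟩

/-- The coefficient of `p β` in terms of that of an element of the same norm that is not divisible
by `p`, and that of `β`. -/
theorem MaassRelations.prime_mul_of_awayEquiv (hA : MaassRelations A) (hp2 : p ≠ 2) {β γ : ℍ[ℚ]}
    (h : AwayEquiv p β γ) (hβ : β ∈ dualLattice) (hβ0 : β ≠ 0) (hγ : γ ∈ order)
    (hγp : divNat γ p ∉ order) (hnorm : Quaternion.normSq γ = (p : ℚ) ^ 2 * Quaternion.normSq β) :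
    A (p * β) = A γ + p * A β := by
  refine hA.prime_mul hp.out hp2 hβ hβ0 (h.mem_dualLattice hp2 hβ hγ) hnorm fun m hm => ?_
  have hm0 : m ≠ 0 := by rintro rfl; simp at hm
  by_cases hpm : p ∣ m
  · exact iff_of_false (divNat_not_mem_of_dvd hγp hm0 hpm) fun h => h.1 hpm
  · exact ⟨fun h' => ⟨hpm, h.symm.divNat_mem (dualLattice_subset hβ) hm0 hpm h'⟩,
      fun h' => h.divNat_mem hγ hm0 hpm h'.2⟩

end AwayEquiv

/-! ### Hecke eigenvalues on the Maass space -/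

section MaassEigenvalues
open Finset Quaternion

variable {p : ℕ} [hp : Fact p.Prime]

/-- Representatives `a x ∈ 𝒪` of norm `p` of the maximal ideals `a x 𝒪` above `p`: an element of
`𝒪` of norm divisible by `p` that is not itself divisible by `p` lies in exactly one of them. -/
structure IsNormSystem {ι : Type} (p : ℕ) (D : Finset ι) (a : ι → ℍ[ℚ]) : Prop where
  card : D.card = p + 1
  mem : ∀ x ∈ D, a x ∈ order
  unit : ∀ x ∈ D, IsAwayUnit p (a x)
  normSq_eq : ∀ x ∈ D, normSq (a x) = p
  unique : ∀ β ∈ order, divNat β p ∉ order → (∃ n : ℕ, normSq β = ((p * n : ℕ) : ℚ)) →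
    ∃ x ∈ D, (a x)⁻¹ * β ∈ order ∧ ∀ y ∈ D, (a y)⁻¹ * β ∈ order → y = x

theorem natCast_mul_inv_eq_star {p : ℕ} {a : ℍ[ℚ]} (ha : normSq a = p) (ha0 : a ≠ 0) :
    (p : ℍ[ℚ]) * a⁻¹ = star a := by
  rw [← mul_left_inj' ha0, mul_assoc, inv_mul_cancel₀ ha0, mul_one, star_mul_self, ha]
  norm_cast

theorem isAwayUnit_natCast : IsAwayUnit p (p : ℍ[ℚ]) := by
  refine ⟨natCast_ne_zero hp.out.ne_zero, natCast_mem _ p, ?_⟩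
  have e : (p : ℍ[ℚ])⁻¹ = ((p : ℚ) ^ 1)⁻¹ • (1 : ℍ[ℚ]) := by
    rw [pow_one, ← divNat, ← mul_right_inj' (natCast_ne_zero hp.out.ne_zero),
      mul_inv_cancel₀ (natCast_ne_zero hp.out.ne_zero), natCast_mul_divNat hp.out.ne_zero]
  rw [e]
  exact smul_inv_pow_mem 1 (one_mem _)

theorem divNat_eq_inv_mul (β : ℍ[ℚ]) : divNat β p = (p : ℍ[ℚ])⁻¹ * β := by
  rw [← mul_right_inj' (natCast_ne_zero hp.out.ne_zero), natCast_mul_divNat hp.out.ne_zero,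
    mul_inv_cancel_left₀ (natCast_ne_zero hp.out.ne_zero)]

theorem not_mem_of_normSq {p : ℕ} {γ : ℍ[ℚ]} {k n : ℕ} (hk : k ≠ 0) (h : (p : ℚ) ^ k * normSq γ = n)
    (hn : ¬ p ∣ n) : γ ∉ order := by
  intro hγ
  obtain ⟨m, hm⟩ := exists_normSq_eq hγ
  rw [hm] at h
  exact hn ((dvd_pow_self p hk).trans ⟨m, by exact_mod_cast h.symm⟩)

theorem divNat_not_mem_of_normSq {γ : ℍ[ℚ]} {k n : ℕ} (hk : k < 2)
    (h : normSq γ = (p : ℚ) ^ k * n) (hn : ¬ p ∣ n) : divNat γ p ∉ order := by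
  have hp0 : (p : ℚ) ≠ 0 := by exact_mod_cast hp.out.ne_zero
  refine not_mem_of_normSq (k := 2 - k) (by omega) ?_ hn
  rw [normSq_divNat, h]
  interval_cases k
  · field_simp
    ring
  · field_simp
    ring

variable {ι : Type} {D : Finset ι} {a : ι → ℍ[ℚ]}

theorem IsNormSystem.divNat_mul_mem_iff (hD : IsNormSystem p D a) {x : ι} (hx : x ∈ D) (β : ℍ[ℚ]) :
    divNat (β * a x) p ∈ order ↔ (a x)⁻¹ * star β ∈ order := by
  have e : star (divNat (β * a x) p) = (a x)⁻¹ * star β := by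
    rw [← mul_right_inj' (natCast_ne_zero hp.out.ne_zero), ← mul_assoc,
      natCast_mul_inv_eq_star (hD.normSq_eq x hx) (hD.unit x hx).1, natCast_comm, ← star_mul,
      ← star_natCast (R := ℍ[ℚ]) p, ← star_mul, natCast_mul_divNat hp.out.ne_zero]
  rw [← e]
  exact ⟨star_mem_order, fun h => by simpa using star_mem_order h⟩

theorem IsNormSystem.unique_right (hD : IsNormSystem p D a) {β : ℍ[ℚ]} (hβ : β ∈ order)
    (hβp : divNat β p ∉ order) (hn : ∃ n : ℕ, normSq β = ((p * n : ℕ) : ℚ)) :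
    ∃ x ∈ D, divNat (β * a x) p ∈ order ∧ ∀ y ∈ D, divNat (β * a y) p ∈ order → y = x := by
  obtain ⟨x, hx, h, h'⟩ := hD.unique (star β) (star_mem_order hβ)
    (fun h => hβp (by simpa [divNat, Quaternion.star_smul] using star_mem_order h))
    (by rwa [normSq_star])
  exact ⟨x, hx, (hD.divNat_mul_mem_iff hx β).2 h, fun y hy hy' =>
    h' y hy ((hD.divNat_mul_mem_iff hy β).1 hy')⟩

variable {A : ℍ[ℚ] → ℂ} {μ₁ μ₂ μ₃ : ℂ}

/-- The action of the Hecke operator `T₁` on a family of Fourier coefficients. -/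
def HeckeOne (p : ℕ) (D : Finset ι) (a : ι → ℍ[ℚ]) (A : ℍ[ℚ] → ℂ) (μ : ℂ) : Prop :=
  ∀ β ∈ dualLattice, β ≠ 0 → μ * A β = p * ∑ x ∈ D, dualLattice.indicator A (β * a x)
    + p * ∑ y ∈ D, dualLattice.indicator A ((a y)⁻¹ * β)

/-- The action of the Hecke operator `T₂` on a family of Fourier coefficients. -/
def HeckeTwo (p : ℕ) (D : Finset ι) (a : ι → ℍ[ℚ]) (A : ℍ[ℚ] → ℂ) (μ : ℂ) : Prop :=
  ∀ β ∈ dualLattice, β ≠ 0 → μ * A β = (p : ℂ) ^ 2 * A (p * β)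
    + p * ∑ x ∈ D, ∑ y ∈ D, dualLattice.indicator A ((a y)⁻¹ * β * a x)
    + (p : ℂ) ^ 2 * dualLattice.indicator A (divNat β p)

/-- The action of the Hecke operator `T₃` on a family of Fourier coefficients. -/
def HeckeThree (p : ℕ) (D : Finset ι) (a : ι → ℍ[ℚ]) (A : ℍ[ℚ] → ℂ) (μ : ℂ) : Prop :=
  ∀ β ∈ dualLattice, β ≠ 0 → μ * A β = p * ∑ y ∈ D, dualLattice.indicator A (p * (a y)⁻¹ * β)
    + p * ∑ x ∈ D, dualLattice.indicator A (divNat (β * a x) p)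

theorem IsNormSystem.mul_mem_dual {p : ℕ} (hD : IsNormSystem p D a) {x : ι} (hx : x ∈ D) {β : ℍ[ℚ]}
    (hβ : β ∈ dualLattice) : β * a x ∈ dualLattice := dualLattice_mul hβ (hD.mem x hx)

theorem IsNormSystem.normSq_mul {p : ℕ} (hD : IsNormSystem p D a) {x : ι} (hx : x ∈ D) (β : ℍ[ℚ]) :
    normSq (β * a x) = p * normSq β := by rw [map_mul, hD.normSq_eq x hx, mul_comm]

theorem IsNormSystem.normSq_inv_mul (hD : IsNormSystem p D a) {x : ι} (hx : x ∈ D) (β : ℍ[ℚ]) :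
    p * normSq ((a x)⁻¹ * β) = normSq β := by
  rw [map_mul, map_inv₀, hD.normSq_eq x hx, mul_inv_cancel_left₀]
  exact_mod_cast hp.out.ne_zero

theorem indicator_of_not_mem_order {γ : ℍ[ℚ]} (h : γ ∉ order) : dualLattice.indicator A γ = 0 :=
  Set.indicator_of_notMem (fun h' => h (dualLattice_subset h')) A

/-- If some Fourier coefficient is not zero, then there is one at an element of norm prime to `p`.
For otherwise take a coefficient `A(β) ≠ 0` with `ν(β)` minimal. For `β = p δ` apply `T₂` at `δ`;
for `β = a y δ` not divisible by `p` apply `T₁` at `δ`: by minimality all the other terms vanish,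
and the remaining ones are all equal to `A(β)`. -/
theorem MaassRelations.eq_zero_of_coprime (hA : MaassRelations A) (hp2 : p ≠ 2)
    (hD : IsNormSystem p D a) (h1 : HeckeOne p D a A μ₁) (h2 : HeckeTwo p D a A μ₂)
    (h : ∀ β ∈ dualLattice, β ≠ 0 → ∀ n : ℕ, normSq β = n → ¬ p ∣ n → A β = 0) (n : ℕ) :
    ∀ β ∈ dualLattice, β ≠ 0 → normSq β = n → A β = 0 := by
  have hpQ : (p : ℚ) ≠ 0 := by exact_mod_cast hp.out.ne_zero
  have hpC : (p : ℂ) ≠ 0 := by exact_mod_cast hp.out.ne_zero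
  have hp1 : (1 : ℚ) < p := by exact_mod_cast hp.out.one_lt
  induction n using Nat.strong_induction_on with
  | _ n ih =>
  intro β hβ hβ0 hn
  -- The induction hypothesis, for the indicator function and any power of `p`.
  have ih' : ∀ γ k, k ≠ 0 → γ ≠ 0 → (p : ℚ) ^ k * normSq γ = n → dualLattice.indicator A γ = 0 := by
    intro γ k hk h0 hγ
    by_cases hγS : γ ∈ dualLattice
    · obtain ⟨m, hm⟩ := exists_normSq_eq (dualLattice_subset hγS)
      rw [Set.indicator_of_mem hγS]
      refine ih m ?_ γ hγS h0 hm
      have hm0 : 0 < (m : ℚ) := by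
        rw [← hm]; exact lt_of_le_of_ne normSq_nonneg (normSq_ne_zero.2 h0).symm
      rw [hm] at hγ
      have : (m : ℚ) < n := by
        rw [← hγ]
        exact lt_mul_of_one_lt_left hm0 (one_lt_pow₀ hp1 hk)
      exact_mod_cast this
    · exact Set.indicator_of_notMem hγS A
  by_cases hpn : p ∣ n
  swap
  · exact h β hβ hβ0 n hn hpn
  obtain ⟨n', rfl⟩ := hpn
  by_cases hβp : divNat β p ∈ order
  · set δ := divNat β p with hδ
    have e : β = p * δ := (natCast_mul_divNat hp.out.ne_zero β).symm
    have hδβ : AwayEquiv p β δ := by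
      rw [hδ, divNat_eq_inv_mul]
      exact (AwayEquiv.refl β).mul_left isAwayUnit_natCast.inv
    have hδ0 := hδβ.ne_zero hβ0
    have hδS := hδβ.mem_dualLattice hp2 hβ hβp
    have hδn : (p : ℚ) ^ 2 * normSq δ = ((p * n' : ℕ) : ℚ) := by
      rw [← hn, e, map_mul, normSq_natCast]
    have hz : A δ = 0 := by
      rw [← Set.indicator_of_mem hδS A]
      exact ih' δ 2 two_ne_zero hδ0 hδn
    have := h2 δ hδS hδ0
    rw [hz, mul_zero, ← e, sum_eq_zero fun x hx => sum_eq_zero fun y hy => ?_,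
      ih' (divNat δ p) 4 (by norm_num) ?_ ?_, mul_zero, mul_zero, add_zero, add_zero] at this
    · exact (mul_eq_zero.1 this.symm).resolve_left (pow_ne_zero 2 hpC)
    · rw [divNat_eq_inv_mul]
      exact mul_ne_zero (inv_ne_zero (natCast_ne_zero hp.out.ne_zero)) hδ0
    · rw [normSq_divNat, ← hδn]
      field_simp
    · refine ih' _ 2 two_ne_zero (mul_ne_zero (mul_ne_zero (hD.unit y hy).inv.1 hδ0) (hD.unit x hx).1) ?_
      rw [hD.normSq_mul hx, ← hδn, ← hD.normSq_inv_mul hy δ]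
  · obtain ⟨y, hy, hyβ, -⟩ := hD.unique β (dualLattice_subset hβ) hβp ⟨n', hn⟩
    set δ := (a y)⁻¹ * β with hδ
    have hδβ : AwayEquiv p β δ := (AwayEquiv.refl β).mul_left (hD.unit y hy).inv
    have hδ0 := hδβ.ne_zero hβ0
    have hδS := hδβ.mem_dualLattice hp2 hβ hyβ
    have hδn : p * normSq δ = ((p * n' : ℕ) : ℚ) := by rw [← hn, hD.normSq_inv_mul hy]
    have hz : A δ = 0 := by
      rw [← Set.indicator_of_mem hδS A]
      exact ih' δ 1 one_ne_zero hδ0 (by rw [pow_one, hδn])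
    have key : ∀ x ∈ D, dualLattice.indicator A (δ * a x) = A β := by
      intro x hx
      have hxS := hD.mul_mem_dual hx hδS
      have hxn : normSq (δ * a x) = normSq β := by rw [hD.normSq_mul hx, hδn, hn]
      have hxβ : AwayEquiv p β (δ * a x) := hδβ.mul_right (hD.unit x hx)
      rw [Set.indicator_of_mem hxS]
      by_cases hxp : divNat (δ * a x) p ∈ order
      · set ε := divNat (δ * a x) p with hε
        have e : δ * a x = p * ε := (natCast_mul_divNat hp.out.ne_zero _).symm
        have hεβ : AwayEquiv p β ε := by
          rw [hε, divNat_eq_inv_mul]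
          exact hxβ.mul_left isAwayUnit_natCast.inv
        have hε0 := hεβ.ne_zero hβ0
        have hεS := hεβ.mem_dualLattice hp2 hβ hxp
        have hεn : normSq β = (p : ℚ) ^ 2 * normSq ε := by rw [← hxn, e, map_mul, normSq_natCast]
        have hz' : A ε = 0 := by
          rw [← Set.indicator_of_mem hεS A]
          exact ih' ε 2 two_ne_zero hε0 (by rw [← hεn, hn])
        rw [e, hA.prime_mul_of_awayEquiv hp2 hεβ.symm hεS hε0 (dualLattice_subset hβ) hβp hεn, hz',
          mul_zero, add_zero]
      · exact hA.eq_of_awayEquiv hp2 hxβ hβ hβ0 (dualLattice_subset hxS) hβp hxp hxn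
    have := h1 δ hδS hδ0
    rw [hz, mul_zero, sum_congr rfl key, sum_const, hD.card, nsmul_eq_mul,
      sum_eq_zero fun x hx => ih' _ 2 two_ne_zero (mul_ne_zero (hD.unit x hx).inv.1 hδ0)
        (by rw [← hδn, ← hD.normSq_inv_mul hx δ]; ring), mul_zero, add_zero] at this
    have h3 : ((p + 1 : ℕ) : ℂ) ≠ 0 := Nat.cast_ne_zero.2 (Nat.succ_ne_zero p)
    exact (mul_eq_zero.1 ((mul_eq_zero.1 this.symm).resolve_left hpC)).resolve_left h3

/-- The Hecke eigenvalues, from the relations at an element `β` of norm prime to `p` and at an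
element of norm `p ν(β)`; `α` is an auxiliary element of norm `p`. -/
theorem MaassRelations.eigenvalues (hA : MaassRelations A) (hp2 : p ≠ 2)
    (hD : IsNormSystem p D a) (h1 : HeckeOne p D a A μ₁) (h2 : HeckeTwo p D a A μ₂)
    (h3 : HeckeThree p D a A μ₃) {α β : ℍ[ℚ]} (hα : α ∈ order) (hαu : IsAwayUnit p α)
    (hαn : normSq α = p) (hβ : β ∈ dualLattice) (hβ0 : β ≠ 0) {n : ℕ}
    (hn : normSq β = n) (hpn : ¬ p ∣ n) (hAβ : A β ≠ 0) : μ₁ = p * (p + 1) * (A (β * α) / A β) ∧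
    μ₂ = (p : ℂ) ^ 2 * (A (β * α) / A β) ^ 2 + (p : ℂ) ^ 3 + p ∧
    μ₃ = p * (p + 1) * (A (β * α) / A β) := by
  classical
  have hpQ : (p : ℚ) ≠ 0 := by exact_mod_cast hp.out.ne_zero
  have hpC : (p : ℂ) ≠ 0 := by exact_mod_cast hp.out.ne_zero
  have prim : ∀ {γ : ℍ[ℚ]} (k : ℕ), k < 2 → normSq γ = (p : ℚ) ^ k * n → divNat γ p ∉ order :=
    fun k hk h => divNat_not_mem_of_normSq hk h hpn
  have hβα : β * α ∈ dualLattice := dualLattice_mul hβ hα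
  have hβαn : normSq (β * α) = (p : ℚ) ^ 1 * n := by rw [map_mul, hn, hαn, pow_one, mul_comm]
  have hβn : normSq β = (p : ℚ) ^ 0 * n := by rw [hn, pow_zero, one_mul]
  -- All coefficients at equivalent elements of norm `n`, or of norm `p n`, agree.
  have val0 : ∀ γ ∈ order, AwayEquiv p β γ → normSq γ = (p : ℚ) ^ 0 * n →
      dualLattice.indicator A γ = A β := fun γ hγ e h => by
    rw [Set.indicator_of_mem (e.mem_dualLattice hp2 hβ hγ)]
    exact hA.eq_of_awayEquiv hp2 e hβ hβ0 hγ (prim 0 two_pos hβn) (prim 0 two_pos h) (h.trans hβn.symm)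
  have val1 : ∀ γ ∈ order, AwayEquiv p β γ → normSq γ = (p : ℚ) ^ 1 * n →
      dualLattice.indicator A γ = A (β * α) := fun γ hγ e h => by
    rw [Set.indicator_of_mem (e.mem_dualLattice hp2 hβ hγ)]
    exact hA.eq_of_awayEquiv hp2 (((AwayEquiv.refl β).mul_right hαu).symm.trans e) hβα
      (mul_ne_zero hβ0 hαu.1) hγ (prim 1 one_lt_two hβαn) (prim 1 one_lt_two h) (h.trans hβαn.symm)
  have vanish : ∀ (γ : ℍ[ℚ]) (k : ℕ), k ≠ 0 → (p : ℚ) ^ k * normSq γ = n →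
      dualLattice.indicator A γ = 0 :=
    fun γ k hk h => indicator_of_not_mem_order (not_mem_of_normSq hk h hpn)
  have equiv_mul : ∀ x ∈ D, AwayEquiv p β (β * a x) := fun x hx =>
    (AwayEquiv.refl β).mul_right (hD.unit x hx)
  have norm_mul : ∀ x ∈ D, normSq (β * a x) = (p : ℚ) ^ 1 * n := fun x hx => by
    rw [hD.normSq_mul hx, hn, pow_one]
  have unique_left : ∀ x ∈ D, ∑ y ∈ D, dualLattice.indicator A ((a y)⁻¹ * β * a x) = A β := by
    intro x hx
    obtain ⟨y, hy, hyx, huniq⟩ := hD.unique (β * a x) (dualLattice_subset (hD.mul_mem_dual hx hβ))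
      (prim 1 one_lt_two (norm_mul x hx)) ⟨n, by rw [norm_mul x hx]; push_cast; ring⟩
    rw [sum_eq_single_of_mem y hy fun z hz hzy => indicator_of_not_mem_order fun h =>
      hzy (huniq z hz (by rwa [mul_assoc] at h)), mul_assoc]
    refine val0 _ hyx ((equiv_mul x hx).mul_left (hD.unit y hy).inv) (mul_left_cancel₀ hpQ ?_)
    rw [hD.normSq_inv_mul hy, norm_mul x hx]
    ring
  have hcard : (D.card : ℂ) = p + 1 := by rw [hD.card]; push_cast; rfl
  -- `T₁` and `T₃` at `β`.
  have r1 : μ₁ * A β = p * ((p + 1) * A (β * α)) := by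
    rw [h1 β hβ hβ0, sum_congr rfl fun x hx => val1 _ (dualLattice_subset
      (hD.mul_mem_dual hx hβ)) (equiv_mul x hx) (norm_mul x hx), sum_const, nsmul_eq_mul, hcard,
      sum_eq_zero fun y hy => vanish _ 1 one_ne_zero (by rw [pow_one, hD.normSq_inv_mul hy, hn]),
      mul_zero, add_zero]
  have r3 : μ₃ * A β = p * ((p + 1) * A (β * α)) := by
    have e : ∀ y ∈ D, dualLattice.indicator A (p * (a y)⁻¹ * β) = A (β * α) := fun y hy => by
      refine val1 _ ?_ ?_ ?_
      · rw [natCast_mul_inv_eq_star (hD.normSq_eq y hy) (hD.unit y hy).1]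
        exact mul_mem (star_mem_order (hD.mem y hy)) (dualLattice_subset hβ)
      · exact (AwayEquiv.refl β).mul_left (isAwayUnit_natCast.mul (hD.unit y hy).inv)
      · rw [map_mul, map_mul, map_inv₀, hD.normSq_eq y hy, normSq_natCast, hn]
        field_simp
    rw [h3 β hβ hβ0, sum_congr rfl e, sum_const, nsmul_eq_mul, hcard,
      sum_eq_zero fun y hy => vanish _ 1 one_ne_zero ?_, mul_zero, add_zero]
    rw [normSq_divNat, norm_mul y hy]
    field_simp
  -- `T₁` at `γ = β a x₀`: one of the elements `γ a x` is `p δ`, the others are not divisible by `p`.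
  obtain ⟨x₀, hx₀⟩ : D.Nonempty := card_pos.1 (by rw [hD.card]; omega)
  set γ := β * a x₀ with hγ
  have hγS := hD.mul_mem_dual hx₀ hβ
  have hγp := prim 1 one_lt_two (norm_mul x₀ hx₀)
  have hγn : normSq γ = ((p * n : ℕ) : ℚ) := by rw [norm_mul x₀ hx₀]; push_cast; ring
  obtain ⟨x₁, hx₁, hδ, huniq⟩ := hD.unique_right (dualLattice_subset hγS) hγp ⟨n, hγn⟩
  obtain ⟨x₂, hx₂, hx₂₁⟩ : ∃ x₂ ∈ D, x₂ ≠ x₁ := by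
    refine exists_mem_ne ?_ x₁
    rw [hD.card]
    exact Nat.lt_add_of_pos_left hp.out.pos
  have hγx : ∀ x ∈ D, γ * a x ∈ dualLattice := fun x hx => hD.mul_mem_dual hx hγS
  have hγxe : ∀ x ∈ D, AwayEquiv p β (γ * a x) := fun x hx =>
    (equiv_mul x₀ hx₀).mul_right (hD.unit x hx)
  have hγxn : ∀ x ∈ D, normSq (γ * a x) = (p : ℚ) ^ 2 * n := fun x hx => by
    rw [hD.normSq_mul hx, norm_mul x₀ hx₀]
    ring
  have hγxp : ∀ x ∈ D, x ≠ x₁ → divNat (γ * a x) p ∉ order := fun x hx h h' => h (huniq x hx h')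
  set δ := divNat (γ * a x₁) p with hδdef
  have eδ : γ * a x₁ = p * δ := (natCast_mul_divNat hp.out.ne_zero _).symm
  have hδe : AwayEquiv p β δ := by
    rw [hδdef, divNat_eq_inv_mul]
    exact (hγxe x₁ hx₁).mul_left isAwayUnit_natCast.inv
  have hδn : normSq δ = (p : ℚ) ^ 0 * n := by
    rw [hδdef, normSq_divNat, hγxn x₁ hx₁]
    field_simp
  have hδS := hδe.mem_dualLattice hp2 hβ hδ
  have mulp : ∀ ε ∈ dualLattice, AwayEquiv p β ε → normSq ε = (p : ℚ) ^ 0 * n →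
      A (p * ε) = A (γ * a x₂) + p * A β := fun ε hε e h => by
    rw [hA.prime_mul_of_awayEquiv hp2 (e.symm.trans (hγxe x₂ hx₂)) hε (e.ne_zero hβ0)
      (dualLattice_subset (hγx x₂ hx₂)) (hγxp x₂ hx₂ hx₂₁) (by rw [hγxn x₂ hx₂, h, pow_zero, one_mul]),
      ← val0 ε (dualLattice_subset hε) e h, Set.indicator_of_mem hε]
  have r1' : μ₁ * A (β * α) = p * (A (γ * a x₂) + p * A β + p * A (γ * a x₂)) + p * A β := by
    have e0 : A γ = A (β * α) := by
      rw [← val1 γ (dualLattice_subset hγS) (equiv_mul x₀ hx₀) (norm_mul x₀ hx₀),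
        Set.indicator_of_mem hγS]
    have e : ∀ x ∈ D.erase x₁, dualLattice.indicator A (γ * a x) = A (γ * a x₂) := fun x hx => by
      obtain ⟨hx1, hxD⟩ := mem_erase.1 hx
      rw [Set.indicator_of_mem (hγx x hxD)]
      exact hA.eq_of_awayEquiv hp2 ((hγxe x₂ hx₂).symm.trans (hγxe x hxD)) (hγx x₂ hx₂)
        ((hγxe x₂ hx₂).ne_zero hβ0) (dualLattice_subset (hγx x hxD)) (hγxp x₂ hx₂ hx₂₁)
        (hγxp x hxD hx1) ((hγxn x hxD).trans (hγxn x₂ hx₂).symm)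
    have hul := unique_left x₀ hx₀
    simp only [mul_assoc, ← hγ] at hul
    rw [← e0, h1 γ hγS ((equiv_mul x₀ hx₀).ne_zero hβ0), hul, ← add_sum_erase D _ hx₁,
      sum_congr rfl e, sum_const, card_erase_of_mem hx₁, hD.card,
      Nat.add_sub_cancel, nsmul_eq_mul, Set.indicator_of_mem (hγx x₁ hx₁), eδ, mulp δ hδS hδe hδn]
  -- `T₂` at `β`.
  have r2 : μ₂ * A β = (p : ℂ) ^ 2 * (A (γ * a x₂) + p * A β) + p * ((p + 1) * A β) := by
    rw [h2 β hβ hβ0, sum_congr rfl unique_left, sum_const, nsmul_eq_mul, hcard,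
      mulp β hβ (AwayEquiv.refl β) hβn, vanish (divNat β p) 2 two_ne_zero, mul_zero, add_zero]
    rw [normSq_divNat, hn]
    field_simp
  have e1 : μ₁ = p * (p + 1) * (A (β * α) / A β) := by field_simp; linear_combination r1
  refine ⟨e1, ?_, by field_simp; linear_combination r3⟩
  have hp1 : (p : ℂ) + 1 ≠ 0 := by exact_mod_cast Nat.succ_ne_zero p
  have e2 : A (γ * a x₂) = (A (β * α) / A β) * A (β * α) - A β := by
    have : p * ((p : ℂ) + 1) * A (γ * a x₂)
        = p * ((p : ℂ) + 1) * ((A (β * α) / A β) * A (β * α) - A β) := by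
      rw [e1] at r1'
      linear_combination -r1'
    exact mul_left_cancel₀ (mul_ne_zero hpC hp1) this
  rw [e2] at r2
  apply mul_right_cancel₀ hAβ
  rw [r2]
  field_simp
  ring

end MaassEigenvalues

/-! ### The maximal ideals above `p` -/

section NormSystem
open PadicInt Finset Matrix

variable {p : ℕ} [hp : Fact p.Prime]

theorem inv_p_mul_mem_iff {z : ℤ_[p]} : (p : ℚ_[p])⁻¹ * z ∈ subring p ↔ toZMod z = 0 := by
  have hp0 : (p : ℚ_[p]) ≠ 0 := by exact_mod_cast hp.out.ne_zero
  rw [← RingHom.mem_ker, ker_toZMod, maximalIdeal_eq_span_p, Ideal.mem_span_singleton]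
  constructor
  · intro h
    refine ⟨⟨_, h⟩, Subtype.ext ?_⟩
    exact (mul_inv_cancel_left₀ hp0 _).symm
  · rintro ⟨w, rfl⟩
    rw [PadicInt.coe_mul, PadicInt.coe_natCast, inv_mul_cancel_left₀ hp0]
    exact w.2

theorem intMat_cosetRep_zero_inv_mul (c : Fin 2 × Fin 2 → ℕ) (N : Matrix (Fin 2) (Fin 2) ℤ_[p]) :
    IntMat ((cosetRep p {0} c)⁻¹.val * N.map (PadicInt.Coe.ringHom (p := p))) ↔
      ∀ j, toZMod (N 0 j) = c (0, 1) * toZMod (N 1 j) := by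
  have hcoe : ∀ z : ℤ_[p], PadicInt.Coe.ringHom z = (z : ℚ_[p]) := fun _ => rfl
  have e0 : ∀ j, ((cosetRep p {0} c)⁻¹.val * N.map (PadicInt.Coe.ringHom (p := p))) 0 j
      = (p : ℚ_[p])⁻¹ * ((N 0 j - c (0, 1) * N 1 j : ℤ_[p]) : ℚ_[p]) := fun j => by
    rw [coe_inv_cosetRep, mul_assoc, diagonal_mul]
    simp [ind, nilPart, IsFree, mul_apply, Fin.sum_univ_two, ← sub_eq_add_neg, hcoe]
  have e1 : ∀ j, ((cosetRep p {0} c)⁻¹.val * N.map (PadicInt.Coe.ringHom (p := p))) 1 j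
      = (N 1 j : ℚ_[p]) := fun j => by
    rw [coe_inv_cosetRep, mul_assoc, diagonal_mul]
    simp [ind, nilPart, IsFree, mul_apply, Fin.sum_univ_two, hcoe]
  rw [IntMat, Fin.forall_fin_two]
  simp only [e0, e1, inv_p_mul_mem_iff, map_sub, map_mul, map_natCast, sub_eq_zero]
  exact and_iff_left fun j => (N 1 j).2

theorem intMat_cosetRep_one_inv_mul (N : Matrix (Fin 2) (Fin 2) ℤ_[p]) :
    IntMat ((cosetRep p {1} 0)⁻¹.val * N.map (PadicInt.Coe.ringHom (p := p))) ↔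
      ∀ j, toZMod (N 1 j) = 0 := by
  have hcoe : ∀ z : ℤ_[p], PadicInt.Coe.ringHom z = (z : ℚ_[p]) := fun _ => rfl
  have e0 : ∀ j, ((cosetRep p ({1} : Finset (Fin 2)) 0)⁻¹.val * N.map (PadicInt.Coe.ringHom (p := p))) 0 j
      = (N 0 j : ℚ_[p]) := fun j => by
    rw [coe_inv_cosetRep, mul_assoc, diagonal_mul]
    simp [ind, nilPart, IsFree, mul_apply, Fin.sum_univ_two, hcoe]
  have e1 : ∀ j, ((cosetRep p ({1} : Finset (Fin 2)) 0)⁻¹.val * N.map (PadicInt.Coe.ringHom (p := p))) 1 j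
      = (p : ℚ_[p])⁻¹ * (N 1 j : ℚ_[p]) := fun j => by
    rw [coe_inv_cosetRep, mul_assoc, diagonal_mul]
    simp [ind, nilPart, IsFree, mul_apply, Fin.sum_univ_two, hcoe]
  rw [IntMat, Fin.forall_fin_two]
  simp only [e0, e1, inv_p_mul_mem_iff]
  exact and_iff_right fun j => (N 0 j).2

/-- The index of the representative with diagonal `(p, 1)` and upper right entry `c`. -/
def ixZero (c : ℕ) : RepIx 2 := ⟨{0}, fun ij => if ij = (0, 1) then c else 0⟩

/-- The index of the representative with diagonal `(1, p)`. -/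
def ixOne : RepIx 2 := ⟨{1}, 0⟩

theorem mem_repIndex_one {p : ℕ} {x : RepIx 2} : x ∈ repIndex p 2 1 ↔ (∃ c < p, x = ixZero c) ∨ x = ixOne := by
  constructor
  · intro hx
    obtain ⟨I, f⟩ := x
    obtain ⟨hI, hf⟩ := mem_repIndex.1 hx
    obtain ⟨i, rfl⟩ := card_eq_one.1 hI
    fin_cases i
    · refine Or.inl ⟨f (0, 1), (hf 0 1).1 (by simp [IsFree]), ?_⟩
      refine Sigma.ext rfl (heq_of_eq (funext fun ij => ?_))
      obtain ⟨i, j⟩ := ij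
      by_cases h : (i, j) = ((0, 1) : Fin 2 × Fin 2)
      · rw [h]
        rfl
      · refine Eq.trans ?_ (if_neg h).symm
        refine (hf i j).2 fun h' => h ?_
        have key : ∀ i j : Fin 2, i < j → (i, j) = (0, 1) := by decide
        exact key i j h'.1
    · refine Or.inr (Sigma.ext rfl (heq_of_eq (funext fun ij => ?_)))
      refine (hf ij.1 ij.2).2 fun h' => ?_
      have h1 := h'.1
      have h2 : ij.1 = 1 := by simpa using h'.2.1
      rw [h2] at h1
      exact absurd h1 (by omega)
  · rintro (⟨c, hc, rfl⟩ | rfl)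
    · refine mem_repIndex.2 ⟨rfl, fun i j => ⟨fun _ => ?_, fun h => ?_⟩⟩
      · simp only [ixZero]
        split_ifs
        exacts [hc, by omega]
      · refine if_neg fun e => h ?_
        obtain ⟨rfl, rfl⟩ := Prod.mk.inj e
        simp [IsFree, ixZero]
    · refine mem_repIndex.2 ⟨rfl, fun i j => ⟨fun h => ?_, fun _ => rfl⟩⟩
      have h1 := h.1
      have h2 : i = 1 := by simpa [ixOne] using h.2.1
      rw [h2] at h1
      exact absurd h1 (by omega)

theorem card_repIndex_one {p : ℕ} : (repIndex p 2 1).card = p + 1 := by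
  have e : repIndex p 2 1 = insert ixOne ((range p).image ixZero) := by
    ext x
    rw [mem_repIndex_one, mem_insert, mem_image, or_comm]
    simp only [mem_range, eq_comm (a := x)]
  rw [e, card_insert_of_notMem, card_image_of_injective, card_range]
  · intro c d h
    have := congrFun (eq_of_heq (Sigma.mk.inj h).2) (0, 1)
    simpa using this
  · intro h
    obtain ⟨c, -, hc⟩ := mem_image.1 h
    have := (Sigma.mk.inj hc).1
    revert this
    decide

/-- A nonzero singular matrix over `𝔽_p` has its image in exactly one of the lines that belong to
the representatives. -/
theorem exists_unique_repIndex {M : Matrix (Fin 2) (Fin 2) ℚ_[p]} (hM : IntMat M)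
    (hp' : ¬ IntMat ((p : ℚ_[p])⁻¹ • M)) (hdet : (p : ℚ_[p])⁻¹ * M.det ∈ subring p) :
    ∃ x ∈ repIndex p 2 1, IntMat ((cosetRep p x.1 x.2)⁻¹.val * M) ∧
      ∀ y ∈ repIndex p 2 1, IntMat ((cosetRep p y.1 y.2)⁻¹.val * M) → y = x := by
  obtain ⟨N, rfl⟩ := hM.exists_lift
  have hN : ¬ ∀ i j, toZMod (N i j) = 0 := fun h => hp' fun i j => inv_p_mul_mem_iff.2 (h i j)
  have hd : toZMod (N 0 0) * toZMod (N 1 1) = toZMod (N 0 1) * toZMod (N 1 0) := by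
    have e : (N.map (PadicInt.Coe.ringHom (p := p))).det = ((N.det : ℤ_[p]) : ℚ_[p]) :=
      ((PadicInt.Coe.ringHom (p := p)).map_det N).symm
    rw [e, inv_p_mul_mem_iff, det_fin_two, map_sub, map_mul, map_mul, sub_eq_zero] at hdet
    exact hdet
  have i0 : ∀ c, IntMat ((cosetRep p (ixZero c).1 (ixZero c).2)⁻¹.val *
      N.map (PadicInt.Coe.ringHom (p := p))) ↔
        ∀ j, toZMod (N 0 j) = c * toZMod (N 1 j) := fun c => by
    have := intMat_cosetRep_zero_inv_mul (ixZero c).2 N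
    simpa [ixZero] using this
  have i1 : IntMat ((cosetRep p ixOne.1 ixOne.2)⁻¹.val * N.map (PadicInt.Coe.ringHom (p := p))) ↔
      ∀ j, toZMod (N 1 j) = 0 := intMat_cosetRep_one_inv_mul N
  simp only [mem_repIndex_one]
  by_cases h1 : ∀ j, toZMod (N 1 j) = 0
  · refine ⟨ixOne, Or.inr rfl, i1.2 h1, ?_⟩
    rintro y (⟨c, -, rfl⟩ | rfl) hy
    · refine absurd (Fin.forall_fin_two.2 ⟨fun j => ?_, h1⟩) hN
      rw [(i0 c).1 hy j, h1, mul_zero]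
    · rfl
  · obtain ⟨k, hk⟩ := not_forall.1 h1
    have hc : ((toZMod (N 0 k) / toZMod (N 1 k)).val : ZMod p)
        = toZMod (N 0 k) / toZMod (N 1 k) := ZMod.natCast_zmod_val _
    refine ⟨ixZero _, Or.inl ⟨_, ZMod.val_lt (toZMod (N 0 k) / toZMod (N 1 k)), rfl⟩,
      (i0 _).2 fun j => ?_, ?_⟩
    · rw [hc, div_mul_eq_mul_div, eq_div_iff hk]
      fin_cases k <;> fin_cases j <;> simp only [Fin.zero_eta, Fin.mk_one]
      · exact hd.symm
      · exact hd
    · rintro y (⟨c, hc', rfl⟩ | rfl) hy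
      · have h2 := (i0 c).1 hy k
        rw [h2, mul_div_cancel_right₀ _ hk, ZMod.val_natCast, Nat.mod_eq_of_lt hc']
      · exact absurd (i1.1 hy) h1

theorem IsGlobalRep.inv_mul_mem_iff {θ : Splitting p} {X : (Matrix (Fin 2) (Fin 2) ℚ_[p])ˣ} {a β : ℍ[ℚ]}
    (ha : IsGlobalRep θ X a) (hβ : β ∈ order) : a⁻¹ * β ∈ order ↔ IntMat (X⁻¹.val * θ.mat β) := by
  constructor
  · intro h
    have e : X⁻¹.val * θ.mat β = X⁻¹.val * θ.mat a * θ.mat (a⁻¹ * β) := by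
      rw [mul_assoc, ← map_mul, mul_inv_cancel_left₀ ha.ne_zero]
    rw [e]
    exact ha.int_left.mul (θ.intMat_mat h)
  · intro h
    refine θ.mem_order_of_intMat (mul_mem ha.inv_mem (order_le_orderAway hβ)) ?_
    have e : θ.mat (a⁻¹ * β) = θ.mat a⁻¹ * X.val * (X⁻¹.val * θ.mat β) := by
      rw [mul_assoc, ← mul_assoc X.val, ← Units.val_mul, mul_inv_cancel, Units.val_one, one_mul, map_mul]
    rw [e]
    exact ha.int_right.mul h

/-- Generators of the ideals that correspond to the `p + 1` cosets of determinant `p`. -/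
theorem isNormSystem_of_isGlobalRep {θ : Splitting p} {a : RepIx 2 → ℍ[ℚ]}
    (ha : ∀ x ∈ repIndex p 2 1, IsGlobalRep θ (cosetRep p x.1 x.2) (a x)) :
    IsNormSystem p (repIndex p 2 1) a where
  card := card_repIndex_one
  mem x hx := (ha x hx).mem_order hx
  unit x hx := ⟨(ha x hx).ne_zero, (ha x hx).mem, (ha x hx).inv_mem⟩
  normSq_eq x hx := by rw [(ha x hx).normSq_eq hx, pow_one]
  unique β hβ hβp hn := by
    have hp0 : (p : ℚ_[p]) ≠ 0 := by exact_mod_cast hp.out.ne_zero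
    obtain ⟨n, hn⟩ := hn
    have h1 : ¬ IntMat ((p : ℚ_[p])⁻¹ • θ.mat β) := fun h => by
      refine hβp (θ.mem_order_of_intMat ?_ ?_)
      · simpa [divNat] using smul_inv_pow_mem (p := p) 1 (order_le_orderAway hβ)
      · rwa [divNat, θ.mat_smul, Rat.cast_inv, Rat.cast_natCast]
    have h2 : (p : ℚ_[p])⁻¹ * (θ.mat β).det ∈ subring p := by
      rw [θ.det_mat, hn]
      push_cast
      rw [inv_mul_cancel_left₀ hp0]
      exact natCast_mem _ n
    obtain ⟨x, hx, h, h'⟩ := exists_unique_repIndex (θ.intMat_mat hβ) h1 h2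
    exact ⟨x, hx, ((ha x hx).inv_mul_mem_iff hβ).2 h, fun y hy hy' =>
      h' y hy (((ha y hy).inv_mul_mem_iff hβ).1 hy')⟩

theorem repIndex_zero (p : ℕ) : repIndex p 2 0 = {⟨∅, 0⟩} := by
  ext x
  rw [mem_repIndex, mem_singleton]
  constructor
  · rintro ⟨h, h'⟩
    obtain ⟨I, f⟩ := x
    obtain rfl := card_eq_zero.1 h
    exact Sigma.ext rfl (heq_of_eq (funext fun ij => (h' ij.1 ij.2).2 fun h => absurd h.2.1 (by simp)))
  · rintro rfl
    exact ⟨rfl, fun i j => ⟨fun h => absurd h.2.1 (by simp), fun _ => rfl⟩⟩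

theorem repIndex_two (p : ℕ) : repIndex p 2 2 = {⟨univ, 0⟩} := by
  ext x
  rw [mem_repIndex, mem_singleton]
  constructor
  · rintro ⟨h, h'⟩
    obtain ⟨I, f⟩ := x
    obtain rfl := (card_eq_iff_eq_univ I).1 (by simpa using h)
    exact Sigma.ext rfl (heq_of_eq (funext fun ij => (h' ij.1 ij.2).2 fun h =>
      absurd (mem_univ _) h.2.2))
  · rintro rfl
    exact ⟨rfl, fun i j => ⟨fun h => absurd (mem_univ _) h.2.2, fun _ => rfl⟩⟩

theorem exists_isGlobalRep_system (θ : Splitting p) : ∃ a : RepIx 2 → ℍ[ℚ],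
    (∀ k, ∀ x ∈ repIndex p 2 k, IsGlobalRep θ (cosetRep p x.1 x.2) (a x)) ∧
    a ⟨∅, 0⟩ = 1 ∧ a ⟨univ, 0⟩ = p := by
  have hp0 : (p : ℚ_[p]) ≠ 0 := by exact_mod_cast hp.out.ne_zero
  choose b hb using fun x : RepIx 2 => exists_isGlobalRep θ (cosetRep p x.1 x.2)
  classical
  refine ⟨fun x => if x = ⟨∅, 0⟩ then 1 else if x = ⟨univ, 0⟩ then p else b x, ?_, if_pos rfl, ?_⟩
  · intro k x _
    dsimp only
    split_ifs with h h'
    · subst h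
      have e : cosetRep p (∅ : Finset (Fin 2)) 0 = 1 := by
        rw [cosetRep_zero]
        refine Units.ext ?_
        simp [coe_diagPow, ind]
      rw [e]
      refine ⟨one_ne_zero, one_mem _, by rw [inv_one]; exact one_mem _, ?_, ?_⟩
      · simpa using IntMat.one
      · simpa using IntMat.one
    · subst h'
      have e : (cosetRep p (univ : Finset (Fin 2)) 0).val = (p : ℚ_[p]) • 1 := by
        rw [cosetRep_zero, coe_diagPow, smul_one_eq_diagonal]
        simp [ind]
      have e' : θ.mat (p : ℍ[ℚ]) = (cosetRep p (univ : Finset (Fin 2)) 0).val := by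
        rw [e, ← mul_one (p : ℍ[ℚ]), natCast_mul_eq_smul, θ.mat_smul, map_one, Rat.cast_natCast]
      obtain ⟨h0, h1, h2⟩ := isAwayUnit_natCast (p := p)
      refine ⟨h0, h1, h2, ?_, ?_⟩
      · rw [e', ← Units.val_mul, inv_mul_cancel, Units.val_one]
        exact IntMat.one
      · rw [← e', θ.mat_inv_mul h0]
        exact IntMat.one
    · exact hb x
  · refine (if_neg fun h => ?_).trans (if_pos rfl)
    have := (Sigma.mk.inj h).1
    revert this
    decide

end NormSystem

/-! ### The Hecke eigenvalues of a form in the Maass space -/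

section FormEigenvalues
open Finset

variable {p : ℕ} [hp : Fact p.Prime] {F : GReal → ℂ} {r : ℂ}

open Classical in
theorem ite_eq_mul_indicator (A : ℍ[ℚ] → ℂ) (c : ℂ) (γ : ℍ[ℚ]) :
    (if γ ∈ dualLattice then c * A γ else 0) = c * dualLattice.indicator A γ := by
  by_cases h : γ ∈ dualLattice
  · rw [if_pos h, Set.indicator_of_mem h]
  · rw [if_neg h, Set.indicator_of_notMem h, mul_zero]

/-- The Hecke operator `T₁` on the Fourier coefficients, with the diagonal blocks written out. -/
theorem heckeOne (hF : IsMaassForm r F) (θ : Splitting p) {a : RepIx 2 → ℍ[ℚ]}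
    (ha : ∀ k, ∀ x ∈ repIndex p 2 k, IsGlobalRep θ (cosetRep p x.1 x.2) (a x)) (h0 : a ⟨∅, 0⟩ = 1)
    {μ : ℂ} (hμ : heckeOp p (θ.toGL4.symm (diagP p 1)) F = μ • F) :
    HeckeOne p (repIndex p 2 1) a (fourierCoeff r F) μ := by
  have hpC : (p : ℂ) ≠ 0 := by exact_mod_cast hp.out.ne_zero
  intro β hβ hβ0
  rw [hF.hecke_fourierCoeff θ (by norm_num) hμ ha hβ hβ0,
    show (range 3 ×ˢ range 3).filter (fun kl => kl.1 + kl.2 = 1) = {(1, 0), (0, 1)} by decide,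
    sum_pair (by decide)]
  simp only [ite_eq_mul_indicator, repIndex_zero, sum_singleton, h0, inv_one, one_mul, mul_one,
    ← mul_sum]
  congr 1
  · field_simp
  · simp

theorem heckeTwo (hF : IsMaassForm r F) (θ : Splitting p) {a : RepIx 2 → ℍ[ℚ]}
    (ha : ∀ k, ∀ x ∈ repIndex p 2 k, IsGlobalRep θ (cosetRep p x.1 x.2) (a x)) (h0 : a ⟨∅, 0⟩ = 1)
    (h2 : a ⟨univ, 0⟩ = p) {μ : ℂ} (hμ : heckeOp p (θ.toGL4.symm (diagP p 2)) F = μ • F) :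
    HeckeTwo p (repIndex p 2 1) a (fourierCoeff r F) μ := by
  have hpC : (p : ℂ) ≠ 0 := by exact_mod_cast hp.out.ne_zero
  intro β hβ hβ0
  rw [hF.hecke_fourierCoeff θ (by norm_num) hμ ha hβ hβ0,
    show (range 3 ×ˢ range 3).filter (fun kl => kl.1 + kl.2 = 2)
      = {(2, 0), (1, 1), (0, 2)} by decide, sum_insert (by decide), sum_pair (by decide)]
  simp only [ite_eq_mul_indicator, repIndex_zero, repIndex_two, sum_singleton, h0, h2, inv_one,
    one_mul, mul_one, ← mul_sum, ← divNat_eq_inv_mul, ← natCast_comm p β]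
  rw [Set.indicator_of_mem (natCast_comm p β ▸ dualLattice_mul hβ (natCast_mem _ p)), ← add_assoc]
  congr 1
  · congr 1
    · field_simp
    · field_simp
      norm_num
  · simp

theorem heckeThree (hF : IsMaassForm r F) (θ : Splitting p) {a : RepIx 2 → ℍ[ℚ]}
    (ha : ∀ k, ∀ x ∈ repIndex p 2 k, IsGlobalRep θ (cosetRep p x.1 x.2) (a x))
    (h2 : a ⟨univ, 0⟩ = p) {μ : ℂ} (hμ : heckeOp p (θ.toGL4.symm (diagP p 3)) F = μ • F) :
    HeckeThree p (repIndex p 2 1) a (fourierCoeff r F) μ := by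
  have hpC : (p : ℂ) ≠ 0 := by exact_mod_cast hp.out.ne_zero
  intro β hβ hβ0
  rw [hF.hecke_fourierCoeff θ (by norm_num) hμ ha hβ hβ0,
    show (range 3 ×ˢ range 3).filter (fun kl => kl.1 + kl.2 = 3) = {(2, 1), (1, 2)} by decide,
    sum_pair (by decide)]
  have e1 : ∀ x, (a x)⁻¹ * β * p = p * (a x)⁻¹ * β := fun x => by rw [← natCast_comm, mul_assoc]
  have e2 : ∀ x, (p : ℍ[ℚ])⁻¹ * β * a x = divNat (β * a x) p := fun x => by
    rw [divNat_eq_inv_mul, mul_assoc]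
  simp only [ite_eq_mul_indicator, repIndex_two, sum_singleton, h2, ← mul_sum, e1, e2]
  congr 1
  · field_simp
  · field_simp
    norm_num

theorem eigenvalue_four (hF : IsMaassForm r F) (θ : Splitting p) {μ : ℂ}
    (hμ : heckeOp p (θ.toGL4.symm (diagP p 4)) F = μ • F) {β : ℍ[ℚ]} (hβ : β ∈ dualLattice)
    (hβ0 : β ≠ 0) (hA : fourierCoeff r F β ≠ 0) : μ = 1 := by
  have hpC : (p : ℂ) ≠ 0 := by exact_mod_cast hp.out.ne_zero
  obtain ⟨a, ha, -, h2⟩ := exists_isGlobalRep_system θ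
  have := hF.hecke_fourierCoeff θ le_rfl hμ ha hβ hβ0
  rw [show (range 3 ×ˢ range 3).filter (fun kl => kl.1 + kl.2 = 4) = {(2, 2)} by decide,
    sum_singleton] at this
  simp only [ite_eq_mul_indicator, repIndex_two, sum_singleton, h2] at this
  rw [mul_assoc (p : ℍ[ℚ])⁻¹, ← natCast_comm, inv_mul_cancel_left₀ (natCast_ne_zero hp.out.ne_zero),
    Set.indicator_of_mem hβ] at this
  refine mul_right_cancel₀ hA (this.trans ?_)
  field_simp
  simp

/-- The Hecke eigenvalues at `p` of a form in the Maass space with a nonzero Fourier coefficient. -/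
theorem IsInMaassSpace.exists_eigenvalues (hF : IsInMaassSpace r F) (hecke : IsHeckeEigenform F)
    (hp2 : p ≠ 2) (hA : ∃ β ∈ dualLattice, β ≠ 0 ∧ fourierCoeff r F β ≠ 0) : ∃ l : ℂ, ∀ θ : Splitting p,
      heckeOp p (θ.toGL4.symm (diagP p 4)) F = F ∧
      heckeOp p (θ.toGL4.symm (diagP p 3)) F = ((p : ℂ) * (p + 1) * l) • F ∧
      heckeOp p (θ.toGL4.symm (diagP p 2)) F = ((p : ℂ) ^ 2 * l ^ 2 + (p : ℂ) ^ 3 + p) • F ∧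
      heckeOp p (θ.toGL4.symm (diagP p 1)) F = ((p : ℂ) * (p + 1) * l) • F := by
  obtain ⟨hM, hR⟩ := hF
  by_cases hθ : Nonempty (Splitting p)
  swap
  · exact ⟨0, fun θ => absurd ⟨θ⟩ hθ⟩
  -- The element `β` of norm prime to `p` and `α` are chosen independently of the splitting.
  obtain ⟨β, hβ, hβ0, n, hn, hpn, hAβ, α, hα, hαu, hαn⟩ : ∃ β ∈ dualLattice, β ≠ 0 ∧ ∃ n : ℕ,
      Quaternion.normSq β = n ∧ ¬ p ∣ n ∧ fourierCoeff r F β ≠ 0 ∧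
      ∃ α ∈ order, IsAwayUnit p α ∧ Quaternion.normSq α = p := by
    obtain ⟨θ⟩ := hθ
    obtain ⟨a, ha, h0, h2⟩ := exists_isGlobalRep_system θ
    have hD := isNormSystem_of_isGlobalRep (ha 1)
    obtain ⟨μ₁, hμ₁⟩ := hecke.2 p (θ.toGL4.symm (diagP p 1))
    obtain ⟨μ₂, hμ₂⟩ := hecke.2 p (θ.toGL4.symm (diagP p 2))
    have hone := mem_repIndex_one (p := p).2 (Or.inr rfl)
    by_contra! hcon
    obtain ⟨β, hβ, hβ0, hAβ⟩ := hA
    obtain ⟨n, hn⟩ := exists_normSq_eq (dualLattice_subset hβ)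
    refine hAβ (hR.eq_zero_of_coprime hp2 hD (heckeOne hM θ ha h0 hμ₁)
      (heckeTwo hM θ ha h0 h2 hμ₂) (fun γ hγ hγ0 m hm hpm => ?_) n β hβ hβ0 hn)
    by_contra hAγ
    exact hcon γ hγ hγ0 m hm hpm hAγ _ (hD.mem _ hone) (hD.unit _ hone) (hD.normSq_eq _ hone)
  refine ⟨fourierCoeff r F (β * α) / fourierCoeff r F β, fun θ => ?_⟩
  obtain ⟨a, ha, h0, h2⟩ := exists_isGlobalRep_system θ
  obtain ⟨μ₁, hμ₁⟩ := hecke.2 p (θ.toGL4.symm (diagP p 1))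
  obtain ⟨μ₂, hμ₂⟩ := hecke.2 p (θ.toGL4.symm (diagP p 2))
  obtain ⟨μ₃, hμ₃⟩ := hecke.2 p (θ.toGL4.symm (diagP p 3))
  obtain ⟨μ₄, hμ₄⟩ := hecke.2 p (θ.toGL4.symm (diagP p 4))
  obtain ⟨e1, e2, e3⟩ := hR.eigenvalues hp2 (isNormSystem_of_isGlobalRep (ha 1))
    (heckeOne hM θ ha h0 hμ₁) (heckeTwo hM θ ha h0 h2 hμ₂) (heckeThree hM θ ha h2 hμ₃)
    hα hαu hαn hβ hβ0 hn hpn hAβ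
  refine ⟨?_, ?_, ?_, ?_⟩
  · rw [hμ₄, eigenvalue_four hM θ hμ₄ hβ hβ0 hAβ, one_smul]
  · rw [hμ₃, e3]
  · rw [hμ₂, e2]
  · rw [hμ₁, e1]

end FormEigenvalues

/-! ### Nonvanishing of the Fourier coefficients -/

section Iwasawa
open Real Quaternion Matrix

theorem exists_unit_part (d : ℍ[ℝ]) : ∃ q : ℍ[ℝ], star q * q = 1 ∧ q * star q = 1 ∧ d = ‖d‖ • q := by
  by_cases hd : d = 0
  · exact ⟨1, by simp, by simp, by simp [hd]⟩
  · have h0 : ‖d‖ ≠ 0 := norm_ne_zero_iff.2 hd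
    have h1 : normSq (‖d‖⁻¹ • d) = 1 := by
      rw [normSq_smul, normSq_eq_norm_mul_self]
      field_simp
    refine ⟨‖d‖⁻¹ • d, ?_, ?_, by rw [smul_smul, mul_inv_cancel₀ h0, one_smul]⟩
    · rw [star_mul_self, h1, coe_one]
    · rw [self_mul_star, h1, coe_one]

theorem exists_isometry {M : Matrix (Fin 2) (Fin 2) ℍ[ℝ]} (h : M * Mᴴ = 1) :
    ∃ k : GReal, k.val = M ∧ k.valᴴ * (k : Matrix _ _ ℍ[ℝ]) = 1 :=
  ⟨⟨M, Mᴴ, h, mul_eq_one_comm.1 h⟩, rfl, mul_eq_one_comm.1 h⟩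

/-- A row of length one is the last row of an isometry. -/
theorem exists_isometry_row {c d : ℍ[ℝ]} (h : ‖c‖ ^ 2 + ‖d‖ ^ 2 = 1) : ∃ a b : ℍ[ℝ],
    (!![a, b; c, d] : Matrix (Fin 2) (Fin 2) ℍ[ℝ]) * (!![a, b; c, d] : Matrix (Fin 2) (Fin 2) ℍ[ℝ])ᴴ = 1 := by
  obtain ⟨q, hq, hq', hd⟩ := exists_unit_part d
  have hc : ∀ c : ℍ[ℝ], c * star c = ((‖c‖ ^ 2 : ℝ) : ℍ[ℝ]) := fun c => by
    rw [self_mul_star, normSq_eq_norm_mul_self, sq]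
  have h1 : ((‖c‖ ^ 2 : ℝ) : ℍ[ℝ]) + ((‖d‖ ^ 2 : ℝ) : ℍ[ℝ]) = 1 := by rw [← coe_add, h, coe_one]
  have h2 : star c * q * star d = ‖d‖ • star c := by
    nth_rw 1 [hd]
    rw [Quaternion.star_smul, mul_smul_comm, mul_assoc, hq', mul_one]
  refine ⟨(‖d‖ : ℍ[ℝ]), -(star c * q), ext fun i j => ?_⟩
  fin_cases i <;> fin_cases j <;>
    simp only [Fin.zero_eta, Fin.mk_one, mul_apply, Fin.sum_univ_two, conjTranspose_apply,
      of_apply, cons_val_zero, cons_val_one, one_apply_eq, star_neg,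
      star_mul, star_star, neg_mul, mul_neg, neg_neg]
  · have h3 : star c * c = ((‖c‖ ^ 2 : ℝ) : ℍ[ℝ]) := by simpa using hc (star c)
    rw [mul_assoc (star c), ← mul_assoc q, hq', one_mul, h3, hc, add_comm, ← h1, norm_coe, norm_norm]
  · rw [h2, coe_mul_eq_smul, add_neg_cancel]
    rfl
  · have h4 : d * (star q * c) = ‖d‖ • c := by
      nth_rw 1 [hd]
      rw [smul_mul_assoc, ← mul_assoc, hq', one_mul]
    rw [h4, star_coe, mul_coe_eq_smul, add_neg_cancel]
    rfl
  · rw [hc, hc, h1]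

/-- The Iwasawa decomposition of `GL₂(ℍ)`. -/
theorem exists_iwasawa_real (g : GReal) : ∃ (c : ℝˣ) (x : ℍ[ℝ]) (y : Set.Ioi (0 : ℝ)) (k : GReal), 0 < (c : ℝ) ∧
    k.valᴴ * (k : Matrix _ _ ℍ[ℝ]) = 1 ∧ g = realDiag c c * (nUnip x * aDiag y) * k := by
  set c := g.val 1 0 with hc
  set d := g.val 1 1 with hd
  have hpos : 0 < ‖c‖ ^ 2 + ‖d‖ ^ 2 := by
    by_contra! hle
    have hc0 : c = 0 := norm_eq_zero.1 (pow_eq_zero_iff two_ne_zero |>.1 (by nlinarith [sq_nonneg ‖c‖, sq_nonneg ‖d‖]))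
    have hd0 : d = 0 := norm_eq_zero.1 (pow_eq_zero_iff two_ne_zero |>.1 (by nlinarith [sq_nonneg ‖c‖, sq_nonneg ‖d‖]))
    have := congrFun (congrFun g.mul_inv 1) 1
    rw [mul_apply, Fin.sum_univ_two, ← hc, ← hd, hc0, hd0, zero_mul, zero_mul, add_zero] at this
    exact zero_ne_one this
  set t := sqrt (‖c‖ ^ 2 + ‖d‖ ^ 2) with ht
  have ht0 : 0 < t := sqrt_pos.2 hpos
  have htt : t ^ 2 = ‖c‖ ^ 2 + ‖d‖ ^ 2 := sq_sqrt hpos.le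
  obtain ⟨a₁, b₁, hk₁⟩ := exists_isometry_row (c := t⁻¹ • c) (d := t⁻¹ • d) (by
    rw [norm_smul, norm_smul, mul_pow, mul_pow, ← mul_add, ← htt, norm_inv, norm_eq_abs,
      abs_of_pos ht0]
    field_simp)
  obtain ⟨k₁, hk₁v, hk₁u⟩ := exists_isometry hk₁
  -- The last row of `h = g k₁⁻¹` is `(0, t)`.
  have hrow : ∀ j, (g * k₁⁻¹).val 1 j = if j = 1 then ((t : ℝ) : ℍ[ℝ]) else 0 := by
    intro j
    have e : ∀ j, g.val 1 j = t • k₁.val 1 j := fun j => by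
      rw [hk₁v]
      fin_cases j
      · change c = t • (t⁻¹ • c)
        rw [smul_smul, mul_inv_cancel₀ ht0.ne', one_smul]
      · change d = t • (t⁻¹ • d)
        rw [smul_smul, mul_inv_cancel₀ ht0.ne', one_smul]
    have e2 := congrFun (congrFun k₁.mul_inv 1) j
    rw [Units.val_mul, mul_apply]
    rw [mul_apply] at e2
    simp only [e, smul_mul_assoc, ← Finset.smul_sum, e2]
    fin_cases j
    · simp
    · change t • (1 : Matrix (Fin 2) (Fin 2) ℍ[ℝ]) 1 1 = (t : ℍ[ℝ])
      rw [one_apply_eq, ← Algebra.algebraMap_eq_smul_one]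
      rfl
  set h := g * k₁⁻¹ with hh
  clear_value h
  have hα : h.val 0 0 ≠ 0 := by
    intro h0
    have := congrFun (congrFun h.inv_mul 0) 0
    rw [mul_apply, Fin.sum_univ_two, h0, hrow, if_neg zero_ne_one, mul_zero, mul_zero,
      add_zero] at this
    exact zero_ne_one this
  obtain ⟨u, hu, hu', hαu⟩ := exists_unit_part (h.val 0 0)
  have hs0 : 0 < ‖h.val 0 0‖ := norm_pos_iff.2 hα
  set s := ‖h.val 0 0‖ with hs
  obtain ⟨k₂, hk₂v, hk₂u⟩ := exists_isometry (M := !![u, 0; 0, 1]) (by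
    refine ext fun i j => ?_
    fin_cases i <;> fin_cases j <;> simp [mul_apply, Fin.sum_univ_two, hu'])
  have hy0 : 0 < s / t := div_pos hs0 ht0
  have hr0 : 0 < sqrt (s / t) := sqrt_pos.2 hy0
  have hrr : sqrt (s / t) * sqrt (s / t) = s / t := mul_self_sqrt hy0.le
  refine ⟨Units.mk0 (t * sqrt (s / t)) (mul_pos ht0 hr0).ne', t⁻¹ • h.val 0 1, ⟨s / t, hy0⟩,
    k₂ * k₁, mul_pos ht0 hr0, ?_, ?_⟩
  · rw [Units.val_mul, conjTranspose_mul, mul_assoc, ← mul_assoc _ k₂.val, hk₂u, one_mul, hk₁u]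
  · rw [← mul_assoc, ← mul_inv_eq_iff_eq_mul, ← hh]
    refine Units.ext (ext fun i j => ?_)
    have e1 : t * sqrt (s / t) * sqrt (s / t) = s := by
      rw [mul_assoc, hrr]
      field_simp
    have e2 : t * sqrt (s / t) * (sqrt (s / t))⁻¹ = t := by field_simp
    rw [Units.val_mul, realDiag_mul_eq_smul, Units.val_mul, hk₂v, coe_nUnip, aDiag, coe_realDiag,
      coe_sqrtUnit, Units.val_inv_eq_inv_val, coe_sqrtUnit]
    fin_cases i <;> fin_cases j
    · rw [Fin.zero_eta, hαu]
      simp [mul_apply, Fin.sum_univ_two, coe_mul_eq_smul, smul_smul, e1]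
    · simp [mul_apply, Fin.sum_univ_two, -coe_inv, mul_coe_eq_smul, smul_smul]
      have e3 : t * sqrt (s / t) * (t⁻¹ * (sqrt (s / t))⁻¹) = 1 := by field_simp
      rw [e3, one_smul]
    · simp [mul_apply, Fin.sum_univ_two, hrow]
    · rw [Fin.mk_one, hrow, if_pos rfl]
      simp [mul_apply, Fin.sum_univ_two, -coe_inv, -coe_mul]
      rw [← coe_smul, smul_eq_mul, e2]

end Iwasawa

/-- A cusp form that is not zero has a nonzero Fourier coefficient. -/
theorem IsMaassForm.exists_fourierCoeff_ne_zero {F : GReal → ℂ} {r : ℂ} (hF : IsMaassForm r F)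
    (hcusp : IsCuspidal F) (h0 : F ≠ 0) : ∃ β ∈ dualLattice, β ≠ 0 ∧ fourierCoeff r F β ≠ 0 := by
  by_contra! hcon
  refine h0 (funext fun g => ?_)
  obtain ⟨c, x, y, k, hc, hk, rfl⟩ := exists_iwasawa_real g
  rw [hF.right_inv k hk, hF.center_inv c hc]
  refine eq_zero_of_cubeMean (f := fun x => F (nUnip x * aDiag y)) (hF.continuous_nUnip _)
    (hF.isPeriodic _) (fun β hβ => ?_) x
  have hβ' : -β ∈ dualLattice := dualGroup.neg_mem hβ
  have e := fourierIntegral_eq F (-β) (aDiag y)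
  rw [neg_neg] at e
  rw [← e]
  by_cases h : β = 0
  · rw [h, neg_zero]
    exact hcusp _
  · rw [hF.fourierIntegral_eq_fourierCoeff hβ' (neg_ne_zero.2 h), hcon _ hβ' (neg_ne_zero.2 h), zero_mul,
      zero_mul]

/-! ### The representation generated by the adelization -/

section LocalComponent
open Matrix hiding mul_inv_rev

variable {p : ℕ} [hp : Fact p.Prime] {F : GReal → ℂ} {r : ℂ}

/-- Strong approximation: `GL₂(B_p) = GL₂(𝒪[1/p]) K_p`. -/
theorem exists_strongApprox (θ : Splitting p) (x : GLoc p) :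
    ∃ γ ∈ glOver (orderAway p), (toLoc p γ)⁻¹ * x ∈ KLoc p := by
  have hp0 : (p : ℚ_[p]) ≠ 0 := by exact_mod_cast hp.out.ne_zero
  obtain ⟨k, hk, hlt⟩ := exists_upperTriangular (θ.toGL4 x).val
  set x' := x * θ.toGL4.symm k with hx'
  have hk' : θ.toGL4.symm k ∈ KLoc p := by rwa [← toGL4_mem_iff θ, MulEquiv.apply_symm_apply]
  have h10 : x'.val 1 0 = 0 := by
    apply θ.equiv.injective
    ext i j
    rw [← toGL4_apply, hx', map_mul, MulEquiv.apply_symm_apply, Units.val_mul,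
      hlt _ _ (blockIndex_lt_cross j i), map_zero, Matrix.zero_apply]
  have hX := congrFun (congrFun x'.inv_mul 0) 0
  have hY := congrFun (congrFun x'.mul_inv 1) 1
  rw [mul_apply, Fin.sum_univ_two, h10, mul_zero, add_zero, one_apply_eq] at hX
  rw [mul_apply, Fin.sum_univ_two, h10, zero_mul, zero_add, one_apply_eq] at hY
  have hX' := (congrArg θ.equiv hX).trans (map_one _)
  have hY' := (congrArg θ.equiv hY).trans (map_one _)
  rw [map_mul] at hX' hY'
  let X : (Matrix (Fin 2) (Fin 2) ℚ_[p])ˣ := ⟨_, _, mul_eq_one_comm.1 hX', hX'⟩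
  let Y : (Matrix (Fin 2) (Fin 2) ℚ_[p])ˣ := ⟨_, _, hY', mul_eq_one_comm.1 hY'⟩
  have hYx : (x'⁻¹).val 1 1 * x'.val 1 1 = 1 := by
    apply θ.equiv.injective
    rw [map_mul, map_one]
    exact mul_eq_one_comm.1 hY'
  set B := x'.val 0 1 * (x'⁻¹).val 1 1 with hB
  have hxB : x' = borel (Units.map (θ.equiv.symm : Matrix (Fin 2) (Fin 2) ℚ_[p] →* ℍ[ℚ_[p]]) X)
      (Units.map (θ.equiv.symm : Matrix (Fin 2) (Fin 2) ℚ_[p] →* ℍ[ℚ_[p]]) Y) B := by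
    refine Units.ext (ext fun i j => ?_)
    rw [coe_borel]
    fin_cases i <;> fin_cases j
    · exact (θ.equiv.symm_apply_apply _).symm
    · change _ = B * θ.equiv.symm (θ.equiv _)
      rw [θ.equiv.symm_apply_apply, hB, mul_assoc, hYx, mul_one]
      rfl
    · exact h10
    · exact (θ.equiv.symm_apply_apply _).symm
  obtain ⟨a, ha⟩ := exists_isGlobalRep θ X
  obtain ⟨d, hd⟩ := exists_isGlobalRep θ Y
  obtain ⟨N, hN⟩ := exists_pow_smul_int (θ.equiv B)
  obtain ⟨N₁, hN₁⟩ := exists_pow_smul_int (θ.mat a⁻¹)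
  obtain ⟨N₂, hN₂⟩ := exists_pow_smul_int (θ.mat d)
  obtain ⟨y, hy, W, hW, e⟩ := θ.exists_near hN (N + (N₁ + N₂))
  have hb : ((p : ℚ) ^ N)⁻¹ • y ∈ orderAway p := smul_inv_pow_mem N (order_le_orderAway hy)
  have key : θ.mat a⁻¹ * θ.equiv (B - quatMap (algebraMap ℚ ℚ_[p]) (((p : ℚ) ^ N)⁻¹ • y)) * θ.mat d
      = ((p : ℚ_[p]) ^ N₁ • θ.mat a⁻¹) * W * ((p : ℚ_[p]) ^ N₂ • θ.mat d) := by
    have e1 : θ.equiv (B - quatMap (algebraMap ℚ ℚ_[p]) (((p : ℚ) ^ N)⁻¹ • y))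
        = (p : ℚ_[p]) ^ (N₁ + N₂) • W := by
      rw [map_sub, ← θ.mat_apply, θ.mat_smul]
      push_cast
      rw [← smul_right_inj (pow_ne_zero N hp0), smul_smul, ← pow_add, eq_sub_of_add_eq' e.symm, smul_sub, smul_smul,
        mul_inv_cancel₀ (pow_ne_zero N hp0), one_smul]
    rw [e1, Matrix.mul_smul, Matrix.smul_mul, Matrix.smul_mul, Matrix.smul_mul, Matrix.mul_smul,
      smul_smul, pow_add]
  refine ⟨borel (Units.mk0 a ha.ne_zero) (Units.mk0 d hd.ne_zero) _, borel_mem_glOver ha.mem ha.inv_mem hd.mem hd.inv_mem hb, ?_⟩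
  have h := toLoc_borel_inv_mul_mem θ ha hd (key ▸ (hN₁.mul hW).mul hN₂)
  rw [← hxB, hx', ← mul_assoc] at h
  have := mul_mem h (inv_mem hk')
  rwa [mul_inv_cancel_right] at this

theorem IsMaassForm.adelize_left (hF : IsMaassForm r F) (θ : Splitting p) {γ : GL2 ℍ[ℚ]}
    (hγ : γ ∈ glOver (orderAway p)) (x : GLoc p) (g : GReal) :
    adelize p F (toLoc p γ * x) g = adelize p F x ((toReal γ)⁻¹ * g) := by
  obtain ⟨γ', hγ', hx⟩ := exists_strongApprox θ x
  rw [hF.adelize_eq hγ' hx, hF.adelize_eq (mul_mem hγ hγ'), map_mul, mul_inv_rev, mul_assoc]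
  rw [map_mul, mul_inv_rev, mul_assoc, inv_mul_cancel_left]
  exact hx

theorem finsum_cosetsIn_mul_left {G M : Type} [Group G] [AddCommMonoid M] {K : Subgroup G} {f : G → M}
    (hf : ∀ k ∈ K, ∀ g, f (g * k) = f g) (h : G) {k : G} (hk : k ∈ K) :
    ∑ᶠ x ∈ cosetsIn K h, f (k * x.out) = ∑ᶠ x ∈ cosetsIn K h, f x.out := by
  have hmaps : ∀ k ∈ K, Set.MapsTo (fun x : G ⧸ K => k • x) (cosetsIn K h) (cosetsIn K h) := by
    rintro k hk _ ⟨x, hx, rfl⟩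
    obtain ⟨k₁, hk₁, k₂, hk₂, rfl⟩ := DoubleCoset.mem_doubleCoset.1 hx
    exact ⟨k * (k₁ * h * k₂), DoubleCoset.mem_doubleCoset.2
      ⟨k * k₁, mul_mem hk hk₁, k₂, hk₂, by simp only [mul_assoc]⟩, rfl⟩
  refine finsum_mem_eq_of_bijOn (fun x => k • x) ⟨hmaps k hk, (MulAction.injective k).injOn,
    fun x hx => ⟨k⁻¹ • x, hmaps _ (inv_mem hk) hx, smul_inv_smul k x⟩⟩ fun x _ => ?_
  obtain ⟨l, hl⟩ := QuotientGroup.mk_out_eq_mul K (k * x.out)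
  have e : k • x = ((k * x.out : G) : G ⧸ K) := by
    conv_lhs => rw [← Quotient.out_eq' x]
    rfl
  rw [e, hl, hf _ l.2]

/-- The adelization of `F` as a vector of the representation that it generates. -/
def generator (p : ℕ) [Fact p.Prime] (F : GReal → ℂ) : (generatedRep p F).toSubmodule :=
  ⟨adelize p F, Submodule.subset_span ⟨1, by simp only [map_one, Module.End.one_apply]⟩⟩

theorem span_generator : Submodule.span ℂ (Set.range fun g : GLoc p =>
    (generatedRep p F).toRepresentation g (generator p F)) = ⊤ := by
  apply Submodule.map_injective_of_injective (generatedRep p F).toSubmodule.injective_subtype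
  rw [Submodule.map_span, Submodule.map_top, Submodule.range_subtype, ← Set.range_comp]
  rfl

theorem IsMaassForm.generator_fixed (hF : IsMaassForm r F) : ∀ k ∈ KLoc p,
    (generatedRep p F).toRepresentation k (generator p F) = generator p F := fun _ hk =>
  Subtype.ext (funext fun x => hF.adelize_mul hk x)

theorem IsMaassForm.generator_ne_zero (hF : IsMaassForm r F) (h0 : F ≠ 0) : generator p F ≠ 0 :=
  fun h => h0 (by
    rw [← hF.adelize_one (p := p)]
    exact congrFun (congrArg Subtype.val h) 1)

theorem isHeckePair_KLoc (θ : Splitting p) : IsHeckePair (KLoc p) := by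
  intro g
  have h1 := isHeckePair_KGL (p := p) (n := 4) (θ.toGL4 g)
  have hK : KLoc p = (KGL p 4).comap θ.toGL4.toMonoidHom :=
    Subgroup.ext fun x => (toGL4_mem_iff θ x).symm
  have hmap : (KLoc p).map θ.toGL4.toMonoidHom = KGL p 4 := by
    rw [hK]
    exact Subgroup.map_comap_eq_self_of_surjective (f := θ.toGL4.toMonoidHom) θ.toGL4.surjective _
  have e : (KLoc p).comap (MulAut.conj g⁻¹).toMonoidHom
      = ((KGL p 4).comap (MulAut.conj (θ.toGL4 g)⁻¹).toMonoidHom).comap θ.toGL4.toMonoidHom := by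
    ext x
    rw [hK]
    simp [Subgroup.mem_comap]
  rw [Subgroup.finiteIndex_iff] at h1 ⊢
  change Subgroup.relIndex _ _ ≠ 0
  rw [e, Subgroup.relIndex_comap, hmap]
  exact h1

/-- The generator is a Hecke eigenvector with the same eigenvalues as `F`. -/
theorem IsMaassForm.hecke_generator (hF : IsMaassForm r F) (θ : Splitting p) {h : GLoc p} {μ : ℂ}
    (hμ : heckeOp p h F = μ • F) : ∑ᶠ x ∈ cosetsIn (KLoc p) h,
      (generatedRep p F).toRepresentation x.out (generator p F) = μ • generator p F := by
  have hfin := finite_cosetsIn (isHeckePair_KLoc θ) h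
  apply Subtype.ext
  funext y g
  let ev : (generatedRep p F).toSubmodule →+ ℂ :=
    { toFun := fun v => v.1 y g
      map_zero' := rfl
      map_add' := fun _ _ => rfl }
  change ev (∑ᶠ x ∈ cosetsIn (KLoc p) h, (generatedRep p F).toRepresentation x.out (generator p F))
    = μ * adelize p F y g
  rw [AddMonoidHom.map_finsum_mem _ _ hfin]
  change ∑ᶠ x ∈ cosetsIn (KLoc p) h, adelize p F (y * x.out) g = μ * adelize p F y g
  obtain ⟨γ, hγ, hy⟩ := exists_strongApprox θ y
  obtain ⟨k, hk, rfl⟩ : ∃ k ∈ KLoc p, y = toLoc p γ * k := ⟨_, hy, by group⟩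
  have hr : ∀ k ∈ KLoc p, ∀ x : GLoc p,
      adelize p F (x * k) ((toReal γ)⁻¹ * g) = adelize p F x ((toReal γ)⁻¹ * g) :=
    fun k hk x => by rw [hF.adelize_mul hk]
  simp only [mul_assoc, hF.adelize_left θ hγ]
  rw [finsum_cosetsIn_mul_left (f := fun x => adelize p F x ((toReal γ)⁻¹ * g)) hr h hk, ← one_mul k, hF.adelize_mul hk, hF.adelize_one]
  exact congrFun hμ _

end LocalComponent

/-! ### The local component -/

section SphericalConstituent
open Finset

variable {G : Type} [Group G] {K : Subgroup G}
variable {V W : Type} [AddCommGroup V] [Module ℂ V] [AddCommGroup W] [Module ℂ W]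
variable {ρ : Representation ℂ G V} {σ : Representation ℂ G W}

/-- A constituent with a nonzero fixed vector of a representation generated by a spherical Hecke
eigenvector: its fixed vectors form a line, and Hecke eigenvalues carry over. -/
theorem exists_spherical_of_constituent (hK : IsHeckePair K) {v : V} (hv : ∀ k ∈ K, ρ k v = v)
    (hgen : Submodule.span ℂ (Set.range fun g : G => ρ g v) = ⊤)
    (heig : ∀ h : G, ∃ μ : ℂ, ∑ᶠ x ∈ cosetsIn K h, ρ x.out v = μ • v) (hσ : IsConstituent σ ρ)
    (hw : ∃ w : W, w ≠ 0 ∧ ∀ k ∈ K, σ k w = w) :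
    ∃ w : W, w ≠ 0 ∧ (∀ k ∈ K, σ k w = w) ∧ (∀ u : W, (∀ k ∈ K, σ k u = u) → ∃ c : ℂ, u = c • w) ∧
      ∀ {ι : Type} (s : Finset ι) (x : ι → G) (μ : ℂ), ∑ i ∈ s, ρ (x i) v = μ • v →
        ∑ i ∈ s, σ (x i) w = μ • w := by
  obtain ⟨-, U, f, hf⟩ := hσ
  -- Fixed vectors lift to multiples of `v`.
  have lift : ∀ u : W, (∀ k ∈ K, σ k u = u) → ∃ (c : ℂ) (y : U.toSubmodule), y.1 = c • v ∧ f y = u := by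
    intro u hu
    obtain ⟨y, rfl⟩ := hf u
    have hy : IsKFinite K U.toRepresentation y := by
      obtain ⟨N, hN, h⟩ := isKFinite_of_mem_span hK hv (u := y.1) (by rw [hgen]; trivial)
      exact ⟨N, hN, fun k hk => Subtype.ext (h k hk)⟩
    obtain ⟨z, hz, hzy⟩ := exists_fixed_lift f hy hu
    obtain ⟨c, hc⟩ := fixed_eq_smul_of_eigen hK hv heig (u := z.1) (by rw [hgen]; trivial)
      fun k hk => congrArg Subtype.val (hz k hk)
    exact ⟨c, z, hc, hzy⟩
  obtain ⟨w, hw0, hw⟩ := hw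
  obtain ⟨c, y, hy, hyw⟩ := lift w hw
  have hc0 : c ≠ 0 := by
    rintro rfl
    refine hw0 (hyw ▸ ?_)
    rw [show y = 0 from Subtype.ext (hy.trans (zero_smul ℂ v)), map_zero]
  have hvU : v ∈ U.toSubmodule := by
    have := U.toSubmodule.smul_mem c⁻¹ y.2
    rwa [hy, smul_smul, inv_mul_cancel₀ hc0, one_smul] at this
  have hyv : y = c • (⟨v, hvU⟩ : U.toSubmodule) := Subtype.ext hy
  refine ⟨f ⟨v, hvU⟩, fun h => hw0 ?_, fun k hk => ?_, fun u hu => ?_, fun s x μ h => ?_⟩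
  · rw [← hyw, hyv, map_smul, h, smul_zero]
  · rw [← f.isIntertwining]
    exact congrArg f (Subtype.ext (hv k hk))
  · obtain ⟨c', y', hy', rfl⟩ := lift u hu
    exact ⟨c', by rw [← map_smul]; exact congrArg f (Subtype.ext hy')⟩
  · simp only [← f.isIntertwining]
    rw [← map_sum, ← map_smul]
    refine congrArg f (Subtype.ext ?_)
    rw [AddSubmonoidClass.coe_finsetSum]
    exact h

theorem IsIrreducible.comp_mulEquiv {G' : Type} [Group G'] (e : G' ≃* G) (hσ : σ.IsIrreducible) :
    Representation.IsIrreducible (σ.comp e.toMonoidHom) := by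
  let φ : Subrepresentation (σ.comp e.toMonoidHom) ≃o Subrepresentation σ :=
    { toFun := fun U => ⟨U.toSubmodule, fun g v hv => by
        have := U.apply_mem_toSubmodule (e.symm g) hv
        simpa using this⟩
      invFun := fun U => ⟨U.toSubmodule, fun g v hv => U.apply_mem_toSubmodule (e g) hv⟩
      left_inv := fun _ => rfl
      right_inv := fun _ => rfl
      map_rel_iff' := Iff.rfl }
  exact φ.isSimpleOrder

end SphericalConstituent

section LocalComponents
open Finset

variable {p : ℕ} [hp : Fact p.Prime] {F : GReal → ℂ} {r : ℂ}

/-- The local component exists: an irreducible quotient of the representation generated by the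
adelization. -/
theorem IsMaassForm.exists_localComponent (hF : IsMaassForm r F) (h0 : F ≠ 0) :
    ∃ (W : Type) (_ : AddCommGroup W) (_ : Module ℂ W) (σ : Representation ℂ (GLoc p) W),
      IsLocalComponent p F σ := by
  obtain ⟨W, i1, i2, σ, f, hσ, hf, hfv⟩ :=
    exists_irreducible_quotient (hF.generator_ne_zero (p := p) h0) span_generator
  let g : Representation.IntertwiningMap
      (⊤ : Subrepresentation (generatedRep p F).toRepresentation).toRepresentation σ :=
    { toLinearMap := f.toLinearMap ∘ₗ (⊤ : Submodule ℂ (generatedRep p F).toSubmodule).subtype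
      isIntertwining' := fun x => LinearMap.ext fun y => LinearMap.congr_fun (f.isIntertwining' x) y.1 }
  refine ⟨W, i1, i2, σ, ⟨hσ, ⊤, g, fun w => ?_⟩, f (generator p F), hfv, fun k hk => ?_⟩
  · obtain ⟨y, rfl⟩ := hf w
    exact ⟨⟨y, trivial⟩, rfl⟩
  · rw [← f.isIntertwining, hF.generator_fixed k hk]

/-- The Satake parameters of a local component, from the Hecke eigenvalues of `F`. -/
theorem IsMaassForm.isConstituent_iff (hF : IsMaassForm r F) (hecke : IsHeckeEigenform F)
    {W : Type} [AddCommGroup W] [Module ℂ W] {σ : Representation ℂ (GLoc p) W}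
    (hσ : IsLocalComponent p F σ) (θ : Splitting p) {l : ℂ}
    (h4 : heckeOp p (θ.toGL4.symm (diagP p 4)) F = F)
    (h3 : heckeOp p (θ.toGL4.symm (diagP p 3)) F = ((p : ℂ) * (p + 1) * l) • F)
    (h2 : heckeOp p (θ.toGL4.symm (diagP p 2)) F = ((p : ℂ) ^ 2 * l ^ 2 + (p : ℂ) ^ 3 + p) • F)
    (h1 : heckeOp p (θ.toGL4.symm (diagP p 1)) F = ((p : ℂ) * (p + 1) * l) • F)
    {χ : Fin 4 → (ℚ_[p]ˣ →* ℂˣ)} (hχ : ∀ i, IsUnramified (χ i)) :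
    IsConstituent (σ.comp θ.toGL4.symm.toMonoidHom) (principalSeries χ).toRepresentation ↔
      ∃ w : Equiv.Perm (Fin 4), ∀ i, (χ (w i) (pUnit p) : ℂ) = satakeParam p l i := by
  have hfix := hF.generator_fixed (p := p)
  obtain ⟨w, hw0, hw, hone, heig⟩ := exists_spherical_of_constituent (isHeckePair_KLoc θ)
    hfix span_generator (fun h => by
      obtain ⟨μ, hμ⟩ := hecke.2 p h
      exact ⟨μ, hF.hecke_generator θ hμ⟩) hσ.1 hσ.2
  have hk : ∀ k ∈ KGL p 4, θ.toGL4.symm k ∈ KLoc p := fun k hk => by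
    rwa [← toGL4_mem_iff θ, MulEquiv.apply_symm_apply]
  -- The Hecke eigenvalues in terms of representatives.
  have key : ∀ m ≤ 4, ∀ μ : ℂ, heckeOp p (θ.toGL4.symm (diagP p m)) F = μ • F →
      ∑ c ∈ repIndex p 4 m, σ (θ.toGL4.symm (cosetRep p c.1 c.2)) w = μ • w := fun m hm μ hμ => by
    refine heig _ _ _ ?_
    have hr : ∀ k ∈ KLoc p, ∀ x : GLoc p, (generatedRep p F).toRepresentation (x * k) (generator p F)
        = (generatedRep p F).toRepresentation x (generator p F) := fun k hk x => by
      rw [map_mul, Module.End.mul_apply, hfix k hk]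
    rw [← hF.hecke_generator θ hμ, finsum_cosetsIn_mulEquiv θ.toGL4 (toGL4_mem_iff θ)
      (f := fun x => (generatedRep p F).toRepresentation x (generator p F)) hr,
      MulEquiv.apply_symm_apply, diagP_eq, finsum_cosetsIn hm (f := fun x =>
        (generatedRep p F).toRepresentation (θ.toGL4.symm x) (generator p F))]
    intro k hk' x
    rw [map_mul, hr _ (hk k hk')]
  obtain ⟨e4, e1, e2, e3⟩ := satakeParam_esymm p l
  refine isConstituent_principalSeries_iff (IsIrreducible.comp_mulEquiv θ.toGL4.symm hσ.1.1) hw0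
    (fun k hk' => hw _ (hk k hk')) (fun u hu => hone u fun k hk' => ?_) (by rw [e4]; exact one_ne_zero)
    (fun m hm hm' => ?_) hχ
  · have := hu (θ.toGL4 k) ((toGL4_mem_iff θ k).2 hk')
    simpa using this
  · interval_cases m
    · rw [e1]
      exact key 1 hm' _ h1
    · rw [e2]
      exact key 2 hm' _ h2
    · rw [e3]
      exact key 3 hm' _ h3
    · have e : powersetCard 4 (univ : Finset (Fin 4)) = {univ} :=
        powersetCard_self (univ : Finset (Fin 4))
      rw [e, sum_singleton, e4]
      refine (key 4 hm' 1 (by rw [h4, one_smul])).trans ?_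
      norm_num

end LocalComponents

end MaassLift

end

theorem proposition5p1 (r : ℂ) (F : MaassLift.GReal → ℂ) (hF : MaassLift.IsInMaassSpace r F)
    (hcusp : MaassLift.IsCuspidal F) (hecke : MaassLift.IsHeckeEigenform F)
    (p : ℕ) [Fact p.Prime] (hp : p ≠ 2) :
    ∃ l : ℂ,
      (∀ θ : MaassLift.Splitting p,
        MaassLift.heckeOp p (θ.toGL4.symm (MaassLift.diagP p 4)) F = F ∧
        MaassLift.heckeOp p (θ.toGL4.symm (MaassLift.diagP p 3)) F
          = ((p : ℂ) * (p + 1) * l) • F ∧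
        MaassLift.heckeOp p (θ.toGL4.symm (MaassLift.diagP p 2)) F
          = ((p : ℂ) ^ 2 * l ^ 2 + (p : ℂ) ^ 3 + p) • F ∧
        MaassLift.heckeOp p (θ.toGL4.symm (MaassLift.diagP p 1)) F
          = ((p : ℂ) * (p + 1) * l) • F) ∧
      (∃ (W : Type) (_ : AddCommGroup W) (_ : Module ℂ W)
        (σ : Representation ℂ (MaassLift.GLoc p) W), MaassLift.IsLocalComponent p F σ) ∧
      ∀ (W : Type) [AddCommGroup W] [Module ℂ W] (σ : Representation ℂ (MaassLift.GLoc p) W),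
        MaassLift.IsLocalComponent p F σ →
        ∀ (θ : MaassLift.Splitting p) (χ : Fin 4 → (ℚ_[p]ˣ →* ℂˣ)),
          (∀ i, MaassLift.IsUnramified (χ i)) →
          (MaassLift.IsConstituent (σ.comp θ.toGL4.symm.toMonoidHom)
              (MaassLift.principalSeries χ).toRepresentation ↔
            ∃ w : Equiv.Perm (Fin 4), ∀ i,
              (χ (w i) (MaassLift.pUnit p) : ℂ) = MaassLift.satakeParam p l i) := by
  obtain ⟨l, hl⟩ := hF.exists_eigenvalues hecke hp (hF.1.exists_fourierCoeff_ne_zero hcusp hecke.1)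
  refine ⟨l, hl, hF.1.exists_localComponent hecke.1, fun W _ _ σ hσ θ χ hχ => ?_⟩
  obtain ⟨h4, h3, h2, h1⟩ := hl θ
  exact hF.1.isConstituent_iff hecke hσ θ h4 h3 h2 h1 hχ
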